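/- Let $n\ge 2$. Write points of $\mathbb R^{n+1}=\mathbb R\times\mathbb R^n$ as $(y,\mathbf x)$ and put $r=\|\mathbf x\|$. A hypersurface with position vector $X$, unit normal $\nu$ and mean curvature $H$ (the trace of the second fundamental form with respect to $\nu$, so that $H\nu$ is the mean curvature vector) is a self-shrinker if $H+\tfrac12 X\cdot\nu=0$. For the surface obtained by rotating the graph $r=u(y)$ about the $y$-axis this is the equation $$\frac{u_{yy}}{1+u_y^2}-\frac y2u_y+\frac u2-\frac{n-1}u=0.\qquad(\ast)$$ Let $\Gamma=\{r=\sqrt{2(n-1)}\}$. **Theorem.** Let $b_0>0$ be given. There is a constant $y_0>0$ for which the following holds. (a) For each $a>y_0$ there is a unique rotationally symmetric, smoothly embedded closed $n$-disc $\Sigma_a$ such that $\Sigma_a$ is a self-shrinker; $\Sigma_a$ meets the $y$-axis at $y=a$; $\Sigma_a$ is contained in the half cylinder $r\le\sqrt{2(n-1)}$, $y\ge y_0$; and $\partial\Sigma_a$ is contained in the disc $r\le\sqrt{2(n-1)}$, $y=y_0$. Moreover $\partial\Sigma_a$ is contained in the disc $r\le b_0y_0$, $y=y_0$. (b) For each $b\in(0,b_0)$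 there is an embedding $\tilde\Sigma_b$ of the cylinder $[y_0,\infty)\times S^{n-1}$, obtained by rotating the graph of a function $r=\tilde u_b(y)$, $y\ge y_0$, about the $y$-axis, such that $\tilde\Sigma_b$ is a self-shrinker and $\tilde u_b$ solves $(\ast)$; $\tilde u_b>\sqrt{2(n-1)}$; $\tilde u_b(y)=by+\mathcal O(y^{-1})$ as $y\to\infty$; and $\partial\tilde\Sigma_b$ is contained in the disc $r\le\sqrt{2(n-1)+b^2y_0^2}$, $y=y_0$. (c) The discs $\Sigma_a$ ($a>y_0$), the cylinders $\tilde\Sigma_b$ ($0<b<b_0$) and the cylinder $\Gamma$, each intersected with the region $\Omega=\{r<b_0y,\ y>y_0\}$, form a foliation of $\Omega$: they are connected, every point of $\Omega$ lies on exactly one of them, and $\Omega$ is covered by charts (homeomorphisms from open sets onto $B^n\times(-1,1)$, with $B^n$ the open unit ball of $\mathbb R^n$) in which the leaves are the slices $B^n\times\{t\}$. The unit normals to $\Sigma_a$, $\tilde\Sigma_b$ and $\Gamma$ (suitably oriented) define a continuous vector field on $\Omega$ that is smooth on $\Omega\setminus\Gamma$. (d) There are constants $C_0,C>0$ such that for every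 $a>y_0$ the disc $\Sigma_a$ is obtained by rotating the graph over $[y_0,a]$ of a continuous function $r=u_a(y)$ on $[0,a]$ that is positive and smooth on $[0,a)$, solves $(\ast)$ on $(0,a)$, vanishes at $y=a$, and satisfies $$u_a(y)\ge\sqrt{2(n-1)}\sqrt{1-y^2/a^2}\quad(0\le y\le a),$$ $$u_a(y)\le\sqrt{2(n-1)}\sqrt{1-\Bigl(1-C\,\frac{\ln a}{a^2}\Bigr)\frac{y^2-10}{a^2}}\quad(5\le y\le a-C_0/a).$$ -/

import Mathlib

open scoped ContDiff RealInnerProductSpace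

noncomputable section

namespace ShrinkerFoliation

/-- Euclidean `ℝⁿ`. -/
abbrev Rn (n : ℕ) : Type := EuclideanSpace ℝ (Fin n)

/-- Euclidean `ℝ^{n+1} = ℝ × ℝⁿ`. A point `p` has the axial coordinate `y = p.fst`, the transversal
coordinates `p.snd`, and the distance `r = ‖p.snd‖` to the `y`-axis. -/
abbrev Amb (n : ℕ) : Type := WithLp 2 (ℝ × EuclideanSpace ℝ (Fin n))

/-- The point `(y, x)` of `ℝ × ℝⁿ`. -/
def pt {n : ℕ} (y : ℝ) (x : Rn n) : Amb n := WithLp.toLp 2 (y, x)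

/-- The radius `√(2(n-1))` of the self-shrinking cylinder. -/
def cylRadius (n : ℕ) : ℝ := √(2 * ((n : ℝ) - 1))

/-- The first fundamental form `g_{ij} = ∂ᵢF · ∂ⱼF` of a parametrized hypersurface. -/
def firstFundamentalForm {n : ℕ} (F : Rn n → Amb n) (x : Rn n) : Matrix (Fin n) (Fin n) ℝ :=
  Matrix.of fun i j =>
    ⟪fderiv ℝ F x (EuclideanSpace.single i 1), fderiv ℝ F x (EuclideanSpace.single j 1)⟫

/-- `ν` is a unit normal of the parametrized hypersurface `F` at the parameter `x`. -/
def IsUnitNormal {n : ℕ} (F : Rn n → Amb n) (x : Rn n) (ν : Amb n) : Prop :=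
  ‖ν‖ = 1 ∧ ∀ v : Rn n, ⟪fderiv ℝ F x v, ν⟫ = 0

/-- The mean curvature `H = ∑ g^{ij} (∂ᵢ∂ⱼF · ν)` with respect to the unit normal `ν` (it is
negative for the outward normal of a round sphere). -/
def meanCurvature {n : ℕ} (F : Rn n → Amb n) (x : Rn n) (ν : Amb n) : ℝ :=
  ∑ i, ∑ j, (firstFundamentalForm F x)⁻¹ i j *
    ⟪fderiv ℝ (fderiv ℝ F) x (EuclideanSpace.single i 1) (EuclideanSpace.single j 1), ν⟫

/-- The self-shrinker equation `H + ½ X · ν = 0` along `F(K)`. -/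
def IsSelfShrinkerOn {n : ℕ} (F : Rn n → Amb n) (K : Set (Rn n)) : Prop :=
  ∀ x ∈ K, ∀ ν, IsUnitNormal F x ν → meanCurvature F x ν + (1 / 2) * ⟪F x, ν⟫ = 0

/-- `F` restricts to a smooth embedding (up to the boundary) of `K ⊆ ℝⁿ`. -/
def IsSmoothEmbeddingOn {n : ℕ} (F : Rn n → Amb n) (K : Set (Rn n)) : Prop :=
  (∃ U, IsOpen U ∧ K ⊆ U ∧ ContDiffOn ℝ ∞ F U) ∧
  (∀ x ∈ K, Function.Injective (fderiv ℝ F x)) ∧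
  Topology.IsEmbedding (K.domRestrict F)

/-- `F`, on the closed unit ball, commutes with the action of `O(n)`, which on `ℝ × ℝⁿ` fixes the
`y`-axis. -/
def IsRotationallySymmetric {n : ℕ} (F : Rn n → Amb n) : Prop :=
  ∀ A : Rn n ≃ₗᵢ[ℝ] Rn n, ∀ x ∈ Metric.closedBall (0 : Rn n) 1,
    F (A x) = pt (F x).fst (A (F x).snd)

/-- The disc `r ≤ R`, `y = y₀`. -/
def disc (n : ℕ) (y₀ R : ℝ) : Set (Amb n) := {p | p.fst = y₀ ∧ ‖p.snd‖ ≤ R}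

/-- `F`, on the closed unit ball, is a rotationally symmetric smooth embedding of a disc that is a
self-shrinker, meets the `y`-axis at `y = a`, lies in `r ≤ √(2(n-1))`, `y ≥ y₀`, and has its
boundary in the disc `r ≤ √(2(n-1))`, `y = y₀`. -/
structure IsCapEmbedding (n : ℕ) (y₀ a : ℝ) (F : Rn n → Amb n) : Prop where
  embedding : IsSmoothEmbeddingOn F (Metric.closedBall 0 1)
  symmetric : IsRotationallySymmetric F
  shrinker : IsSelfShrinkerOn F (Metric.closedBall 0 1)
  meets_axis : F '' Metric.closedBall 0 1 ∩ {p | p.snd = 0} = {pt a 0}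
  subset_halfCylinder :
    F '' Metric.closedBall 0 1 ⊆ {p | ‖p.snd‖ ≤ cylRadius n ∧ y₀ ≤ p.fst}
  boundary_subset : F '' Metric.sphere 0 1 ⊆ disc n y₀ (cylRadius n)

/-- `S` is the image of an embedding as in `IsCapEmbedding`. -/
def IsCap (n : ℕ) (y₀ a : ℝ) (S : Set (Amb n)) : Prop :=
  ∃ F, IsCapEmbedding n y₀ a F ∧ S = F '' Metric.closedBall 0 1

/-- The surface `r = u(y)`, `y ∈ I`, obtained by rotating the graph of `u` over `I`. -/
def surfaceOfRevolution (n : ℕ) (u : ℝ → ℝ) (I : Set ℝ) : Set (Amb n) :=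
  {p | p.fst ∈ I ∧ ‖p.snd‖ = u p.fst}

/-- The parametrization `(y, ω) ↦ (y, u(y) ω)` of a surface of revolution, where
`(y, ω) ∈ (0, ∞) × S^{n-1}` is written as the vector `z = y ω`. -/
def revolve {n : ℕ} (u : ℝ → ℝ) (z : Rn n) : Amb n := pt ‖z‖ ((u ‖z‖ / ‖z‖) • z)

/-- The cylinder `[y₀, ∞) × S^{n-1}`, with `(y, ω)` written as the vector `z = y ω`. -/
def tube (n : ℕ) (y₀ : ℝ) : Set (Rn n) := {z | y₀ ≤ ‖z‖}

/-- The equation `u'' / (1 + u'²) - (y/2) u' + u/2 - (n-1)/u = 0` at `y`. -/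
def ShrinkerODEAt (n : ℕ) (u : ℝ → ℝ) (y : ℝ) : Prop :=
  deriv (deriv u) y / (1 + deriv u y ^ 2) - y / 2 * deriv u y + u y / 2
    - ((n : ℝ) - 1) / u y = 0

/-- Rotating the graph of `u` over `[y₀, ∞)` gives an embedded cylinder that is a self-shrinker,
lies outside the cylinder of radius `√(2(n-1))`, is asymptotic to the cone of slope `b`, and has
its boundary in the disc `r ≤ √(2(n-1) + b² y₀²)`, `y = y₀`. -/
structure IsConicalEnd (n : ℕ) (y₀ b : ℝ) (u : ℝ → ℝ) : Prop where
  outside : ∀ y, y₀ ≤ y → cylRadius n < u y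
  embedding : IsSmoothEmbeddingOn (revolve (n := n) u) (tube n y₀)
  shrinker : IsSelfShrinkerOn (revolve (n := n) u) (tube n y₀)
  ode : ∀ y, y₀ ≤ y → ShrinkerODEAt n u y
  asymptotic : (fun y => u y - b * y) =O[Filter.atTop] fun y => y⁻¹
  boundary_subset : revolve (n := n) u '' Metric.sphere 0 y₀ ⊆
    disc n y₀ √(2 * ((n : ℝ) - 1) + b ^ 2 * y₀ ^ 2)

/-- The cylinder `r = √(2(n-1))`. -/
def cylinder (n : ℕ) : Set (Amb n) := {p | ‖p.snd‖ = cylRadius n}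

/-- The truncated cone `r < b₀ y`, `y > y₀`. -/
def region (n : ℕ) (b₀ y₀ : ℝ) : Set (Amb n) := {p | ‖p.snd‖ < b₀ * p.fst ∧ y₀ < p.fst}

/-- The members of `L`, intersected with the open set `Ω`, are the leaves of a foliation of `Ω` of
codimension one: they are connected and partition `Ω`, and `Ω` is covered by charts onto
`ball × (-1, 1)` in which the leaves are the slices `ball × {t}`. -/
def IsFoliation {n : ℕ} (Ω : Set (Amb n)) (L : Set (Set (Amb n))) : Prop :=
  (∀ p ∈ Ω, ∃! S, S ∈ L ∧ p ∈ S) ∧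
  (∀ S ∈ L, IsConnected (S ∩ Ω)) ∧
  ∀ p ∈ Ω, ∃ φ : OpenPartialHomeomorph (Amb n) (Rn n × ℝ),
    p ∈ φ.source ∧ φ.source ⊆ Ω ∧
    φ.target = Metric.ball (0 : Rn n) 1 ×ˢ Set.Ioo (-1 : ℝ) 1 ∧
    ∀ q ∈ φ.source, ∀ q' ∈ φ.source,
      ((φ q).2 = (φ q').2 ↔ ∃ S ∈ L, q ∈ S ∧ q' ∈ S)

/-- `v` is orthogonal at `p` to `S`, that is, to the velocity of every curve in `S` through `p`. -/
def IsNormalTo {n : ℕ} (S : Set (Amb n)) (p v : Amb n) : Prop :=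
  ∀ (γ : ℝ → Amb n) (w : Amb n), γ 0 = p → (∀ᶠ t in nhds 0, γ t ∈ S) → HasDerivAt γ w 0 →
    ⟪w, v⟫ = 0

/-- The leaves: the caps `Σ_a` with `a > y₀`, the ends `Σ̃_b` with `0 < b < b₀` obtained by rotating
the graphs of `u b` over `[y₀, ∞)`, and the cylinder. -/
def leaves (n : ℕ) (b₀ y₀ : ℝ) (cap : ℝ → Set (Amb n)) (u : ℝ → ℝ → ℝ) : Set (Set (Amb n)) :=
  {S | (∃ a, y₀ < a ∧ S = cap a) ∨
    (∃ b, 0 < b ∧ b < b₀ ∧ S = surfaceOfRevolution n (u b) (Set.Ici y₀)) ∨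
    S = cylinder n}

/-- The cap `S` is obtained by rotating the graph of the part over `[y₀, a]` of a function `u`
which, on `[0, a)`, is a positive solution of the self-shrinker equation, and `u a = 0`. -/
structure IsCapProfile (n : ℕ) (y₀ a : ℝ) (S : Set (Amb n)) (u : ℝ → ℝ) : Prop where
  continuousOn : ContinuousOn u (Set.Icc 0 a)
  smooth : ContDiffOn ℝ ∞ u (Set.Ico 0 a)
  pos : ∀ y ∈ Set.Ico 0 a, 0 < u y
  tip : u a = 0
  ode : ∀ y ∈ Set.Ioo 0 a, ShrinkerODEAt n u y
  eq_surface : S = surfaceOfRevolution n u (Set.Icc y₀ a)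

end ShrinkerFoliation

end

open ShrinkerFoliation

noncomputable section

namespace ShrinkerFoliation

open Set Filter Topology Metric Function
open Real (exp log sqrt_sq sq_sqrt sqrt_pos norm_of_nonneg norm_eq_abs exp_pos exp_add)

local notation:max n:max "₋₁" => ((n : ℝ) - 1)

variable {n : ℕ}

/-! ### First-crossing arguments -/

/-- A continuous function which is positive at the left end point and has positive derivative at
every potential first zero stays positive. -/
lemma pos_of_first_zero {φ : ℝ → ℝ} {α β : ℝ} (hc : ContinuousOn φ (Ico α β)) (h0 : 0 < φ α)
    (hd : ∀ r ∈ Ioo α β, φ r = 0 → (∀ s ∈ Ico α r, 0 < φ s) → ∃ d > 0, HasDerivAt φ d r) :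
    ∀ r ∈ Ico α β, 0 < φ r := by
  intro r hr
  by_contra! hneg
  set S := {s ∈ Icc α r | φ s ≤ 0}
  have hcr : ContinuousOn φ (Icc α r) := hc.mono fun s hs => ⟨hs.1, hs.2.trans_lt hr.2⟩
  have hScl : IsClosed S := hcr.preimage_isClosed_of_isClosed isClosed_Icc isClosed_Iic
  have hSne : S.Nonempty := ⟨r, ⟨hr.1, le_rfl⟩, hneg⟩
  have hSb : BddBelow S := ⟨α, fun s hs => hs.1.1⟩
  set ρ := sInf S
  have hρS : ρ ∈ S := hScl.csInf_mem hSne hSb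
  have hρα : α < ρ := by
    rcases hρS.1.1.lt_or_eq with h | h
    · exact h
    · exact absurd (h ▸ hρS.2) (not_le.2 h0)
  have hpos : ∀ s ∈ Ico α ρ, 0 < φ s := fun s hs => by
    by_contra h
    exact absurd (csInf_le hSb (show s ∈ S from ⟨⟨hs.1, hs.2.le.trans hρS.1.2⟩, not_lt.1 h⟩))
      (not_le.2 hs.2)
  have hρβ : ρ < β := hρS.1.2.trans_lt hr.2
  have hρ0 : φ ρ = 0 := by
    refine le_antisymm hρS.2 ?_
    have : Tendsto φ (𝓝[<] ρ) (𝓝 (φ ρ)) := ((hcr ρ hρS.1).mono_of_mem_nhdsWithin (by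
        refine mem_of_superset (Ioo_mem_nhdsLT hρα) fun s hs => ⟨hs.1.le, hs.2.le.trans hρS.1.2⟩))
    exact ge_of_tendsto this (mem_of_superset (Ioo_mem_nhdsLT hρα) fun s hs =>
      (hpos s ⟨hs.1.le, hs.2⟩).le)
  obtain ⟨d, hd0, hd'⟩ := hd ρ ⟨hρα, hρβ⟩ hρ0 hpos
  have h1 : ∀ᶠ s in 𝓝[<] ρ, slope φ ρ s ≤ 0 := by
    refine mem_of_superset (Ioo_mem_nhdsLT hρα) fun s hs => ?_
    rw [mem_ofPred_eq, slope_def_field, hρ0, sub_zero]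
    exact div_nonpos_of_nonneg_of_nonpos (hpos s ⟨hs.1.le, hs.2⟩).le (by linarith [hs.2])
  exact absurd (le_of_tendsto ((hasDerivAt_iff_tendsto_slope.1 hd').mono_left
    (nhdsWithin_mono ρ (show Iio ρ ⊆ {ρ}ᶜ from fun s hs => ne_of_lt hs))) h1) (not_le.2 hd0)

/-- The mirror image of `pos_of_first_zero`. -/
lemma pos_of_last_zero {φ : ℝ → ℝ} {α β : ℝ} (hc : ContinuousOn φ (Ioc α β)) (h0 : 0 < φ β)
    (hd : ∀ r ∈ Ioo α β, φ r = 0 → (∀ s ∈ Ioc r β, 0 < φ s) → ∃ d < 0, HasDerivAt φ d r) :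
    ∀ r ∈ Ioc α β, 0 < φ r := by
  have key := pos_of_first_zero (φ := fun x => φ (-x)) (α := -β) (β := -α)
    (hc.comp continuousOn_neg fun x hx => ⟨by linarith [hx.2], by linarith [hx.1]⟩)
    (by simpa using h0) (by
      intro r hr h1 h2
      obtain ⟨d, hd0, hd'⟩ := hd (-r) ⟨by linarith [hr.2], by linarith [hr.1]⟩ h1 (by
        intro s hs; simpa using h2 (-s) ⟨by linarith [hs.2], by linarith [hs.1]⟩)
      refine ⟨-d, by linarith, ?_⟩
      have := hd'.comp r (hasDerivAt_neg r)
      rw [mul_neg_one] at this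
      exact this)
  intro r hr
  simpa using key (-r) ⟨by linarith [hr.2], by linarith [hr.1]⟩

/-! ### Smooth dependence of fixed points -/

lemma exists_contDiffAt_fixedPoint {Λ X : Type*} [NormedAddCommGroup Λ] [NormedSpace ℝ Λ]
    [CompleteSpace Λ] [NormedAddCommGroup X] [NormedSpace ℝ X] [CompleteSpace X]
    {k : WithTop ℕ∞} (hne : k ≠ 0) {T : Λ × X → X} {l0 : Λ} {x0 : X}
    (hT : ContDiffAt ℝ k T (l0, x0)) (hfix : T (l0, x0) = x0)
    {K : X →L[ℝ] X} (hK : HasFDerivAt (fun x => T (l0, x)) K x0) (hinv : IsUnit (1 - K)) :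
    ∃ φ : Λ → X, ContDiffAt ℝ k φ l0 ∧ φ l0 = x0 ∧ (∀ᶠ l in 𝓝 l0, T (l, φ l) = φ l) ∧
      ∀ᶠ z in 𝓝 (l0, x0), T z = z.2 → z.2 = φ z.1 := by
  set f : Λ × X → X := fun z => z.2 - T z
  have hf : ContDiffAt ℝ k f (l0, x0) := contDiffAt_snd.sub hT
  have hder : fderiv ℝ f (l0, x0) ∘L .inr ℝ Λ X = 1 - K := by
    have h1 : HasFDerivAt (fun x => f (l0, x)) (fderiv ℝ f (l0, x0) ∘L .inr ℝ Λ X) x0 :=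
      ((hf.differentiableAt hne).hasFDerivAt).comp x0 (hasFDerivAt_prodMk_right l0 x0)
    have h2 : HasFDerivAt (fun x => f (l0, x)) (1 - K) x0 := (hasFDerivAt_id x0).sub hK
    exact h1.unique h2
  have hi : (fderiv ℝ f (l0, x0) ∘L .inr ℝ Λ X).IsInvertible := by
    rw [hder]
    obtain ⟨u, hu⟩ := hinv
    exact ⟨ContinuousLinearEquiv.ofUnit u, by ext; simp [← hu, ContinuousLinearEquiv.ofUnit]⟩
  refine ⟨hf.implicitFunction hne hi, hf.contDiffAt_implicitFunction hne hi,
    hf.implicitFunction_apply_self hne hi, ?_, ?_⟩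
  · filter_upwards [hf.eventually_apply_implicitFunction hne hi] with l hl
    simp only [f, hfix, sub_self] at hl
    exact (sub_eq_zero.1 hl).symm
  · filter_upwards [hf.eventually_apply_eq_iff_implicitFunction hne hi] with z hz hz'
    exact (hz.1 (by simp only [f, hz', hfix, sub_self])).symm

lemma exists_smooth_fixedPoint {Λ X : Type*} [NormedAddCommGroup Λ] [NormedSpace ℝ Λ]
    [CompleteSpace Λ] [NormedAddCommGroup X] [NormedSpace ℝ X] [CompleteSpace X]
    {T : Λ × X → X} {l0 : Λ} {x0 : X} (hT : ContDiffAt ℝ ∞ T (l0, x0)) (hfix : T (l0, x0) = x0)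
    {K : X →L[ℝ] X} (hK : HasFDerivAt (fun x => T (l0, x)) K x0) (hinv : IsUnit (1 - K)) :
    ∃ φ : Λ → X, ContDiffAt ℝ ∞ φ l0 ∧ φ l0 = x0 ∧ ∀ᶠ l in 𝓝 l0, T (l, φ l) = φ l := by
  obtain ⟨φ, h1, h2, h3, -⟩ := exists_contDiffAt_fixedPoint (by simp) hT hfix hK hinv
  exact ⟨φ, h1, h2, h3⟩

lemma hasFDerivAt_of_sub_eq {X : Type*} [NormedAddCommGroup X] [NormedSpace ℝ X]
    {T : X → X} {K : X → X →L[ℝ] X} {x0 : X}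
    (h : ∀ᶠ x in 𝓝 x0, T x - T x0 = K x (x - x0)) (hK : ContinuousAt K x0) :
    HasFDerivAt T (K x0) x0 := by
  rw [hasFDerivAt_iff_isLittleO, Asymptotics.isLittleO_iff]
  intro c hc
  filter_upwards [h, continuousAt_iff'.1 hK c hc] with x hx hx'
  rw [hx, ← sub_apply]
  exact (ContinuousLinearMap.le_opNorm _ _).trans
    (mul_le_mul_of_nonneg_right (by rw [← dist_eq_norm]; exact hx'.le) (norm_nonneg _))

section

open intervalIntegral

/-! ### Volterra operators on `C([0, 1], ℝ)` -/

/-- The Banach algebra of continuous functions on the unit interval. -/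
abbrev CI : Type := C(unitInterval, ℝ)

/-- The continuous extension of `φ : C([0, 1], ℝ)` to the real line. -/
def ext01 (φ : CI) (s : ℝ) : ℝ := φ (projIcc 0 1 zero_le_one s)

lemma ext01_of_mem (φ : CI) {s : ℝ} (hs : s ∈ Icc (0 : ℝ) 1) : ext01 φ s = φ ⟨s, hs⟩ := by
  rw [ext01, projIcc_of_mem zero_le_one hs]

lemma ext01_coe (φ : CI) (s : unitInterval) : ext01 φ s = φ s := ext01_of_mem φ s.2

lemma continuous_ext01 (φ : CI) : Continuous (ext01 φ) := φ.continuous.comp continuous_projIcc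

lemma abs_ext01_le (φ : CI) (s : ℝ) : |ext01 φ s| ≤ ‖φ‖ := φ.norm_coe_le_norm _

lemma ext01_bound {φ : CI} {c : ℝ} {k : ℕ} (h : ∀ σ : unitInterval, |φ σ| ≤ c * (σ : ℝ) ^ k)
    {s : ℝ} (hs : s ∈ Icc (0 : ℝ) 1) : |ext01 φ s| ≤ c * s ^ k := by
  rw [ext01_of_mem φ hs]; exact h ⟨s, hs⟩

/-- The primitive `σ ↦ ∫₀^σ φ`. -/
def primitive : CI →L[ℝ] CI := LinearMap.mkContinuous
    { toFun := fun φ => ⟨fun σ => ∫ s in (0 : ℝ)..σ, ext01 φ s, (continuous_primitive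
          (fun a b => (continuous_ext01 φ).intervalIntegrable a b) 0).comp continuous_subtype_val⟩
      map_add' := fun φ ψ => by
        ext σ
        exact integral_add ((continuous_ext01 φ).intervalIntegrable _ _)
          ((continuous_ext01 ψ).intervalIntegrable _ _)
      map_smul' := fun c φ => by
        ext σ; exact integral_const_mul c _ } 1 (fun φ => by
      rw [ContinuousMap.norm_le _ (by positivity)]
      intro σ
      have h := norm_integral_le_of_norm_le_const (a := 0) (b := (σ : ℝ))
        (f := ext01 φ) (C := ‖φ‖) (fun s _ => abs_ext01_le φ s)
      refine h.trans ?_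
      rw [sub_zero, abs_of_nonneg σ.2.1, one_mul]
      exact mul_le_of_le_one_right (norm_nonneg _) σ.2.2)

lemma primitive_apply (φ : CI) (σ : unitInterval) :
    primitive φ σ = ∫ s in (0 : ℝ)..σ, ext01 φ s := rfl

/-- The weighted average `σ ↦ ∫₀¹ 2 κ^{n-1} φ(κ² σ) dκ`. -/
def average (n : ℕ) : CI →L[ℝ] CI := LinearMap.mkContinuous
    { toFun := fun φ => ⟨fun σ => ∫ κ in (0 : ℝ)..1, 2 * κ ^ (n - 1) * ext01 φ (κ ^ 2 * σ), by
        apply continuous_parametric_intervalIntegral_of_continuous'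
        have := continuous_ext01 φ; simp only [uncurry_def]; fun_prop⟩
      map_add' := fun φ ψ => by
        ext σ
        have h1 := continuous_ext01 φ
        have h2 := continuous_ext01 ψ
        refine Eq.trans ?_ (integral_add (Continuous.intervalIntegrable (by fun_prop) _ _)
          (Continuous.intervalIntegrable (by fun_prop) _ _))
        refine integral_congr fun κ _ => ?_
        simp [ext01, mul_add]
      map_smul' := fun c φ => by
        ext σ
        refine Eq.trans ?_ (integral_const_mul c _)
        refine integral_congr fun κ _ => ?_
        simp [ext01]; ring } 2 (fun φ => by
      rw [ContinuousMap.norm_le _ (by positivity)]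
      intro σ
      have h := norm_integral_le_of_norm_le_const (a := 0) (b := (1 : ℝ))
        (f := fun κ => 2 * κ ^ (n - 1) * ext01 φ (κ ^ 2 * σ)) (C := 2 * ‖φ‖) (fun s hs => by
          rw [uIoc_of_le zero_le_one] at hs
          rw [norm_eq_abs, abs_mul, abs_of_nonneg (by have := hs.1; positivity)]
          have h1 : s ^ (n - 1) ≤ 1 := pow_le_one₀ hs.1.le hs.2
          have h2 := abs_ext01_le φ (s ^ 2 * σ)
          have h3 : 0 ≤ s ^ (n - 1) := pow_nonneg hs.1.le _
          nlinarith [abs_nonneg (ext01 φ (s ^ 2 * σ)), norm_nonneg φ])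
      simpa using h)

lemma average_apply (n : ℕ) (φ : CI) (σ : unitInterval) :
    average n φ σ = ∫ κ in (0 : ℝ)..1, 2 * κ ^ (n - 1) * ext01 φ (κ ^ 2 * σ) := rfl

/-- `K` raises the order of vanishing at `0` by one, with the gain of a factor `C / (k + 1)`. -/
def IsVolterra (C : ℝ) (K : CI →L[ℝ] CI) : Prop :=
  ∀ (k : ℕ) (c : ℝ) (φ : CI), (∀ σ : unitInterval, |φ σ| ≤ c * (σ : ℝ) ^ k) →
    ∀ σ : unitInterval, |K φ σ| ≤ c * C * (σ : ℝ) ^ (k + 1) / (k + 1)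

lemma nonneg_of_pow_bound {φ : CI} {c : ℝ} {k : ℕ}
    (h : ∀ σ : unitInterval, |φ σ| ≤ c * (σ : ℝ) ^ k) : 0 ≤ c := by
  have := (abs_nonneg _).trans (h 1)
  simpa using this

lemma isVolterra_primitive : IsVolterra 1 primitive := by
  intro k c φ h σ
  rw [primitive_apply]
  rw [← norm_eq_abs]
  refine (norm_integral_le_of_norm_le (a := 0) (b := (σ : ℝ)) (f := ext01 φ)
    (g := fun s => c * s ^ k) σ.2.1 (Eventually.of_forall fun s hs => ext01_bound h
    ⟨hs.1.le, hs.2.trans σ.2.2⟩) (Continuous.intervalIntegrable (μ := MeasureTheory.volume)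
    (by fun_prop) _ _)).trans (le_of_eq ?_)
  rw [integral_const_mul, integral_pow]
  simp
  ring

lemma IsVolterra.add {C C' : ℝ} {K K' : CI →L[ℝ] CI} (h : IsVolterra C K)
    (h' : IsVolterra C' K') : IsVolterra (C + C') (K + K') := by
  intro k c φ hφ σ
  calc |(K + K') φ σ| ≤ |K φ σ| + |K' φ σ| := abs_add_le _ _
    _ ≤ _ := add_le_add (h k c φ hφ σ) (h' k c φ hφ σ)
    _ = _ := by ring

lemma IsVolterra.smul {C : ℝ} {K : CI →L[ℝ] CI} (h : IsVolterra C K) (t : ℝ) :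
    IsVolterra (|t| * C) (t • K) := by
  intro k c φ hφ σ
  calc |(t • K) φ σ| = |t| * |K φ σ| := abs_mul _ _
    _ ≤ |t| * _ := mul_le_mul_of_nonneg_left (h k c φ hφ σ) (abs_nonneg t)
    _ = _ := by ring

lemma abs_mul_bound {φ : CI} {c : ℝ} {k : ℕ} (m : CI)
    (h : ∀ σ : unitInterval, |φ σ| ≤ c * (σ : ℝ) ^ k) (σ : unitInterval) :
    |(m * φ) σ| ≤ ‖m‖ * c * (σ : ℝ) ^ k := by
  rw [ContinuousMap.mul_apply, abs_mul, mul_assoc]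
  exact mul_le_mul (m.norm_coe_le_norm σ) (h σ) (abs_nonneg _) (norm_nonneg _)

lemma IsVolterra.comp_mul {C : ℝ} {K : CI →L[ℝ] CI} (h : IsVolterra C K) (m : CI) :
    IsVolterra (‖m‖ * C) (K ∘L ContinuousLinearMap.mul ℝ CI m) := by
  intro k c φ hφ σ
  refine (h k (‖m‖ * c) (m * φ) (abs_mul_bound m hφ) σ).trans (le_of_eq ?_)
  ring

lemma primitive_bound {φ : CI} {c : ℝ} {k : ℕ}
    (h : ∀ σ : unitInterval, |φ σ| ≤ c * (σ : ℝ) ^ k) (σ : unitInterval) :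
    |primitive φ σ| ≤ c * (σ : ℝ) ^ k := by
  have hc := nonneg_of_pow_bound h
  refine (isVolterra_primitive k c φ h σ).trans ?_
  rw [div_le_iff₀ (by positivity), pow_succ]
  have h1 : (σ : ℝ) ≤ 1 := σ.2.2
  have h0 : (0 : ℝ) ≤ σ := σ.2.1
  have h2 : (0 : ℝ) ≤ c * (σ : ℝ) ^ k := by positivity
  nlinarith

lemma IsVolterra.comp_primitive {C : ℝ} {K : CI →L[ℝ] CI} (h : IsVolterra C K) :
    IsVolterra C (K ∘L primitive) := fun k c _ hφ σ => h k c _ (primitive_bound hφ) σ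

lemma average_bound (hn : 2 ≤ n) {φ : CI} {c : ℝ} {k : ℕ}
    (h : ∀ σ : unitInterval, |φ σ| ≤ c * (σ : ℝ) ^ k) (σ : unitInterval) :
    |average n φ σ| ≤ c * (σ : ℝ) ^ k / (k + 1) := by
  rw [average_apply, ← norm_eq_abs]
  have h1 := norm_integral_le_of_norm_le (a := 0) (b := (1 : ℝ))
    (f := fun κ => 2 * κ ^ (n - 1) * ext01 φ (κ ^ 2 * σ))
    (g := fun κ => 2 * c * (σ : ℝ) ^ k * κ ^ (2 * k + 1)) zero_le_one
    (Eventually.of_forall fun s hs => by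
      have hs0 := hs.1.le
      have hσ := σ.2
      have hm : s ^ 2 * (σ : ℝ) ∈ Icc (0 : ℝ) 1 :=
        ⟨mul_nonneg (by positivity) hσ.1, mul_le_one₀ (pow_le_one₀ hs0 hs.2) hσ.1 hσ.2⟩
      rw [norm_eq_abs, abs_mul, abs_of_nonneg (by positivity)]
      have e1 := ext01_bound h hm
      have e2 : s ^ (n - 1) ≤ s := by
        simpa using pow_le_pow_of_le_one hs0 hs.2 (show 1 ≤ n - 1 by omega)
      calc 2 * s ^ (n - 1) * |ext01 φ (s ^ 2 * σ)| ≤ 2 * s * (c * (s ^ 2 * σ) ^ k) := by gcongr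
        _ = _ := by rw [mul_pow, ← pow_mul]; ring)
    (Continuous.intervalIntegrable (μ := MeasureTheory.volume) (by fun_prop) _ _)
  refine h1.trans (le_of_eq ?_)
  rw [integral_const_mul, integral_pow]
  field_simp
  simp
  ring

/-- The identity function of the unit interval. -/
def idCI : CI := ⟨fun σ => (σ : ℝ), continuous_subtype_val⟩

lemma isVolterra_average_mul_id (hn : 2 ≤ n) :
    IsVolterra 1 (average n ∘L ContinuousLinearMap.mul ℝ CI idCI) := by
  intro k c φ h σ
  have hc := nonneg_of_pow_bound h
  have := average_bound hn (φ := idCI * φ) (c := c) (k := k + 1) (fun σ => by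
    rw [ContinuousMap.mul_apply, abs_mul, pow_succ, abs_of_nonneg (show 0 ≤ idCI σ from σ.2.1),
      mul_comm]
    calc _ ≤ c * (σ : ℝ) ^ k * σ := mul_le_mul_of_nonneg_right (h σ) σ.2.1
      _ = _ := by ring) σ
  refine (show |(average n ∘L ContinuousLinearMap.mul ℝ CI idCI) φ σ| ≤ _ from this).trans ?_
  have h0 : (0 : ℝ) ≤ σ := σ.2.1
  rw [mul_one]
  gcongr
  linarith

lemma isVolterra_average_mul_primitive (hn : 2 ≤ n) (m : CI) :
    IsVolterra ‖m‖ (average n ∘L ContinuousLinearMap.mul ℝ CI m ∘L primitive) := by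
  intro k c φ h σ
  have hc := nonneg_of_pow_bound h
  have e1 : ∀ σ : unitInterval, |primitive φ σ| ≤ c / (k + 1) * (σ : ℝ) ^ (k + 1) := fun σ => by
    refine (isVolterra_primitive k c φ h σ).trans (le_of_eq ?_)
    ring
  refine (average_bound hn (abs_mul_bound m e1) σ).trans ?_
  have h0 : (0 : ℝ) ≤ σ := σ.2.1
  have : ‖m‖ * (c / (k + 1)) * (σ : ℝ) ^ (k + 1) = c * ‖m‖ * σ ^ (k + 1) / (k + 1) := by ring
  rw [this]
  exact div_le_self (by positivity) (by push_cast; linarith [show (0 : ℝ) ≤ k by positivity])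

lemma IsVolterra.pow_bound {C : ℝ} {K : CI →L[ℝ] CI} (h : IsVolterra C K) (N : ℕ) (φ : CI)
    (σ : unitInterval) : |(K ^ N) φ σ| ≤ ‖φ‖ * C ^ N / N.factorial * (σ : ℝ) ^ N := by
  induction N generalizing σ with
  | zero => simpa using φ.norm_coe_le_norm σ
  | succ N ih =>
    rw [pow_succ', mul_apply_eq_comp]
    refine (h N _ _ ih σ).trans (le_of_eq ?_)
    rw [Nat.factorial_succ]
    push_cast; field_simp; ring

lemma IsVolterra.isUnit_one_sub {C : ℝ} {K : CI →L[ℝ] CI} (h : IsVolterra C K) :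
    IsUnit (1 - K) := by
  obtain ⟨N, hN⟩ : ∃ N : ℕ, |C ^ N / N.factorial| < 1 := by
    have := (FloorSemiring.tendsto_pow_div_factorial_atTop C).abs
    rw [abs_zero] at this
    exact (this.eventually (gt_mem_nhds one_pos)).exists
  have hnorm : ‖K ^ N‖ < 1 := by
    refine lt_of_le_of_lt (ContinuousLinearMap.opNorm_le_bound _ (abs_nonneg _) fun φ => ?_) hN
    rw [ContinuousMap.norm_le _ (by positivity)]
    intro σ
    refine (h.pow_bound N φ σ).trans ?_
    have h1 : (σ : ℝ) ^ N ≤ 1 := pow_le_one₀ σ.2.1 σ.2.2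
    have h0 : (0 : ℝ) ≤ (σ : ℝ) ^ N := pow_nonneg σ.2.1 _
    calc ‖φ‖ * C ^ N / N.factorial * (σ : ℝ) ^ N
        = ‖φ‖ * (C ^ N / N.factorial) * (σ : ℝ) ^ N := by ring
      _ ≤ ‖φ‖ * |C ^ N / N.factorial| * (σ : ℝ) ^ N := by gcongr; exact le_abs_self _
      _ ≤ ‖φ‖ * |C ^ N / N.factorial| * 1 := by gcongr
      _ = _ := by ring
  have hu := isUnit_one_sub_of_norm_lt_one (R := CI →L[ℝ] CI) (x := K ^ N) hnorm
  rw [← mul_neg_geom_sum] at hu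
  have hcomm : Commute (1 - K) (∑ i ∈ Finset.range N, K ^ i) := by
    rw [commute_iff_eq, mul_neg_geom_sum, geom_sum_mul_neg]
  exact (hcomm.isUnit_mul_iff.1 hu).1

lemma IsVolterra.eq_zero_of_fixed {C : ℝ} {K : CI →L[ℝ] CI} (h : IsVolterra C K) {φ : CI}
    (hφ : K φ = φ) : φ = 0 := by
  obtain ⟨u, hu⟩ := h.isUnit_one_sub
  have h1 : (1 - K) φ = 0 := by simp [hφ]
  have h2 : ((↑u⁻¹ : CI →L[ℝ] CI) * (1 - K)) φ = 0 := by rw [mul_apply_eq_comp, h1, map_zero]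
  rwa [← hu, Units.inv_mul, one_apply_eq_self] at h2

end

section

open intervalIntegral

/-! ### The profile of a cap as a graph over the radius -/

/-- The right-hand side of the equation `t p' + (n/2) p = G(t, h, p)` for `p = h'`, which says that
rotating the graph `y = h(r²)` gives a self-shrinker. -/
def capG (n : ℕ) (t h p : ℝ) : ℝ := -h / 8 + t * (p / 4 - p ^ 2 * ((2 * n₋₁ - t) * p + h / 2))

/-- The graph `y = f(r)`, `0 ≤ r ≤ ρ`, with `f' = 2 r π`, is the profile of a self-shrinker that
meets the axis orthogonally at `y = a`. -/
structure IsCapArc (n : ℕ) (a ρ : ℝ) (f π : ℝ → ℝ) : Prop where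
  f_zero : f 0 = a
  p_zero : π 0 = -a / (4 * n)
  cont_f : ContinuousOn f (Icc 0 ρ)
  cont_p : ContinuousOn π (Icc 0 ρ)
  deriv_f : ∀ r ∈ Ioo 0 ρ, HasDerivAt f (2 * r * π r) r
  deriv_p : ∀ r ∈ Ioo 0 ρ, HasDerivAt π (2 / r * (capG n (r ^ 2) (f r) (π r) - n / 2 * π r)) r

lemma IsCapArc.mono {a ρ ρ' : ℝ} {f π : ℝ → ℝ} (h : IsCapArc n a ρ f π) (hρ : ρ' ≤ ρ) :
    IsCapArc n a ρ' f π :=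
  ⟨h.f_zero, h.p_zero, h.cont_f.mono (Icc_subset_Icc_right hρ),
    h.cont_p.mono (Icc_subset_Icc_right hρ), fun r hr => h.deriv_f r ⟨hr.1, hr.2.trans_le hρ⟩,
    fun r hr => h.deriv_p r ⟨hr.1, hr.2.trans_le hρ⟩⟩

/-- The height `σ ↦ h(T σ)` of a cap in terms of `p`. -/
def capHeight (a T : ℝ) (p : CI) : CI := a • (1 : CI) + T • primitive p

/-- The function `G(T σ, h(T σ), p(T σ))`. -/
def capSource (n : ℕ) (a T : ℝ) (p : CI) : CI :=
  (-(1 / 8) : ℝ) • capHeight a T p + T • (idCI * ((1 / 4 : ℝ) • p -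
    p ^ 2 * (((2 * n₋₁) • (1 : CI) - T • idCI) * p + (1 / 2 : ℝ) • capHeight a T p)))

/-- The operator whose fixed points are the caps. -/
def capOp (n : ℕ) (z : (ℝ × ℝ) × CI) : CI := average n (capSource n z.1.1 z.1.2 z.2)

lemma contDiff_capOp (n : ℕ) : ContDiff ℝ ∞ (capOp n) := by
  unfold capOp capSource capHeight
  fun_prop

/-- The derivative of `capOp`, and more generally its difference quotients. -/
def capDiff (n : ℕ) (a T : ℝ) (p q : CI) : CI →L[ℝ] CI :=
  (average n ∘L ContinuousLinearMap.mul ℝ CI idCI) ∘L ContinuousLinearMap.mul ℝ CI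
      (T • ((1 / 4 : ℝ) • (1 : CI) - (p + q) * (((2 * n₋₁) • (1 : CI) - T • idCI) * p +
        (1 / 2 : ℝ) • capHeight a T p) - q ^ 2 * ((2 * n₋₁) • (1 : CI) - T • idCI))) +
    average n ∘L ContinuousLinearMap.mul ℝ CI
      ((-(1 / 8) * T) • (1 : CI) - (T * T / 2) • (idCI * q ^ 2)) ∘L primitive

lemma capOp_sub (n : ℕ) (a T : ℝ) (p q : CI) :
    capOp n ((a, T), p) - capOp n ((a, T), q) = capDiff n a T p q (p - q) := by
  simp only [capOp, capDiff, add_apply, ContinuousLinearMap.comp_apply,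
    ContinuousLinearMap.mul_apply', ← map_sub, ← map_add]
  congr 1
  simp only [capSource, capHeight, map_sub, Algebra.smul_def, mul_one, map_mul, map_neg]
  set A := algebraMap ℝ CI
  have e4 : A (1 / 4) = 2 * A (1 / 8) := by rw [← map_ofNat A, ← map_mul]; norm_num
  have e2 : A (1 / 2) = 4 * A (1 / 8) := by rw [← map_ofNat A, ← map_mul]; norm_num
  have e3 : A (T * T / 2) = 4 * A (1 / 8) * A T * A T := by
    rw [← map_ofNat A, ← map_mul, ← map_mul, ← map_mul]; congr 1; ring
  rw [e4, e2, e3]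
  ring

lemma exists_isVolterra_capDiff (hn : 2 ≤ n) (a T : ℝ) (p q : CI) :
    ∃ C, IsVolterra C (capDiff n a T p q) :=
  ⟨_, ((isVolterra_average_mul_id hn).comp_mul _).add (isVolterra_average_mul_primitive hn _)⟩

lemma capOp_fixed_unique (hn : 2 ≤ n) {a T : ℝ} {p q : CI}
    (hp : capOp n ((a, T), p) = p) (hq : capOp n ((a, T), q) = q) : p = q := by
  obtain ⟨C, hC⟩ := exists_isVolterra_capDiff hn a T p q
  refine sub_eq_zero.1 (hC.eq_zero_of_fixed ?_)
  rw [← capOp_sub, hp, hq]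

lemma exists_smooth_capOp_fixed (hn : 2 ≤ n) {a T : ℝ} {p : CI} (hp : capOp n ((a, T), p) = p) :
    ∃ P : ℝ × ℝ → CI, ContDiffAt ℝ ∞ P (a, T) ∧ P (a, T) = p ∧
      ∀ᶠ l in 𝓝 (a, T), capOp n (l, P l) = P l := by
  obtain ⟨C, hC⟩ := exists_isVolterra_capDiff hn a T p p
  refine exists_smooth_fixedPoint (contDiff_capOp n).contDiffAt hp
    (K := capDiff n a T p p) ?_ hC.isUnit_one_sub
  refine hasFDerivAt_of_sub_eq (K := fun q => capDiff n a T q p)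
    (Eventually.of_forall fun q => capOp_sub n a T q p) ?_
  refine Continuous.continuousAt ?_
  unfold capDiff capHeight
  fun_prop

lemma capSource_apply (n : ℕ) (a T : ℝ) (p : CI) (σ : unitInterval) :
    capSource n a T p σ = capG n (T * σ) (capHeight a T p σ) (p σ) := by
  simp only [capSource, capG, idCI, ContinuousMap.add_apply, ContinuousMap.smul_apply, smul_eq_mul,
    ContinuousMap.mul_apply, ContinuousMap.coe_mk, ContinuousMap.sub_apply, ContinuousMap.pow_apply,
    ContinuousMap.one_apply]
  ring

lemma capHeight_apply (a T : ℝ) (p : CI) (σ : unitInterval) :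
    capHeight a T p σ = a + T * ∫ s in (0 : ℝ)..σ, ext01 p s := by
  simp [capHeight, primitive_apply]

/-- The total mass of the kernel of `average`. -/
lemma integral_average_const (hn : 2 ≤ n) (c : ℝ) :
    ∫ κ in (0 : ℝ)..1, 2 * κ ^ (n - 1) * c = 2 * c / n := by
  have e : ((n - 1 : ℕ) : ℝ) + 1 = n := by rw [Nat.cast_sub (by omega)]; push_cast; ring
  rw [integral_mul_const, integral_const_mul, integral_pow, e]
  simp
  ring

/-- The arc determined by a fixed point of `capOp`. -/
lemma isCapArc_of_fixed (hn : 2 ≤ n) {a ρ : ℝ} (hρ : 0 < ρ) {p : CI}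
    (hp : capOp n ((a, ρ ^ 2), p) = p) :
    IsCapArc n a ρ (fun r => a + ρ ^ 2 * ∫ s in (0 : ℝ)..r ^ 2 / ρ ^ 2, ext01 p s)
      (fun r => ext01 p (r ^ 2 / ρ ^ 2)) := by
  set S : CI := capSource n a (ρ ^ 2) p with hS
  have hfix : ∀ σ : unitInterval, p σ = ∫ κ in (0 : ℝ)..1, 2 * κ ^ (n - 1) * ext01 S (κ ^ 2 * σ) :=
    fun σ => by conv_lhs => rw [← hp]
                rfl
  have hcp := continuous_ext01 p
  have hmem : ∀ r ∈ Icc 0 ρ, r ^ 2 / ρ ^ 2 ∈ Icc (0 : ℝ) 1 := fun r hr =>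
    ⟨by positivity, by rw [div_le_one (by positivity)]; exact pow_le_pow_left₀ hr.1 hr.2 2⟩
  have hcf : Continuous fun r : ℝ => a + ρ ^ 2 * ∫ s in (0 : ℝ)..r ^ 2 / ρ ^ 2, ext01 p s := by
    have h1 : Continuous fun r : ℝ => r ^ 2 / ρ ^ 2 := by fun_prop
    exact continuous_const.add (continuous_const.mul ((continuous_primitive
      (fun a b => hcp.intervalIntegrable a b) 0).comp h1))
  refine ⟨by simp, ?_, hcf.continuousOn, ?_, ?_, ?_⟩
  · have h0 : ext01 p ((0 : ℝ) ^ 2 / ρ ^ 2) = p 0 := by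
      rw [show (0 : ℝ) ^ 2 / ρ ^ 2 = ((0 : unitInterval) : ℝ) by simp, ext01_coe]
    have h1 : S 0 = -a / 8 := by rw [hS, capSource_apply, capHeight_apply]; simp [capG]
    have h2 : ∀ κ : ℝ, ext01 S (κ ^ 2 * ((0 : unitInterval) : ℝ)) = -a / 8 := fun κ => by
      rw [← h1, ← ext01_coe]; simp
    simp only [h0, hfix, h2]
    rw [integral_average_const hn]
    ring
  · exact (hcp.comp (by fun_prop)).continuousOn
  · intro r hr
    have h1 : HasDerivAt (fun r : ℝ => r ^ 2 / ρ ^ 2) (2 * r / ρ ^ 2) r := by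
      simpa using (hasDerivAt_pow 2 r).div_const (ρ ^ 2)
    refine ((((integral_hasDerivAt_right (hcp.intervalIntegrable 0 (r ^ 2 / ρ ^ 2))
      (hcp.stronglyMeasurableAtFilter _ _) hcp.continuousAt).comp r h1).const_mul (ρ ^ 2)).const_add
      a).congr_deriv ?_
    field_simp
  · intro r hr
    have hcS := continuous_ext01 S
    have key : ∀ s ∈ Ioo 0 ρ, ext01 p (s ^ 2 / ρ ^ 2) =
        2 * (∫ x in (0 : ℝ)..s, x ^ (n - 1) * ext01 S (x ^ 2 / ρ ^ 2)) / s ^ n := fun s hs => by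
      have hs0 := hs.1
      rw [ext01_of_mem p (hmem s ⟨hs.1.le, hs.2.le⟩), hfix]
      have := integral_comp_mul_left (a := 0) (b := 1)
        (fun x => x ^ (n - 1) * ext01 S (x ^ 2 / ρ ^ 2)) hs0.ne'
      rw [mul_zero, mul_one, smul_eq_mul, inv_mul_eq_div, eq_div_iff hs0.ne'] at this
      rw [← this, eq_div_iff (by positivity), ← integral_mul_const,
        ← integral_mul_const, ← integral_const_mul]
      refine integral_congr fun κ _ => ?_
      have e : s ^ n = s ^ (n - 1) * s := by rw [← pow_succ]; congr 1; omega
      have e2 : (s * κ) ^ 2 / ρ ^ 2 = κ ^ 2 * (s ^ 2 / ρ ^ 2) := by ring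
      simp only [e, e2]
      ring
    have hr0 := hr.1
    have hcont : Continuous fun x : ℝ => x ^ (n - 1) * ext01 S (x ^ 2 / ρ ^ 2) := by fun_prop
    have hd := ((integral_hasDerivAt_right (hcont.intervalIntegrable 0 r)
      (hcont.stronglyMeasurableAtFilter _ _) hcont.continuousAt).const_mul 2).div
      (hasDerivAt_pow n r) (by positivity)
    have hev : (fun r => ext01 p (r ^ 2 / ρ ^ 2)) =ᶠ[𝓝 r]
        fun s => 2 * (∫ x in (0 : ℝ)..s, x ^ (n - 1) * ext01 S (x ^ 2 / ρ ^ 2)) / s ^ n :=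
      mem_of_superset (Ioo_mem_nhds hr.1 hr.2) key
    refine (hd.congr_of_eventuallyEq hev).congr_deriv ?_
    have hSr : ext01 S (r ^ 2 / ρ ^ 2) = capG n (r ^ 2)
        (a + ρ ^ 2 * ∫ s in (0 : ℝ)..r ^ 2 / ρ ^ 2, ext01 p s) (ext01 p (r ^ 2 / ρ ^ 2)) := by
      rw [ext01_of_mem S (hmem r ⟨hr.1.le, hr.2.le⟩), hS, capSource_apply, capHeight_apply,
        ext01_of_mem p (hmem r ⟨hr.1.le, hr.2.le⟩)]
      congr 1
      field_simp
    have hk := key r hr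
    rw [eq_div_iff (by positivity)] at hk
    rw [hSr, ← hk]
    have e : r ^ n = r ^ (n - 1) * r := by rw [← pow_succ]; congr 1; omega
    rw [e]
    field_simp

/-- The function `σ ↦ π(ρ √σ)` associated with an arc. -/
def arcFun {ρ : ℝ} {π : ℝ → ℝ} (hρ : 0 ≤ ρ) (h : ContinuousOn π (Icc 0 ρ)) : CI :=
  ⟨fun σ => π (ρ * √σ), by
    refine h.comp_continuous (by fun_prop) fun σ => ⟨by positivity, ?_⟩
    exact mul_le_of_le_one_right hρ (Real.sqrt_le_one.2 σ.2.2)⟩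

lemma ext01_arcFun {ρ : ℝ} {π : ℝ → ℝ} (hρ : 0 ≤ ρ) (h : ContinuousOn π (Icc 0 ρ)) {s : ℝ}
    (hs : s ∈ Icc (0 : ℝ) 1) : ext01 (arcFun hρ h) s = π (ρ * √s) := ext01_of_mem _ hs

lemma IsCapArc.height_eq {a ρ : ℝ} {f π : ℝ → ℝ} (h : IsCapArc n a ρ f π) (hρ : 0 < ρ)
    (σ : unitInterval) : capHeight a (ρ ^ 2) (arcFun hρ.le h.cont_p) σ = f (ρ * √σ) := by
  rw [capHeight_apply]
  have hmaps : ∀ s ∈ Icc (0 : ℝ) σ, ρ * √s ∈ Icc 0 ρ := fun s hs => ⟨by positivity,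
    mul_le_of_le_one_right hρ.le (Real.sqrt_le_one.2 (hs.2.trans σ.2.2))⟩
  have hitg : ∫ s in (0 : ℝ)..σ, ρ ^ 2 * ext01 (arcFun hρ.le h.cont_p) s =
      f (ρ * √σ) - f (ρ * √0) := by
    refine integral_eq_sub_of_hasDerivAt_of_le σ.2.1
      (h.cont_f.comp (by fun_prop) hmaps) (fun s hs => ?_)
      (Continuous.intervalIntegrable (by have := continuous_ext01 (arcFun hρ.le h.cont_p); fun_prop)
        _ _)
    have hs1 : s < 1 := hs.2.trans_le σ.2.2
    rw [ext01_arcFun _ _ ⟨hs.1.le, hs1.le⟩]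
    have hsq : 0 < √s := sqrt_pos.2 hs.1
    have hd := (h.deriv_f (ρ * √s) ⟨by positivity, by
      have : √s < 1 := by rw [Real.sqrt_lt' one_pos]; simpa using hs1
      nlinarith⟩).comp s ((Real.hasDerivAt_sqrt hs.1.ne').const_mul ρ)
    refine hd.congr_deriv ?_
    field_simp
  rw [integral_const_mul] at hitg
  rw [hitg]
  simp [h.f_zero]

lemma IsCapArc.fixed (hn : 2 ≤ n) {a ρ : ℝ} {f π : ℝ → ℝ} (h : IsCapArc n a ρ f π)
    (hρ : 0 < ρ) : capOp n ((a, ρ ^ 2), arcFun hρ.le h.cont_p) = arcFun hρ.le h.cont_p := by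
  set p := arcFun hρ.le h.cont_p
  ext σ
  show average n (capSource n a (ρ ^ 2) p) σ = p σ
  rw [average_apply]
  set S := capSource n a (ρ ^ 2) p with hS
  have hSv : ∀ s (hs : s ∈ Icc (0 : ℝ) 1), ext01 S s =
      capG n ((ρ * √s) ^ 2) (f (ρ * √s)) (π (ρ * √s)) := fun s hs => by
    rw [ext01_of_mem S hs, hS, capSource_apply, h.height_eq hρ, mul_pow, sq_sqrt hs.1]
    rfl
  have hpσ : p σ = π (ρ * √σ) := rfl
  rcases σ.2.1.eq_or_lt with h0 | h0
  · have h1 : ∀ κ : ℝ, ext01 S (κ ^ 2 * (σ : ℝ)) = -a / 8 := fun κ => by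
      rw [← h0, mul_zero, hSv 0 ⟨le_rfl, zero_le_one⟩]; simp [capG, h.f_zero]
    simp only [h1]
    rw [hpσ, ← h0, integral_average_const hn, Real.sqrt_zero, mul_zero, h.p_zero]
    ring
  · set R := ρ * √(σ : ℝ) with hR
    have hR0 : 0 < R := by have := sqrt_pos.2 h0; positivity
    have hRρ : R ≤ ρ := mul_le_of_le_one_right hρ.le (Real.sqrt_le_one.2 σ.2.2)
    have e1 : ∀ κ ∈ Icc (0 : ℝ) 1, κ ^ 2 * (σ : ℝ) ∈ Icc (0 : ℝ) 1 ∧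
        ρ * √(κ ^ 2 * (σ : ℝ)) = R * κ := fun κ hκ =>
      ⟨⟨by positivity, mul_le_one₀ (pow_le_one₀ hκ.1 hκ.2) σ.2.1 σ.2.2⟩, by
        rw [Real.sqrt_mul (by positivity), sqrt_sq hκ.1]; ring⟩
    have hmaps : MapsTo (fun κ => R * κ) (Icc (0 : ℝ) 1) (Icc 0 ρ) := fun κ hκ =>
      ⟨mul_nonneg hR0.le hκ.1, (mul_le_of_le_one_right hR0.le hκ.2).trans hRρ⟩
    have hitg : ∫ κ in (0 : ℝ)..1, 2 * κ ^ (n - 1) * ext01 S (κ ^ 2 * σ) =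
        (1 : ℝ) ^ n * π (R * 1) - 0 ^ n * π (R * 0) := by
      refine integral_eq_sub_of_hasDerivAt_of_le (f := fun κ => κ ^ n * π (R * κ)) zero_le_one
        ((continuousOn_pow n).mul (h.cont_p.comp (by fun_prop) hmaps)) (fun κ hκ => ?_)
        (Continuous.intervalIntegrable (by have := continuous_ext01 S; fun_prop) _ _)
      have hκ' : κ ∈ Icc (0 : ℝ) 1 := ⟨hκ.1.le, hκ.2.le⟩
      rw [hSv _ (e1 κ hκ').1, (e1 κ hκ').2]
      have hκ0 := hκ.1
      refine ((hasDerivAt_pow n κ).mul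
        ((h.deriv_p (R * κ) ⟨by positivity, by nlinarith [hκ.2]⟩).comp κ
        ((hasDerivAt_id κ).const_mul R))).congr_deriv ?_
      have e : κ ^ n = κ ^ (n - 1) * κ := by rw [← pow_succ]; congr 1; omega
      simp only [comp]
      rw [e]; field_simp; ring
    rw [hitg, hpσ]
    simp [show n ≠ 0 by omega]

lemma IsCapArc.unique (hn : 2 ≤ n) {a ρ : ℝ} {f π f' π' : ℝ → ℝ}
    (h : IsCapArc n a ρ f π) (h' : IsCapArc n a ρ f' π') {r : ℝ} (hr : r ∈ Icc 0 ρ) :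
    f r = f' r ∧ π r = π' r := by
  rcases hr.1.eq_or_lt with h0 | h0
  · rw [← h0, h.f_zero, h'.f_zero, h.p_zero, h'.p_zero]; exact ⟨rfl, rfl⟩
  have k := h.mono hr.2
  have k' := h'.mono hr.2
  have e := capOp_fixed_unique hn (k.fixed hn h0) (k'.fixed hn h0)
  have e1 := k.height_eq h0 1
  rw [e, k'.height_eq h0 1] at e1
  have e2 := congrArg (fun p : CI => p 1) e
  simp only [arcFun, ContinuousMap.coe_mk] at e2
  simp only [Set.Icc.coe_one, Real.sqrt_one, mul_one] at e1 e2
  exact ⟨e1.symm, e2⟩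

/-- Near a given arc, or near the axis, the arcs exist and depend smoothly on `a` and `r²`. -/
lemma exists_smooth_arcs (hn : 2 ≤ n) {a T : ℝ} {p : CI} (hp : capOp n ((a, T), p) = p) :
    ∃ (h q : ℝ × ℝ → ℝ), ContDiffAt ℝ ∞ h (a, T) ∧ ContDiffAt ℝ ∞ q (a, T) ∧
      (∀ᶠ l : ℝ × ℝ in 𝓝 (a, T), l.2 = 0 → h l = l.1 ∧ q l = -l.1 / (4 * n)) ∧
      ∀ ε > 0, ∀ᶠ l : ℝ × ℝ in 𝓝 (a, T), 0 < l.2 → ∃ f π, IsCapArc n l.1 √l.2 f π ∧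
        f √l.2 = h l ∧ π √l.2 = q l ∧
        ∀ σ : unitInterval, |f (√l.2 * √σ) - capHeight a T p σ| < ε := by
  obtain ⟨P, hP, hP0, hfix⟩ := exists_smooth_capOp_fixed hn hp
  have hev : ∀ (σ : unitInterval), ContDiff ℝ ∞ fun φ : CI => φ σ := fun σ =>
    (ContinuousMap.evalCLM ℝ σ : CI →L[ℝ] ℝ).contDiff
  have hH : ContDiffAt ℝ ∞ (fun l : ℝ × ℝ => capHeight l.1 l.2 (P l)) (a, T) := by
    unfold capHeight; fun_prop
  refine ⟨fun l => capHeight l.1 l.2 (P l) 1, fun l => P l 1,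
    (hev 1).contDiffAt.comp (a, T) hH, (hev 1).contDiffAt.comp (a, T) hP, ?_, ?_⟩
  · filter_upwards [hfix] with l hl h0
    constructor
    · rw [capHeight_apply, h0]; simp
    · have hS : ∀ σ : unitInterval, capSource n l.1 l.2 (P l) σ = -l.1 / 8 := fun σ => by
        rw [capSource_apply, capHeight_apply, h0]; simp [capG]
      have h1 : ∀ κ : ℝ, ext01 (capSource n l.1 l.2 (P l)) κ = -l.1 / 8 := fun κ => hS _
      have h2 : P l 1 = average n (capSource n l.1 l.2 (P l)) 1 := by
        conv_lhs => rw [← hl]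
        rfl
      rw [h2, average_apply]
      simp only [h1]
      rw [integral_average_const hn]; ring
  · intro ε hε
    have hc : ∀ᶠ l in 𝓝 (a, T), ‖capHeight l.1 l.2 (P l) - capHeight a T p‖ < ε := by
      have := continuousAt_iff'.1 hH.continuousAt ε hε; simpa only [hP0, dist_eq_norm] using this
    filter_upwards [hfix, hc] with l hl hl' hpos
    have hs : 0 < √l.2 := sqrt_pos.2 hpos
    have hsq : √l.2 ^ 2 = l.2 := sq_sqrt hpos.le
    have hl2 : capOp n ((l.1, √l.2 ^ 2), P l) = P l := by rw [hsq]; exact hl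
    refine ⟨_, _, isCapArc_of_fixed hn hs hl2, ?_, ?_, fun σ => ?_⟩
    · simp only [capHeight_apply, hsq, div_self hpos.ne', Set.Icc.coe_one]
    · simp only [div_self (pow_ne_zero 2 hs.ne')]
      exact ext01_coe (P l) 1
    · have e : (√l.2 * √(σ : ℝ)) ^ 2 / l.2 = σ := by rw [mul_pow, hsq, sq_sqrt σ.2.1]; field_simp
      have : l.1 + √l.2 ^ 2 * ∫ s in (0 : ℝ)..(√l.2 * √(σ : ℝ)) ^ 2 / √l.2 ^ 2, ext01 (P l) s =
          capHeight l.1 l.2 (P l) σ := by rw [hsq, e, capHeight_apply]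
      rw [this]
      exact lt_of_le_of_lt ((capHeight l.1 l.2 (P l) - capHeight a T p).norm_coe_le_norm σ) hl'

/-- The fixed point of `capOp` for the degenerate arc. -/
lemma capOp_fixed_zero (hn : 2 ≤ n) (a : ℝ) :
    capOp n ((a, 0), (-a / (4 * n)) • (1 : CI)) = (-a / (4 * n)) • (1 : CI) := by
  ext σ
  have h1 : ∀ κ : ℝ, ext01 (capSource n a 0 ((-a / (4 * n)) • (1 : CI))) κ = -a / 8 := fun κ => by
    rw [ext01, capSource_apply, capHeight_apply]; simp [capG]
  show average n (capSource n a 0 _) σ = _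
  rw [average_apply]
  simp only [h1, ContinuousMap.smul_apply, ContinuousMap.one_apply, smul_eq_mul]
  rw [integral_average_const hn]
  ring

/-- Every point of the axis is the tip of a short arc. -/
lemma exists_short_arc (hn : 2 ≤ n) (a : ℝ) {ε : ℝ} (hε : 0 < ε) :
    ∃ ρ ∈ Ioo 0 ε, ∃ f π, IsCapArc n a ρ f π := by
  obtain ⟨h, q, -, -, -, H⟩ := exists_smooth_arcs hn (capOp_fixed_zero hn a)
  have h1 : Tendsto (fun ρ : ℝ => (a, ρ ^ 2)) (𝓝[>] 0) (𝓝 (a, 0)) := by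
    have : Continuous fun ρ : ℝ => (a, ρ ^ 2) := by fun_prop
    have := this.tendsto 0
    simp only [ne_eq, OfNat.ofNat_ne_zero, not_false_eq_true, zero_pow] at this
    exact this.mono_left nhdsWithin_le_nhds
  obtain ⟨ρ, hρ, hρ'⟩ := ((h1.eventually (H 1 one_pos)).and (Ioo_mem_nhdsGT hε)).exists
  obtain ⟨f, π, hf, -⟩ := hρ (by have := hρ'.1; positivity)
  simp only [sqrt_sq hρ'.1.le] at hf
  exact ⟨ρ, hρ', f, π, hf⟩

end

section

/-! ### Estimates for the arcs of caps -/

lemma le_of_hasDerivAt_nonneg {φ φ' : ℝ → ℝ} {α β : ℝ} (hαβ : α ≤ β)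
    (hc : ContinuousOn φ (Icc α β)) (hd : ∀ x ∈ Ioo α β, HasDerivAt φ (φ' x) x)
    (h0 : ∀ x ∈ Ioo α β, 0 ≤ φ' x) : φ α ≤ φ β := by
  refine monotoneOn_of_deriv_nonneg (convex_Icc α β) hc ?_ ?_ ⟨le_rfl, hαβ⟩ ⟨hαβ, le_rfl⟩ hαβ
  · rw [interior_Icc]
    exact fun x hx => (hd x hx).differentiableAt.differentiableWithinAt
  · rw [interior_Icc]; exact fun x hx => by rw [(hd x hx).deriv]; exact h0 x hx

lemma lt_of_hasDerivAt_pos {φ φ' : ℝ → ℝ} {α β : ℝ} (hαβ : α < β)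
    (hc : ContinuousOn φ (Icc α β)) (hd : ∀ x ∈ Ioo α β, HasDerivAt φ (φ' x) x)
    (h0 : ∀ x ∈ Ioo α β, 0 < φ' x) : φ α < φ β := by
  refine strictMonoOn_of_deriv_pos (convex_Icc α β) hc ?_ ⟨le_rfl, hαβ.le⟩ ⟨hαβ.le, le_rfl⟩ hαβ
  rw [interior_Icc]
  exact fun x hx => by rw [(hd x hx).deriv]; exact h0 x hx

/-- The slope `g = -f'` of an arc. -/
def arcSlope (π : ℝ → ℝ) (r : ℝ) : ℝ := -(2 * r * π r)

/-- The quantity `E = f/2 + r g/2 - (n-1) g/r`, for which `g' = (1 + g²) E`. -/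
def arcE (n : ℕ) (f π : ℝ → ℝ) (r : ℝ) : ℝ := f r / 2 + (2 * n₋₁ - r ^ 2) * π r

namespace IsCapArc

variable {a ρ : ℝ} {f π : ℝ → ℝ}

lemma cont_g (h : IsCapArc n a ρ f π) : ContinuousOn (arcSlope π) (Icc 0 ρ) := by
  have := h.cont_p
  unfold arcSlope
  fun_prop

lemma cont_E (h : IsCapArc n a ρ f π) : ContinuousOn (arcE n f π) (Icc 0 ρ) := by
  have := h.cont_p
  have := h.cont_f
  unfold arcE
  fun_prop

lemma deriv_f' (h : IsCapArc n a ρ f π) {r : ℝ} (hr : r ∈ Ioo 0 ρ) :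
    HasDerivAt f (-arcSlope π r) r := by
  simpa [arcSlope] using h.deriv_f r hr

lemma E_eq {r : ℝ} : 2 * r * arcE n f π r =
    r * f r + r ^ 2 * arcSlope π r - 2 * n₋₁ * arcSlope π r := by
  simp only [arcE, arcSlope]; ring

lemma deriv_g (h : IsCapArc n a ρ f π) {r : ℝ} (hr : r ∈ Ioo 0 ρ) :
    HasDerivAt (arcSlope π) ((1 + arcSlope π r ^ 2) * arcE n f π r) r := by
  have hr0 := hr.1.ne'
  refine ((((hasDerivAt_id r).const_mul 2).mul (h.deriv_p r hr)).neg).congr_deriv ?_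
  simp only [arcSlope, arcE, capG, id]
  field_simp
  ring

lemma deriv_E (h : IsCapArc n a ρ f π) {r : ℝ} (hr : r ∈ Ioo 0 ρ) :
    HasDerivAt (arcE n f π) (-((2 * n₋₁ - r ^ 2) / (2 * r)) *
      ((1 + arcSlope π r ^ 2) * arcE n f π r) + n₋₁ * arcSlope π r / r ^ 2) r := by
  have hr0 := hr.1.ne'
  refine (((h.deriv_f r hr).div_const 2).add (((hasDerivAt_pow 2 r).const_sub (2 * n₋₁)).mul
    (h.deriv_p r hr))).congr_deriv ?_
  simp only [arcSlope, arcE, capG]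
  field_simp
  ring

lemma one_le_sub (hn : 2 ≤ n) : (1 : ℝ) ≤ (n : ℝ) - 1 := by
  have : (2 : ℝ) ≤ n := by exact_mod_cast hn
  linarith

lemma g_pos_of_E_pos (h : IsCapArc n a ρ f π) {r : ℝ} (hr : r ∈ Ioc 0 ρ)
    (hE : ∀ s ∈ Ico 0 r, 0 < arcE n f π s) : 0 < arcSlope π r := by
  have := lt_of_hasDerivAt_pos hr.1 (h.cont_g.mono (Icc_subset_Icc_right hr.2))
    (fun x hx => h.deriv_g ⟨hx.1, hx.2.trans_le hr.2⟩)
    (fun x hx => mul_pos (by positivity) (hE x ⟨hx.1.le, hx.2⟩))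
  simpa [arcSlope] using this

lemma E_pos (h : IsCapArc n a ρ f π) (hn : 2 ≤ n) (ha : 0 < a) :
    ∀ r ∈ Ico 0 ρ, 0 < arcE n f π r := by
  have hN := one_le_sub hn
  refine pos_of_first_zero (h.cont_E.mono Ico_subset_Icc_self) ?_ ?_
  · simp only [arcE, h.f_zero, h.p_zero]
    have : a / 2 + (2 * n₋₁ - 0 ^ 2) * (-a / (4 * n)) = a / (2 * n) := by field_simp; ring
    rw [this]
    positivity
  · intro r hr h0 hpos
    have hg := h.g_pos_of_E_pos ⟨hr.1, hr.2.le⟩ hpos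
    refine ⟨_, ?_, h.deriv_E hr⟩
    rw [h0]
    have := hr.1; simp only [mul_zero, zero_add]; positivity

lemma g_pos (h : IsCapArc n a ρ f π) (hn : 2 ≤ n) (ha : 0 < a) {r : ℝ} (hr : r ∈ Ioc 0 ρ) :
    0 < arcSlope π r :=
  h.g_pos_of_E_pos hr fun s hs => h.E_pos hn ha s ⟨hs.1, hs.2.trans_le hr.2⟩

lemma f_strictAnti (h : IsCapArc n a ρ f π) (hn : 2 ≤ n) (ha : 0 < a) :
    StrictAntiOn f (Icc 0 ρ) := by
  refine strictAntiOn_of_deriv_neg (convex_Icc 0 ρ) h.cont_f fun x hx => ?_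
  rw [interior_Icc] at hx
  rw [(h.deriv_f' hx).deriv]
  linarith [h.g_pos hn ha ⟨hx.1, hx.2.le⟩]

lemma f_le (h : IsCapArc n a ρ f π) (hn : 2 ≤ n) (ha : 0 < a) {r : ℝ} (hr : r ∈ Icc 0 ρ) :
    f r ≤ a := by
  rw [← h.f_zero]
  exact (h.f_strictAnti hn ha).antitoneOn ⟨le_rfl, hr.1.trans hr.2⟩ hr hr.1

lemma p_nonpos (h : IsCapArc n a ρ f π) (hn : 2 ≤ n) (ha : 0 < a) {r : ℝ} (hr : r ∈ Ioc 0 ρ) :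
    π r ≤ 0 := by
  have h1 := h.g_pos hn ha hr
  have h2 := hr.1
  simp only [arcSlope] at h1
  by_contra! h3
  have : 0 < 2 * r * π r := by positivity
  linarith

lemma p_le (h : IsCapArc n a ρ f π) (hn : 2 ≤ n) (ha : 0 < a) {r : ℝ} (hr : r ∈ Ioc 0 ρ) :
    π r ≤ -f r / (4 * n) := by
  have hr0 := hr.1
  have key := le_of_hasDerivAt_nonneg (φ := fun s => -(s ^ n * (2 * π s + f s / (2 * n))))
    (φ' := fun s => s ^ (n - 1) * (-(s ^ 2 * π s * (1 + 1 / n)) +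
      4 * s ^ 2 * π s ^ 2 * arcE n f π s)) hr0.le
    (by
      have := (h.mono hr.2).cont_p
      have := (h.mono hr.2).cont_f; fun_prop)
    (fun s hs => by
      have hs' : s ∈ Ioo 0 ρ := ⟨hs.1, hs.2.trans_le hr.2⟩
      have hs0 := hs.1.ne'
      have e : s ^ n = s ^ (n - 1) * s := by rw [← pow_succ]; congr 1; omega
      refine ((hasDerivAt_pow n s).mul (((h.deriv_p s hs').const_mul 2).add
        ((h.deriv_f s hs').div_const (2 * n)))).neg.congr_deriv ?_
      simp only [arcE, capG, e, Pi.add_apply]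
      field_simp; ring)
    (fun s hs => by
      have hs' : s ∈ Ioo 0 ρ := ⟨hs.1, hs.2.trans_le hr.2⟩
      have hE := h.E_pos hn ha s ⟨hs.1.le, hs'.2⟩
      have hp := h.p_nonpos hn ha ⟨hs.1, hs'.2.le⟩
      have hs0 := hs.1
      have : 0 ≤ -(s ^ 2 * π s * (1 + 1 / n)) := by
        have : 0 ≤ s ^ 2 * (-π s) * (1 + 1 / n) := by
          have : 0 ≤ -π s := by linarith
          positivity
        linarith
      positivity)
  simp only [ne_eq, show n ≠ 0 by omega, not_false_eq_true, zero_pow, zero_mul, neg_zero] at key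
  have h2 : 2 * π r + f r / (2 * n) ≤ 0 := by
    by_contra! h3
    have : 0 < r ^ n * (2 * π r + f r / (2 * n)) := by positivity
    linarith
  have e : -f r / (4 * n) = -(f r / (2 * n)) / 2 := by field_simp; ring
  rw [e]
  linarith

lemma g_ge (h : IsCapArc n a ρ f π) (hn : 2 ≤ n) (ha : 0 < a) {r : ℝ} (hr : r ∈ Ioc 0 ρ) :
    r * f r / (2 * n) ≤ arcSlope π r := by
  have e : r * f r / (2 * n) = -(2 * r * (-f r / (4 * n))) := by ring
  rw [e, arcSlope, neg_le_neg_iff]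
  exact mul_le_mul_of_nonneg_left (h.p_le hn ha hr) (by have := hr.1; positivity)

lemma g_lt (h : IsCapArc n a ρ f π) (hn : 2 ≤ n) (ha : 0 < a) {r : ℝ} (hr : r ∈ Ioo 0 ρ) :
    (2 * n₋₁ - r ^ 2) * arcSlope π r < r * f r := by
  have h2 := E_eq (n := n) (f := f) (π := π) (r := r)
  have := mul_pos (mul_pos two_pos hr.1) (h.E_pos hn ha r ⟨hr.1.le, hr.2⟩)
  nlinarith

lemma E_le (h : IsCapArc n a ρ f π) (hn : 2 ≤ n) (ha : 0 < a) {r : ℝ} (hr : r ∈ Ioc 0 ρ)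
    (hf : 0 ≤ f r) : arcE n f π r ≤ f r / 4 + r * arcSlope π r / 2 := by
  have hN := one_le_sub hn
  have h2 : 2 * n₋₁ * π r ≤ 2 * n₋₁ * (-f r / (4 * n)) :=
    mul_le_mul_of_nonneg_left (h.p_le hn ha hr) (by linarith)
  have h3 : 2 * n₋₁ * (-f r / (4 * n)) ≤ -f r / 4 := by
    have e : 2 * n₋₁ * (-f r / (4 * n)) = -f r / 4 - (n - 2) * f r / (4 * n) := by field_simp; ring
    have : 0 ≤ ((n : ℝ) - 2) * f r / (4 * n) := by
      have : (0 : ℝ) ≤ (n : ℝ) - 2 := by linarith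
      positivity
    linarith
  simp only [arcE, arcSlope]
  nlinarith

lemma f_ge (h : IsCapArc n a ρ f π) (hn : 2 ≤ n) (ha : 0 < a) {r : ℝ}
    (hr : r ∈ Ico 0 ρ) (hr1 : r ≤ 1) : a * (1 - r ^ 2 / 2) ≤ f r := by
  have hN := one_le_sub hn
  have key := le_of_hasDerivAt_nonneg (φ := fun s => f s + a * s ^ 2 / 2)
    (φ' := fun s => -arcSlope π s + a * s) hr.1
    (by have := (h.mono hr.2.le).cont_f; fun_prop)
    (fun s hs => by
      refine ((h.deriv_f' ⟨hs.1, hs.2.trans hr.2⟩).add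
        (((hasDerivAt_pow 2 s).const_mul a).div_const 2)).congr_deriv ?_
      simp
      ring)
    (fun s hs => by
      have hs' : s ∈ Ioo 0 ρ := ⟨hs.1, hs.2.trans hr.2⟩
      have h1 := h.g_lt hn ha hs'
      have h2 := h.g_pos hn ha ⟨hs'.1, hs'.2.le⟩
      have hs1 : s ^ 2 ≤ 1 := pow_le_one₀ hs.1.le (hs.2.le.trans hr1)
      have : 1 ≤ 2 * n₋₁ - s ^ 2 := by linarith
      have h4 : s * f s ≤ s * a := mul_le_mul_of_nonneg_left (h.f_le hn ha ⟨hs.1.le, hs'.2.le⟩)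
        hs.1.le
      nlinarith)
  simp only [h.f_zero] at key
  linarith

end IsCapArc

/-! #### The upper bound for `E` -/

lemma barrier_coeff_pos {N M a r f K : ℝ} (hN : 1 ≤ N) (hM : 400 * (N + 1) ≤ M)
    (ha : 100 * M ≤ a) (hr : M / a ≤ r) (hA : M / 2 ≤ r * f) (hf : 0 < f)
    (hfr : r ≤ 1 → a * (1 - r ^ 2 / 2) ≤ f) (hK : K = 3 * N + 0.3 * M ^ 2 * f ^ 2 / a ^ 2) :
    N + 2 * (0.3 * M ^ 2) / a ^ 2 < K * (1 / 2 - K / (r * f) ^ 2 - 1 / (r * f)) := by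
  have hM0 : 0 < M := by linarith
  have ha0 : 0 < a := by linarith
  have hr0 : 0 < r := lt_of_lt_of_le (by positivity) hr
  have hra : M ≤ r * a := by rwa [div_le_iff₀ ha0] at hr
  have hA0 : 0 < r * f := by positivity
  have e1 : K / (r * f) ^ 2 = 3 * N / (r * f) ^ 2 + 0.3 * M ^ 2 / (r * a) ^ 2 := by
    rw [hK]; field_simp
  have b1 : 3 * N / (r * f) ^ 2 ≤ 0.005 := by
    rw [div_le_iff₀ (by positivity)]
    have : (M / 2) ^ 2 ≤ (r * f) ^ 2 := pow_le_pow_left₀ (by positivity) hA 2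
    nlinarith
  have b2 : 1 / (r * f) ≤ 0.005 := by rw [div_le_iff₀ hA0]; linarith
  have b3 : 2 * (0.3 * M ^ 2) / a ^ 2 ≤ 0.01 := by
    rw [div_le_iff₀ (by positivity)]
    have : (100 * M) ^ 2 ≤ a ^ 2 := pow_le_pow_left₀ (by positivity) ha 2
    nlinarith
  have hK3 : 3 * N ≤ K := by
    rw [hK]
    have : 0 ≤ 0.3 * M ^ 2 * f ^ 2 / a ^ 2 := by positivity
    linarith
  rw [e1]
  by_cases hc : 3 * M ^ 2 ≤ (r * a) ^ 2
  · have b4 : 0.3 * M ^ 2 / (r * a) ^ 2 ≤ 0.1 := by rw [div_le_iff₀ (by positivity)]; linarith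
    have : 0.39 ≤ 1 / 2 - (3 * N / (r * f) ^ 2 + 0.3 * M ^ 2 / (r * a) ^ 2) - 1 / (r * f) := by
      linarith
    nlinarith
  · push Not at hc
    have b4 : 0.3 * M ^ 2 / (r * a) ^ 2 ≤ 0.3 := by
      rw [div_le_iff₀ (by positivity)]
      have : M ^ 2 ≤ (r * a) ^ 2 := pow_le_pow_left₀ hM0.le hra 2
      linarith
    have hr2 : r ^ 2 ≤ 0.001 := by
      have : (100 * M) ^ 2 ≤ a ^ 2 := pow_le_pow_left₀ (by positivity) ha 2
      by_contra! h
      have : 0.001 * (100 * M) ^ 2 ≤ r ^ 2 * a ^ 2 := by gcongr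
      nlinarith
    have hr1 : r ≤ 1 := by nlinarith
    have hfa : 0.99 * a ≤ f := by have := hfr hr1; nlinarith
    have hK' : 0.29 * M ^ 2 ≤ K := by
      have h1 : (0.99 * a) ^ 2 ≤ f ^ 2 := pow_le_pow_left₀ (by positivity) hfa 2
      have h2 : 0.29 * M ^ 2 ≤ 0.3 * M ^ 2 * f ^ 2 / a ^ 2 := by
        rw [le_div_iff₀ (by positivity)]
        nlinarith [sq_nonneg M, mul_le_mul_of_nonneg_left h1 (sq_nonneg M), sq_nonneg (M * a)]
      rw [hK]; linarith
    have : 0.19 ≤ 1 / 2 - (3 * N / (r * f) ^ 2 + 0.3 * M ^ 2 / (r * a) ^ 2) - 1 / (r * f) := by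
      linarith
    have hK0 : 0 ≤ K := by linarith
    have h5 : 0.29 * M ^ 2 * 0.19 ≤ K * (1 / 2 - (3 * N / (r * f) ^ 2 +
        0.3 * M ^ 2 / (r * a) ^ 2) - 1 / (r * f)) := by gcongr
    nlinarith

/-- The barrier function for `r² f E`. -/
def arcBarrier (n : ℕ) (M a y : ℝ) : ℝ := 3 * n₋₁ + 0.3 * M ^ 2 * y ^ 2 / a ^ 2

/-- The height below which the estimates for caps are not used; it depends on `n` only. -/
def arcM (n : ℕ) : ℝ := 400 * n

namespace IsCapArc

variable {a ρ : ℝ} {f π : ℝ → ℝ}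

lemma area_ge (h : IsCapArc n a ρ f π) (hn : 2 ≤ n) {M Y : ℝ} (hM : 400 * (n : ℝ) ≤ M)
    (ha : 100 * M ≤ a) (hY : M ≤ Y) (hf : ∀ r ∈ Ico 0 ρ, Y ≤ f r) {r c : ℝ} (hc : 0 ≤ c)
    (hr : r ∈ Ico (c / a) ρ) (hcM : c ≤ M) :
    c / 2 ≤ r * f r := by
  have hN := one_le_sub hn
  have ha0 : 0 < a := by linarith
  have hr0 : 0 ≤ r := le_trans (by positivity) hr.1
  have hra : c ≤ r * a := by have := hr.1; rwa [div_le_iff₀ ha0] at this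
  rcases le_total r 1 with h1 | h1
  · have := h.f_ge hn ha0 ⟨hr0, hr.2⟩ h1
    have h2 : r ^ 2 ≤ 1 := pow_le_one₀ hr0 h1
    have h3 : a / 2 ≤ f r := by nlinarith
    nlinarith
  · have := hf r ⟨hr0, hr.2⟩; nlinarith

lemma E_barrier (h : IsCapArc n a ρ f π) (hn : 2 ≤ n) {M Y : ℝ} (hM : 400 * (n : ℝ) ≤ M)
    (ha : 100 * M ≤ a) (hY : M ≤ Y) (hf : ∀ r ∈ Ico 0 ρ, Y ≤ f r) :
    ∀ r ∈ Ico (M / a) ρ, r ^ 2 * f r * arcE n f π r < arcBarrier n M a (f r) := by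
  intro r' hr'
  have hN := one_le_sub hn
  have hM0 : 0 < M := by linarith
  have ha0 : 0 < a := by linarith
  have h1a : 0 < M / a := by positivity
  have hsmall : M / a ≤ 0.01 := by rw [div_le_iff₀ ha0]; linarith
  have hfpos : ∀ r ∈ Ico 0 ρ, 0 < f r := fun s hs => by linarith [hf s hs]
  have hsub : Ico (M / a) ρ ⊆ Icc 0 ρ := fun x hx => ⟨h1a.le.trans hx.1, hx.2.le⟩
  have key := pos_of_first_zero (φ := fun r => arcBarrier n M a (f r) - r ^ 2 * f r * arcE n f π r)
    (α := M / a) (β := ρ) ?_ ?_ ?_ r' hr'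
  · linarith
  · have := h.cont_f.mono hsub
    have := h.cont_E.mono hsub
    unfold arcBarrier
    fun_prop
  · have hm : M / a ∈ Ioo 0 ρ := ⟨h1a, hr'.1.trans_lt hr'.2⟩
    have e1 := h.E_le hn ha0 ⟨hm.1, hm.2.le⟩ (hfpos _ ⟨hm.1.le, hm.2⟩).le
    have e2 := h.g_lt hn ha0 hm
    have e3 := h.g_pos hn ha0 ⟨hm.1, hm.2.le⟩
    have e4 := hfpos _ ⟨hm.1.le, hm.2⟩
    have hsq : (M / a) ^ 2 ≤ 0.0001 := by nlinarith
    have e5 : (M / a) * arcSlope π (M / a) ≤ 0.0002 * f (M / a) := by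
      have : arcSlope π (M / a) ≤ M / a * f (M / a) := by nlinarith
      nlinarith
    have e6 : arcE n f π (M / a) ≤ 0.3 * f (M / a) := by linarith
    have e7 : (M / a) ^ 2 * f (M / a) * arcE n f π (M / a) ≤
        (M / a) ^ 2 * f (M / a) * (0.3 * f (M / a)) := by gcongr
    have e8 : (M / a) ^ 2 * f (M / a) * (0.3 * f (M / a)) =
        0.3 * M ^ 2 * f (M / a) ^ 2 / a ^ 2 := by field_simp
    simp only [arcBarrier]
    linarith
  · intro r hr h0 _
    have hr0 : 0 < r := h1a.trans hr.1
    have hr' : r ∈ Ioo 0 ρ := ⟨hr0, hr.2⟩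
    have hA := h.area_ge hn hM ha hY hf hM0.le ⟨hr.1.le, hr.2⟩ le_rfl
    have hg := h.g_pos hn ha0 ⟨hr0, hr.2.le⟩
    have hfr := hfpos r ⟨hr0.le, hr.2⟩
    set K := arcBarrier n M a (f r) with hK
    have hKeq : r ^ 2 * f r * arcE n f π r = K := by linarith
    have hE : arcE n f π r = K / (r ^ 2 * f r) := by rw [← hKeq]; field_simp
    have hEeq := E_eq (n := n) (f := f) (π := π) (r := r)
    refine ⟨_, ?_, ((((h.deriv_f' hr').pow 2).const_mul (0.3 * M ^ 2)).div_const (a ^ 2)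
      |>.const_add (3 * n₋₁)).sub
      ((((hasDerivAt_pow 2 r).mul (h.deriv_f' hr')).mul (h.deriv_E hr')))⟩
    set g := arcSlope π r
    set F := f r
    set E := arcE n f π r
    set N := (n : ℝ) - 1
    have hKpos : 0 < K := by rw [hK, arcBarrier]; positivity
    have hg1 : K * (1 + g ^ 2) * (1 / (r * F)) ≥ 2 * K * g / (r * F) := by
      rw [mul_one_div, ge_iff_le]
      gcongr ?_ / _
      nlinarith [sq_nonneg (g - 1)]
    have hfin : 0 < g / F * (-(2 * (0.3 * M ^ 2) * F * g / a ^ 2) - 2 * K / r + K * g / F +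
        K * (1 + g ^ 2) * (F - 2 * E) / (2 * g) - N * F * g) := by
      have e : g / F * (-(2 * (0.3 * M ^ 2) * F * g / a ^ 2) - 2 * K / r + K * g / F +
          K * (1 + g ^ 2) * (F - 2 * E) / (2 * g) - N * F * g) =
          (1 + g ^ 2) * (K * (1 / 2 - K / (r * F) ^ 2)) - 2 * K * g / (r * F) + K * g ^ 2 / F ^ 2 -
            (N + 2 * (0.3 * M ^ 2) / a ^ 2) * g ^ 2 := by
        rw [hE]; field_simp; ring
      rw [e]
      have h1 : (1 + g ^ 2) * (N + 2 * (0.3 * M ^ 2) / a ^ 2) <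
        (1 + g ^ 2) * (K * (1 / 2 - K / (r * F) ^ 2 - 1 / (r * F))) :=
        mul_lt_mul_of_pos_left (barrier_coeff_pos hN (by linarith : 400 * ((n : ℝ) - 1 + 1) ≤ M) ha
          hr.1.le hA hfr (fun h1 => h.f_ge hn ha0 ⟨hr0.le, hr.2⟩ h1) hK) (by positivity)
      have h2 : 0 ≤ K * g ^ 2 / F ^ 2 := by positivity
      have h3 : 0 ≤ N + 2 * (0.3 * M ^ 2) / a ^ 2 := by positivity
      nlinarith
    have hid : (2 * N - r ^ 2) = r * (F - 2 * E) / g := by rw [eq_div_iff hg.ne']; linarith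
    refine lt_of_lt_of_eq ((pos_iff_pos_of_mul_pos hfin).1 (by positivity)) ?_
    rw [hid, ← hKeq]
    simp only [Nat.cast_ofNat, Pi.mul_apply]
    rw [show f r = F from rfl]; field_simp; ring

/-! #### The bounds for the ellipse parameter -/

/-- The quantity `(2(n-1) - r²) / f²`, which is constant on ellipses. -/
lemma deriv_Z (h : IsCapArc n a ρ f π) {r : ℝ} (hr : r ∈ Ioo 0 ρ) (hf : 0 < f r) :
    HasDerivAt (fun r => (2 * n₋₁ - r ^ 2) / f r ^ 2) (-(4 * r * arcE n f π r / f r ^ 3)) r := by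
  refine (((hasDerivAt_pow 2 r).const_sub (2 * n₋₁)).div ((h.deriv_f r hr).pow 2)
    (pow_ne_zero 2 hf.ne')).congr_deriv ?_
  simp only [arcE, Pi.pow_apply]
  field_simp
  simp only [Nat.cast_ofNat]
  ring

lemma cont_Z (h : IsCapArc n a ρ f π) (hf : ∀ r ∈ Ico 0 ρ, 0 < f r) :
    ContinuousOn (fun r => (2 * n₋₁ - r ^ 2) / f r ^ 2) (Ico 0 ρ) := by
  have h1 := h.cont_f.mono Ico_subset_Icc_self
  exact ContinuousOn.div (by fun_prop) (by fun_prop) fun r hr => by have := hf r hr; positivity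

lemma Z_le (h : IsCapArc n a ρ f π) (hn : 2 ≤ n) (ha : 0 < a)
    (hf : ∀ r ∈ Ico 0 ρ, 0 < f r) {r : ℝ} (hr : r ∈ Ico 0 ρ) :
    (2 * n₋₁ - r ^ 2) / f r ^ 2 ≤ 2 * n₋₁ / a ^ 2 := by
  have key := le_of_hasDerivAt_nonneg (φ := fun r => -((2 * n₋₁ - r ^ 2) / f r ^ 2))
    (φ' := fun r => (4 * r * arcE n f π r / f r ^ 3)) hr.1
    ((h.cont_Z hf).mono fun x hx => ⟨hx.1, hx.2.trans_lt hr.2⟩).neg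
    (fun s hs => by
      have := (h.deriv_Z ⟨hs.1, hs.2.trans hr.2⟩ (hf s ⟨hs.1.le, hs.2.trans hr.2⟩)).neg
      rwa [neg_neg] at this)
    (fun s hs => by
      have := hf s ⟨hs.1.le, hs.2.trans hr.2⟩
      have := h.E_pos hn ha s ⟨hs.1.le, hs.2.trans hr.2⟩
      have := hs.1; positivity)
  simp only [h.f_zero] at key
  norm_num at key
  linarith

end IsCapArc

end

section

/-- The constant in the lower bound for the ellipse parameter. -/
def arcC (n : ℕ) : ℝ := (24 + 3 * n₋₁) * arcM n ^ 2

namespace IsCapArc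

variable {a ρ : ℝ} {f π : ℝ → ℝ}

lemma Z_ge_of_le_one (h : IsCapArc n a ρ f π) (hn : 2 ≤ n) (ha : 0 < a)
    (hf : ∀ r ∈ Ico 0 ρ, 0 < f r) {r : ℝ} (hr : r ∈ Ico 0 ρ) (hr1 : r ≤ 1) :
    2 * n₋₁ / a ^ 2 - 8 * r ^ 2 / a ^ 2 ≤ (2 * n₋₁ - r ^ 2) / f r ^ 2 := by
  have hN := one_le_sub hn
  have key := le_of_hasDerivAt_nonneg
    (φ := fun r => (2 * n₋₁ - r ^ 2) / f r ^ 2 + 8 * r ^ 2 / a ^ 2)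
    (φ' := fun r => -(4 * r * arcE n f π r / f r ^ 3) + 16 * r / a ^ 2) hr.1
    (((h.cont_Z hf).mono fun x hx => ⟨hx.1, hx.2.trans_lt hr.2⟩).add (by fun_prop))
    (fun s hs => by
      refine (h.deriv_Z ⟨hs.1, hs.2.trans hr.2⟩ (hf s ⟨hs.1.le, hs.2.trans hr.2⟩)).add
        ((((hasDerivAt_pow 2 s).const_mul 8).div_const (a ^ 2)).congr_deriv ?_)
      simp
      ring)
    (fun s hs => by
      have hs' : s ∈ Ioo 0 ρ := ⟨hs.1, hs.2.trans hr.2⟩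
      have hs1 : s ≤ 1 := hs.2.le.trans hr1
      have hs2 : s ^ 2 ≤ 1 := pow_le_one₀ hs.1.le hs1
      have hs0 := hs.1
      have hf0 := hf s ⟨hs.1.le, hs'.2⟩
      have h1 := h.f_ge hn ha ⟨hs.1.le, hs'.2⟩ hs1
      have h2 : a / 2 ≤ f s := by nlinarith
      have h3 := h.E_le hn ha ⟨hs'.1, hs'.2.le⟩ hf0.le
      have h4 := h.g_lt hn ha hs'
      have h5 := h.g_pos hn ha ⟨hs'.1, hs'.2.le⟩
      have h6 : arcSlope π s ≤ s * f s := by nlinarith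
      have h7 : s * arcSlope π s ≤ f s := by nlinarith
      have h8 : arcE n f π s ≤ f s := by linarith
      have h9 : 4 * s * arcE n f π s / f s ^ 3 ≤ 16 * s / a ^ 2 := by
        rw [div_le_div_iff₀ (by positivity) (by positivity)]
        have e1 : (a / 2) ^ 2 ≤ f s ^ 2 := pow_le_pow_left₀ (by positivity) h2 2
        have e2 : 4 * s * arcE n f π s * a ^ 2 ≤ 4 * s * f s * a ^ 2 := by gcongr
        have e3 : 4 * s * f s * a ^ 2 ≤ 4 * s * f s * (4 * f s ^ 2) := by gcongr; linarith
        calc _ ≤ _ := e2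
          _ ≤ _ := e3
          _ = _ := by ring
      linarith)
  simp only [h.f_zero] at key
  norm_num at key
  linarith

lemma barrier_le (h : IsCapArc n a ρ f π) (hn : 2 ≤ n) (ha : 0 < a) {r : ℝ} (hr : r ∈ Icc 0 ρ)
    (hf : 0 ≤ f r) : arcBarrier n (arcM n) a (f r) ≤ arcM n ^ 2 := by
  have hN := one_le_sub hn
  have h1 := h.f_le hn ha hr
  have h2 : 0.3 * arcM n ^ 2 * f r ^ 2 / a ^ 2 ≤ 0.3 * arcM n ^ 2 := by
    rw [div_le_iff₀ (by positivity)]; gcongr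
  have h3 : 3 * n₋₁ ≤ 0.7 * arcM n ^ 2 := by rw [arcM]; nlinarith
  rw [arcBarrier]
  linarith

lemma Z_ge_of_sq_le (h : IsCapArc n a ρ f π) (hn : 2 ≤ n) {Y : ℝ} (ha : 100 * arcM n ≤ a)
    (hY : arcM n ≤ Y) (hf : ∀ r ∈ Ico 0 ρ, Y ≤ f r) (hlog : 1 ≤ log a) {r : ℝ}
    (hr : r ∈ Ico 0 ρ) (hr1 : r ^ 2 ≤ (n : ℝ) - 1) :
    2 * n₋₁ / a ^ 2 - 24 * arcM n ^ 2 * log a / a ^ 4 ≤ (2 * n₋₁ - r ^ 2) / f r ^ 2 := by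
  have hN := one_le_sub hn
  set M := arcM n
  have hMn : 400 * (n : ℝ) ≤ M := le_of_eq rfl
  have hM0 : 0 < M := by linarith
  have ha0 : 0 < a := by linarith
  have hfpos : ∀ r ∈ Ico 0 ρ, 0 < f r := fun s hs => by linarith [hf s hs]
  have hm0 : 0 < M / a := by positivity
  have hm1 : M / a ≤ 1 := by rw [div_le_iff₀ ha0]; linarith
  have first : ∀ s ∈ Ico 0 ρ, s ≤ M / a →
      2 * n₋₁ / a ^ 2 - 8 * M ^ 2 / a ^ 4 ≤ (2 * n₋₁ - s ^ 2) / f s ^ 2 := fun s hs hsm => by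
    have h1 := h.Z_ge_of_le_one hn ha0 hfpos hs (hsm.trans hm1)
    have h2 : 8 * s ^ 2 / a ^ 2 ≤ 8 * M ^ 2 / a ^ 4 := by
      calc 8 * s ^ 2 / a ^ 2 ≤ 8 * (M / a) ^ 2 / a ^ 2 := by have := hs.1; gcongr
        _ = _ := by field_simp
    linarith
  rcases le_total r (M / a) with hc | hc
  · have h1 := first r hr hc
    have h2 : 8 * M ^ 2 / a ^ 4 ≤ 24 * M ^ 2 * log a / a ^ 4 := by
      gcongr ?_ / _
      nlinarith [sq_nonneg M]
    linarith
  · have h1 := first (M / a) ⟨hm0.le, hc.trans_lt hr.2⟩ le_rfl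
    have key := le_of_hasDerivAt_nonneg
      (φ := fun r => (2 * n₋₁ - r ^ 2) / f r ^ 2 + 16 * M ^ 2 / a ^ 4 * log r)
      (φ' := fun r => -(4 * r * arcE n f π r / f r ^ 3) + 16 * M ^ 2 / a ^ 4 * r⁻¹) hc
      (((h.cont_Z hfpos).mono fun x hx => ⟨hm0.le.trans hx.1, hx.2.trans_lt hr.2⟩).add
        (continuousOn_const.mul (Real.continuousOn_log.mono fun x hx => (hm0.trans_le hx.1).ne')))
      (fun s hs => by
        have hs0 : 0 < s := hm0.trans hs.1
        exact (h.deriv_Z ⟨hs0, hs.2.trans hr.2⟩ (hfpos s ⟨hs0.le, hs.2.trans hr.2⟩)).add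
          ((Real.hasDerivAt_log hs0.ne').const_mul _))
      (fun s hs => by
        have hs0 : 0 < s := hm0.trans hs.1
        have hsρ : s < ρ := hs.2.trans hr.2
        have hf0 := hfpos s ⟨hs0.le, hsρ⟩
        have hb' := h.barrier_le hn ha0 ⟨hs0.le, hsρ.le⟩ hf0.le
        have hZ := h.Z_le hn ha0 hfpos ⟨hs0.le, hsρ⟩
        have hs2 : s ^ 2 ≤ (n : ℝ) - 1 := (pow_le_pow_left₀ hs0.le hs.2.le 2).trans hr1
        have hfa : a ^ 2 ≤ 2 * f s ^ 2 := by
          rw [div_le_div_iff₀ (by positivity) (by positivity)] at hZ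
          nlinarith [sq_nonneg a]
        have e : 4 * s * arcE n f π s / f s ^ 3 =
            4 * (s ^ 2 * f s * arcE n f π s) / f s ^ 4 * s⁻¹ := by field_simp
        have e2 : 4 * (s ^ 2 * f s * arcE n f π s) / f s ^ 4 ≤ 16 * M ^ 2 / a ^ 4 := by
          rw [div_le_div_iff₀ (by positivity) (by positivity)]
          have e3 : a ^ 4 ≤ 4 * f s ^ 4 := by nlinarith [sq_nonneg a, sq_nonneg (f s)]
          calc 4 * (s ^ 2 * f s * arcE n f π s) * a ^ 4 ≤ 4 * M ^ 2 * (4 * f s ^ 4) := by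
                gcongr
                exact (h.E_barrier hn hMn ha hY hf s ⟨hs.1.le, hsρ⟩).le.trans hb'
            _ = _ := by ring
        have : 0 < s⁻¹ := by positivity
        rw [e]; nlinarith)
    have hr0 : 0 < r := hm0.trans_le hc
    have hlog2 : log r - log (M / a) ≤ log a := by
      rw [Real.log_div hM0.ne' ha0.ne']
      have : log r ≤ log M := Real.log_le_log hr0 (by nlinarith)
      linarith
    have h3 : 16 * M ^ 2 / a ^ 4 * (log r - log (M / a)) ≤ 16 * M ^ 2 / a ^ 4 * log a := by gcongr
    have h4 : 8 * M ^ 2 / a ^ 4 * 1 ≤ 8 * M ^ 2 / a ^ 4 * log a := by gcongr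
    have e5 : 24 * M ^ 2 * log a / a ^ 4 =
        16 * M ^ 2 / a ^ 4 * log a + 8 * M ^ 2 / a ^ 4 * log a := by ring
    linarith

/-- The slope of an arc away from the axis, from below. -/
lemma slope_ge (h : IsCapArc n a ρ f π) (hn : 2 ≤ n) {Y : ℝ} (ha : 100 * arcM n ≤ a)
    (hY : arcM n ≤ Y) (hf : ∀ r ∈ Ico 0 ρ, Y ≤ f r) {r c : ℝ} (hr : r ∈ Ico (arcM n / a) ρ)
    (hc : 2 * arcBarrier n (arcM n) a (f r) ≤ c * (r * f r) ^ 2) :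
    r * f r * (1 - c) ≤ (2 * n₋₁ - r ^ 2) * arcSlope π r := by
  have hN := one_le_sub hn
  have hM0 : 0 < arcM n := by rw [arcM]; linarith
  have ha0 : 0 < a := by linarith
  have hr0 : 0 < r := lt_of_lt_of_le (by positivity) hr.1
  have hf0 : 0 < f r := by linarith [hf r ⟨hr0.le, hr.2⟩]
  have hb := h.E_barrier hn (M := arcM n) (le_of_eq rfl) ha hY hf r hr
  have hEeq := E_eq (n := n) (f := f) (π := π) (r := r)
  have h2 : 2 * arcE n f π r ≤ c * f r := by
    have : 0 < r ^ 2 * f r := by positivity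
    by_contra! h3
    nlinarith
  nlinarith

/-- The slope bound in the form used for the logarithmic correction. -/
lemma mul_slope_ge (h : IsCapArc n a ρ f π) (hn : 2 ≤ n) {Y : ℝ} (ha : 100 * arcM n ≤ a)
    (hY : arcM n ≤ Y) (hf : ∀ r ∈ Ico 0 ρ, Y ≤ f r) {s : ℝ} (hs : s ∈ Ico 1 ρ) :
    13 / 14 * s * a ^ 2 ≤ 2 * n₋₁ * f s * arcSlope π s := by
  have hN := one_le_sub hn
  set N := (n : ℝ) - 1 with hNdef
  set M := arcM n with hM
  have hMn : 400 * (N + 1) ≤ M := by rw [hM, arcM, hNdef]; linarith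
  have hM0 : 0 < M := by linarith
  have ha0 : 0 < a := by linarith
  have hfpos : ∀ r ∈ Ico 0 ρ, 0 < f r := fun s hs => by linarith [hf s hs]
  have hm1 : M / a ≤ 1 := by rw [div_le_iff₀ ha0]; linarith
  have hs1 := hs.1
  have hs0 : 0 < s := by linarith
  have hsρ : s < ρ := hs.2
  have hfY := hf s ⟨hs0.le, hsρ⟩
  have hf0 := hfpos s ⟨hs0.le, hsρ⟩
  have hKF : arcBarrier n M a (f s) / f s ^ 2 = 3 * N / f s ^ 2 + 0.3 * M ^ 2 / a ^ 2 := by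
    rw [arcBarrier, ← hNdef]; field_simp
  have b1 : 3 * N / f s ^ 2 ≤ 0.01 := by rw [div_le_iff₀ (by positivity)]; nlinarith
  have b2 : 0.3 * M ^ 2 / a ^ 2 ≤ 0.01 := by
    rw [div_le_iff₀ (by positivity)]
    have : (100 * M) ^ 2 ≤ a ^ 2 := pow_le_pow_left₀ (by positivity) ha 2
    nlinarith
  have hKs : 2 * arcBarrier n M a (f s) ≤ (1 / 14) * (s * f s) ^ 2 := by
    have h2 : arcBarrier n M a (f s) ≤ 0.02 * f s ^ 2 := by
      rw [← div_le_iff₀ (by positivity)]; linarith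
    have h3 : f s ^ 2 ≤ (s * f s) ^ 2 := by
      rw [mul_pow]; exact le_mul_of_one_le_left (by positivity) (one_le_pow₀ hs1)
    have := sq_nonneg (s * f s)
    linarith
  have hslope := h.slope_ge hn ha hY hf (c := 1 / 14) ⟨hm1.trans hs1, hsρ⟩ hKs
  have hg : 0 < arcSlope π s := h.g_pos hn ha0 ⟨hs0, hsρ.le⟩
  have hZ := h.Z_le hn ha0 hfpos ⟨hs0.le, hsρ⟩
  rw [div_le_div_iff₀ (by positivity) (by positivity), ← hNdef] at hZ
  rw [← hNdef] at hslope
  have e3 : f s * (13 / 14 * s * a ^ 2) ≤ f s * (2 * N * f s * arcSlope π s) :=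
    calc f s * (13 / 14 * s * a ^ 2) = s * f s * (1 - 1 / 14) * a ^ 2 := by ring
      _ ≤ (2 * N - s ^ 2) * arcSlope π s * a ^ 2 := by gcongr
      _ = (2 * N - s ^ 2) * a ^ 2 * arcSlope π s := by ring
      _ ≤ 2 * N * f s ^ 2 * arcSlope π s := by gcongr
      _ = _ := by ring
  exact le_of_mul_le_mul_left e3 hf0

lemma Z_deriv_ge (h : IsCapArc n a ρ f π) (hn : 2 ≤ n) {Y : ℝ} (ha : 100 * arcM n ≤ a)
    (hY : arcM n ≤ Y) (hf : ∀ r ∈ Ico 0 ρ, Y ≤ f r) {s : ℝ} (hs : s ∈ Ico 1 ρ)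
    (hsN : (n : ℝ) - 1 ≤ s ^ 2) :
    0 ≤ -(4 * s * arcE n f π s / f s ^ 3) + 28 * n₋₁ * arcSlope π s / (a ^ 2 * f s ^ 3) +
      3 * n₋₁ * arcM n ^ 2 * arcSlope π s / (a ^ 4 * f s) := by
  have hg2 := h.mul_slope_ge hn ha hY hf hs
  have hN := one_le_sub hn
  set N := (n : ℝ) - 1 with hNdef
  set M := arcM n with hM
  have hMn : 400 * (N + 1) ≤ M := by rw [hM, arcM, hNdef]; linarith
  have hM0 : 0 < M := by linarith
  have ha0 : 0 < a := by linarith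
  have hfpos : ∀ r ∈ Ico 0 ρ, 0 < f r := fun s hs => by linarith [hf s hs]
  have hm1 : M / a ≤ 1 := by rw [div_le_iff₀ ha0]; linarith
  have hs1 := hs.1
  have hs0 : 0 < s := by linarith
  have hsρ : s < ρ := hs.2
  have hf0 := hfpos s ⟨hs0.le, hsρ⟩
  have hb := h.E_barrier hn (M := arcM n) (le_of_eq rfl) ha hY hf s ⟨hm1.trans hs1, hsρ⟩
  rw [← hM] at hb
  have hg : 0 < arcSlope π s := h.g_pos hn ha0 ⟨hs0, hsρ.le⟩
  have hK : arcBarrier n M a (f s) = 3 * N + 0.3 * M ^ 2 * f s ^ 2 / a ^ 2 := rfl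
  rw [hK] at hb
  generalize arcE n f π s = E at hb ⊢
  generalize arcSlope π s = g at hb hg hg2 ⊢
  generalize f s = F at hb hg2 hf0 ⊢
  have t1 : 13 * s / F ^ 4 ≤ 28 * N * g / (a ^ 2 * F ^ 3) := by
    rw [div_le_div_iff₀ (by positivity) (by positivity)]
    have : 14 * F ^ 3 * (13 / 14 * s * a ^ 2) ≤ 14 * F ^ 3 * (2 * N * F * g) := by gcongr
    linarith
  have t2 : (39 / 28) * s * M ^ 2 / (a ^ 2 * F ^ 2) ≤ 3 * N * M ^ 2 * g / (a ^ 4 * F) := by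
    rw [div_le_div_iff₀ (by positivity) (by positivity)]
    have : (3 / 2) * M ^ 2 * a ^ 2 * F * (13 / 14 * s * a ^ 2) ≤
      (3 / 2) * M ^ 2 * a ^ 2 * F * (2 * N * F * g) := by gcongr
    linarith
  have t3 : 4 * s * E / F ^ 3 ≤ 4 * (3 * N + 0.3 * M ^ 2 * F ^ 2 / a ^ 2) / (s * F ^ 4) := by
    have : 4 * s * E / F ^ 3 = 4 * (s ^ 2 * F * E) / (s * F ^ 4) := by field_simp
    rw [this]; gcongr
  have t4 : 4 * (3 * N + 0.3 * M ^ 2 * F ^ 2 / a ^ 2) / (s * F ^ 4) =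
      12 * N / (s * F ^ 4) + 1.2 * M ^ 2 / (a ^ 2 * s * F ^ 2) := by
    field_simp; ring
  have t5 : 12 * N / (s * F ^ 4) ≤ 13 * s / F ^ 4 := by
    rw [div_le_div_iff₀ (by positivity) (by positivity)]
    have : 0 ≤ F ^ 4 * (13 * s ^ 2 - 12 * N) := mul_nonneg (by positivity) (by nlinarith)
    linarith
  have t6 : 1.2 * M ^ 2 / (a ^ 2 * s * F ^ 2) ≤ (39 / 28) * s * M ^ 2 / (a ^ 2 * F ^ 2) := by
    rw [div_le_div_iff₀ (by positivity) (by positivity)]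
    have : 0 ≤ M ^ 2 * a ^ 2 * F ^ 2 * ((39 / 28) * s ^ 2 - 1.2) :=
      mul_nonneg (by positivity) (by linarith)
    linarith
  linarith

lemma Z_ge (h : IsCapArc n a ρ f π) (hn : 2 ≤ n) {Y : ℝ} (ha : 100 * arcM n ≤ a)
    (hY : arcM n ≤ Y) (hf : ∀ r ∈ Ico 0 ρ, Y ≤ f r) (hlog : 1 ≤ log a) {r : ℝ}
    (hr : r ∈ Ico 0 ρ) :
    2 * n₋₁ / a ^ 2 - arcC n * log a / a ^ 4 -
      14 * n₋₁ / (a ^ 2 * f r ^ 2) ≤ (2 * n₋₁ - r ^ 2) / f r ^ 2 := by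
  have hN := one_le_sub hn
  set N := (n : ℝ) - 1 with hNdef
  set M := arcM n with hM
  have hMn : 400 * (N + 1) ≤ M := by rw [hM, arcM, hNdef]; linarith
  have hM0 : 0 < M := by linarith
  have ha0 : 0 < a := by linarith
  have hfpos : ∀ r ∈ Ico 0 ρ, 0 < f r := fun s hs => by linarith [hf s hs]
  have hC : arcC n * log a / a ^ 4 =
      24 * M ^ 2 * log a / a ^ 4 + 3 * N * M ^ 2 * log a / a ^ 4 := by
    rw [arcC]; ring
  have hpos1 : 0 ≤ 3 * N * M ^ 2 * log a / a ^ 4 := by positivity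
  have hfr := hfpos r hr
  have hpos2 : 0 ≤ 14 * N / (a ^ 2 * f r ^ 2) := by positivity
  by_cases hc : r ^ 2 ≤ N
  · have := h.Z_ge_of_sq_le hn ha hY hf hlog hr hc; linarith
  push Not at hc
  set q := √N
  have hqq : q ^ 2 = N := sq_sqrt (by linarith)
  have hq1 : 1 ≤ q := Real.one_le_sqrt.2 hN
  have hqr : q < r := lt_of_pow_lt_pow_left₀ 2 hr.1 (by rw [hqq]; exact hc)
  have hqm : q ∈ Ico 0 ρ := ⟨by linarith, hqr.trans hr.2⟩
  have h1 := h.Z_ge_of_sq_le hn ha hY hf hlog hqm hqq.le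
  have key := le_of_hasDerivAt_nonneg
    (φ := fun r => (2 * N - r ^ 2) / f r ^ 2 + 14 * N / a ^ 2 * (f r ^ 2)⁻¹ -
      3 * N * M ^ 2 / a ^ 4 * log (f r))
    (φ' := fun r => -(4 * r * arcE n f π r / f r ^ 3) + 28 * N * arcSlope π r / (a ^ 2 * f r ^ 3) +
      3 * N * M ^ 2 * arcSlope π r / (a ^ 4 * f r)) hqr.le
    (by
      have hs : Icc q r ⊆ Ico 0 ρ := fun x hx => ⟨by linarith [hx.1], hx.2.trans_lt hr.2⟩
      have hcf := h.cont_f.mono (hs.trans Ico_subset_Icc_self)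
      refine (((h.cont_Z hfpos).mono hs).add (continuousOn_const.mul
        (ContinuousOn.inv₀ (by fun_prop) fun x hx => ?_))).sub
          (continuousOn_const.mul (hcf.log fun x hx => ?_))
      · have := hfpos x (hs hx); positivity
      · exact (hfpos x (hs hx)).ne')
    (fun s hs => by
      have hs0 : 0 < s := by linarith [hs.1]
      have hs' : s ∈ Ioo 0 ρ := ⟨hs0, hs.2.trans hr.2⟩
      have hf0 := hfpos s ⟨hs0.le, hs'.2⟩
      refine (((h.deriv_Z hs' hf0).add ((((h.deriv_f' hs').pow 2).inv
        (pow_ne_zero 2 hf0.ne')).const_mul (14 * N / a ^ 2))).sub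
        (((h.deriv_f' hs').log hf0.ne').const_mul (3 * N * M ^ 2 / a ^ 4))).congr_deriv ?_
      simp only [Pi.pow_apply, Nat.cast_ofNat]
      field_simp; ring)
    (fun s hs => h.Z_deriv_ge hn ha hY hf ⟨hq1.trans hs.1.le, hs.2.trans hr.2⟩
      (by rw [← hNdef, ← hqq]; exact pow_le_pow_left₀ (by linarith) hs.1.le 2))
  have hl1 : 0 ≤ log (f r) := Real.log_nonneg (by linarith [hf r hr])
  have hl2 : log (f q) ≤ log a := Real.log_le_log (hfpos q hqm) (h.f_le hn ha0 ⟨hqm.1, hqm.2.le⟩)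
  have hpq : 0 ≤ 14 * N / a ^ 2 * (f q ^ 2)⁻¹ := by have := hfpos q hqm; positivity
  have e1 : 14 * N / (a ^ 2 * f r ^ 2) = 14 * N / a ^ 2 * (f r ^ 2)⁻¹ := by field_simp
  have e2 : 0 ≤ 3 * N * M ^ 2 / a ^ 4 * log (f r) := by positivity
  have e3 : 3 * N * M ^ 2 / a ^ 4 * log (f q) ≤ 3 * N * M ^ 2 / a ^ 4 * log a := by gcongr
  have e4 : 3 * N * M ^ 2 * log a / a ^ 4 = 3 * N * M ^ 2 / a ^ 4 * log a := by ring
  rw [e1, hC, e4]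
  linarith

end IsCapArc

end

section

/-! ### Continuation of the arcs -/

namespace IsCapArc

variable {a ρ : ℝ} {f π : ℝ → ℝ}

lemma congr (h : IsCapArc n a ρ f π) (hρ : 0 ≤ ρ) {f' π' : ℝ → ℝ} (hf : ∀ r ∈ Icc 0 ρ, f' r = f r)
    (hp : ∀ r ∈ Icc 0 ρ, π' r = π r) : IsCapArc n a ρ f' π' := by
  have hev : ∀ r ∈ Ioo 0 ρ, ∀ᶠ s in 𝓝 r, s ∈ Icc 0 ρ := fun r hr => Icc_mem_nhds hr.1 hr.2
  refine ⟨(hf 0 ⟨le_rfl, hρ⟩).trans h.f_zero, (hp 0 ⟨le_rfl, hρ⟩).trans h.p_zero,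
    h.cont_f.congr hf, h.cont_p.congr hp, fun r hr => ?_, fun r hr => ?_⟩
  · rw [hp r ⟨hr.1.le, hr.2.le⟩]
    exact (h.deriv_f r hr).congr_of_eventuallyEq ((hev r hr).mono hf)
  · rw [hf r ⟨hr.1.le, hr.2.le⟩, hp r ⟨hr.1.le, hr.2.le⟩]
    exact (h.deriv_p r hr).congr_of_eventuallyEq ((hev r hr).mono hp)

/-- An arc on a half-open interval with limits at the end point extends to the closed interval. -/
lemma of_tendsto (hρ : 0 < ρ) (h : ∀ s ∈ Ioo 0 ρ, IsCapArc n a s f π) {L K : ℝ}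
    (hL : Tendsto f (𝓝[<] ρ) (𝓝 L)) (hK : Tendsto π (𝓝[<] ρ) (𝓝 K)) :
    IsCapArc n a ρ (update f ρ L) (update π ρ K) := by
  have hne : ∀ r ∈ Ioo 0 ρ, ∀ φ : ℝ → ℝ, ∀ L, update φ ρ L =ᶠ[𝓝 r] φ := fun r hr φ L =>
    mem_of_superset (Iio_mem_nhds hr.2) fun s hs => update_of_ne (ne_of_lt hs) _ _
  have hcont : ∀ (φ : ℝ → ℝ) (L : ℝ), (∀ s ∈ Ioo 0 ρ, ContinuousOn φ (Icc 0 s)) →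
      Tendsto φ (𝓝[<] ρ) (𝓝 L) → ContinuousOn (update φ ρ L) (Icc 0 ρ) := fun φ L hφ hl => by
    have hd : Icc 0 ρ \ {ρ} = Ico 0 ρ := by
      ext x; simp only [Set.mem_sdiff, mem_Icc, mem_singleton_iff, mem_Ico]; grind
    rw [continuousOn_update_iff, hd]
    refine ⟨fun r hr => ?_, fun _ => ?_⟩
    · obtain ⟨s, hs, hs'⟩ := exists_between hr.2
      refine (hφ s ⟨hr.1.trans_lt hs, hs'⟩ r ⟨hr.1, hs.le⟩).mono_of_mem_nhdsWithin ?_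
      exact mem_of_superset (inter_mem_nhdsWithin _ (Iio_mem_nhds hs)) fun x hx => ⟨hx.1.1, hx.2.le⟩
    · exact hl.mono_left (nhdsWithin_mono _ fun x hx => hx.2)
  have h2 : ρ / 2 ∈ Ioo 0 ρ := ⟨by linarith, by linarith⟩
  refine ⟨?_, ?_, hcont f L (fun s hs => (h s hs).cont_f) hL,
    hcont π K (fun s hs => (h s hs).cont_p) hK, fun r hr => ?_, fun r hr => ?_⟩
  · rw [update_of_ne hρ.ne]; exact (h _ h2).f_zero
  · rw [update_of_ne hρ.ne]; exact (h _ h2).p_zero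
  all_goals
    obtain ⟨s, hs, hs'⟩ := exists_between hr.2
    have hs0 : s ∈ Ioo 0 ρ := ⟨hr.1.trans hs, hs'⟩
    simp only [update_of_ne hr.2.ne]
  · exact ((h s hs0).deriv_f r ⟨hr.1, hs⟩).congr_of_eventuallyEq (hne r hr f L)
  · exact ((h s hs0).deriv_p r ⟨hr.1, hs⟩).congr_of_eventuallyEq (hne r hr π K)

lemma exists_extension (hn : 2 ≤ n) (h : IsCapArc n a ρ f π) (hρ : 0 < ρ) :
    ∃ ρ' > ρ, ∃ f' π', IsCapArc n a ρ' f' π' := by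
  obtain ⟨h', q, -, -, -, H⟩ := exists_smooth_arcs hn (h.fixed hn hρ)
  have h1 : Tendsto (fun s : ℝ => (a, s ^ 2)) (𝓝[>] ρ) (𝓝 (a, ρ ^ 2)) := by
    have : Continuous fun s : ℝ => (a, s ^ 2) := by fun_prop
    exact (this.tendsto ρ).mono_left nhdsWithin_le_nhds
  obtain ⟨s, hs, hs'⟩ := ((h1.eventually (H 1 one_pos)).and self_mem_nhdsWithin).exists
  have hs0 : 0 < s := hρ.trans hs'
  obtain ⟨f', π', hf, -⟩ := hs (by positivity)
  simp only [sqrt_sq hs0.le] at hf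
  exact ⟨s, hs', f', π', hf⟩

/-- As long as the height exceeds `Y`, the arc stays away from the cylinder. -/
lemma sub_sq_ge (h : IsCapArc n a ρ f π) (hn : 2 ≤ n) {Y : ℝ} (ha : 100 * arcM n ≤ a)
    (hY : arcM n ≤ Y) (hf : ∀ r ∈ Ico 0 ρ, Y ≤ f r) (hlog : 1 ≤ log a)
    (hC : arcC n * log a ≤ a ^ 2 / 4) {r : ℝ} (hr : r ∈ Ico 0 ρ) :
    n₋₁ / a ^ 2 * f r ^ 2 ≤ 2 * n₋₁ - r ^ 2 := by
  have hN := one_le_sub hn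
  have hM : 400 * (2 : ℝ) ≤ arcM n := by rw [arcM]; linarith
  have ha0 : 0 < a := by linarith
  have hfr : 800 ≤ f r := by linarith [hf r hr]
  rw [← le_div_iff₀ (by positivity)]
  refine le_trans ?_ (h.Z_ge hn ha hY hf hlog hr)
  set N := (n : ℝ) - 1
  have h2 : arcC n * log a / a ^ 4 ≤ (N / 4) / a ^ 2 := by
    rw [div_le_div_iff₀ (by positivity) (by positivity)]
    calc arcC n * log a * a ^ 2 ≤ a ^ 2 / 4 * a ^ 2 := by gcongr
      _ = 1 / 4 * a ^ 4 := by ring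
      _ ≤ N / 4 * a ^ 4 := by gcongr
  have h3 : 14 * N / (a ^ 2 * f r ^ 2) ≤ (N / 4) / a ^ 2 := by
    rw [div_le_div_iff₀ (by positivity) (by positivity)]
    have : 0 ≤ N * a ^ 2 * (f r ^ 2 - 56) := mul_nonneg (by positivity) (by nlinarith)
    linarith
  have h4 : N / a ^ 2 = 2 * N / a ^ 2 - (N / 4) / a ^ 2 * 4 := by ring
  have h5 : 0 ≤ (N / 4) / a ^ 2 := by positivity
  linarith

lemma slope_monotone (h : IsCapArc n a ρ f π) (hn : 2 ≤ n) (ha : 0 < a) :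
    StrictMonoOn (arcSlope π) (Icc 0 ρ) := by
  refine strictMonoOn_of_deriv_pos (convex_Icc 0 ρ) h.cont_g fun x hx => ?_
  rw [interior_Icc] at hx
  rw [(h.deriv_g hx).deriv]
  exact mul_pos (by positivity) (h.E_pos hn ha x ⟨hx.1.le, hx.2⟩)

end IsCapArc

/-! ### The family of all arcs -/

/-- The height at radius `r` of the cap with tip at height `a`. -/
def capF (n : ℕ) (a r : ℝ) : ℝ :=
  open Classical in if h : ∃ z : (ℝ → ℝ) × (ℝ → ℝ), IsCapArc n a r z.1 z.2 then h.choose.1 r else 0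

/-- The derivative with respect to `r²` of the height at radius `r` of the cap with tip at
height `a`. -/
def capP (n : ℕ) (a r : ℝ) : ℝ :=
  open Classical in if h : ∃ z : (ℝ → ℝ) × (ℝ → ℝ), IsCapArc n a r z.1 z.2 then h.choose.2 r else 0

lemma IsCapArc.eq_cap (hn : 2 ≤ n) {a ρ : ℝ} {f π : ℝ → ℝ} (h : IsCapArc n a ρ f π) {r : ℝ}
    (hr : r ∈ Icc 0 ρ) : capF n a r = f r ∧ capP n a r = π r := by
  have hex : ∃ z : (ℝ → ℝ) × (ℝ → ℝ), IsCapArc n a r z.1 z.2 := ⟨(f, π), h.mono hr.2⟩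
  rw [capF, capP, dif_pos hex, dif_pos hex]
  exact IsCapArc.unique hn hex.choose_spec (h.mono hr.2) ⟨hr.1, le_rfl⟩

/-- The arc of the cap with tip at height `a` exists up to radius `ρ`. -/
def HasArc (n : ℕ) (a ρ : ℝ) : Prop := IsCapArc n a ρ (capF n a) (capP n a)

lemma IsCapArc.hasArc (hn : 2 ≤ n) {a ρ : ℝ} (hρ : 0 ≤ ρ) {f π : ℝ → ℝ}
    (h : IsCapArc n a ρ f π) : HasArc n a ρ :=
  h.congr hρ (fun _ hr => (h.eq_cap hn hr).1) fun _ hr => (h.eq_cap hn hr).2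

lemma hasArc_zero (hn : 2 ≤ n) (a : ℝ) : HasArc n a 0 := by
  obtain ⟨ρ, hρ, f, π, h⟩ := exists_short_arc hn a one_pos
  exact (h.mono hρ.1.le).hasArc hn le_rfl

lemma capF_zero (hn : 2 ≤ n) (a : ℝ) : capF n a 0 = a := (hasArc_zero hn a).f_zero

lemma capP_zero (hn : 2 ≤ n) (a : ℝ) : capP n a 0 = -a / (4 * n) := (hasArc_zero hn a).p_zero

/-- The arc with a high tip exists down to the height `Y`. -/
lemma exists_arc (hn : 2 ≤ n) {a Y : ℝ} (ha : 100 * arcM n ≤ a) (hY : arcM n ≤ Y)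
    (hYa : Y < a) (hlog : 1 ≤ log a) (hC : arcC n * log a ≤ a ^ 2 / 4) :
    ∃ ρ > 0, HasArc n a ρ ∧ capF n a ρ = Y := by
  have hN := IsCapArc.one_le_sub hn
  have hM : 400 * (2 : ℝ) ≤ arcM n := by rw [arcM]; linarith
  have ha0 : 0 < a := by linarith
  set S := {ρ : ℝ | 0 < ρ ∧ HasArc n a ρ ∧ Y < capF n a ρ}
  have short : ∀ {ρ}, HasArc n a ρ → ∀ s ∈ Ico 0 ρ, Y < capF n a s → ∃ t ∈ Ioo s ρ, t ∈ S := by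
    intro ρ h s hs hfs
    have hc : Tendsto (capF n a) (𝓝[>] s) (𝓝 (capF n a s)) :=
      (h.cont_f s ⟨hs.1, hs.2.le⟩).mono_of_mem_nhdsWithin (mem_of_superset (Ioo_mem_nhdsGT hs.2)
        fun x hx => ⟨hs.1.trans hx.1.le, hx.2.le⟩)
    obtain ⟨t, ht, ht'⟩ := ((hc.eventually (lt_mem_nhds hfs)).and (Ioo_mem_nhdsGT hs.2)).exists
    exact ⟨t, ht', hs.1.trans_lt ht'.1, h.mono ht'.2.le, ht⟩
  obtain ⟨ρ0, hρ0⟩ : S.Nonempty := by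
    obtain ⟨ρ, hρ, f, π, h⟩ := exists_short_arc hn a one_pos
    obtain ⟨t, -, ht⟩ := short (h.hasArc hn hρ.1.le) 0 ⟨le_rfl, hρ.1⟩ (by rwa [capF_zero hn])
    exact ⟨t, ht⟩
  have hsq : ∀ ρ ∈ S, ∀ r ∈ Ico 0 ρ,
      n₋₁ / a ^ 2 * capF n a r ^ 2 ≤ 2 * n₋₁ - r ^ 2 := fun ρ h r hr =>
    h.2.1.sub_sq_ge hn ha hY (fun s hs => h.2.2.le.trans ((h.2.1.f_strictAnti hn ha0).antitoneOn
      ⟨hs.1, hs.2.le⟩ ⟨h.1.le, le_rfl⟩ hs.2.le)) hlog hC hr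
  have hbdd : BddAbove S := ⟨2 * (2 * n₋₁), fun ρ h => by
    have h1 := hsq ρ h (ρ / 2) ⟨by linarith [h.1], by linarith [h.1]⟩
    have : 0 ≤ (n : ℝ) - 1 := by linarith
    have h2 : 0 ≤ n₋₁ / a ^ 2 * capF n a (ρ / 2) ^ 2 := by positivity
    nlinarith⟩
  set σ := sSup S
  have hσ0 : 0 < σ := hρ0.1.trans_le (le_csSup hbdd hρ0)
  have hlt : ∀ s ∈ Ioo 0 σ, s ∈ S := fun s hs => by
    obtain ⟨ρ, h, hsρ⟩ := exists_lt_of_lt_csSup ⟨ρ0, hρ0⟩ hs.2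
    exact ⟨hs.1, h.2.1.mono hsρ.le, h.2.2.trans ((h.2.1.f_strictAnti hn ha0)
      ⟨hs.1.le, hsρ.le⟩ ⟨h.1.le, le_rfl⟩ hsρ)⟩
  have hfanti : AntitoneOn (capF n a) (Ioo 0 σ) := fun r hr s hs hrs =>
    ((hlt s hs).2.1.f_strictAnti hn ha0).antitoneOn ⟨hr.1.le, hrs⟩ ⟨hs.1.le, le_rfl⟩ hrs
  have hgmono : MonotoneOn (arcSlope (capP n a)) (Ioo 0 σ) := fun r hr s hs hrs =>
    ((hlt s hs).2.1.slope_monotone hn ha0).monotoneOn ⟨hr.1.le, hrs⟩ ⟨hs.1.le, le_rfl⟩ hrs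
  have hgbd : ∀ r ∈ Ioo 0 σ, arcSlope (capP n a) r ≤ 2 * n₋₁ * a * a ^ 2 := fun r hr => by
    obtain ⟨s, hs, hs'⟩ := exists_between hr.2
    have hS := hlt s ⟨hr.1.trans hs, hs'⟩
    have h1 := hsq s hS r ⟨hr.1.le, hs⟩
    have h2 := hS.2.1.g_lt hn ha0 ⟨hr.1, hs⟩
    have h3 := hS.2.1.g_pos hn ha0 ⟨hr.1, hs.le⟩
    have h5 := (hlt r hr).2.2
    have h6 : 1 / a ^ 2 ≤ n₋₁ / a ^ 2 * capF n a r ^ 2 := by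
      rw [div_mul_eq_mul_div]
      gcongr
      have : 1 ≤ capF n a r ^ 2 := one_le_pow₀ (by linarith)
      nlinarith
    have h7 : 1 / a ^ 2 * arcSlope (capP n a) r ≤ (2 * n₋₁ - r ^ 2) * arcSlope (capP n a) r := by
      gcongr
      exact h6.trans h1
    have hr2 : r ≤ 2 * n₋₁ := by
      have : 0 < 1 / a ^ 2 := by positivity
      nlinarith [hr.1]
    have h8 : r * capF n a r ≤ 2 * n₋₁ * a := by
      have := hr.1
      exact mul_le_mul hr2 (hS.2.1.f_le hn ha0 ⟨hr.1.le, hs.le⟩) (by linarith) (by linarith)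
    rw [← div_le_iff₀ (by positivity)]
    rw [one_div, inv_mul_eq_div] at h7
    linarith
  have hne : (Ioo 0 σ).Nonempty := nonempty_Ioo.2 hσ0
  obtain ⟨L, hL⟩ : ∃ L, Tendsto (capF n a) (𝓝[<] σ) (𝓝 L) :=
    ⟨_, hfanti.tendsto_nhdsWithin_Ioo_left hne
      ⟨Y, by rintro _ ⟨r, hr, rfl⟩; exact (hlt r hr).2.2.le⟩⟩
  obtain ⟨G, hG⟩ : ∃ G, Tendsto (arcSlope (capP n a)) (𝓝[<] σ) (𝓝 G) :=
    ⟨_, hgmono.tendsto_nhdsWithin_Ioo_left hne ⟨_, by rintro _ ⟨r, hr, rfl⟩; exact hgbd r hr⟩⟩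
  have hK : Tendsto (capP n a) (𝓝[<] σ) (𝓝 (-G / (2 * σ))) := by
    have h1 : Tendsto (fun r : ℝ => 2 * r) (𝓝[<] σ) (𝓝 (2 * σ)) :=
      ((continuous_const.mul continuous_id).tendsto σ).mono_left nhdsWithin_le_nhds
    refine (hG.neg.div h1 (by positivity)).congr' ?_
    filter_upwards [Ioo_mem_nhdsLT hσ0] with r hr
    have := hr.1; simp only [arcSlope, Pi.div_apply, neg_neg]; field_simp
  have hfull := IsCapArc.of_tendsto hσ0 (fun s hs => (hlt s hs).2.1) hL hK
  have hLσ := (hfull.eq_cap hn ⟨hσ0.le, le_rfl⟩).1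
  rw [update_self] at hLσ
  refine ⟨σ, hσ0, hfull.hasArc hn hσ0.le, ?_⟩
  refine le_antisymm (not_lt.1 fun hgt => ?_) (hLσ ▸ ge_of_tendsto hL (mem_of_superset
    (Ioo_mem_nhdsLT hσ0) fun r hr => (hlt r hr).2.2.le))
  obtain ⟨ρ', hρ', f', π', h'⟩ := hfull.exists_extension hn hσ0
  obtain ⟨t, ht, htS⟩ := short (h'.hasArc hn (hσ0.trans hρ').le) σ ⟨hσ0.le, hρ'⟩ hgt
  exact absurd (le_csSup hbdd htS) (not_le.2 ht.1)

end

/-! ### Differentiation with respect to a parameter -/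

lemma two_le_infty : (2 : WithTop ℕ∞) ≤ ∞ := WithTop.coe_le_coe.2 (le_top : (2 : ℕ∞) ≤ ⊤)

lemma hasDerivAt_fst_of_contDiffAt {Φ : ℝ × ℝ → ℝ} {a r : ℝ} (h : DifferentiableAt ℝ Φ (a, r)) :
    HasDerivAt (fun b => Φ (b, r)) (fderiv ℝ Φ (a, r) (1, 0)) a := by
  have h1 : HasDerivAt (fun b : ℝ => (b, r)) (1, 0) a :=
    (hasDerivAt_id a).prodMk (hasDerivAt_const a r)
  exact HasFDerivAt.comp_hasDerivAt (x := a) (hl := h.hasFDerivAt) (hf := h1)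

lemma hasDerivAt_snd_of_contDiffAt {Φ : ℝ × ℝ → ℝ} {a r : ℝ} (h : DifferentiableAt ℝ Φ (a, r)) :
    HasDerivAt (fun s => Φ (a, s)) (fderiv ℝ Φ (a, r) (0, 1)) r := by
  have h1 : HasDerivAt (fun s : ℝ => (a, s)) (0, 1) r :=
    (hasDerivAt_const r a).prodMk (hasDerivAt_id r)
  exact HasFDerivAt.comp_hasDerivAt (x := r) (hl := h.hasFDerivAt) (hf := h1)

/-- Differentiation with respect to a parameter commutes with differentiation. -/
lemma hasDerivAt_deriv_param {Φ Ψ : ℝ × ℝ → ℝ} {a r : ℝ} (hΦ : ContDiffAt ℝ 2 Φ (a, r))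
    (hd : ∀ᶠ z : ℝ × ℝ in 𝓝 (a, r), HasDerivAt (fun s => Φ (z.1, s)) (Ψ z) z.2) :
    HasDerivAt (fun s => deriv (fun b => Φ (b, s)) a) (deriv (fun b => Ψ (b, r)) a) r := by
  have hdiff : ∀ᶠ z in 𝓝 (a, r), DifferentiableAt ℝ Φ z :=
    (hΦ.eventually (by simp)).mono fun z hz => hz.differentiableAt (by simp)
  have hc1 : Tendsto (fun b : ℝ => (b, r)) (𝓝 a) (𝓝 (a, r)) :=
    (by fun_prop : Continuous fun b : ℝ => (b, r)).tendsto a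
  have hc2 : Tendsto (fun s : ℝ => (a, s)) (𝓝 r) (𝓝 (a, r)) :=
    (by fun_prop : Continuous fun s : ℝ => (a, s)).tendsto r
  have hΨ : ∀ᶠ z in 𝓝 (a, r), Ψ z = fderiv ℝ Φ z (0, 1) := by
    filter_upwards [hdiff, hd] with z h1 h2
    exact h2.unique (hasDerivAt_snd_of_contDiffAt h1)
  have hD : DifferentiableAt ℝ (fderiv ℝ Φ) (a, r) :=
    (hΦ.fderiv_right (m := 1) (by norm_num)).differentiableAt (by simp)
  have e1 : deriv (fun b => Ψ (b, r)) a = fderiv ℝ (fderiv ℝ Φ) (a, r) (1, 0) (0, 1) := by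
    have h1 : (fun b => Ψ (b, r)) =ᶠ[𝓝 a] fun b => fderiv ℝ Φ (b, r) (0, 1) := hc1.eventually hΨ
    rw [h1.deriv_eq]
    have h2 : HasDerivAt (fun b : ℝ => (b, r)) (1, 0) a :=
      (hasDerivAt_id a).prodMk (hasDerivAt_const a r)
    have h3 := HasFDerivAt.comp_hasDerivAt (x := a) (hl := hD.hasFDerivAt) (hf := h2)
    exact (h3.clm_apply (hasDerivAt_const a ((0 : ℝ), (1 : ℝ)))).deriv.trans (by simp)
  have h1 : (fun s => deriv (fun b => Φ (b, s)) a) =ᶠ[𝓝 r] fun s => fderiv ℝ Φ (a, s) (1, 0) := by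
    filter_upwards [hc2.eventually hdiff] with s hs
    exact (hasDerivAt_fst_of_contDiffAt hs).deriv
  rw [e1]
  refine HasDerivAt.congr_of_eventuallyEq ?_ h1
  have h2 : HasDerivAt (fun s : ℝ => (a, s)) (0, 1) r :=
    (hasDerivAt_const r a).prodMk (hasDerivAt_id r)
  have h4 := (HasFDerivAt.comp_hasDerivAt (x := r) (hl := hD.hasFDerivAt) (hf := h2)).clm_apply
    (hasDerivAt_const r ((1 : ℝ), (0 : ℝ)))
  refine h4.congr_deriv ?_
  simp only [map_zero, add_zero, comp_apply]
  exact (hΦ.isSymmSndFDerivAt (by simp)).eq _ _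

/-- The heights of the caps and their derivatives are smooth functions of `a` and `r²`. -/
lemma HasArc.exists_smooth (hn : 2 ≤ n) {a r : ℝ} (hr : 0 ≤ r) (h : HasArc n a r) :
    ∃ Φ P : ℝ × ℝ → ℝ, ContDiffAt ℝ ∞ Φ (a, r ^ 2) ∧ ContDiffAt ℝ ∞ P (a, r ^ 2) ∧
      ∀ᶠ l : ℝ × ℝ in 𝓝 (a, r ^ 2), 0 ≤ l.2 → HasArc n l.1 √l.2 ∧
        Φ l = capF n l.1 √l.2 ∧ P l = capP n l.1 √l.2 := by
  obtain ⟨p, hp⟩ : ∃ p, capOp n ((a, r ^ 2), p) = p := by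
    rcases hr.eq_or_lt with h0 | h0
    · rw [← h0]
      exact ⟨_, by simpa using capOp_fixed_zero hn a⟩
    · exact ⟨_, h.fixed hn h0⟩
  obtain ⟨Φ, P, hΦ, hP, h0, h1⟩ := exists_smooth_arcs hn hp
  refine ⟨Φ, P, hΦ, hP, ?_⟩
  filter_upwards [h0, h1 1 one_pos] with l hl0 hl1 hl
  rcases hl.eq_or_lt with h2 | h2
  · rw [← h2, Real.sqrt_zero, capF_zero hn, capP_zero hn]
    exact ⟨hasArc_zero hn _, hl0 h2.symm⟩
  · obtain ⟨f, π, hf, e1, e2, -⟩ := hl1 h2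
    have hs := Real.sqrt_nonneg l.2
    refine ⟨hf.hasArc hn hs, ?_, ?_⟩
    · rw [(hf.eq_cap hn ⟨hs, le_rfl⟩).1, e1]
    · rw [(hf.eq_cap hn ⟨hs, le_rfl⟩).2, e2]

/-- In terms of `r` instead of `r²`. -/
lemma HasArc.exists_smooth' (hn : 2 ≤ n) {a r : ℝ} (hr : 0 ≤ r) (h : HasArc n a r) :
    ∃ Φ P : ℝ × ℝ → ℝ, ContDiffAt ℝ ∞ Φ (a, r) ∧ ContDiffAt ℝ ∞ P (a, r) ∧
      ∀ᶠ l : ℝ × ℝ in 𝓝 (a, r), 0 ≤ l.2 → HasArc n l.1 l.2 ∧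
        Φ l = capF n l.1 l.2 ∧ P l = capP n l.1 l.2 := by
  obtain ⟨Φ, P, hΦ, hP, hev⟩ := h.exists_smooth hn hr
  have hs : ContDiff ℝ ∞ fun l : ℝ × ℝ => (l.1, l.2 ^ 2) := by fun_prop
  refine ⟨fun l => Φ (l.1, l.2 ^ 2), fun l => P (l.1, l.2 ^ 2),
    hΦ.comp (a, r) hs.contDiffAt, hP.comp (a, r) hs.contDiffAt, ?_⟩
  have ht : Tendsto (fun l : ℝ × ℝ => (l.1, l.2 ^ 2)) (𝓝 (a, r)) (𝓝 (a, r ^ 2)) :=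
    hs.continuous.tendsto (a, r)
  filter_upwards [ht.eventually hev] with l hl h0
  have := hl (sq_nonneg _)
  rwa [sqrt_sq h0] at this

lemma HasArc.eventually (hn : 2 ≤ n) {a r : ℝ} (hr : 0 < r) (h : HasArc n a r) :
    ∀ᶠ l : ℝ × ℝ in 𝓝 (a, r), HasArc n l.1 l.2 := by
  obtain ⟨Φ, P, -, -, hev⟩ := h.exists_smooth' hn hr.le
  have : ∀ᶠ l : ℝ × ℝ in 𝓝 (a, r), 0 < l.2 := continuousAt_snd.eventually (lt_mem_nhds hr)
  filter_upwards [hev, this] with l h1 h2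
  exact (h1 h2.le).1

lemma HasArc.contDiffAt (hn : 2 ≤ n) {a r : ℝ} (hr : 0 < r) (h : HasArc n a r) :
    ContDiffAt ℝ ∞ (fun l : ℝ × ℝ => capF n l.1 l.2) (a, r) ∧
      ContDiffAt ℝ ∞ (fun l : ℝ × ℝ => capP n l.1 l.2) (a, r) := by
  obtain ⟨Φ, P, hΦ, hP, hev⟩ := h.exists_smooth' hn hr.le
  have : ∀ᶠ l : ℝ × ℝ in 𝓝 (a, r), 0 < l.2 := continuousAt_snd.eventually (lt_mem_nhds hr)
  constructor
  · refine hΦ.congr_of_eventuallyEq ?_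
    filter_upwards [hev, this] with l h1 h2
    exact (h1 h2.le).2.1.symm
  · refine hP.congr_of_eventuallyEq ?_
    filter_upwards [hev, this] with l h1 h2
    exact (h1 h2.le).2.2.symm

lemma HasArc.exists_gt (hn : 2 ≤ n) {a r : ℝ} (hr : 0 ≤ r) (h : HasArc n a r) :
    ∃ s > r, HasArc n a s := by
  rcases hr.eq_or_lt with h0 | h0
  · obtain ⟨ρ, hρ, f, π, h⟩ := exists_short_arc hn a one_pos
    exact ⟨ρ, h0 ▸ hρ.1, h.hasArc hn hρ.1.le⟩
  · obtain ⟨s, hs, f, π, h'⟩ := h.exists_extension hn h0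
    exact ⟨s, hs, h'.hasArc hn (hr.trans hs.le)⟩

lemma HasArc.mono {a r s : ℝ} (h : HasArc n a r) (hs : s ≤ r) : HasArc n a s := IsCapArc.mono h hs

/-- The derivative of the cap heights with respect to `a`. -/
def capFa (n : ℕ) (a r : ℝ) : ℝ := deriv (fun b => capF n b r) a

/-- The derivative of `capP` with respect to `a`. -/
def capPa (n : ℕ) (a r : ℝ) : ℝ := deriv (fun b => capP n b r) a

lemma capFa_zero (hn : 2 ≤ n) (a : ℝ) : capFa n a 0 = 1 := by simp [capFa, capF_zero hn]

lemma capPa_zero (hn : 2 ≤ n) (a : ℝ) : capPa n a 0 = -1 / (4 * n) := by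
  simp only [capPa, capP_zero hn]
  rw [deriv_div_const, deriv_neg'']

lemma HasArc.hasDerivAt_param (hn : 2 ≤ n) {a r : ℝ} (hr : 0 ≤ r) (h : HasArc n a r) :
    HasDerivAt (fun b => capF n b r) (capFa n a r) a ∧
      HasDerivAt (fun b => capP n b r) (capPa n a r) a := by
  obtain ⟨Φ, P, hΦ, hP, hev⟩ := h.exists_smooth' hn hr
  have hc1 : Tendsto (fun b : ℝ => (b, r)) (𝓝 a) (𝓝 (a, r)) :=
    (by fun_prop : Continuous fun b : ℝ => (b, r)).tendsto a
  have hev' := hc1.eventually hev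
  constructor
  · have h1 := hasDerivAt_fst_of_contDiffAt (hΦ.differentiableAt (by simp))
    have h2 := h1.congr_of_eventuallyEq (hev'.mono fun b hb => (hb hr).2.1.symm)
    rw [capFa, h2.deriv]
    exact h2
  · have h1 := hasDerivAt_fst_of_contDiffAt (hP.differentiableAt (by simp))
    have h2 := h1.congr_of_eventuallyEq (hev'.mono fun b hb => (hb hr).2.2.symm)
    rw [capPa, h2.deriv]; exact h2

lemma continuousOn_deriv_param {g : ℝ × ℝ → ℝ} {a ρ : ℝ}
    (h : ∀ r ∈ Icc 0 ρ, ∃ Φ : ℝ × ℝ → ℝ, ContDiffAt ℝ ∞ Φ (a, r) ∧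
      ∀ᶠ l : ℝ × ℝ in 𝓝 (a, r), 0 ≤ l.2 → Φ l = g l) :
    ContinuousOn (fun r => deriv (fun b => g (b, r)) a) (Icc 0 ρ) := by
  intro r hr
  obtain ⟨Φ, hΦ, hev⟩ := h r hr
  have hc2 : ContinuousAt (fun s : ℝ => (a, s)) r := by fun_prop
  have hdiff : ∀ᶠ z in 𝓝 (a, r), DifferentiableAt ℝ Φ z := by
    have := (hΦ.of_le (m := 1) (by exact_mod_cast le_top)).eventually (by simp)
    exact this.mono fun z hz => hz.differentiableAt (by simp)
  have hD : ContinuousAt (fderiv ℝ Φ) (a, r) :=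
    (hΦ.fderiv_right (m := 1) (by norm_num; exact two_le_infty)).continuousAt
  have h1 : ContinuousAt (fun s => fderiv ℝ Φ (a, s) (1, 0)) r :=
    (ContinuousAt.comp (x := r) (g := fderiv ℝ Φ) (f := fun s : ℝ => (a, s)) hD hc2).clm_apply
      continuousAt_const
  have h2 : ∀ᶠ s in 𝓝 r, 0 ≤ s → deriv (fun b => g (b, s)) a = fderiv ℝ Φ (a, s) (1, 0) := by
    filter_upwards [hc2.eventually hdiff, hc2.eventually hev.eventually_nhds] with s hs hs' h0
    have hc1 : Tendsto (fun b : ℝ => (b, s)) (𝓝 a) (𝓝 (a, s)) :=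
      (by fun_prop : Continuous fun b : ℝ => (b, s)).tendsto a
    exact ((hasDerivAt_fst_of_contDiffAt hs).congr_of_eventuallyEq ((hc1.eventually hs').mono fun b
      hb => (hb h0).symm)).deriv
  refine h1.continuousWithinAt.congr_of_eventuallyEq ?_ (h2.self_of_nhds hr.1)
  filter_upwards [mem_nhdsWithin_of_mem_nhds h2, self_mem_nhdsWithin] with s hs hs'
  exact hs hs'.1

/-- The linearized equation. -/
lemma HasArc.linearized (hn : 2 ≤ n) {a ρ : ℝ} (h : HasArc n a ρ) :
    ContinuousOn (capFa n a) (Icc 0 ρ) ∧ ContinuousOn (capPa n a) (Icc 0 ρ) ∧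
    ∀ r ∈ Ioo 0 ρ, HasDerivAt (capFa n a) (2 * r * capPa n a r) r ∧
      HasDerivAt (capPa n a) (2 / r * (-capFa n a r / 8 + r ^ 2 * (capPa n a r / 4
        - 2 * capP n a r * capPa n a r * arcE n (capF n a) (capP n a) r
        - capP n a r ^ 2 * ((2 * n₋₁ - r ^ 2) * capPa n a r + capFa n a r / 2))
        - n / 2 * capPa n a r)) r := by
  refine ⟨?_, ?_, fun r hr => ?_⟩
  · refine continuousOn_deriv_param (g := fun l => capF n l.1 l.2) fun r hr => ?_
    obtain ⟨Φ, P, hΦ, -, hev⟩ := (h.mono hr.2).exists_smooth' hn hr.1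
    exact ⟨Φ, hΦ, hev.mono fun l hl h0 => (hl h0).2.1⟩
  · refine continuousOn_deriv_param (g := fun l => capP n l.1 l.2) fun r hr => ?_
    obtain ⟨Φ, P, -, hP, hev⟩ := (h.mono hr.2).exists_smooth' hn hr.1
    exact ⟨P, hP, hev.mono fun l hl h0 => (hl h0).2.2⟩
  · obtain ⟨s, hs, hs'⟩ := exists_between hr.2
    have hs0 : 0 < s := hr.1.trans hs
    have hev : ∀ᶠ z : ℝ × ℝ in 𝓝 (a, r), HasArc n z.1 s ∧ z.2 ∈ Ioo 0 s := by
      have h1 := (h.mono hs'.le).eventually hn hs0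
      have h2 : Tendsto (fun z : ℝ × ℝ => (z.1, s)) (𝓝 (a, r)) (𝓝 (a, s)) :=
        (by fun_prop : Continuous fun z : ℝ × ℝ => (z.1, s)).tendsto _
      exact (h2.eventually h1).and (continuousAt_snd.eventually (Ioo_mem_nhds hr.1 hs))
    obtain ⟨hF, hP⟩ := (h.mono hr.2.le).contDiffAt hn hr.1
    obtain ⟨dF, dP⟩ := (h.mono hr.2.le).hasDerivAt_param hn hr.1.le
    constructor
    · refine (hasDerivAt_deriv_param (Φ := fun l => capF n l.1 l.2)
        (Ψ := fun l => 2 * l.2 * capP n l.1 l.2) (hF.of_le two_le_infty) ?_).congr_deriv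
        (dP.const_mul (2 * r)).deriv
      filter_upwards [hev] with z hz
      exact hz.1.deriv_f _ hz.2
    · refine (hasDerivAt_deriv_param (Φ := fun l => capP n l.1 l.2)
        (Ψ := fun l => 2 / l.2 * (capG n (l.2 ^ 2) (capF n l.1 l.2) (capP n l.1 l.2) -
          n / 2 * capP n l.1 l.2)) (hP.of_le two_le_infty) ?_).congr_deriv ?_
      · filter_upwards [hev] with z hz
        exact hz.1.deriv_p _ hz.2
      · refine HasDerivAt.deriv ?_
        simp only [capG]
        refine (((((dF.neg.div_const 8).add (((dP.div_const 4).sub ((dP.pow 2).mul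
          ((dP.const_mul (2 * n₋₁ - r ^ 2)).add (dF.div_const 2)))).const_mul
            (r ^ 2))).sub (dP.const_mul ((n : ℝ) / 2))).const_mul (2 / r)).congr_deriv ?_)
        simp only [arcE, Pi.pow_apply, Pi.add_apply]
        push_cast; ring

section

/-! ### Monotonicity of the caps in the height of the tip -/

/-- The size of the tip region, in units of `1/a`. -/
def tipM (n : ℕ) : ℝ := 10 * arcM n

/-- A bound for the linearized slope in the tip region. -/
def tipΛ (n : ℕ) : ℝ := 2 * exp (2 * tipM n * tipM n)

/-- The exponent in the lower bound for the linearized height. -/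
def tipμ (n : ℕ) : ℝ := 4 + 5 * n₋₁ * tipΛ n

/-- The tip height `a` is large enough for the estimates on the part of the cap above `Y`. -/
structure IsHigh (n : ℕ) (Y a : ℝ) : Prop where
  two_le : 2 ≤ n
  Y_ge : tipM n + tipμ n + 11 ≤ Y
  a_ge : 100 * tipM n ≤ a
  lt : Y < a
  log_ge : 1 ≤ log a
  log_le : arcC n * log a ≤ a ^ 2 / 4
  sq_ge : tipΛ n * tipM n ^ 2 ≤ a ^ 2

variable {a Y ρ : ℝ}

namespace IsHigh

lemma arcM_ge (h : IsHigh n Y a) : 800 ≤ arcM n := by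
  have := IsCapArc.one_le_sub h.two_le
  rw [arcM]; linarith

lemma tipμ_ge (h : IsHigh n Y a) : 4 ≤ tipμ n := by
  have := IsCapArc.one_le_sub h.two_le
  have : 0 ≤ 5 * n₋₁ * tipΛ n := mul_nonneg (by linarith) (by rw [tipΛ]; positivity)
  rw [tipμ]; linarith

lemma arcM_le (h : IsHigh n Y a) : arcM n ≤ Y := by
  have h1 := h.arcM_ge
  have h2 := h.tipμ_ge
  have h3 := h.Y_ge
  rw [tipM] at h3
  linarith

lemma arcM_le' (h : IsHigh n Y a) : 100 * arcM n ≤ a := by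
  have h1 := h.arcM_ge
  have h3 := h.a_ge
  rw [tipM] at h3
  linarith

lemma pos (h : IsHigh n Y a) : 0 < a := by
  have h1 := h.arcM_ge
  have := h.arcM_le'
  linarith

end IsHigh

lemma capFa_tip (hh : IsHigh n Y a) (h : HasArc n a ρ) (hf : ∀ r ∈ Ico 0 ρ, Y ≤ capF n a r)
    {r : ℝ} (hr : r ∈ Ico 0 ρ) (hrM : r ≤ tipM n / a) :
    2 * |capPa n a r| ≤ tipΛ n ∧ 1 / 2 ≤ capFa n a r := by
  obtain ⟨hcF, hcP, hd⟩ := h.linearized hh.two_le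
  have hn := hh.two_le
  have hN := IsCapArc.one_le_sub hn
  have ha0 := hh.pos
  have hM8 := hh.arcM_ge
  have haM := hh.a_ge
  set M := tipM n with hM
  have hM0 : 8000 ≤ M := by rw [hM, tipM]; linarith
  set β := min ρ (2 * M / a)
  set κ := 2 * M with hκ
  have hfpos : ∀ r ∈ Ico 0 ρ, 0 < capF n a r := fun s hs => by linarith [hf s hs, hh.arcM_le]
  -- a bound for the linearized slope bounds the linearized height
  have hFb : ∀ t ∈ Ico 0 ρ, ∀ b, (∀ s ∈ Ioo 0 t, |capPa n a s| ≤ b) →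
      |capFa n a t - 1| ≤ b * t ^ 2 := fun t ht b hb => by
    have hsub : Icc 0 t ⊆ Icc 0 ρ := Icc_subset_Icc_right ht.2.le
    have hcF' := hcF.mono hsub
    have k1 := le_of_hasDerivAt_nonneg (φ := fun s => capFa n a s + b * s ^ 2)
      (φ' := fun s => 2 * s * capPa n a s + b * (2 * s)) ht.1 (by fun_prop)
      (fun s hs => ((hd s ⟨hs.1, hs.2.trans ht.2⟩).1.add
        ((hasDerivAt_pow 2 s).const_mul b)).congr_deriv (by norm_num))
      (fun s hs => by
        have h1 := (abs_le.1 (hb s hs)).1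
        have h2 := hs.1
        nlinarith)
    have k2 := le_of_hasDerivAt_nonneg (φ := fun s => b * s ^ 2 - capFa n a s)
      (φ' := fun s => b * (2 * s) - 2 * s * capPa n a s) ht.1 (by fun_prop)
      (fun s hs => (((hasDerivAt_pow 2 s).const_mul b).sub
        (hd s ⟨hs.1, hs.2.trans ht.2⟩).1).congr_deriv (by norm_num))
      (fun s hs => by
        have h1 := (abs_le.1 (hb s hs)).2
        have h2 := hs.1
        nlinarith)
    simp only [capFa_zero hn] at k1 k2
    rw [abs_le]
    constructor <;> linarith
  have key : ∀ s ∈ Ico 0 β, 0 < exp (κ * a * s) ^ 2 - capPa n a s ^ 2 := by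
    refine pos_of_first_zero ?_ ?_ ?_
    · have := hcP.mono (Ico_subset_Icc_self.trans (Icc_subset_Icc_right (min_le_left ρ (2 * M / a))))
      fun_prop
    · rw [capPa_zero hn]
      have : -1 / (4 * (n : ℝ)) = -(1 / (4 * n)) := by ring
      rw [this]
      have h1 : 1 / (4 * (n : ℝ)) ≤ 1 / 8 := one_div_le_one_div_of_le (by norm_num) (by linarith)
      have h2 : 0 ≤ 1 / (4 * (n : ℝ)) := by
        have : 0 ≤ (n : ℝ) := by linarith
        positivity
      simp only [mul_zero, Real.exp_zero]
      nlinarith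
    · intro s hs h0 hpos
      have hs0 := hs.1
      have hsρ : s < ρ := hs.2.trans_le (min_le_left _ _)
      have hsM : s * a < 2 * M := by
        have := hs.2.trans_le (min_le_right ρ (2 * M / a)); rwa [lt_div_iff₀ ha0] at this
      have hs1 : s ≤ 1 / 2 := by nlinarith
      have hs2 : s ^ 2 ≤ 1 / 4 := by nlinarith
      set b := exp (κ * a * s) with hb
      have hb1 : 1 ≤ b := Real.one_le_exp (by positivity)
      have hP2 : capPa n a s ^ 2 = b ^ 2 := by linarith
      have hPb : |capPa n a s| ≤ b := by rw [← Real.sqrt_sq_eq_abs, hP2, sqrt_sq (by linarith)]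
      have hF := hFb s ⟨hs0.le, hsρ⟩ b (fun t ht => by
        have h1 := hpos t ⟨ht.1.le, ht.2⟩
        have h2 : exp (κ * a * t) ≤ b := Real.exp_le_exp.2 (by gcongr; exact ht.2.le)
        have h3 : |capPa n a t| ≤ exp (κ * a * t) := by
          rw [← Real.sqrt_sq_eq_abs]; exact Real.sqrt_le_iff.2 ⟨(exp_pos _).le, by linarith⟩
        exact h3.trans h2)
      have hF2 : |capFa n a s| ≤ 2 * b := by
        have h1 : b * s ^ 2 ≤ b * (1 / 4) := by gcongr
        have h2 := abs_le.1 hF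
        rw [abs_le]
        constructor <;> linarith
      have hb2 : HasDerivAt (fun s => exp (κ * a * s) ^ 2) (2 * (κ * a) * b ^ 2) s := by
        refine (((((hasDerivAt_id s).const_mul (κ * a)).exp).pow 2)).congr_deriv ?_
        simp only [id, hb]
        push_cast; ring
      refine ⟨_, ?_, hb2.sub ((hd s ⟨hs0, hsρ⟩).2.pow 2)⟩
      have hEle := IsCapArc.E_le h hn ha0 ⟨hs0, hsρ.le⟩ (hfpos s ⟨hs0.le, hsρ⟩).le
      have hglt := IsCapArc.g_lt h hn ha0 ⟨hs0, hsρ⟩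
      have hgpos := IsCapArc.g_pos h hn ha0 ⟨hs0, hsρ.le⟩
      have hfle := IsCapArc.f_le h hn ha0 ⟨hs0.le, hsρ.le⟩
      have hgdef : arcSlope (capP n a) s = -(2 * s * capP n a s) := rfl
      set g := arcSlope (capP n a) s
      set E := arcE n (capF n a) (capP n a) s
      set f := capF n a s
      have hg2M : g ≤ 2 * M := by
        have h1 : g ≤ (2 * n₋₁ - s ^ 2) * g := by nlinarith
        have h2 : s * f ≤ s * a := by gcongr
        linarith
      have hE2 : E ≤ a / 2 := by
        have h1 : s * g ≤ s * (2 * M) := by gcongr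
        have h2 : s * (2 * M) ≤ a / 2 := by nlinarith
        linarith
      have hgE : 2 * (g * E) ≤ κ * a := by
        have : g * E ≤ 2 * M * (a / 2) := mul_le_mul hg2M hE2 (IsCapArc.E_pos h hn ha0 s
            ⟨hs0.le, hsρ⟩).le (by linarith)
        rw [hκ]; linarith
      have hexpand : s * (2 * (κ * a) * b ^ 2 - ((2 : ℕ) : ℝ) * capPa n a s ^ (2 - 1) *
          (2 / s * (-capFa n a s / 8 + s ^ 2 * (capPa n a s / 4 - 2 * capP n a s * capPa n a s * E -
            capP n a s ^ 2 * ((2 * n₋₁ - s ^ 2) * capPa n a s + capFa n a s / 2)) -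
              n / 2 * capPa n a s))) =
          2 * (κ * a) * s * b ^ 2 + (1 / 2) * (1 + g ^ 2) * (capPa n a s * capFa n a s) +
          capPa n a s ^ 2 * ((1 + g ^ 2) * (2 * n₋₁ - s ^ 2) + 2 - 4 * s * (g * E)) := by
        rw [hgdef]
        push_cast; field_simp; ring
      have hprod : -(2 * b ^ 2) ≤ capPa n a s * capFa n a s := by
        have h1 : |capPa n a s * capFa n a s| ≤ b * (2 * b) := by
          rw [abs_mul]; exact mul_le_mul hPb hF2 (abs_nonneg _) (by linarith)
        have := (abs_le.1 h1).1
        linarith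
      have hfin : 0 < 2 * (κ * a) * s * b ^ 2 + (1 / 2) * (1 + g ^ 2) * (capPa n a s * capFa n a s) +
          capPa n a s ^ 2 * ((1 + g ^ 2) * (2 * n₋₁ - s ^ 2) + 2 - 4 * s * (g * E)) := by
        rw [hP2]
        have h1 : (1 / 2) * (1 + g ^ 2) * -(2 * b ^ 2) ≤
            (1 / 2) * (1 + g ^ 2) * (capPa n a s * capFa n a s) := by gcongr
        have h2 : (1 + g ^ 2) * 1 ≤ (1 + g ^ 2) * (2 * n₋₁ - s ^ 2) := by gcongr; linarith
        have h3 : 2 * s * (2 * (g * E)) ≤ 2 * s * (κ * a) := by gcongr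
        have h4 : b ^ 2 * (1 + g ^ 2 + 2 - 2 * s * (κ * a)) ≤ b ^ 2 *
            ((1 + g ^ 2) * (2 * n₋₁ - s ^ 2) + 2 - 4 * s * (g * E)) := by
          gcongr ?_ * ?_
          linarith
        have h5 : 0 < b ^ 2 := by positivity
        linarith
      rw [← hexpand] at hfin
      exact pos_of_mul_pos_right hfin hs0.le
  have hrβ : ∀ s ∈ Icc 0 r, |capPa n a s| ≤ tipΛ n / 2 := fun s hs => by
    have hMa : 0 < M / a := by positivity
    have h1 := key s ⟨hs.1, lt_min (hs.2.trans_lt hr.2) (by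
      have : 2 * M / a = M / a + M / a := by ring
      linarith [hs.2])⟩
    have h3 : |capPa n a s| ≤ exp (κ * a * s) := by
      rw [← Real.sqrt_sq_eq_abs]; exact Real.sqrt_le_iff.2 ⟨(exp_pos _).le, by linarith⟩
    have h4 : a * s ≤ M := by
      have := hs.2.trans hrM
      rw [le_div_iff₀ ha0] at this
      linarith
    refine h3.trans ?_
    rw [tipΛ, mul_div_cancel_left₀ _ two_ne_zero, Real.exp_le_exp, ← hM, mul_assoc]
    exact mul_le_mul_of_nonneg_left h4 (by linarith)
  refine ⟨by linarith [hrβ r ⟨hr.1, le_rfl⟩], ?_⟩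
  have h2 : r ^ 2 ≤ (M / a) ^ 2 := pow_le_pow_left₀ hr.1 hrM 2
  have h3 : tipΛ n * r ^ 2 ≤ 1 := by
    have hΛ : 0 ≤ tipΛ n := by rw [tipΛ]; positivity
    calc tipΛ n * r ^ 2 ≤ tipΛ n * (M / a) ^ 2 := by gcongr
      _ = tipΛ n * M ^ 2 / a ^ 2 := by ring
      _ ≤ 1 := by rw [div_le_one (by positivity)]; exact hh.sq_ge
  linarith [(abs_le.1 (hFb r hr (tipΛ n / 2) fun s hs => hrβ s ⟨hs.1.le, hs.2.le⟩)).1]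

/-- The algebra of the barrier for the linearized equation. -/
lemma barrier_deriv_pos {μ r f g E F G D : ℝ} (hμ : 4 ≤ μ) (hr : 0 < r) (hF : 0 < F)
    (hD : 0 < D) (hf : 11 + μ ≤ f) (hE : 0 < E) (hfE : 18 * E ≤ f)
    (hg : D * g = r * f - 2 * r * E) (hG : D * G = μ * r * F) :
    0 < μ * (F - r * G) + 2 * r * G - D * (2 * g * E * G + (1 + g ^ 2) * (F / 2 - D * G / (2 * r))) := by
  have hf0 : 0 < f := by linarith
  have e1 : D * G / (2 * r) = μ * F / 2 := by rw [hG]; field_simp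
  have hgpos : 0 < g := by
    have : 0 < D * g := by rw [hg]; nlinarith
    exact pos_of_mul_pos_right this hD.le
  have hG' : G = μ * F * (r / D) := by field_simp; linarith
  have hgk : 8 / 9 * f * (r / D) ≤ g := by rw [mul_div_assoc', div_le_iff₀ hD]; nlinarith
  have hg2 : 8 * μ * (r / D) ^ 2 ≤ g ^ 2 := by
    have h1 : (8 / 9 * f * (r / D)) ^ 2 ≤ g ^ 2 := pow_le_pow_left₀ (by positivity) hgk 2
    have h2 : 8 * μ ≤ (8 / 9 * f) ^ 2 := by nlinarith
    calc 8 * μ * (r / D) ^ 2 ≤ (8 / 9 * f) ^ 2 * (r / D) ^ 2 := by gcongr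
      _ = (8 / 9 * f * (r / D)) ^ 2 := by ring
      _ ≤ _ := h1
  have hDG : D * (2 * g * E * G) = 2 * g * E * (μ * r * F) := by rw [← hG]; ring
  rw [mul_add, hDG, e1, hG']
  have hmain : 0 < μ - μ * μ * (r * (r / D)) - 2 * g * E * μ * r + D * (1 + g ^ 2) * ((μ - 1) / 2) := by
    have h3 : 16 * (r * E) ≤ D * g := by rw [hg]; nlinarith
    have h4 : 2 * g * E * μ * r ≤ μ * (D * g ^ 2 / 8) := by
      have : (μ * g / 8) * (16 * (r * E)) ≤ (μ * g / 8) * (D * g) := by gcongr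
      linarith
    have h5 : μ * μ * (r * (r / D)) ≤ μ * (D * g ^ 2 / 8) := by
      have : (μ * D / 8) * (8 * μ * (r / D) ^ 2) ≤ (μ * D / 8) * g ^ 2 := by gcongr
      have e : (μ * D / 8) * (8 * μ * (r / D) ^ 2) = μ * μ * (r * (r / D)) := by field_simp
      linarith
    have h6 : D * g ^ 2 * (μ / 4) ≤ D * (1 + g ^ 2) * ((μ - 1) / 2) := by
      have h7 : D * g ^ 2 ≤ D * (1 + g ^ 2) := by nlinarith
      exact mul_le_mul h7 (by linarith) (by linarith) (by positivity)
    linarith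
  have h8 : 0 ≤ 2 * r * (μ * F * (r / D)) := by positivity
  have h9 := mul_pos hF hmain
  nlinarith

lemma capFa_pos (hh : IsHigh n Y a) (h : HasArc n a ρ) (hf : ∀ r ∈ Ico 0 ρ, Y ≤ capF n a r)
    {r : ℝ} (hr : r ∈ Ico 0 ρ) : 0 < capFa n a r := by
  obtain ⟨hcF, hcP, hd⟩ := h.linearized hh.two_le
  have hn := hh.two_le
  have hN := IsCapArc.one_le_sub hn
  have ha0 := hh.pos
  have hM8 := hh.arcM_ge
  have hμ4 := hh.tipμ_ge
  have hYge := hh.Y_ge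
  have hM10 : tipM n = 10 * arcM n := rfl
  have hΛ0 : 0 < tipΛ n := by rw [tipΛ]; positivity
  rcases le_or_gt r (tipM n / a) with hrM | hrM
  · linarith [(capFa_tip hh h hf hr hrM).2]
  set q := tipM n / a with hq
  have hq0 : 0 < q := by have : 0 < tipM n := by linarith
                         positivity
  have hqρ : q < ρ := hrM.trans hr.2
  set μ := tipμ n
  have hD : ∀ s ∈ Ico 0 ρ, 0 < 2 * n₋₁ - s ^ 2 := fun s hs => by
    have h1 := IsCapArc.sub_sq_ge h hn hh.arcM_le' hh.arcM_le hf hh.log_ge hh.log_le hs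
    have h2 : 0 < capF n a s := by linarith [hf s hs, hh.arcM_le]
    have : 0 < n₋₁ / a ^ 2 * capF n a s ^ 2 := by positivity
    linarith
  set φ : ℝ → ℝ := fun s => μ * (s * capFa n a s) - (2 * n₋₁ - s ^ 2) *
    (-(2 * s * capPa n a s)) with hφ
  have hFpos : ∀ t ∈ Ico q ρ, (∀ s ∈ Ico q t, 0 < φ s) → 0 < capFa n a t := fun t ht hs => by
    have hsub : Icc q t ⊆ Icc 0 ρ := Icc_subset_Icc hq0.le ht.2.le
    have hcF' := hcF.mono hsub
    have hpw : ∀ s ∈ Icc q t, 0 < 2 * n₋₁ - s ^ 2 := fun s hs =>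
      hD s ⟨hq0.le.trans hs.1, hs.2.trans_lt ht.2⟩
    have k := le_of_hasDerivAt_nonneg
      (φ := fun s => capFa n a s * (2 * n₋₁ - s ^ 2) ^ (-(μ / 2)))
      (φ' := fun s => 2 * s * capPa n a s * (2 * n₋₁ - s ^ 2) ^ (-(μ / 2)) +
        capFa n a s * (-(2 * s) * (-(μ / 2)) * (2 * n₋₁ - s ^ 2) ^ (-(μ / 2) - 1))) ht.1
      (hcF'.mul (ContinuousOn.rpow_const (by fun_prop) fun s hs => Or.inl (hpw s hs).ne'))
      (fun s hs => by
        have h1 : HasDerivAt (fun s : ℝ => 2 * n₋₁ - s ^ 2) (-(2 * s)) s :=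
          ((hasDerivAt_pow 2 s).const_sub _).congr_deriv (by norm_num)
        exact (hd s ⟨hq0.trans hs.1, hs.2.trans ht.2⟩).1.mul
          (h1.rpow_const (Or.inl (hpw s ⟨hs.1.le, hs.2.le⟩).ne')))
      (fun s hs' => by
        have h1 := hpw s ⟨hs'.1.le, hs'.2.le⟩
        have h2 := hs s ⟨hs'.1.le, hs'.2⟩
        simp only [hφ] at h2
        have h3 : (2 * n₋₁ - s ^ 2) ^ (-(μ / 2)) =
            (2 * n₋₁ - s ^ 2) ^ (-(μ / 2) - 1) * (2 * n₋₁ - s ^ 2) := by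
          rw [← Real.rpow_add_one h1.ne']; ring_nf
        rw [h3]
        have h4 : 0 < (2 * n₋₁ - s ^ 2) ^ (-(μ / 2) - 1) := Real.rpow_pos_of_pos h1 _
        have := mul_pos h4 h2
        nlinarith)
    have h1 := (capFa_tip hh h hf (r := q) ⟨hq0.le, hqρ⟩ le_rfl).2
    have h4 : 0 < capFa n a t * (2 * n₋₁ - t ^ 2) ^ (-(μ / 2)) :=
      lt_of_lt_of_le (mul_pos (by linarith) (Real.rpow_pos_of_pos (hpw q ⟨le_rfl, ht.1⟩)
          (-(μ / 2)))) k
    exact pos_of_mul_pos_left h4 (Real.rpow_pos_of_pos (hpw t ⟨ht.1, le_rfl⟩) (-(μ / 2))).le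
  have key : ∀ s ∈ Ico q ρ, 0 < φ s := by
    refine pos_of_first_zero ?_ ?_ ?_
    · have hsub : Ico q ρ ⊆ Icc 0 ρ := fun s hs => ⟨hq0.le.trans hs.1, hs.2.le⟩
      have h1 := hcF.mono hsub
      have h2 := hcP.mono hsub
      simp only [hφ]
      fun_prop
    · have h1 := capFa_tip hh h hf (r := q) ⟨hq0.le, hqρ⟩ le_rfl
      have h2 := hD q ⟨hq0.le, hqρ⟩
      have h3 := neg_abs_le (capPa n a q)
      have h4 : μ = 4 + 5 * n₋₁ * tipΛ n := rfl
      have h5 : (2 * n₋₁ - q ^ 2) * (-(2 * q * capPa n a q)) ≤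
          q * (2 * n₋₁ * tipΛ n) := by
        have : -(2 * capPa n a q) ≤ tipΛ n := by linarith
        have h6 : (2 * n₋₁ - q ^ 2) * (-(2 * capPa n a q)) ≤
            2 * n₋₁ * tipΛ n := by
          calc _ ≤ (2 * n₋₁ - q ^ 2) * tipΛ n := by gcongr
            _ ≤ _ := by nlinarith [sq_nonneg q]
        have := mul_le_mul_of_nonneg_left h6 hq0.le
        linarith
      have h7 : μ * (q * (1 / 2)) ≤ μ * (q * capFa n a q) := by gcongr; exact h1.2
      have h8 : q * (2 * n₋₁ * tipΛ n) < μ * (q * (1 / 2)) := by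
        have : 0 < q * (2 + n₋₁ * tipΛ n / 2) := by
          have : 0 < (n : ℝ) - 1 := by linarith
          positivity
        rw [h4]
        linarith
      simp only [hφ]
      linarith
    · intro s hs h0 hpos
      have hs0 : 0 < s := hq0.trans hs.1
      have hsρ := hs.2
      have hF := hFpos s ⟨hs.1.le, hs.2⟩ hpos
      have hDs := hD s ⟨hs0.le, hsρ⟩
      have hfs := hf s ⟨hs0.le, hsρ⟩
      have hE := IsCapArc.E_pos h hn ha0 s ⟨hs0.le, hsρ⟩
      have hEeq := IsCapArc.E_eq (n := n) (f := capF n a) (π := capP n a) (r := s)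
      have hA := IsCapArc.area_ge h hn (M := tipM n) (Y := Y) (c := tipM n) (r := s)
        (by rw [hM10, arcM]; linarith) hh.a_ge (by linarith) hf (by linarith) ⟨hs.1.le, hsρ⟩ le_rfl
      have hb := IsCapArc.E_barrier h hn (M := arcM n) (le_of_eq rfl) hh.arcM_le' hh.arcM_le hf s
        ⟨le_trans (by rw [hq, hM10]; gcongr; linarith) hs.1.le, hsρ⟩
      have hb' := IsCapArc.barrier_le h hn ha0 ⟨hs0.le, hsρ.le⟩ (by linarith)
      have hfE : 18 * arcE n (capF n a) (capP n a) s ≤ capF n a s := by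
        have hf0 : 0 < capF n a s := by linarith
        have h1 : (5 * arcM n) ^ 2 ≤ (s * capF n a s) ^ 2 :=
          pow_le_pow_left₀ (by linarith) (by linarith) 2
        have h2 : s ^ 2 * capF n a s * (18 * arcE n (capF n a) (capP n a) s) ≤
            s ^ 2 * capF n a s * capF n a s := by
          have : 0 ≤ arcM n ^ 2 := sq_nonneg _
          nlinarith
        exact le_of_mul_le_mul_left h2 (by positivity)
      refine ⟨_, barrier_deriv_pos (μ := μ) (r := s) (f := capF n a s) (g := arcSlope (capP n a) s)
          (E := arcE n (capF n a) (capP n a) s) (F := capFa n a s) (G := -(2 * s * capPa n a s))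
              (D := 2 * n₋₁ - s ^ 2) hμ4 hs0 hF hDs (by linarith) hE hfE (by linarith)
                  (by simp only [hφ] at h0; linarith), ?_⟩
      have h1 : HasDerivAt (fun s : ℝ => 2 * n₋₁ - s ^ 2) (-(2 * s)) s :=
        ((hasDerivAt_pow 2 s).const_sub _).congr_deriv (by norm_num)
      obtain ⟨dF, dP⟩ := hd s ⟨hs0, hsρ⟩
      refine ((((hasDerivAt_id s).mul dF).const_mul μ).sub
        (h1.mul (((hasDerivAt_id s).const_mul 2).mul dP).neg)).congr_deriv ?_
      simp only [id, arcE, arcSlope, Pi.neg_apply, Pi.mul_apply]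
      field_simp
      ring
  exact hFpos r ⟨hrM.le, hr.2⟩ fun s hs => key s ⟨hs.1, hs.2.trans hr.2⟩

end

section

/-! ### Caps as graphs over the axis -/

/-- A scalar implicit function theorem. -/
lemma exists_smooth_implicit {E : Type*} [NormedAddCommGroup E] [NormedSpace ℝ E]
    [CompleteSpace E] {Φ : E × ℝ → ℝ} {x : E} {r d : ℝ} (hΦ : ContDiffAt ℝ ∞ Φ (x, r))
    (hd : HasDerivAt (fun s => Φ (x, s)) d r) (hd0 : d ≠ 0) :
    ∃ φ : E → ℝ, ContDiffAt ℝ ∞ φ x ∧ φ x = r ∧ ∀ᶠ z in 𝓝 x, Φ (z, φ z) = Φ (x, r) := by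
  obtain ⟨φ, h1, h2, h3⟩ := exists_smooth_fixedPoint
    (T := fun z : E × ℝ => z.2 - d⁻¹ * (Φ z - Φ (x, r))) (l0 := x) (x0 := r) (K := 0)
    (by fun_prop) (by simp) (by
      have := (hasDerivAt_id r).sub ((hd.sub_const (Φ (x, r))).const_mul d⁻¹)
      rw [inv_mul_cancel₀ hd0, sub_self] at this
      have h := this.hasFDerivAt
      rw [ContinuousLinearMap.toSpanSingleton_zero] at h
      exact h) (by simp)
  refine ⟨φ, h1, h2, h3.mono fun z hz => ?_⟩
  have : d⁻¹ * (Φ (z, φ z) - Φ (x, r)) = 0 := by linarith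
  rcases mul_eq_zero.1 this with h | h
  · exact absurd h (inv_ne_zero hd0)
  · linarith

/-- The radius at height `y` of the cap with tip at height `a`. -/
def capU (n : ℕ) (a y : ℝ) : ℝ :=
  open Classical in if h : ∃ r, 0 ≤ r ∧ HasArc n a r ∧ capF n a r = y then h.choose else 0

variable {a b y r Y A : ℝ}

lemma HasArc.radius_unique (hn : 2 ≤ n) (ha : 0 < a) {r s : ℝ} (hr : 0 ≤ r) (hs : 0 ≤ s)
    (h : HasArc n a r) (h' : HasArc n a s) (he : capF n a r = capF n a s) : r = s := by
  rcases le_total r s with hc | hc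
  · exact (h'.f_strictAnti hn ha).injOn ⟨hr, hc⟩ ⟨hs, le_rfl⟩ he
  · exact (h.f_strictAnti hn ha).injOn ⟨hr, le_rfl⟩ ⟨hs, hc⟩ he

lemma capU_eq (hn : 2 ≤ n) (ha : 0 < a) (hr : 0 ≤ r) (h : HasArc n a r) (he : capF n a r = y) :
    capU n a y = r := by
  have hex : ∃ r, 0 ≤ r ∧ HasArc n a r ∧ capF n a r = y := ⟨r, hr, h, he⟩
  rw [capU, dif_pos hex]
  obtain ⟨h1, h2, h3⟩ := hex.choose_spec
  exact h2.radius_unique hn ha h1 hr h (h3.trans he.symm)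

/-- The caps with tips above `A` are controlled above height `Y`. -/
def HighFrom (n : ℕ) (Y A : ℝ) : Prop := ∀ a, A ≤ a → IsHigh n Y a

namespace HighFrom

lemma capU_spec (H : HighFrom n Y A) (ha : A ≤ a) (hy : y ∈ Icc Y a) :
    0 ≤ capU n a y ∧ HasArc n a (capU n a y) ∧ capF n a (capU n a y) = y := by
  have h := H a ha
  have hn := h.two_le
  obtain ⟨ρ, hρ, hA, hρY⟩ := exists_arc hn h.arcM_le' h.arcM_le h.lt h.log_ge h.log_le
  obtain ⟨r, hr, he⟩ := intermediate_value_Icc' hρ.le hA.cont_f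
    (show y ∈ Icc (capF n a ρ) (capF n a 0) by rw [hρY, capF_zero hn]; exact hy)
  have hr' := hA.mono hr.2
  rw [capU_eq hn h.pos hr.1 hr' he]
  exact ⟨hr.1, hr', he⟩

lemma le_capF (H : HighFrom n Y A) (ha : A ≤ a) (hy : y ∈ Icc Y a) {s : ℝ}
    (hs : s ∈ Icc 0 (capU n a y)) : y ≤ capF n a s := by
  obtain ⟨h1, h2, h3⟩ := H.capU_spec ha hy
  have := (h2.f_strictAnti (H a ha).two_le (H a ha).pos).antitoneOn hs ⟨h1, le_rfl⟩ hs.2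
  linarith

/-- Some arc reaches strictly beyond a given height above `Y`. -/
lemma exists_gt (H : HighFrom n Y A) (ha : A ≤ a) (hy : y ∈ Ioc Y a) :
    ∃ ρ, capU n a y < ρ ∧ HasArc n a ρ ∧ ∀ s ∈ Ico 0 ρ, Y ≤ capF n a s := by
  have h := H a ha
  obtain ⟨h1, h2, h3⟩ := H.capU_spec ha ⟨hy.1.le, hy.2⟩
  obtain ⟨k1, k2, k3⟩ := H.capU_spec ha (y := Y) ⟨le_rfl, hy.1.le.trans hy.2⟩
  refine ⟨capU n a Y, ?_, k2, fun s hs => H.le_capF ha ⟨le_rfl, hy.1.le.trans hy.2⟩ ⟨hs.1, hs.2.le⟩⟩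
  by_contra! hc
  have := (h2.f_strictAnti h.two_le h.pos).antitoneOn ⟨k1, hc⟩ ⟨h1, le_rfl⟩ hc
  linarith [hy.1]

lemma capFa_pos (H : HighFrom n Y A) (ha : A ≤ a) (hy : y ∈ Ioc Y a) :
    0 < capFa n a (capU n a y) := by
  obtain ⟨ρ, h1, h2, h3⟩ := H.exists_gt ha hy
  exact ShrinkerFoliation.capFa_pos (H a ha) h2 h3 ⟨(H.capU_spec ha ⟨hy.1.le, hy.2⟩).1, h1⟩

lemma slope_pos (H : HighFrom n Y A) (ha : A ≤ a) (hr : 0 < r) (h : HasArc n a r) :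
    0 < arcSlope (capP n a) r :=
  IsCapArc.g_pos h (H a ha).two_le (H a ha).pos ⟨hr, le_rfl⟩

lemma capU_tip (H : HighFrom n Y A) (ha : A ≤ a) : capU n a a = 0 :=
  capU_eq (H a ha).two_le (H a ha).pos le_rfl (hasArc_zero (H a ha).two_le a)
    (capF_zero (H a ha).two_le a)

lemma capU_pos (H : HighFrom n Y A) (ha : A ≤ a) (hy : y ∈ Ico Y a) : 0 < capU n a y := by
  obtain ⟨h1, h2, h3⟩ := H.capU_spec ha ⟨hy.1, hy.2.le⟩
  refine lt_of_le_of_ne h1 fun h0 => ?_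
  rw [← h0, capF_zero (H a ha).two_le] at h3
  linarith [hy.2]

lemma strictAntiOn (H : HighFrom n Y A) (ha : A ≤ a) : StrictAntiOn (capU n a) (Icc Y a) := by
  intro y hy z hz hyz
  obtain ⟨h1, h2, h3⟩ := H.capU_spec ha hy
  obtain ⟨k1, k2, k3⟩ := H.capU_spec ha hz
  by_contra! hc
  have := (k2.f_strictAnti (H a ha).two_le (H a ha).pos).antitoneOn ⟨h1, hc⟩ ⟨k1, le_rfl⟩ hc
  linarith

lemma capU_sq_lt (H : HighFrom n Y A) (ha : A ≤ a) (hy : y ∈ Ioc Y a) :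
    capU n a y ^ 2 < 2 * n₋₁ := by
  have h := H a ha
  obtain ⟨ρ, h1, h2, h3⟩ := H.exists_gt ha hy
  obtain ⟨k1, k2, k3⟩ := H.capU_spec ha ⟨hy.1.le, hy.2⟩
  have := IsCapArc.sub_sq_ge h2 h.two_le h.arcM_le' h.arcM_le h3 h.log_ge h.log_le ⟨k1, h1⟩
  have hN := IsCapArc.one_le_sub h.two_le
  have hy0 : 0 < y := by linarith [hy.1, h.arcM_le, h.arcM_ge]
  rw [k3] at this
  have ha0 := h.pos
  have : 0 < n₋₁ / a ^ 2 * y ^ 2 := by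
    have : 0 < (n : ℝ) - 1 := by linarith
    positivity
  linarith

/-- The caps lie outside the ellipses with the same tips. -/
lemma capU_sq_ge (H : HighFrom n Y A) (ha : A ≤ a) (hy : y ∈ Ioc Y a) :
    2 * n₋₁ * (1 - y ^ 2 / a ^ 2) ≤ capU n a y ^ 2 := by
  have h := H a ha
  obtain ⟨ρ, h1, h2, h3⟩ := H.exists_gt ha hy
  obtain ⟨k1, k2, k3⟩ := H.capU_spec ha ⟨hy.1.le, hy.2⟩
  have hY := h.arcM_le
  have hY' := h.arcM_ge
  have := IsCapArc.Z_le h2 h.two_le h.pos (fun s hs => by linarith [h3 s hs]) ⟨k1, h1⟩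
  have hy0 : 0 < y := by linarith [hy.1]
  rw [k3, div_le_iff₀ (by positivity)] at this
  have e : 2 * n₋₁ * (1 - y ^ 2 / a ^ 2) = 2 * n₋₁ - 2 * n₋₁ / a ^ 2 * y ^ 2 := by ring
  linarith

/-- The caps lie close to the ellipses with the same tips. -/
lemma capU_sq_le (H : HighFrom n Y A) (ha : A ≤ a) (hy : y ∈ Ioc Y a) :
    capU n a y ^ 2 ≤ 2 * n₋₁ - (2 * n₋₁ / a ^ 2 -
      arcC n * log a / a ^ 4) * y ^ 2 + 14 * n₋₁ / a ^ 2 := by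
  have h := H a ha
  obtain ⟨ρ, h1, h2, h3⟩ := H.exists_gt ha hy
  obtain ⟨k1, k2, k3⟩ := H.capU_spec ha ⟨hy.1.le, hy.2⟩
  have hY := h.arcM_le
  have hY' := h.arcM_ge
  have := IsCapArc.Z_ge h2 h.two_le h.arcM_le' h.arcM_le h3 h.log_ge ⟨k1, h1⟩
  have hy0 : 0 < y := by linarith [hy.1]
  have ha0 := h.pos
  rw [k3, le_div_iff₀ (by positivity)] at this
  have e : (2 * n₋₁ / a ^ 2 - arcC n * log a / a ^ 4 -
      14 * n₋₁ / (a ^ 2 * y ^ 2)) * y ^ 2 = (2 * n₋₁ / a ^ 2 -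
      arcC n * log a / a ^ 4) * y ^ 2 - 14 * n₋₁ / a ^ 2 := by
    field_simp
  linarith

/-- The caps close up near their tips. -/
lemma capU_sq_le_tip (H : HighFrom n Y A) (ha : A ≤ a) (hy : y ∈ Icc Y a) :
    capU n a y ^ 2 * y ≤ 4 * n * (a - y) := by
  have h := H a ha
  have hn := h.two_le
  obtain ⟨k1, k2, k3⟩ := H.capU_spec ha hy
  have hN := IsCapArc.one_le_sub hn
  have hc := k2.cont_f
  have key := le_of_hasDerivAt_nonneg (φ := fun s => -(4 * n * capF n a s) - s ^ 2 * y)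
    (φ' := fun s => 4 * n * arcSlope (capP n a) s - 2 * s * y) k1 (by fun_prop)
    (fun s hs => by
      refine (((IsCapArc.deriv_f' k2 hs).const_mul (4 * (n : ℝ))).neg.sub
        ((hasDerivAt_pow 2 s).mul_const y)).congr_deriv ?_
      norm_num)
    (fun s hs => by
      have h1 := IsCapArc.g_ge k2 hn h.pos ⟨hs.1, hs.2.le⟩
      have h2 := H.le_capF ha hy ⟨hs.1.le, hs.2.le⟩
      have h3 : s * y ≤ s * capF n a s := by have := hs.1; gcongr
      rw [div_le_iff₀ (by positivity)] at h1
      linarith)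
  simp only [k3, capF_zero hn] at key
  norm_num at key
  linarith

/-- Smooth dependence of the radius on the tip and the height. -/
lemma contDiffAt (H : HighFrom n Y A) (ha : A < a) (hy : y ∈ Ico Y a) :
    ContDiffAt ℝ ∞ (fun l : ℝ × ℝ => capU n l.1 l.2) (a, y) := by
  have hn := (H a ha.le).two_le
  obtain ⟨k1, k2, k3⟩ := H.capU_spec ha.le ⟨hy.1, hy.2.le⟩
  have hU := H.capU_pos ha.le hy
  set r := capU n a y
  obtain ⟨s, hs, hs'⟩ := k2.exists_gt hn k1
  obtain ⟨φ, h1, h2, h3⟩ := exists_smooth_implicit (E := ℝ × ℝ)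
    (Φ := fun z => capF n z.1.1 z.2 - z.1.2) (x := (a, y)) (r := r)
    (by
      have h1 : ContDiffAt ℝ ∞ (fun z : (ℝ × ℝ) × ℝ => capF n z.1.1 z.2) ((a, y), r) := by
        have := (k2.contDiffAt hn hU).1
        exact ContDiffAt.comp (g := fun l : ℝ × ℝ => capF n l.1 l.2)
          (f := fun z : (ℝ × ℝ) × ℝ => (z.1.1, z.2)) ((a, y), r) this (by fun_prop)
      fun_prop) ((IsCapArc.deriv_f' hs' ⟨hU, hs⟩).sub_const y)
    (neg_ne_zero.2 (H.slope_pos ha.le hU k2).ne')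
  refine h1.congr_of_eventuallyEq ?_
  have e1 : Tendsto (fun z : ℝ × ℝ => (z.1, φ z)) (𝓝 (a, y)) (𝓝 (a, r)) := by
    have : ContinuousAt (fun z : ℝ × ℝ => (z.1, φ z)) (a, y) :=
      continuousAt_fst.prodMk h1.continuousAt
    have := this.tendsto
    rwa [h2] at this
  have e2 : ∀ᶠ z : ℝ × ℝ in 𝓝 (a, y), A < z.1 := continuousAt_fst.eventually (lt_mem_nhds ha)
  have e3 : ∀ᶠ l : ℝ × ℝ in 𝓝 (a, r), 0 < l.2 := continuousAt_snd.eventually (lt_mem_nhds hU)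
  filter_upwards [e1.eventually (k2.eventually hn hU), e1.eventually e3, e2, h3] with z z1 z2 z3 z4
  simp only [k3, sub_self] at z4
  exact capU_eq hn (H z.1 z3.le).pos z2.le z1 (by linarith)

lemma hasDerivAt_y (H : HighFrom n Y A) (ha : A < a) (hy : y ∈ Ioo Y a) :
    HasDerivAt (capU n a) (-(arcSlope (capP n a) (capU n a y))⁻¹) y := by
  have h := H a ha.le
  obtain ⟨k1, k2, k3⟩ := H.capU_spec ha.le ⟨hy.1.le, hy.2.le⟩
  have hU := H.capU_pos ha.le ⟨hy.1.le, hy.2⟩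
  obtain ⟨s, hs, hs'⟩ := k2.exists_gt h.two_le k1
  have hg := H.slope_pos ha.le hU k2
  have h1 := hasDerivAt_snd_of_contDiffAt
    ((H.contDiffAt ha ⟨hy.1.le, hy.2⟩).differentiableAt (by simp))
  simp only at h1
  have h2 := HasDerivAt.comp (h₂ := capF n a) y (IsCapArc.deriv_f' hs' ⟨hU, hs⟩) h1
  have h3 : capF n a ∘ (fun s => capU n a s) =ᶠ[𝓝 y] id := by
    filter_upwards [Ioo_mem_nhds hy.1 hy.2] with z hz
    exact (H.capU_spec ha.le ⟨hz.1.le, hz.2.le⟩).2.2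
  have h5 := (h2.congr_of_eventuallyEq h3.symm).unique (hasDerivAt_id y)
  refine h1.congr_deriv ?_
  rw [eq_neg_iff_add_eq_zero]
  field_simp
  linarith

lemma hasDerivAt_a (H : HighFrom n Y A) (ha : A < a) (hy : y ∈ Ioo Y a) :
    HasDerivAt (fun b => capU n b y)
      (capFa n a (capU n a y) / arcSlope (capP n a) (capU n a y)) a := by
  have hn := (H a ha.le).two_le
  obtain ⟨k1, k2, k3⟩ := H.capU_spec ha.le ⟨hy.1.le, hy.2.le⟩
  have hU := H.capU_pos ha.le ⟨hy.1.le, hy.2⟩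
  obtain ⟨s, hs, hs'⟩ := k2.exists_gt hn k1
  have hd := IsCapArc.deriv_f' hs' ⟨hU, hs⟩
  have hg := H.slope_pos ha.le hU k2
  have h1 := hasDerivAt_fst_of_contDiffAt
    ((H.contDiffAt ha ⟨hy.1.le, hy.2⟩).differentiableAt (by simp))
  simp only at h1
  have hF := ((k2.contDiffAt hn hU).1.differentiableAt (by simp)).hasFDerivAt
  have e2 := (hasDerivAt_snd_of_contDiffAt hF.differentiableAt).unique hd
  have h3 : (fun b => capF n b (capU n b y)) =ᶠ[𝓝 a] fun _ => y := by
    filter_upwards [Ioi_mem_nhds ha, Ioi_mem_nhds hy.2] with z hz hz'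
    exact (H.capU_spec (le_of_lt hz) ⟨hy.1.le, le_of_lt hz'⟩).2.2
  have h4 := (HasFDerivAt.comp_hasDerivAt (x := a) (hl := hF) (hf := (hasDerivAt_id a).prodMk
    h1)).congr_of_eventuallyEq h3.symm
  have h5 := h4.unique (hasDerivAt_const a y)
  refine h1.congr_deriv ?_
  set D := fderiv ℝ (fun l : ℝ × ℝ => capU n l.1 l.2) (a, y) (1, 0)
  have e3 : ((1 : ℝ), D) = (1 : ℝ) • ((1 : ℝ), (0 : ℝ)) + D • ((0 : ℝ), (1 : ℝ)) := by simp
  rw [e3, map_add, map_smul, map_smul, (hasDerivAt_fst_of_contDiffAt hF.differentiableAt).unique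
    (k2.hasDerivAt_param hn k1).1, e2] at h5
  simp only [smul_eq_mul] at h5
  field_simp
  linarith

lemma strictMono_tip (H : HighFrom n Y A) (hy : Y < y) (hA : A ≤ y) :
    StrictMonoOn (fun b => capU n b y) (Ici y) := by
  have hd : ∀ b ∈ Ioi y, HasDerivAt (fun b => capU n b y)
      (capFa n b (capU n b y) / arcSlope (capP n b) (capU n b y)) b := fun b hb =>
    H.hasDerivAt_a (hA.trans_lt hb) ⟨hy, hb⟩
  have h1 : StrictMonoOn (fun b => capU n b y) (Ioi y) := by
    refine strictMonoOn_of_deriv_pos (convex_Ioi y)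
      (fun b hb => (hd b hb).continuousAt.continuousWithinAt) fun b hb => ?_
    rw [interior_Ioi] at hb
    have hb' : A ≤ b := (hA.trans_lt hb).le
    have hb2 : y < b := hb
    rw [(hd b hb).deriv]
    exact div_pos (H.capFa_pos hb' ⟨hy, hb2.le⟩)
      (H.slope_pos hb' (H.capU_pos hb' ⟨hy.le, hb⟩) (H.capU_spec hb' ⟨hy.le, hb2.le⟩).2.1)
  intro b hb c hc hbc
  rcases (show y ≤ b from hb).eq_or_lt with h | h
  · subst h
    simp only
    rw [H.capU_tip hA]
    exact H.capU_pos (hA.trans hbc.le) ⟨hy.le, hbc⟩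
  · exact h1 h (h.trans hbc) hbc

/-- Every point inside the cylinder lies on a cap. -/
lemma exists_tip (H : HighFrom n Y A) (hy : Y < y) (hA : A ≤ y) (hr : 0 ≤ r)
    (hr2 : r ^ 2 < 2 * n₋₁) : ∃ a, y ≤ a ∧ capU n a y = r := by
  have h := H y hA
  have hN := IsCapArc.one_le_sub h.two_le
  have hy0 : 0 < y := h.pos
  rcases hr.eq_or_lt with h0 | h0
  · exact ⟨y, le_rfl, by rw [H.capU_tip hA, h0]⟩
  have hn0 : (0 : ℝ) < n := by linarith
  -- a cap with smaller radius
  set c := y + r ^ 2 * y / (4 * n) / 2 with hc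
  have hcy : y < c := by rw [hc]; have : 0 < r ^ 2 * y / (4 * n) / 2 := by positivity
                         linarith
  have h1 : capU n c y ≤ r := by
    have k := H.capU_sq_le_tip (a := c) (y := y) (hA.trans hcy.le) ⟨hy.le, hcy.le⟩
    have e : 4 * n * (c - y) = r ^ 2 * y / 2 := by rw [hc]; field_simp; ring
    have k2 : capU n c y ^ 2 ≤ r ^ 2 := by
      have : capU n c y ^ 2 * y ≤ r ^ 2 * y := by
        have : 0 ≤ r ^ 2 * y := by positivity
        linarith
      exact le_of_mul_le_mul_right this hy0
    exact le_of_sq_le_sq k2 hr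
  -- a cap with larger radius
  set δ := 2 * n₋₁ - r ^ 2
  have hδ0 : 0 < δ := by linarith
  set d := c + y * (2 * n₋₁ / δ + 1) with hd
  have hcd : c ≤ d := by
    have : 0 ≤ y * (2 * n₋₁ / δ + 1) := by
      have : 0 ≤ (n : ℝ) - 1 := by linarith
      positivity
    linarith
  have h2 : r ≤ capU n d y := by
    refine le_of_sq_le_sq ?_ ((H.capU_spec (a := d) (y := y) (hA.trans (hcy.le.trans hcd))
      ⟨hy.le, hcy.le.trans hcd⟩).1)
    refine le_trans ?_ (H.capU_sq_ge (a := d) (y := y) (hA.trans (hcy.le.trans hcd))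
      ⟨hy, hcy.le.trans hcd⟩)
    have hX : 1 ≤ 2 * n₋₁ / δ := by rw [le_div_iff₀ hδ0]; nlinarith [sq_nonneg r]
    set X := 2 * n₋₁ / δ with hXdef
    have hdX : y * X ≤ d := by rw [hd]; nlinarith
    have h3 : y ^ 2 / d ^ 2 ≤ 1 / X := by
      rw [div_le_div_iff₀ (by nlinarith) (by linarith)]
      have : (y * X) ^ 2 ≤ d ^ 2 := pow_le_pow_left₀ (by positivity) hdX 2
      nlinarith [sq_nonneg y, mul_nonneg (sq_nonneg y) (by linarith : 0 ≤ X)]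
    have h4 : 2 * n₋₁ * (1 / X) = δ := by rw [hXdef]; field_simp
    have h5 : 2 * n₋₁ * (y ^ 2 / d ^ 2) ≤ 2 * n₋₁ * (1 / X) := by gcongr
    linarith
  have hcont : ContinuousOn (fun b => capU n b y) (Icc c d) := fun b hb =>
    (H.hasDerivAt_a (hA.trans_lt (hcy.trans_le hb.1)) ⟨hy, hcy.trans_le hb.1⟩).continuousAt.continuousWithinAt
  obtain ⟨a, ha, he⟩ := intermediate_value_Icc hcd hcont ⟨h1, h2⟩
  exact ⟨a, hcy.le.trans ha.1, he⟩

lemma continuousOn_y (H : HighFrom n Y A) (ha : A < a) : ContinuousOn (capU n a) (Ioc Y a) := by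
  intro y hy
  have h := H a ha.le
  rcases hy.2.eq_or_lt with h0 | h0
  · subst h0
    rw [ContinuousWithinAt, H.capU_tip ha.le]
    have h1 : Tendsto (fun z => √(4 * n * (y - z) / z)) (𝓝[Ioc Y y] y) (𝓝 0) := by
      have : ContinuousAt (fun z => √(4 * n * (y - z) / z)) y :=
        (ContinuousAt.div (by fun_prop) continuousAt_id h.pos.ne').sqrt
      have := this.tendsto
      simp only [sub_self, mul_zero, zero_div, Real.sqrt_zero] at this
      exact this.mono_left nhdsWithin_le_nhds
    refine tendsto_of_tendsto_of_tendsto_of_le_of_le' tendsto_const_nhds h1 ?_ ?_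
    · filter_upwards [self_mem_nhdsWithin] with z hz
      exact (H.capU_spec ha.le ⟨hz.1.le, hz.2⟩).1
    · filter_upwards [self_mem_nhdsWithin] with z hz
      have hz0 : 0 < z := by linarith [hz.1, h.arcM_le, h.arcM_ge]
      refine Real.le_sqrt_of_sq_le ?_
      rw [le_div_iff₀ hz0]; exact H.capU_sq_le_tip ha.le ⟨hz.1.le, hz.2⟩
  · exact (H.hasDerivAt_y ha ⟨hy.1, h0⟩).continuousAt.continuousWithinAt

end HighFrom

end

section

/-! ### The cap through a given point -/

variable {a b y r Y A : ℝ}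

lemma exists_highFrom (hn : 2 ≤ n) (hY : tipM n + tipμ n + 11 ≤ Y) : ∃ A, HighFrom n Y A := by
  have hN := IsCapArc.one_le_sub hn
  have hM : 0 < arcM n := by rw [arcM]; linarith
  have hM' : 0 < tipM n := by rw [tipM]; linarith
  have hΛ : 0 < tipΛ n := by rw [tipΛ]; positivity
  have hμ : 0 < tipμ n := by
    have : 0 < (n : ℝ) - 1 := by linarith
    rw [tipμ]; positivity
  have hC : 0 < arcC n := by
    rw [arcC]
    have : 0 < 24 + 3 * n₋₁ := by linarith
    positivity
  refine ⟨100 * tipM n + Y + 1 + exp 1 + 4 * arcC n + tipΛ n * tipM n ^ 2, fun a ha => ?_⟩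
  have he := exp_pos 1
  have hT : 0 < tipΛ n * tipM n ^ 2 := by positivity
  refine ⟨hn, hY, by linarith, by linarith, ?_, ?_, ?_⟩
  · rw [Real.le_log_iff_exp_le (by linarith)]
    linarith
  · have h1 : log a ≤ a := (Real.log_le_sub_one_of_pos (by linarith)).trans (by linarith)
    have h2 : arcC n * log a ≤ arcC n * a := by gcongr
    nlinarith
  · nlinarith

/-- The height of the tip of the cap through the points at height `y` and radius `r`. -/
def capTip (n : ℕ) (y r : ℝ) : ℝ :=
  open Classical in if h : ∃ a, y ≤ a ∧ capU n a y = r then h.choose else 0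

namespace HighFrom

lemma capTip_spec (H : HighFrom n Y A) (hy : Y < y) (hA : A ≤ y) (hr : 0 ≤ r)
    (hr2 : r ^ 2 < 2 * n₋₁) : y ≤ capTip n y r ∧ capU n (capTip n y r) y = r := by
  have h := H.exists_tip hy hA hr hr2
  rw [capTip, dif_pos h]
  exact h.choose_spec

lemma capTip_eq (H : HighFrom n Y A) (hy : Y < y) (hA : A ≤ y) (ha : y ≤ a) (h : capU n a y = r) :
    capTip n y r = a := by
  have hex : ∃ a, y ≤ a ∧ capU n a y = r := ⟨a, ha, h⟩
  rw [capTip, dif_pos hex]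
  exact (H.strictMono_tip hy hA).injOn hex.choose_spec.1 ha (hex.choose_spec.2.trans h.symm)

/-- Smooth dependence of the tip and of the slope on the point. -/
lemma exists_smooth_tip (H : HighFrom n Y A) (hy : Y < y) (hA : A < y) (hr : 0 ≤ r)
    (hr2 : r ^ 2 < 2 * n₋₁) :
    ∃ L P : ℝ × ℝ → ℝ, ContDiffAt ℝ ∞ L (y, r ^ 2) ∧ ContDiffAt ℝ ∞ P (y, r ^ 2) ∧
      ∀ᶠ l : ℝ × ℝ in 𝓝 (y, r ^ 2), 0 ≤ l.2 → L l = capTip n l.1 √l.2 ∧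
        P l = capP n (capTip n l.1 √l.2) √l.2 := by
  obtain ⟨h1, h2⟩ := H.capTip_spec hy hA.le hr hr2
  set a := capTip n y r
  have hAa : A < a := hA.trans_le h1
  have hn := (H a hAa.le).two_le
  obtain ⟨k1, k2, k3⟩ := H.capU_spec hAa.le ⟨hy.le, h1⟩
  rw [h2] at k1 k2 k3
  obtain ⟨Φ, P, hΦ, hP, hev⟩ := k2.exists_smooth hn hr
  have hda : HasDerivAt (fun b => Φ (b, r ^ 2)) (capFa n a r) a := by
    refine (k2.hasDerivAt_param hn k1).1.congr_of_eventuallyEq ?_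
    have hc1 : Tendsto (fun b : ℝ => (b, r ^ 2)) (𝓝 a) (𝓝 (a, r ^ 2)) :=
      (by fun_prop : Continuous fun b : ℝ => (b, r ^ 2)).tendsto a
    filter_upwards [hc1.eventually hev] with b hb
    have := (hb (sq_nonneg r)).2.1; rwa [sqrt_sq hr] at this
  have hFa := H.capFa_pos hAa.le ⟨hy, h1⟩
  rw [h2] at hFa
  obtain ⟨φ, p1, p2, p3⟩ := exists_smooth_implicit (E := ℝ × ℝ)
    (Φ := fun z => Φ (z.2, z.1.2) - z.1.1) (x := (y, r ^ 2)) (r := a)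
    (by
      have : ContDiffAt ℝ ∞ (fun z : (ℝ × ℝ) × ℝ => Φ (z.2, z.1.2)) ((y, r ^ 2), a) :=
        ContDiffAt.comp (g := Φ) (f := fun z : (ℝ × ℝ) × ℝ => (z.2, z.1.2)) ((y, r ^ 2), a) hΦ
          (by fun_prop)
      fun_prop) (hda.sub_const y) hFa.ne'
  have hval : Φ (a, r ^ 2) - y = 0 := by
    have := (hev.self_of_nhds (sq_nonneg r)).2.1
    simp only [sqrt_sq hr] at this
    rw [this, k3, sub_self]
  have hc : ContinuousAt (fun l : ℝ × ℝ => (φ l, l.2)) (y, r ^ 2) :=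
    p1.continuousAt.prodMk continuousAt_snd
  have hct : Tendsto (fun l : ℝ × ℝ => (φ l, l.2)) (𝓝 (y, r ^ 2)) (𝓝 (a, r ^ 2)) := by
    have := hc.tendsto; rwa [p2] at this
  refine ⟨φ, fun l => P (φ l, l.2), p1, ?_, ?_⟩
  · exact ContDiffAt.comp (g := P) (f := fun l : ℝ × ℝ => (φ l, l.2)) (y, r ^ 2)
      (by simp only [p2]; exact hP) (p1.prodMk contDiffAt_snd)
  · have e1 : ∀ᶠ l : ℝ × ℝ in 𝓝 (y, r ^ 2), Y < l.1 ∧ A < l.1 :=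
      (continuousAt_fst.eventually (lt_mem_nhds hy)).and
        (continuousAt_fst.eventually (lt_mem_nhds hA))
    have e2 : ∀ᶠ l : ℝ × ℝ in 𝓝 (y, r ^ 2), A < φ l :=
      p1.continuousAt.eventually (by rw [p2]; exact lt_mem_nhds hAa)
    filter_upwards [e1, e2, p3, hct.eventually hev] with l l1 l2 l3 l4 l0
    obtain ⟨m1, m2, m3⟩ := l4 l0
    simp only [hval] at l3
    have hφ0 := (H _ l2.le).pos
    have hcF : capF n (φ l) √l.2 = l.1 := by linarith
    have hle : l.1 ≤ φ l := by
      rw [← hcF]; exact IsCapArc.f_le m1 hn hφ0 ⟨Real.sqrt_nonneg _, le_rfl⟩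
    have hT : capTip n l.1 √l.2 = φ l := H.capTip_eq l1.1 l1.2.le hle
      (capU_eq hn hφ0 (Real.sqrt_nonneg _) m1 hcF)
    rw [hT]
    exact ⟨rfl, m3⟩

end HighFrom

end

section

open intervalIntegral

/-! ### Profiles as graphs over the axis -/

/-- The right-hand side of the profile equation `u'' = (1 + u'²) Q(y, u, u')`. -/
def profQ (n : ℕ) (y u p : ℝ) : ℝ := y / 2 * p - u / 2 + n₋₁ / u

/-- `u` is, on the set `s`, a positive solution of the profile equation, and `p = u'`. -/
structure IsProfile (n : ℕ) (s : Set ℝ) (u p : ℝ → ℝ) : Prop where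
  pos : ∀ y ∈ s, 0 < u y
  deriv_u : ∀ y ∈ s, HasDerivAt u (p y) y
  deriv_p : ∀ y ∈ s, HasDerivAt p ((1 + p y ^ 2) * profQ n y (u y) (p y)) y

lemma IsProfile.mono {s t : Set ℝ} {u p : ℝ → ℝ} (h : IsProfile n s u p) (hts : t ⊆ s) :
    IsProfile n t u p :=
  ⟨fun y hy => h.pos y (hts hy), fun y hy => h.deriv_u y (hts hy), fun y hy => h.deriv_p y (hts hy)⟩

lemma IsProfile.cont_u {s : Set ℝ} {u p : ℝ → ℝ} (h : IsProfile n s u p) : ContinuousOn u s :=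
  fun y hy => (h.deriv_u y hy).continuousAt.continuousWithinAt

lemma IsProfile.cont_p {s : Set ℝ} {u p : ℝ → ℝ} (h : IsProfile n s u p) : ContinuousOn p s :=
  fun y hy => (h.deriv_p y hy).continuousAt.continuousWithinAt

lemma IsProfile.shrinkerODEAt {s : Set ℝ} (hs : IsOpen s) {u p : ℝ → ℝ} (h : IsProfile n s u p)
    {y : ℝ} (hy : y ∈ s) : ShrinkerODEAt n u y := by
  have h1 : deriv u =ᶠ[𝓝 y] p := by
    filter_upwards [hs.mem_nhds hy] with z hz
    exact (h.deriv_u z hz).deriv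
  rw [ShrinkerODEAt, h1.deriv_eq, (h.deriv_p y hy).deriv, (h.deriv_u y hy).deriv, profQ]
  have : 1 + p y ^ 2 ≠ 0 := by positivity
  rw [mul_div_cancel_left₀ _ this]
  ring

lemma IsProfile.contDiffOn_nat {s : Set ℝ} (hs : IsOpen s) {u p : ℝ → ℝ}
    (h : IsProfile n s u p) (k : ℕ) : ContDiffOn ℝ k u s ∧ ContDiffOn ℝ k p s := by
  induction k with
  | zero => exact ⟨contDiffOn_zero.2 h.cont_u, contDiffOn_zero.2 h.cont_p⟩
  | succ k ih =>
    have key : ∀ {f g : ℝ → ℝ}, (∀ y ∈ s, HasDerivAt f (g y) y) → ContDiffOn ℝ k g s →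
        ContDiffOn ℝ (k + 1 : ℕ) f s := by
      intro f g hf hg
      push_cast
      rw [contDiffOn_succ_iff_deriv_of_isOpen hs]
      exact ⟨fun y hy => (hf y hy).differentiableAt.differentiableWithinAt, by simp,
        hg.congr fun y hy => (hf y hy).deriv⟩
    refine ⟨key h.deriv_u ih.2, key h.deriv_p ?_⟩
    obtain ⟨h1, h2⟩ := ih
    unfold profQ
    exact (contDiffOn_const.add (h2.pow 2)).mul ((((contDiffOn_id.div_const 2).mul h2).sub
      (h1.div_const 2)).add (contDiffOn_const.div h1 fun y hy => (h.pos y hy).ne'))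

lemma IsProfile.contDiffOn {s : Set ℝ} (hs : IsOpen s) {u p : ℝ → ℝ} (h : IsProfile n s u p) :
    ContDiffOn ℝ ∞ u s :=
  contDiffOn_infty.2 fun k => (h.contDiffOn_nat hs k).1

/-! ### Smooth dependence on initial data -/

/-- The function `σ ↦ u(y + t σ)` in terms of `u(y)` and `q = u'(y + t ·)`. -/
def profU (x t : ℝ) (q : CI) : CI := x • (1 : CI) + t • primitive q

/-- The function `σ ↦ Q(y + t σ, u, u')`. -/
def profA (n : ℕ) (y x t : ℝ) (q : CI) : CI :=
  (1 / 2 : ℝ) • ((y • (1 : CI) + t • idCI) * q - profU x t q) + n₋₁ • Ring.inverse (profU x t q)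

/-- The integral operator whose fixed points are the profiles. -/
def profOp (n : ℕ) (y : ℝ) (z : ((ℝ × ℝ) × ℝ) × CI) : CI :=
  z.1.1.2 • (1 : CI) + z.1.2 • primitive ((1 + z.2 ^ 2) * profA n y z.1.1.1 z.1.2 z.2)

lemma contDiffAt_profOp (n : ℕ) (y : ℝ) {z : ((ℝ × ℝ) × ℝ) × CI}
    (hz : IsUnit (profU z.1.1.1 z.1.2 z.2)) : ContDiffAt ℝ ∞ (profOp n y) z := by
  have hU : ContDiff ℝ ∞ fun z : ((ℝ × ℝ) × ℝ) × CI => profU z.1.1.1 z.1.2 z.2 := by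
    unfold profU; fun_prop
  have hI : ContDiffAt ℝ ∞
      (fun z : ((ℝ × ℝ) × ℝ) × CI => Ring.inverse (profU z.1.1.1 z.1.2 z.2)) z := by
    obtain ⟨w, hw⟩ := hz
    have h1 := contDiffAt_ringInverse (n := ∞) ℝ w
    rw [hw] at h1
    exact ContDiffAt.comp (g := Ring.inverse) z h1 hU.contDiffAt
  unfold profOp profA
  fun_prop

/-- The derivative of `profOp` and its difference quotients. -/
def profDiff (n : ℕ) (y x t : ℝ) (p q : CI) : CI →L[ℝ] CI :=
  t • (primitive ∘L ContinuousLinearMap.mul ℝ CI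
      ((p + q) * profA n y x t p + (1 + q ^ 2) * ((1 / 2 : ℝ) • (y • (1 : CI) + t • idCI))) +
    (primitive ∘L ContinuousLinearMap.mul ℝ CI ((1 + q ^ 2) * (t • (-(1 / 2 : ℝ) • (1 : CI) -
      n₋₁ • (Ring.inverse (profU x t p) * Ring.inverse (profU x t q)))))) ∘L primitive)

lemma profOp_sub (n : ℕ) (y x v t : ℝ) {p q : CI} (hp : IsUnit (profU x t p))
    (hq : IsUnit (profU x t q)) :
    profOp n y (((x, v), t), p) - profOp n y (((x, v), t), q) = profDiff n y x t p q (p - q) := by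
  have hinv : Ring.inverse (profU x t p) - Ring.inverse (profU x t q) =
      -(Ring.inverse (profU x t p) * Ring.inverse (profU x t q) * (t • primitive (p - q))) := by
    have e : t • primitive (p - q) = profU x t p - profU x t q := by
      simp only [profU, map_sub, smul_sub]; abel
    rw [e]
    linear_combination (Ring.inverse (profU x t q)) * (Ring.inverse_mul_cancel _ hp) -
      (Ring.inverse (profU x t p)) * (Ring.inverse_mul_cancel _ hq)
  simp only [profOp, profDiff, smul_apply, add_apply, ContinuousLinearMap.comp_apply,
    ContinuousLinearMap.mul_apply', add_sub_add_left_eq_sub, ← smul_sub, ← map_sub, ← map_add]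
  congr 2
  have hA : profA n y x t p - profA n y x t q =
      (1 / 2 : ℝ) • ((y • (1 : CI) + t • idCI) * (p - q) - t • primitive (p - q)) -
      n₋₁ • (Ring.inverse (profU x t p) * Ring.inverse (profU x t q) *
        (t • primitive (p - q))) := by
    have : profA n y x t p - profA n y x t q =
      (1 / 2 : ℝ) • ((y • (1 : CI) + t • idCI) * (p - q) - (profU x t p - profU x t q)) +
        n₋₁ • (Ring.inverse (profU x t p) - Ring.inverse (profU x t q)) := by
      simp only [profA, Algebra.smul_def]; ring
    rw [this, hinv]
    have e : profU x t p - profU x t q = t • primitive (p - q) := by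
      simp only [profU, map_sub, smul_sub]; abel
    rw [e]
    simp only [Algebra.smul_def]; ring
  have hB : (1 + p ^ 2) * profA n y x t p - (1 + q ^ 2) * profA n y x t q =
      (p + q) * profA n y x t p * (p - q) + (1 + q ^ 2) * (profA n y x t p - profA n y x t q) := by
    ring
  rw [hB, hA]
  simp only [Algebra.smul_def, map_neg]
  ring

lemma exists_isVolterra_profDiff (n : ℕ) (y x t : ℝ) (p q : CI) :
    ∃ C, IsVolterra C (profDiff n y x t p q) :=
  ⟨_, ((isVolterra_primitive.comp_mul _).add (isVolterra_primitive.comp_mul _).comp_primitive).smul t⟩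

lemma profOp_fixed_unique {y x v t : ℝ} {p q : CI} (hp : IsUnit (profU x t p))
    (hq : IsUnit (profU x t q)) (h : profOp n y (((x, v), t), p) = p)
    (h' : profOp n y (((x, v), t), q) = q) : p = q := by
  obtain ⟨C, hC⟩ := exists_isVolterra_profDiff n y x t p q
  refine sub_eq_zero.1 (hC.eq_zero_of_fixed ?_)
  rw [← profOp_sub n y x v t hp hq, h, h']

lemma exists_smooth_profOp_fixed {y x v t : ℝ} {p : CI} (hp : IsUnit (profU x t p))
    (h : profOp n y (((x, v), t), p) = p) :
    ∃ P : (ℝ × ℝ) × ℝ → CI, ContDiffAt ℝ ∞ P ((x, v), t) ∧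
      ∀ᶠ l in 𝓝 ((x, v), t), profOp n y (l, P l) = P l ∧ IsUnit (profU l.1.1 l.2 (P l)) := by
  have hUc : Continuous fun z : ((ℝ × ℝ) × ℝ) × CI => profU z.1.1.1 z.1.2 z.2 := by
    unfold profU; fun_prop
  have hopen : ∀ w : CI, IsUnit w → ∀ᶠ w' in 𝓝 w, IsUnit w' := fun w hw => Units.isOpen.mem_nhds hw
  obtain ⟨C, hC⟩ := exists_isVolterra_profDiff n y x t p p
  obtain ⟨P, h1, h2, h3⟩ := exists_smooth_fixedPoint (l0 := ((x, v), t)) (x0 := p)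
    (contDiffAt_profOp n y hp) h (K := profDiff n y x t p p) (by
      have hx : Continuous fun q : CI => profU x t q := by unfold profU; fun_prop
      refine hasFDerivAt_of_sub_eq (K := fun q => profDiff n y x t q p) ?_ ?_
      · filter_upwards [hx.continuousAt.eventually (hopen _ hp)] with q hq
        exact profOp_sub n y x v t hq hp
      · have hI : ContinuousAt (fun q : CI => Ring.inverse (profU x t q)) p := by
          obtain ⟨w, hw⟩ := hp
          have h1 := NormedRing.inverse_continuousAt w
          rw [hw] at h1
          exact ContinuousAt.comp (g := Ring.inverse) h1 hx.continuousAt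
        unfold profDiff profA
        fun_prop) hC.isUnit_one_sub
  refine ⟨P, h1, h3.and ?_⟩
  have hc : ContinuousAt (fun l : (ℝ × ℝ) × ℝ => profU l.1.1 l.2 (P l)) ((x, v), t) :=
    ContinuousAt.comp (f := fun l : (ℝ × ℝ) × ℝ => (l, P l)) hUc.continuousAt
      (continuousAt_id.prodMk h1.continuousAt)
  exact hc.eventually (hopen _ (by simp only [h2]; exact hp))

/-- A profile gives a fixed point. -/
lemma IsProfile.fixed {s : Set ℝ} {u p : ℝ → ℝ} {y t : ℝ} (h : IsProfile n s u p)
    (hs : ∀ σ ∈ Icc (0 : ℝ) 1, y + t * σ ∈ s) :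
    ∃ q : CI, (∀ σ : unitInterval, q σ = p (y + t * σ)) ∧
      (∀ σ : unitInterval, profU (u y) t q σ = u (y + t * σ)) ∧
      IsUnit (profU (u y) t q) ∧ profOp n y (((u y, p y), t), q) = q := by
  have hm : ∀ σ : unitInterval, y + t * (σ : ℝ) ∈ s := fun σ => hs σ σ.2
  have hline : Continuous fun σ : ℝ => y + t * σ := by fun_prop
  let q : CI := ⟨fun σ => p (y + t * σ), by
    have := h.cont_p.comp_continuous (hline.comp continuous_subtype_val) hm; exact this⟩
  have hq : ∀ σ : unitInterval, q σ = p (y + t * σ) := fun _ => rfl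
  have hdl : ∀ σ : ℝ, HasDerivAt (fun σ : ℝ => y + t * σ) t σ := fun σ => by
    simpa using ((hasDerivAt_id σ).const_mul t).const_add y
  -- integrating a function along the segment
  have hitg : ∀ (f g : ℝ → ℝ) (φ : CI), (∀ x ∈ s, HasDerivAt f (g x) x) →
      (∀ σ : unitInterval, φ σ = g (y + t * σ)) → ∀ σ : unitInterval,
      f y + t * primitive φ σ = f (y + t * σ) := fun f g φ hf hφ σ => by
    have hsub : ∀ τ ∈ uIcc (0 : ℝ) σ, τ ∈ Icc (0 : ℝ) 1 := fun τ hτ => by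
      rw [uIcc_of_le σ.2.1] at hτ
      exact ⟨hτ.1, hτ.2.trans σ.2.2⟩
    have := integral_eq_sub_of_hasDerivAt (a := 0) (b := (σ : ℝ))
      (f := fun τ => f (y + t * τ)) (f' := fun τ => t * ext01 φ τ)
      (fun τ hτ => by
        have hτ' := hsub τ hτ
        rw [ext01_of_mem φ hτ', hφ, mul_comm]; exact (hf _ (hs τ hτ')).comp τ (hdl τ))
      ((continuous_const.mul (continuous_ext01 φ)).intervalIntegrable _ _)
    rw [integral_const_mul] at this
    rw [primitive_apply]
    simp only [mul_zero, add_zero] at this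
    linarith
  have hU : ∀ σ : unitInterval, profU (u y) t q σ = u (y + t * σ) := fun σ => by
    rw [← hitg u p q h.deriv_u hq σ]; simp [profU]
  have hunit : IsUnit (profU (u y) t q) := by
    rw [ContinuousMap.isUnit_iff_forall_ne_zero]
    intro σ
    rw [hU σ]; exact (h.pos _ (hm σ)).ne'
  have hinv : ∀ σ : unitInterval, Ring.inverse (profU (u y) t q) σ = (u (y + t * σ))⁻¹ := fun σ => by
    have h1 := congrArg (fun φ : CI => φ σ) (Ring.inverse_mul_cancel _ hunit)
    simp only [ContinuousMap.mul_apply, ContinuousMap.one_apply, hU σ] at h1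
    exact eq_inv_of_mul_eq_one_left h1
  refine ⟨q, hq, hU, hunit, ?_⟩
  ext σ
  have := hitg p (fun x => (1 + p x ^ 2) * profQ n x (u x) (p x))
    ((1 + q ^ 2) * profA n y (u y) t q) h.deriv_p (fun σ => by
      simp only [profA, profQ, ContinuousMap.mul_apply, ContinuousMap.add_apply,
        ContinuousMap.pow_apply, ContinuousMap.one_apply, ContinuousMap.smul_apply, smul_eq_mul,
        ContinuousMap.sub_apply, hU σ, hinv σ, hq σ, idCI, ContinuousMap.coe_mk]
      ring) σ
  rw [hq σ, ← this]
  simp [profOp]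

/-- Profiles in a family with smooth initial data are jointly smooth. -/
lemma contDiffAt_profile_family {s : Set ℝ} (hso : IsOpen s) (hs : s.OrdConnected)
    {U P : ℝ → ℝ → ℝ} {b y0 y : ℝ} (h : ∀ᶠ c in 𝓝 b, IsProfile n s (U c) (P c)) (hy0 : y0 ∈ s)
    (hy : y ∈ s) (hU : ContDiffAt ℝ ∞ (fun c => U c y0) b)
    (hP : ContDiffAt ℝ ∞ (fun c => P c y0) b) :
    ContDiffAt ℝ ∞ (fun z : ℝ × ℝ => U z.1 z.2) (b, y) ∧
      ContDiffAt ℝ ∞ (fun z : ℝ × ℝ => P z.1 z.2) (b, y) := by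
  have hseg : ∀ x ∈ s, ∀ σ ∈ Icc (0 : ℝ) 1, y0 + (x - y0) * σ ∈ s := fun x hx σ hσ => by
    have hc : Convex ℝ s := hs.convex
    have := hc hy0 hx (sub_nonneg.2 hσ.2) hσ.1 (by ring)
    simp only [smul_eq_mul] at this
    convert this using 1
    ring
  obtain ⟨q, -, -, hq2, hq3⟩ := h.self_of_nhds.fixed (t := y - y0) (hseg y hy)
  obtain ⟨Q, hQ, hev⟩ := exists_smooth_profOp_fixed hq2 hq3
  set τ : ℝ × ℝ → (ℝ × ℝ) × ℝ := fun z => ((U z.1 y0, P z.1 y0), z.2 - y0)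
  have hτs : ContDiffAt ℝ ∞ τ (b, y) := by fun_prop
  have hQτ : ContDiffAt ℝ ∞ (fun z => Q (τ z)) (b, y) := ContDiffAt.comp (b, y) hQ hτs
  have hev1 : ContDiff ℝ ∞ fun φ : CI => φ 1 :=
    (ContinuousMap.evalCLM ℝ (1 : unitInterval) : CI →L[ℝ] ℝ).contDiff
  have hUs : ContDiffAt ℝ ∞ (fun z => profU (τ z).1.1 (τ z).2 (Q (τ z))) (b, y) := by
    unfold profU; fun_prop
  have key : ∀ᶠ z : ℝ × ℝ in 𝓝 (b, y), U z.1 z.2 = profU (τ z).1.1 (τ z).2 (Q (τ z)) 1 ∧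
      P z.1 z.2 = Q (τ z) 1 := by
    have h1 : ∀ᶠ z : ℝ × ℝ in 𝓝 (b, y), IsProfile n s (U z.1) (P z.1) ∧ z.2 ∈ s :=
      ((continuousAt_fst (p := (b, y))).eventually h).and
        ((continuousAt_snd (p := (b, y))).eventually (hso.mem_nhds hy))
    filter_upwards [h1, hτs.continuousAt.eventually hev] with z hz hz'
    obtain ⟨q', k1, k2, k3, k4⟩ := hz.1.fixed (t := z.2 - y0) (hseg z.2 hz.2)
    have e : Q (τ z) = q' := profOp_fixed_unique (v := P z.1 y0) hz'.2 k3 hz'.1 k4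
    have e1 := k1 1
    have e2 := k2 1
    simp only [Set.Icc.coe_one, mul_one, add_sub_cancel] at e1 e2
    rw [e]; exact ⟨e2.symm, e1.symm⟩
  constructor
  · exact (ContDiffAt.comp (g := fun φ : CI => φ 1) (b, y) hev1.contDiffAt hUs).congr_of_eventuallyEq
      (key.mono fun z hz => hz.1)
  · exact (ContDiffAt.comp (g := fun φ : CI => φ 1) (b, y) hev1.contDiffAt hQτ).congr_of_eventuallyEq
      (key.mono fun z hz => hz.2)

end

section

open scoped ContDiff RealInnerProductSpace BoundedContinuousFunction

open MeasureTheory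

/-! ### Conical profiles near infinity -/

/-- The Banach algebra of bounded continuous functions on the real line. -/
abbrev CB : Type := ℝ →ᵇ ℝ

lemma integrableOn_tail {k B : ℝ → ℝ} (hB : ContinuousOn B (Ici 0))
    (hd : ∀ s ∈ Ioi (0 : ℝ), HasDerivAt B (-k s) s) (hk0 : ∀ s ∈ Ioi (0 : ℝ), 0 ≤ k s)
    (hB0 : Tendsto B atTop (𝓝 0)) {s : ℝ} (hs : 0 ≤ s) :
    IntegrableOn k (Ioi s) ∧ ∫ x in Ioi s, k x = B s := by
  have h1 : ContinuousWithinAt (fun x => -B x) (Ici s) s :=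
    ((hB s hs).mono (Ici_subset_Ici.2 hs)).neg
  have h2 : ∀ x ∈ Ioi s, HasDerivAt (fun x => -B x) (k x) x := fun x hx => by
    exact (hd x (hs.trans_lt hx)).neg.congr_deriv (neg_neg _)
  have h3 : Tendsto (fun x => -B x) atTop (𝓝 0) := by simpa using hB0.neg
  have h4 := integrableOn_Ioi_deriv_of_nonneg h1 h2 (fun x hx => hk0 x (hs.trans_lt hx)) h3
  refine ⟨h4, ?_⟩
  rw [integral_Ioi_of_hasDerivAt_of_tendsto h1 h2 h4 h3]
  ring

lemma integrableOn_mul_bdd {k : ℝ → ℝ} {s : ℝ} (hk : IntegrableOn k (Ioi s)) (φ : CB) :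
    IntegrableOn (fun x => k x * φ x) (Ioi s) :=
  Integrable.mul_bdd hk φ.continuous.aestronglyMeasurable (c := ‖φ‖)
    (Eventually.of_forall fun x => φ.norm_coe_le_norm x)

/-- The primitive from infinity. -/
lemma hasDerivAt_tail {g : ℝ → ℝ} (hg : Continuous g) (hi : IntegrableOn g (Ioi 0)) {s : ℝ}
    (hs : 0 < s) : HasDerivAt (fun t => ∫ x in Ioi t, g x) (-g s) s := by
  have h1 : (fun t => ∫ x in Ioi t, g x) =ᶠ[𝓝 s] fun t => (∫ x in Ioi 0, g x) - ∫ x in (0 : ℝ)..t, g x := by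
    filter_upwards [lt_mem_nhds hs] with t ht
    rw [← intervalIntegral.integral_Ioi_sub_Ioi hi ht.le]; ring
  refine HasDerivAt.congr_of_eventuallyEq ?_ h1
  exact (hg.integral_hasStrictDerivAt 0 s).hasDerivAt.const_sub _

/-- The operator `φ ↦ ρ(s) ∫_s^∞ k φ`, for `s ≥ 0`. -/
lemma exists_tailOp {k B ρ : ℝ → ℝ} {C : ℝ} (hk : Continuous k) (hρ : Continuous ρ)
    (hB : ContinuousOn B (Ici 0))
    (hd : ∀ s ∈ Ioi (0 : ℝ), HasDerivAt B (-k s) s) (hk0 : ∀ s ∈ Ioi (0 : ℝ), 0 ≤ k s)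
    (hB0 : Tendsto B atTop (𝓝 0)) (hC : 0 ≤ C) (hbd : ∀ s, 0 ≤ s → |ρ s| * B s ≤ C) :
    ∃ S : CB →L[ℝ] CB, (∀ φ s, S φ s = ρ (max s 0) * ∫ x in Ioi (max s 0), k x * φ x) ∧
      ‖S‖ ≤ C ∧ IntegrableOn k (Ioi 0) := by
  have hitg := fun {s : ℝ} (hs : 0 ≤ s) => integrableOn_tail hB hd hk0 hB0 hs
  have hcont : ∀ φ : CB, Continuous fun s => ρ (max s 0) * ∫ x in Ioi (max s 0), k x * φ x := fun φ
    => by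
    have h1 : (fun s => ∫ x in Ioi (max s 0), k x * φ x) =
        fun s => (∫ x in Ioi 0, k x * φ x) - ∫ x in (0 : ℝ)..(max s 0), k x * φ x := by
      ext s
      rw [← intervalIntegral.integral_Ioi_sub_Ioi (integrableOn_mul_bdd (hitg le_rfl).1 φ)
        (le_max_right s 0)]
      ring
    have h2 : Continuous fun t => ∫ x in (0 : ℝ)..t, k x * φ x :=
      intervalIntegral.continuous_primitive
        (fun a b => (hk.mul φ.continuous).intervalIntegrable a b) 0
    have h3 : Continuous fun s : ℝ => max s 0 := by fun_prop
    refine (hρ.comp h3).mul ?_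
    rw [h1]; exact continuous_const.sub (h2.comp h3)
  have hle : ∀ (φ : CB) s, ‖ρ (max s 0) * ∫ x in Ioi (max s 0), k x * φ x‖ ≤ C * ‖φ‖ := fun φ s =>
    by
    have hs := le_max_right s 0
    have h1 : ‖∫ x in Ioi (max s 0), k x * φ x‖ ≤ ∫ x in Ioi (max s 0), k x * ‖φ‖ := by
      refine norm_integral_le_of_norm_le ((hitg hs).1.mul_const _) ?_
      filter_upwards [ae_restrict_mem measurableSet_Ioi] with x hx
      rw [norm_mul, norm_of_nonneg (hk0 x (hs.trans_lt hx))]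
      exact mul_le_mul_of_nonneg_left (φ.norm_coe_le_norm x) (hk0 x (hs.trans_lt hx))
    rw [integral_mul_const, (hitg hs).2] at h1
    rw [norm_mul]
    calc _ ≤ ‖ρ (max s 0)‖ * (B (max s 0) * ‖φ‖) := by gcongr
      _ = |ρ (max s 0)| * B (max s 0) * ‖φ‖ := by rw [norm_eq_abs]; ring
      _ ≤ _ := by gcongr; exact hbd _ hs
  refine ⟨LinearMap.mkContinuous
    { toFun := fun φ => BoundedContinuousFunction.ofNormedAddCommGroup _ (hcont φ) _ (hle φ)
      map_add' := fun φ ψ => by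
        ext s
        have hs := (hitg (le_max_right s 0)).1
        simp only [BoundedContinuousFunction.coe_ofNormedAddCommGroup,
          BoundedContinuousFunction.coe_add, Pi.add_apply, mul_add]
        rw [integral_add (integrableOn_mul_bdd hs φ) (integrableOn_mul_bdd hs ψ), mul_add]
      map_smul' := fun c φ => by
        ext s
        simp only [BoundedContinuousFunction.coe_ofNormedAddCommGroup,
          BoundedContinuousFunction.coe_smul, smul_eq_mul, RingHom.id_apply]
        rw [mul_left_comm c, ← integral_const_mul c]
        exact congrArg _ (integral_congr_ae (Eventually.of_forall fun x => mul_left_comm _ _ _)) } C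
      fun φ => ?_, fun φ s => rfl, LinearMap.mkContinuous_norm_le _ hC _,
    (hitg le_rfl).1⟩
  rw [BoundedContinuousFunction.norm_le (by positivity)]
  exact hle φ

/-- The height in terms of `s = y² - Y²`. -/
def conicY (Y s : ℝ) : ℝ := √(Y ^ 2 + |s|)

lemma le_conicY (Y s : ℝ) : Y ≤ conicY Y s := Real.le_sqrt_of_sq_le (by linarith [abs_nonneg s])

lemma continuous_conicY (Y : ℝ) : Continuous (conicY Y) := by unfold conicY; fun_prop

lemma tendsto_conicY (Y : ℝ) : Tendsto (conicY Y) atTop atTop := by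
  refine Real.tendsto_sqrt_atTop.comp (tendsto_atTop_add_const_left _ _ tendsto_abs_atTop_atTop)

lemma hasDerivAt_conicY {Y s : ℝ} (hY : 0 < Y) (hs : 0 < s) :
    HasDerivAt (conicY Y) (1 / (2 * conicY Y s)) s := by
  have h1 : HasDerivAt (fun s : ℝ => Y ^ 2 + |s|) 1 s := by
    have := (hasDerivAt_abs_pos hs).const_add (Y ^ 2); exact this
  exact h1.sqrt (by positivity)

/-- The function `1/y`. -/
def conicInv (Y : ℝ) (hY : 0 < Y) : CB :=
  BoundedContinuousFunction.ofNormedAddCommGroup (fun s => (conicY Y s)⁻¹)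
    ((continuous_conicY Y).inv₀ fun s => (hY.trans_le (le_conicY Y s)).ne') Y⁻¹ (fun s => by
      have := hY.trans_le (le_conicY Y s)
      rw [norm_of_nonneg (by positivity)]; exact inv_anti₀ hY (le_conicY Y s))

lemma norm_conicInv_le {Y : ℝ} (hY : 0 < Y) : ‖conicInv Y hY‖ ≤ Y⁻¹ :=
  BoundedContinuousFunction.norm_ofNormedAddCommGroup_le _ (by positivity) _

/-- The operator `φ ↦ ∫_y^∞ φ(η) η⁻² dη`. -/
lemma exists_conicOp {Y : ℝ} (hY : 0 < Y) : ∃ S : CB →L[ℝ] CB,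
    (∀ φ s, S φ s = ∫ x in Ioi (max s 0), (2 * conicY Y x ^ 3)⁻¹ * φ x) ∧ ‖S‖ ≤ Y⁻¹ ∧
    IntegrableOn (fun x => (2 * conicY Y x ^ 3)⁻¹) (Ioi 0) := by
  have hpos : ∀ s, 0 < conicY Y s := fun s => hY.trans_le (le_conicY Y s)
  obtain ⟨S, h1, h2, h3⟩ := exists_tailOp (k := fun x => (2 * conicY Y x ^ 3)⁻¹)
    (B := fun s => (conicY Y s)⁻¹) (ρ := fun _ => 1) (C := Y⁻¹)
    (by
      have := continuous_conicY Y
      exact Continuous.inv₀ (by fun_prop) fun s => by have := hpos s; positivity)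
    continuous_const
    ((continuous_conicY Y).inv₀ fun s => (hpos s).ne').continuousOn
    (fun s hs => by
      refine ((hasDerivAt_conicY hY hs).inv (hpos s).ne').congr_deriv ?_
      have := hpos s; field_simp)
    (fun s _ => by have := hpos s; positivity)
    (tendsto_inv_atTop_zero.comp (tendsto_conicY Y)) (by positivity)
    (fun s _ => by rw [abs_one, one_mul]; exact inv_anti₀ hY (le_conicY Y s))
  exact ⟨S, fun φ s => by rw [h1, one_mul], h2, h3⟩

/-- The solution operator of `ζ' = (c/4) ζ - ψ/4`. -/
lemma exists_dampOp {c : ℝ} (hc : 0 < c) : ∃ S : CB →L[ℝ] CB,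
    (∀ φ s, S φ s = exp (c / 4 * max s 0) *
      ∫ x in Ioi (max s 0), 1 / 4 * exp (-(c / 4 * x)) * φ x) ∧
    IntegrableOn (fun x => 1 / 4 * exp (-(c / 4 * x))) (Ioi 0) := by
  obtain ⟨S, h1, -, h3⟩ := exists_tailOp (k := fun x => 1 / 4 * exp (-(c / 4 * x)))
    (B := fun s => 1 / c * exp (-(c / 4 * s))) (ρ := fun s => exp (c / 4 * s)) (C := 1 / c)
    (by fun_prop) (by fun_prop) (by fun_prop)
    (fun s _ => by
      refine (((((hasDerivAt_id s).const_mul (c / 4)).neg).exp).const_mul (1 / c)).congr_deriv ?_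
      simp only [id, Pi.neg_apply]; field_simp)
    (fun s _ => by positivity)
    (by
      have : Tendsto (fun s : ℝ => c / 4 * s) atTop atTop :=
        tendsto_id.const_mul_atTop (by positivity)
      simpa using (Real.tendsto_exp_neg_atTop_nhds_zero.comp this).const_mul (1 / c))
    (by positivity)
    (fun s _ => by
      rw [abs_of_pos (exp_pos _), mul_left_comm, ← exp_add, add_neg_cancel, Real.exp_zero, mul_one])
  exact ⟨S, h1, h3⟩

/-- The function `u/y` in terms of `ζ = u - y u'`; the parameters are the slope, the function `1/y`
and the operator `φ ↦ ∫_y^∞ φ(η) η⁻² dη`. -/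
def conicW (l : ℝ × CB × (CB →L[ℝ] CB)) (ζ : CB) : CB := l.1 • (1 : CB) + l.2.2 ζ

/-- The function `u'` in terms of `ζ = u - y u'`. -/
def conicP (l : ℝ × CB × (CB →L[ℝ] CB)) (ζ : CB) : CB := conicW l ζ - l.2.1 * ζ

/-- The operator whose fixed points are the functions `ζ = u - y u'` of the conical profiles. -/
def conicT (n : ℕ) (b : ℝ) (V : CB →L[ℝ] CB) (z : (ℝ × CB × (CB →L[ℝ] CB)) × CB) : CB :=
  V ((b ^ 2 • (1 : CB) - conicP z.1 z.2 ^ 2) * z.2 + (2 * n₋₁) •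
    ((1 + conicP z.1 z.2 ^ 2) * (z.1.2.1 * Ring.inverse (conicW z.1 z.2))))

lemma isUnit_of_lt {φ : CB} {c : ℝ} (hc : 0 < c) (h : ∀ s, c ≤ φ s) : IsUnit φ := by
  let ψ : CB := BoundedContinuousFunction.ofNormedAddCommGroup (fun s => (φ s)⁻¹)
    (φ.continuous.inv₀ fun s => (hc.trans_le (h s)).ne') c⁻¹ (fun s => by
      have := hc.trans_le (h s)
      rw [norm_of_nonneg (by positivity)]; exact inv_anti₀ hc (h s))
  refine IsUnit.of_mul_eq_one ψ ?_
  ext s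
  exact mul_inv_cancel₀ (hc.trans_le (h s)).ne'

lemma ringInverse_apply {φ : CB} (h : IsUnit φ) (s : ℝ) : Ring.inverse φ s = (φ s)⁻¹ := by
  exact eq_inv_of_mul_eq_one_left (congrArg (fun φ : CB => φ s) (Ring.inverse_mul_cancel _ h))

/-- Conical profiles near infinity exist, are unique, and depend smoothly on the slope. -/
lemma exists_conic_fixed (n : ℕ) {b1 : ℝ} (hb : 0 < b1) (V : CB →L[ℝ] CB) :
    ∃ δ > 0, ∃ Y1 > 0, ∀ Y, Y1 ≤ Y → ∀ (m : CB) (S : CB →L[ℝ] CB), ‖m‖ ≤ Y⁻¹ → ‖S‖ ≤ Y⁻¹ →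
      ∃ φ : ℝ → CB, ∀ b, |b - b1| < δ → ContDiffAt ℝ ∞ φ b ∧
        (∀ s, b1 / 2 ≤ conicW (b, m, S) (φ b) s) ∧ conicT n b1 V ((b, m, S), φ b) = φ b ∧
        ∀ ζ : CB, ‖ζ‖ < δ → conicT n b1 V ((b, m, S), ζ) = ζ → ζ = φ b := by
  set l0 : ℝ × CB × (CB →L[ℝ] CB) := (b1, 0, 0) with hl0
  have hW0 : ∀ ζ, conicW l0 ζ = b1 • (1 : CB) := fun ζ => by simp [conicW, hl0]
  have hT0 : ∀ ζ, conicT n b1 V (l0, ζ) = 0 := fun ζ => by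
    have : conicP l0 ζ = b1 • (1 : CB) := by rw [conicP, hW0]; simp [hl0]
    rw [conicT, this]; simp [hl0, smul_pow]
  have hu : IsUnit (b1 • (1 : CB)) := isUnit_of_lt hb fun s => by simp
  have hWs : ContDiff ℝ ω fun z : (ℝ × CB × (CB →L[ℝ] CB)) × CB => conicW z.1 z.2 := by
    unfold conicW; fun_prop
  have hTs : ContDiffAt ℝ ω (conicT n b1 V) (l0, 0) := by
    have hI : ContDiffAt ℝ ω (fun z : (ℝ × CB × (CB →L[ℝ] CB)) × CB =>
        Ring.inverse (conicW z.1 z.2)) (l0, 0) := by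
      obtain ⟨w, hw⟩ := hu
      have h1 := contDiffAt_ringInverse (n := ω) ℝ w
      rw [hw, ← hW0 0] at h1
      exact ContDiffAt.comp (g := Ring.inverse) (l0, (0 : CB)) h1 hWs.contDiffAt
    unfold conicT conicP
    fun_prop
  obtain ⟨φ, h1, h2, h3, h4⟩ := exists_contDiffAt_fixedPoint (by simp) hTs (hT0 0) (K := 0)
    ((hasFDerivAt_const (0 : CB) (0 : CB)).congr_of_eventuallyEq
      (Eventually.of_forall fun ζ => hT0 ζ)) (by simp)
  have h5 : ∀ᶠ l in 𝓝 l0, ContDiffAt ℝ ω φ l := h1.eventually (by simp)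
  have h6 : ∀ᶠ l in 𝓝 l0, ‖conicW l (φ l) - b1 • (1 : CB)‖ < b1 / 2 := by
    have hc : ContinuousAt (fun l => conicW l (φ l)) l0 :=
      ContinuousAt.comp (f := fun l => (l, φ l)) hWs.continuous.continuousAt
        (continuousAt_id.prodMk h1.continuousAt)
    have := continuousAt_iff'.1 hc (b1 / 2) (by positivity)
    simpa only [hW0, dist_eq_norm] using this
  obtain ⟨ε, hε, hball⟩ := eventually_nhds_iff_ball.1 (h3.and (h5.and h6))
  obtain ⟨ε', hε', hball'⟩ := (eventually_nhds_iff_ball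
    (α := (ℝ × CB × (CB →L[ℝ] CB)) × CB) (x := (l0, 0))).1 h4
  set δ := min ε ε'
  have hδ0 : 0 < δ := lt_min hε hε'
  refine ⟨δ, hδ0, δ⁻¹ + 1, by positivity, fun Y hY m S hm hS => ?_⟩
  have hYδ : Y⁻¹ < δ := inv_lt_of_inv_lt₀ hδ0 (by linarith)
  have hmem : ∀ b, |b - b1| < δ → dist ((b, m, S) : ℝ × CB × (CB →L[ℝ] CB)) l0 < δ := fun b hb' =>
    by
    simp only [hl0, Prod.dist_eq, dist_zero_right, Real.dist_eq]
    refine max_lt hb' (max_lt (hm.trans_lt hYδ) ?_)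
    exact (dist_zero_right S).trans_lt (hS.trans_lt hYδ)
  refine ⟨fun b => φ (b, m, S), fun b hb' => ?_⟩
  have hd := hmem b hb'
  obtain ⟨k1, k2, k3⟩ := hball _ (mem_ball.2 (hd.trans_le (min_le_left _ _)))
  refine ⟨?_, fun s => ?_, k1, fun ζ hζ hζ' => ?_⟩
  · exact ContDiffAt.comp (g := φ) (f := fun b : ℝ => (b, m, S)) b (k2.of_le le_top) (by fun_prop)
  · have := ((conicW (b, m, S) (φ (b, m, S)) - b1 • (1 : CB)).norm_coe_le_norm s).trans k3.le
    rw [norm_eq_abs] at this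
    have := (abs_le.1 this).1
    simp only [BoundedContinuousFunction.coe_sub, Pi.sub_apply, BoundedContinuousFunction.coe_smul,
      BoundedContinuousFunction.coe_one, Pi.one_apply, smul_eq_mul, mul_one] at this
    linarith
  · refine hball' ((b, m, S), ζ) (mem_ball.2 ?_) hζ'
    rw [Prod.dist_eq, dist_zero_right]
    exact max_lt (hd.trans_le (min_le_right _ _)) (hζ.trans_le (min_le_right _ _))

end

section

open MeasureTheory

/-! ### Conical profiles -/

/-- A solution of `h' = α h + β` with `α ≥ 1`, `β > 0` and `h ≥ 0` initially grows
exponentially. -/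
lemma tendsto_of_linear_growth {h α β : ℝ → ℝ} {y1 : ℝ}
    (hd : ∀ y, y1 ≤ y → HasDerivAt h (α y * h y + β y) y) (hα : ∀ y, y1 ≤ y → 1 ≤ α y)
    (hβ : ∀ y, y1 ≤ y → 0 < β y) (h0 : 0 ≤ h y1) : Tendsto h atTop atTop := by
  have hcont : ∀ z, y1 ≤ z → ContinuousOn h (Ici z) := fun z hz y hy =>
    (hd y (hz.trans hy)).continuousAt.continuousWithinAt
  obtain ⟨y2, hy2, hpos⟩ : ∃ y2, y1 ≤ y2 ∧ 0 < h y2 := by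
    rcases h0.eq_or_lt with h0 | h0
    · by_contra! hc
      have h2 : ∀ᶠ s in 𝓝[>] y1, slope h y1 s ≤ 0 := by
        filter_upwards [self_mem_nhdsWithin] with s hs
        rw [slope_def_field, ← h0, sub_zero]
        exact div_nonpos_of_nonpos_of_nonneg (hc s (le_of_lt hs)) (sub_nonneg.2 (le_of_lt hs))
      have h3 := le_of_tendsto ((hasDerivAt_iff_tendsto_slope.1 (hd y1 le_rfl)).mono_left
        (nhdsWithin_mono y1 (show Ioi y1 ⊆ {y1}ᶜ from fun s hs => ne_of_gt hs))) h2
      rw [← h0, mul_zero, zero_add] at h3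
      linarith [hβ y1 le_rfl]
    · exact ⟨y1, le_rfl, h0⟩
  have hp : ∀ y, y2 ≤ y → 0 < h y := fun y hy =>
    pos_of_first_zero (φ := h) (α := y2) (β := y + 1) ((hcont y2 hy2).mono Ico_subset_Ici_self)
      hpos (fun r hr hr0 _ => ⟨β r, hβ r (hy2.trans hr.1.le), by
        have := hd r (hy2.trans hr.1.le)
        rwa [hr0, mul_zero, zero_add] at this⟩) y ⟨hy, by linarith⟩
  have hmono : ∀ y, y2 ≤ y → h y2 * exp (y - y2) ≤ h y := fun y hy => by
    have k := le_of_hasDerivAt_nonneg (φ := fun t => h t * exp (-t))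
      (φ' := fun t => (α t * h t + β t) * exp (-t) + h t * (exp (-t) * -1)) hy
      (((hcont y2 hy2).mono Icc_subset_Ici_self).mul (by fun_prop))
      (fun t ht => (hd t (hy2.trans ht.1.le)).mul (hasDerivAt_neg t).exp)
      (fun t ht => by
        have h1 := hp t ht.1.le
        have h2 := hα t (hy2.trans ht.1.le)
        have h3 := hβ t (hy2.trans ht.1.le)
        have : 0 ≤ (α t * h t + β t - h t) * exp (-t) := mul_nonneg (by nlinarith) (exp_pos (-t)).le
        linarith)
    have e : exp (y - y2) = exp (-y2) * exp y := by rw [← exp_add]; ring_nf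
    have e2 : exp (-y) * exp y = 1 := by rw [← exp_add]; simp
    calc h y2 * exp (y - y2) = h y2 * exp (-y2) * exp y := by rw [e]; ring
      _ ≤ h y * exp (-y) * exp y := by gcongr
      _ = h y := by rw [mul_assoc, e2, mul_one]
  have ht : Tendsto (fun y => h y2 * exp (y - y2)) atTop atTop :=
    (Real.tendsto_exp_atTop.comp (tendsto_atTop_add_const_right _ (-y2) tendsto_id)).const_mul_atTop
      hpos
  exact tendsto_atTop_mono' _ ((eventually_ge_atTop y2).mono hmono) ht

/-- A profile on `(Y, ∞)` asymptotic to a cone of slope `b`. -/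
structure IsConical (n : ℕ) (Y b : ℝ) (u p : ℝ → ℝ) : Prop where
  profile : IsProfile n (Ioi Y) u p
  slope : Tendsto (fun y => u y / y) atTop (𝓝 b)
  bdd : ∃ C, ∀ᶠ y in atTop, |u y - y * p y| ≤ C

/-- The square of the radius of the cylinder is `2(n-1)`. -/
lemma cylRadius_sq (hn : 2 ≤ n) : cylRadius n ^ 2 = 2 * n₋₁ :=
  sq_sqrt (by linarith [IsCapArc.one_le_sub hn])

lemma cylRadius_pos (hn : 2 ≤ n) : 0 < cylRadius n :=
  sqrt_pos.2 (by linarith [IsCapArc.one_le_sub hn])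

namespace IsConical

variable {Y b : ℝ} {u p : ℝ → ℝ}

lemma mono (h : IsConical n Y b u p) {Y' : ℝ} (hY : Y ≤ Y') : IsConical n Y' b u p :=
  ⟨h.profile.mono (Ioi_subset_Ioi hY), h.slope, h.bdd⟩

/-- The derivative of `ζ = u - y u'`. -/
lemma hasDerivAt_zeta (h : IsConical n Y b u p) {y : ℝ} (hy : Y < y) :
    HasDerivAt (fun y => u y - y * p y)
      (y / 2 * (1 + p y ^ 2) * (u y - y * p y - 2 * n₋₁ / u y)) y := by
  refine ((h.profile.deriv_u y hy).sub
    ((hasDerivAt_id y).mul (h.profile.deriv_p y hy))).congr_deriv ?_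
  have := (h.profile.pos y hy).ne'
  simp only [id, profQ]
  field_simp
  ring

lemma zeta_pos (h : IsConical n Y b u p) (hn : 2 ≤ n) (hY : 2 ≤ Y) {y : ℝ} (hy : Y < y) :
    0 < u y - y * p y := by
  have hN := IsCapArc.one_le_sub hn
  by_contra! hc
  obtain ⟨C, hC⟩ := h.bdd
  have ht := tendsto_of_linear_growth (h := fun y => -(u y - y * p y)) (y1 := y)
    (α := fun y => y / 2 * (1 + p y ^ 2))
    (β := fun y => y / 2 * (1 + p y ^ 2) * (2 * n₋₁ / u y))
    (fun t ht => ((h.hasDerivAt_zeta (hy.trans_le ht)).neg).congr_deriv (by ring))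
    (fun t ht => by nlinarith [sq_nonneg (p t)])
    (fun t ht => by
      have := h.profile.pos t (hy.trans_le ht)
      have h1 : 0 < t := by linarith
      have h2 : 0 < (n : ℝ) - 1 := by linarith
      positivity) (by linarith)
  obtain ⟨z, hz, hz'⟩ := ((ht.eventually (eventually_gt_atTop C)).and hC).exists
  have := (abs_le.1 hz').1
  linarith

lemma strictAntiOn_div (h : IsConical n Y b u p) (hn : 2 ≤ n) (hY : 2 ≤ Y) :
    StrictAntiOn (fun t => u t / t) (Ioi Y) := by
  have hd : ∀ t, Y < t → HasDerivAt (fun t => u t / t) (-(u t - t * p t) / t ^ 2) t := fun t ht => by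
    have h0 : t ≠ 0 := by linarith
    refine ((h.profile.deriv_u t ht).div (hasDerivAt_id t) h0).congr_deriv ?_
    simp only [id]; ring
  refine strictAntiOn_of_deriv_neg (convex_Ioi Y)
    (fun t ht => (hd t ht).continuousAt.continuousWithinAt) fun t ht => ?_
  rw [interior_Ioi] at ht
  rw [(hd t ht).deriv]
  have h1 := h.zeta_pos hn hY ht
  have h2 : 0 < t := by linarith [show Y < t from ht]
  have : 0 < (u t - t * p t) / t ^ 2 := by positivity
  rw [neg_div]
  linarith

lemma slope_mul_lt (h : IsConical n Y b u p) (hn : 2 ≤ n) (hY : 2 ≤ Y) {y : ℝ} (hy : Y < y) :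
    b * y < u y := by
  have hanti := h.strictAntiOn_div hn hY
  have h1 : b ≤ u (y + 1) / (y + 1) := by
    refine le_of_tendsto h.slope ?_
    filter_upwards [eventually_ge_atTop (y + 1)] with t ht
    exact hanti.antitoneOn (show Y < y + 1 by linarith) (show Y < t by linarith) ht
  have hy0 : 0 < y := by linarith
  have : b < u y / y := h1.trans_lt (hanti (show Y < y from hy) (show Y < y + 1 by linarith)
    (by linarith : y < y + 1))
  rwa [lt_div_iff₀ hy0] at this

lemma tendsto_u (h : IsConical n Y b u p) (hb : 0 < b) : Tendsto u atTop atTop := by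
  have := h.slope.pos_mul_atTop hb tendsto_id
  refine this.congr' ?_
  filter_upwards [eventually_gt_atTop 0] with t ht
  simp only [id]
  field_simp

lemma tendsto_p (h : IsConical n Y b u p) : Tendsto p atTop (𝓝 b) := by
  obtain ⟨C, hC⟩ := h.bdd
  have h1 : Tendsto (fun y => (u y - y * p y) / y) atTop (𝓝 0) := by
    refine squeeze_zero_norm' (a := fun y => C / y) ?_ (tendsto_const_nhds.div_atTop tendsto_id)
    filter_upwards [hC, eventually_gt_atTop 0] with t ht ht'
    rw [norm_div, norm_eq_abs, norm_of_nonneg ht'.le]; gcongr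
  have := h.slope.sub h1
  rw [sub_zero] at this
  refine this.congr' ?_
  filter_upwards [eventually_gt_atTop 0] with t ht
  field_simp
  ring

/-- Conical profiles lie outside the cylinder, with a lower bound for `ζ`. -/
lemma outside (h : IsConical n Y b u p) (hn : 2 ≤ n) (hb : 0 < b) (hY : 4 ≤ Y) {y : ℝ}
    (hy : Y < y) : cylRadius n < u y ∧
      0 < u y - y * p y - cylRadius n + 2 * (u y - cylRadius n) := by
  have hR := cylRadius_pos hn
  set R := cylRadius n
  obtain ⟨z, hz1, hz2⟩ := ((h.tendsto_u hb).eventually (eventually_gt_atTop (2 * R))).and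
    (eventually_gt_atTop y) |>.exists
  have hzeta : ∀ t, Y < t → 0 < u t - t * p t := fun t ht => h.zeta_pos hn (by linarith) ht
  have hcont : ContinuousOn u (Ioc Y z) := h.profile.cont_u.mono fun t ht => ht.1
  have hcont' : ContinuousOn p (Ioc Y z) := h.profile.cont_p.mono fun t ht => ht.1
  -- as long as the lower bound holds, the profile stays outside
  have hout : ∀ t ∈ Ioc Y z, (∀ s ∈ Ioc t z, 0 < u s - s * p s - R + 2 * (u s - R)) → R < u t := fun
    t ht hs => by
    have ht0 : 0 < t := by linarith [ht.1]
    have k := le_of_hasDerivAt_nonneg (φ := fun s => -((u s - R) / s ^ 3))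
      (φ' := fun s => -((p s * s ^ 3 - (u s - R) * (3 * s ^ 2)) / (s ^ 3) ^ 2)) ht.2
      ((((hcont.mono fun s hs => ⟨ht.1.trans_le hs.1, hs.2⟩).sub continuousOn_const).div
        (by fun_prop) fun s hs => by have : 0 < s := by linarith [hs.1]
                                     positivity).neg)
      (fun s hs => by
        have hs0 : 0 < s := by linarith [hs.1]
        refine ((((h.profile.deriv_u s (ht.1.trans hs.1)).sub_const R).div (hasDerivAt_pow 3 s)
          (by positivity)).neg).congr_deriv ?_
        norm_num)
      (fun s hs' => by
        have hs0 : 0 < s := by linarith [hs'.1]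
        have h1 := hs s ⟨hs'.1, hs'.2.le⟩
        rw [neg_nonneg]
        refine div_nonpos_of_nonpos_of_nonneg ?_ (by positivity)
        have : 0 ≤ s ^ 2 * (3 * (u s - R) - s * p s) := mul_nonneg (by positivity) (by linarith)
        linarith)
    have hz0 : 0 < z := by linarith
    have h1 : 0 < (u z - R) / z ^ 3 := div_pos (by linarith) (by positivity)
    have h2 : 0 < (u t - R) / t ^ 3 := by linarith
    have h3 := (div_pos_iff_of_pos_right (pow_pos ht0 3)).1 h2
    linarith
  have key : ∀ t ∈ Ioc Y z, 0 < u t - t * p t - R + 2 * (u t - R) := by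
    refine pos_of_last_zero (by fun_prop) ?_ ?_
    · have := hzeta z (hy.trans hz2)
      linarith
    · intro t ht h0 hs
      have hut := hout t ⟨ht.1, ht.2.le⟩ hs
      have ht4 : 4 < t := by linarith [ht.1]
      refine ⟨_, ?_, ((h.hasDerivAt_zeta ht.1).sub_const R).add
        (((h.profile.deriv_u t ht.1).sub_const R).const_mul 2)⟩
      set w := u t - R with hw
      have hw0 : 0 < w := by linarith
      have hz' : u t - t * p t = R - 2 * w := by linarith
      have hu : u t = R + w := by rw [hw]; ring
      have e1 : u t - t * p t - 2 * n₋₁ / u t ≤ -w := by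
        rw [hz', ← (cylRadius_sq hn), hu, sub_le_iff_le_add, ← sub_le_iff_le_add', le_div_iff₀
          (by linarith)]
        nlinarith
      have e2 : t / 2 * (1 + p t ^ 2) * (u t - t * p t - 2 * n₋₁ / u t) ≤
          t / 2 * (1 + p t ^ 2) * (-w) := mul_le_mul_of_nonneg_left e1 (by positivity)
      have e3 : 2 * w ≤ t / 2 * (1 + p t ^ 2) * w :=
        mul_le_mul_of_nonneg_right (by nlinarith [sq_nonneg (p t)]) hw0.le
      have e4 : p t < w := by nlinarith
      linarith
  exact ⟨hout y ⟨hy, hz2.le⟩ fun s hs => key s ⟨hy.trans hs.1, hs.2⟩, key y ⟨hy, hz2.le⟩⟩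

lemma p_pos (h : IsConical n Y b u p) (hn : 2 ≤ n) (hb : 0 < b) (hY : 4 ≤ Y) {y : ℝ}
    (hy : Y < y) : 0 < p y := by
  obtain ⟨z, hz1, hz2⟩ := (((h.tendsto_p).eventually (lt_mem_nhds hb)).and
    (eventually_gt_atTop y)).exists
  refine pos_of_last_zero (h.profile.cont_p.mono fun t ht => ht.1) hz1
    (fun t ht h0 _ => ⟨_, ?_, h.profile.deriv_p t ht.1⟩) y ⟨hy, hz2.le⟩
  have h1 := (h.outside hn hb hY ht.1).1
  have hR := cylRadius_pos hn
  have hR2 := cylRadius_sq hn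
  have : n₋₁ / u t < u t / 2 := by rw [div_lt_iff₀ (h.profile.pos t ht.1)]; nlinarith
  rw [h0, profQ]
  linarith

/-- Conical profiles are convex. -/
lemma zeta_mul_lt (h : IsConical n Y b u p) (hn : 2 ≤ n) (hb : 0 < b) (hY : 4 ≤ Y) {y : ℝ}
    (hy : Y < y) : u y - y * p y < 2 * n₋₁ / u y := by
  have hN := IsCapArc.one_le_sub hn
  by_contra! hc
  obtain ⟨C, hC⟩ := h.bdd
  have ht := tendsto_of_linear_growth (h := fun y => (u y - y * p y) - 2 * n₋₁ / u y) (y1 := y)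
    (α := fun y => y / 2 * (1 + p y ^ 2))
    (β := fun y => 2 * n₋₁ * p y / u y ^ 2)
    (fun t ht => by
      have ht' := hy.trans_le ht
      refine ((h.hasDerivAt_zeta ht').sub ((hasDerivAt_const t (2 * n₋₁)).div
        (h.profile.deriv_u t ht') (h.profile.pos t ht').ne')).congr_deriv ?_
      ring)
    (fun t ht => by nlinarith [sq_nonneg (p t)])
    (fun t ht => by
      have := h.profile.pos t (hy.trans_le ht)
      have h1 := h.p_pos hn hb hY (hy.trans_le ht)
      have h2 : 0 < (n : ℝ) - 1 := by linarith
      positivity) (by linarith)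
  obtain ⟨z, hz, hz', hz''⟩ :=
    ((ht.eventually (eventually_gt_atTop C)).and (hC.and (eventually_gt_atTop Y))).exists
  have h1 := (abs_le.1 hz').2
  have h3 : 0 ≤ 2 * n₋₁ / u z := div_nonneg (by linarith) (h.profile.pos z hz'').le
  linarith

lemma sq_lt (h : IsConical n Y b u p) (hn : 2 ≤ n) (hb : 0 < b) (hY : 4 ≤ Y) {y : ℝ}
    (hy : Y < y) : u y ^ 2 < 2 * n₋₁ + b ^ 2 * y ^ 2 := by
  have hd : ∀ t, Y < t → HasDerivAt (fun t => (u t ^ 2 - 2 * n₋₁) / t ^ 2)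
      (2 * u t * (2 * n₋₁ / u t - (u t - t * p t)) / t ^ 3) t := fun t ht => by
    have h0 : t ≠ 0 := by linarith
    have h1 := (h.profile.pos t ht).ne'
    refine ((((h.profile.deriv_u t ht).pow 2).sub_const _).div (hasDerivAt_pow 2 t)
      (pow_ne_zero 2 h0)).congr_deriv ?_
    simp only [Pi.pow_apply]
    field_simp; ring
  have hmono : StrictMonoOn (fun t => (u t ^ 2 - 2 * n₋₁) / t ^ 2) (Ioi Y) := by
    refine strictMonoOn_of_deriv_pos (convex_Ioi Y)
      (fun t ht => (hd t ht).continuousAt.continuousWithinAt) fun t ht => ?_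
    rw [interior_Ioi] at ht
    rw [(hd t ht).deriv]
    have h1 := h.zeta_mul_lt hn hb hY ht
    have h2 : 0 < t := by linarith [show Y < t from ht]
    have h3 := h.profile.pos t ht
    positivity
  have hlim : Tendsto (fun t => (u t ^ 2 - 2 * n₋₁) / t ^ 2) atTop (𝓝 (b ^ 2)) := by
    have h1 : Tendsto (fun t : ℝ => 2 * n₋₁ / t ^ 2) atTop (𝓝 0) :=
      tendsto_const_nhds.div_atTop (tendsto_pow_atTop two_ne_zero)
    have h2 := (h.slope.pow 2).sub h1
    rw [sub_zero] at h2
    refine h2.congr fun t => ?_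
    rw [div_pow, sub_div]
  have h1 : (u (y + 1) ^ 2 - 2 * n₋₁) / (y + 1) ^ 2 ≤ b ^ 2 := by
    refine ge_of_tendsto hlim ?_
    filter_upwards [eventually_ge_atTop (y + 1)] with t ht
    exact hmono.monotoneOn (show Y < y + 1 by linarith) (show Y < t by linarith) ht
  have hy0 : 0 < y := by linarith
  have h3 : (u y ^ 2 - 2 * n₋₁) / y ^ 2 < b ^ 2 := (hmono (show Y < y from hy)
    (show Y < y + 1 by linarith) (by linarith : y < y + 1)).trans_le h1
  rw [div_lt_iff₀ (by positivity)] at h3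
  linarith

lemma isBigO (h : IsConical n Y b u p) (hn : 2 ≤ n) (hb : 0 < b) (hY : 4 ≤ Y) :
    (fun y => u y - b * y) =O[atTop] fun y => y⁻¹ := by
  refine Asymptotics.IsBigO.of_bound (n₋₁ / b) ?_
  filter_upwards [eventually_gt_atTop Y] with y hy
  have hy0 : 0 < y := by linarith
  have h1 := h.slope_mul_lt hn (by linarith) hy
  have h2 := h.sq_lt hn hb hY hy
  rw [norm_of_nonneg (by linarith), norm_of_nonneg (by positivity), ← div_eq_mul_inv,
    div_div, le_div_iff₀ (by positivity)]
  have : 0 < b * y := by positivity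
  nlinarith

lemma tendsto_zeta (h : IsConical n Y b u p) (hn : 2 ≤ n) (hb : 0 < b) :
    Tendsto (fun y => u y - y * p y) atTop (𝓝 0) := by
  have h' := h.mono (le_max_left Y 4)
  have h1 : Tendsto (fun y => 2 * n₋₁ / u y) atTop (𝓝 0) :=
    tendsto_const_nhds.div_atTop (h.tendsto_u hb)
  refine squeeze_zero' ?_ ?_ h1
  · filter_upwards [eventually_gt_atTop (max Y 4)] with y hy
    exact (h'.zeta_pos hn (by linarith [le_max_right Y 4]) hy).le
  · filter_upwards [eventually_gt_atTop (max Y 4)] with y hy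
    exact (h'.zeta_mul_lt hn hb (le_max_right _ _) hy).le

end IsConical

end

section

open MeasureTheory

/-! ### Existence and uniqueness of conical profiles near infinity -/

lemma conicY_sub {Y y : ℝ} (hY : 0 < Y) (hy : Y ≤ y) : conicY Y (y ^ 2 - Y ^ 2) = y := by
  rw [conicY, abs_of_nonneg (by nlinarith), add_sub_cancel, sqrt_sq (by linarith)]

lemma continuous_conicKernel {Y : ℝ} (hY : 0 < Y) : Continuous fun x => (2 * conicY Y x ^ 3)⁻¹ := by
  have := continuous_conicY Y
  exact Continuous.inv₀ (by fun_prop) fun s => by have := hY.trans_le (le_conicY Y s); positivity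

/-- The parameters of `conicT`, for slope `b` on the half line `y ≥ Y`, with `V` the solution
operator of `ζ' = (c/4) ζ - ψ/4`. -/
structure IsConicData (Y c : ℝ) (m : CB) (S V : CB →L[ℝ] CB) : Prop where
  pos : 0 < Y
  m_apply : ∀ s, m s = (conicY Y s)⁻¹
  S_apply : ∀ φ s, S φ s = ∫ x in Ioi (max s 0), (2 * conicY Y x ^ 3)⁻¹ * φ x
  S_int : IntegrableOn (fun x => (2 * conicY Y x ^ 3)⁻¹) (Ioi 0)
  V_apply : ∀ φ s, V φ s = exp (c / 4 * max s 0) *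
      ∫ x in Ioi (max s 0), 1 / 4 * exp (-(c / 4 * x)) * φ x
  V_int : IntegrableOn (fun x => 1 / 4 * exp (-(c / 4 * x))) (Ioi 0)

/-- The function to which the solution operator is applied in `conicT`. -/
def conicF (n : ℕ) (c : ℝ) (l : ℝ × CB × (CB →L[ℝ] CB)) (ζ : CB) : CB :=
  (c ^ 2 • (1 : CB) - conicP l ζ ^ 2) * ζ + (2 * n₋₁) •
    ((1 + conicP l ζ ^ 2) * (l.2.1 * Ring.inverse (conicW l ζ)))

lemma conicF_apply {c d : ℝ} {l : ℝ × CB × (CB →L[ℝ] CB)} {ζ : CB} (hd : 0 < d)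
    (hW : ∀ s, d ≤ conicW l ζ s) (s : ℝ) : conicF n c l ζ s = (c ^ 2 - conicP l ζ s ^ 2) * ζ s +
      2 * n₋₁ * ((1 + conicP l ζ s ^ 2) * (l.2.1 s * (conicW l ζ s)⁻¹)) := by
  rw [← ringInverse_apply (isUnit_of_lt hd hW)]; simp [conicF]

namespace IsConicData

variable {Y c b : ℝ} {m : CB} {S V : CB →L[ℝ] CB}

lemma hasDerivAt_S (h : IsConicData Y c m S V) (φ : CB) {s : ℝ} (hs : 0 < s) :
    HasDerivAt (S φ) (-((2 * conicY Y s ^ 3)⁻¹ * φ s)) s := by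
  refine (hasDerivAt_tail ((continuous_conicKernel h.pos).mul φ.continuous)
    (integrableOn_mul_bdd h.S_int φ) hs).congr_of_eventuallyEq ?_
  filter_upwards [lt_mem_nhds hs] with t ht
  rw [h.S_apply, max_eq_left ht.le]
  rfl

lemma hasDerivAt_V (h : IsConicData Y c m S V) (φ : CB) {s : ℝ} (hs : 0 < s) :
    HasDerivAt (V φ) (c / 4 * V φ s - φ s / 4) s := by
  have h1 := hasDerivAt_tail (g := fun x => 1 / 4 * exp (-(c / 4 * x)) * φ x)
    (by have := φ.continuous; fun_prop) (integrableOn_mul_bdd h.V_int φ) hs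
  have h2 := (((hasDerivAt_id s).const_mul (c / 4)).exp).mul h1
  refine (h2.congr_of_eventuallyEq ?_).congr_deriv ?_
  · filter_upwards [lt_mem_nhds hs] with t ht
    rw [h.V_apply, max_eq_left ht.le]
    rfl
  · have e : exp (c / 4 * s) * exp (-(c / 4 * s)) = 1 := by rw [← exp_add]; simp
    rw [h.V_apply, max_eq_left hs.le]
    simp only [id, mul_one]
    linear_combination (-(φ s) / 4) * e

lemma tendsto_S (h : IsConicData Y c m S V) (φ : CB) : Tendsto (S φ) atTop (𝓝 0) := by
  have h1 : Tendsto (fun s : ℝ => max s 0) atTop atTop :=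
    tendsto_atTop_mono (fun s => le_max_left s 0) tendsto_id
  refine (tendsto_integral_Ioi_zero (f := fun x => (2 * conicY Y x ^ 3)⁻¹ * φ x) (μ := volume)
    h1).congr fun s => (h.S_apply φ s).symm

lemma m_sub (h : IsConicData Y c m S V) {y : ℝ} (hy : Y < y) : m (y ^ 2 - Y ^ 2) = y⁻¹ := by
  rw [h.m_apply, conicY_sub h.pos hy.le]

lemma conicP_apply (h : IsConicData Y c m S V) (ζ : CB) {y : ℝ} (hy : Y < y) :
    conicP (b, m, S) ζ (y ^ 2 - Y ^ 2) =
      conicW (b, m, S) ζ (y ^ 2 - Y ^ 2) - ζ (y ^ 2 - Y ^ 2) / y := by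
  rw [div_eq_inv_mul, ← h.m_sub hy]
  rfl

lemma sub_conicP (h : IsConicData Y c m S V) (ζ : CB) {y : ℝ} (hy : Y < y) :
    y * conicW (b, m, S) ζ (y ^ 2 - Y ^ 2) - y * conicP (b, m, S) ζ (y ^ 2 - Y ^ 2) =
      ζ (y ^ 2 - Y ^ 2) := by
  have := (h.pos.trans hy).ne'
  rw [h.conicP_apply ζ hy]; field_simp; ring

lemma tendsto_sub (Y : ℝ) : Tendsto (fun y : ℝ => y ^ 2 - Y ^ 2) atTop atTop :=
  tendsto_atTop_add_const_right _ _ (tendsto_pow_atTop two_ne_zero)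

/-- The functions `y (b + Sφ)` are asymptotically conical. -/
lemma tendsto_conicW (h : IsConicData Y c m S V) (ζ : CB) :
    Tendsto (fun y : ℝ => conicW (b, m, S) ζ (y ^ 2 - Y ^ 2)) atTop (𝓝 b) := by
  have := ((h.tendsto_S ζ).comp (tendsto_sub Y)).const_add b
  rw [add_zero] at this
  refine this.congr fun y => ?_
  simp [conicW]

/-- Fixed points of `conicT` are conical profiles. -/
lemma isConical (b1 : ℝ) (h : IsConicData Y (1 + b1 ^ 2) m S V) {ζ : CB}
    (hfix : conicT n b1 V ((b, m, S), ζ) = ζ) {d : ℝ} (hd : 0 < d)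
    (hW : ∀ s, d ≤ conicW (b, m, S) ζ s) :
    IsConical n Y b (fun y => y * conicW (b, m, S) ζ (y ^ 2 - Y ^ 2))
      (fun y => conicP (b, m, S) ζ (y ^ 2 - Y ^ 2)) := by
  have hY := h.pos
  have hsq : ∀ y : ℝ, HasDerivAt (fun y : ℝ => y ^ 2 - Y ^ 2) (2 * y) y := fun y =>
    ((hasDerivAt_pow 2 y).sub_const _).congr_deriv (by norm_num)
  have hs : ∀ y : ℝ, Y < y → 0 < y ^ 2 - Y ^ 2 := fun y hy => by nlinarith
  have hWd : ∀ y : ℝ, Y < y → HasDerivAt (fun y => conicW (b, m, S) ζ (y ^ 2 - Y ^ 2))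
      (-(ζ (y ^ 2 - Y ^ 2) / y ^ 2)) y := fun y hy => by
    have h1 : HasDerivAt (fun s => b + S ζ s) _ (y ^ 2 - Y ^ 2) :=
      (h.hasDerivAt_S ζ (hs y hy)).const_add b
    have h2 : HasDerivAt (fun s => conicW (b, m, S) ζ s) _ (y ^ 2 - Y ^ 2) :=
      h1.congr_of_eventuallyEq (Eventually.of_forall fun s => by simp [conicW])
    refine (h2.comp y (hsq y)).congr_deriv ?_
    rw [conicY_sub hY hy.le]
    have : y ≠ 0 := by linarith
    field_simp
  have hfix' : V (conicF n b1 (b, m, S) ζ) = ζ := hfix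
  refine ⟨⟨fun y hy => ?_, fun y hy => ?_, fun y hy => ?_⟩, ?_, ‖ζ‖,
    (eventually_gt_atTop Y).mono fun y hy => ?_⟩
  · exact mul_pos (hY.trans hy) (hd.trans_le (hW _))
  · have hy0 : y ≠ 0 := (hY.trans hy).ne'
    refine ((hasDerivAt_id y).mul (hWd y hy)).congr_deriv ?_
    rw [h.conicP_apply ζ hy]
    simp only [id]
    field_simp
    ring
  · have hy0 : 0 < y := hY.trans hy
    have h1 := h.hasDerivAt_V (conicF n b1 (b, m, S) ζ) (hs y hy)
    rw [hfix'] at h1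
    have h2 : HasDerivAt (fun y => ζ (y ^ 2 - Y ^ 2)) _ y := h1.comp y (hsq y)
    refine (((hWd y hy).sub (h2.div (hasDerivAt_id y) hy0.ne')).congr_of_eventuallyEq
      ?_).congr_deriv ?_
    · filter_upwards [lt_mem_nhds hy] with t ht
      exact h.conicP_apply ζ ht
    · have hW0 := hd.trans_le (hW (y ^ 2 - Y ^ 2))
      rw [conicF_apply hd hW, h.m_sub hy]
      have hP := h.conicP_apply (b := b) ζ hy
      generalize conicP (b, m, S) ζ (y ^ 2 - Y ^ 2) = P at *
      generalize conicW (b, m, S) ζ (y ^ 2 - Y ^ 2) = W at *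
      have hz : ζ (y ^ 2 - Y ^ 2) = y * (W - P) := by rw [hP]; field_simp; ring
      rw [hz, profQ]; simp only [id]; field_simp; ring
  · refine (h.tendsto_conicW (b := b) ζ).congr' ?_
    filter_upwards [eventually_gt_atTop 0] with y hy
    field_simp
  · rw [h.sub_conicP ζ hy]; exact ζ.norm_coe_le_norm _

end IsConicData

lemma exists_isConicData {Y c : ℝ} (hY : 0 < Y) {V : CB →L[ℝ] CB}
    (hV : (∀ φ s, V φ s = exp (c / 4 * max s 0) *
      ∫ x in Ioi (max s 0), 1 / 4 * exp (-(c / 4 * x)) * φ x) ∧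
      IntegrableOn (fun x => 1 / 4 * exp (-(c / 4 * x))) (Ioi 0)) :
    ∃ m S, IsConicData Y c m S V ∧ ‖m‖ ≤ Y⁻¹ ∧ ‖S‖ ≤ Y⁻¹ := by
  obtain ⟨S, h1, h2, h3⟩ := exists_conicOp hY
  exact ⟨conicInv Y hY, S, ⟨hY, fun s => rfl, h1, h3, hV.1, hV.2⟩, norm_conicInv_le hY, h2⟩

/-- A smooth family of conical profiles near infinity, with the asymptotics of its derivative with
respect to the slope. -/
lemma exists_conical_family (n : ℕ) {b1 : ℝ} (hb : 0 < b1) :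
    ∃ δ > 0, ∃ Y, 4 ≤ Y ∧ ∃ U P : ℝ → ℝ → ℝ, ∀ b, |b - b1| < δ → IsConical n Y b (U b) (P b) ∧
      (∀ y, Y < y → ContDiffAt ℝ ∞ (fun b => U b y) b ∧ ContDiffAt ℝ ∞ (fun b => P b y) b) ∧
      Tendsto (fun y => deriv (fun b => U b y) b / y) atTop (𝓝 1) ∧
      ∃ C, ∀ y, Y < y → |deriv (fun b => U b y) b - y * deriv (fun b => P b y) b| ≤ C := by
  obtain ⟨V, hV⟩ := exists_dampOp (c := 1 + b1 ^ 2) (by positivity)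
  obtain ⟨δ, hδ, Y1, hY1, H⟩ := exists_conic_fixed n hb V
  have hY : 0 < max Y1 4 := hY1.trans_le (le_max_left _ _)
  obtain ⟨m, S, hD, hm, hS⟩ := exists_isConicData hY hV
  obtain ⟨φ, hφ⟩ := H _ (le_max_left Y1 4) m S hm hS
  set Y := max Y1 4
  refine ⟨δ, hδ, Y, le_max_right _ _, fun b y => y * conicW (b, m, S) (φ b) (y ^ 2 - Y ^ 2),
    fun b y => conicP (b, m, S) (φ b) (y ^ 2 - Y ^ 2), fun b hb' => ?_⟩
  obtain ⟨h1, h2, h3, -⟩ := hφ b hb'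
  have hev : ∀ s : ℝ, ContDiff ℝ ∞ fun ζ : CB => ζ s := fun s =>
    (BoundedContinuousFunction.evalCLM ℝ s : CB →L[ℝ] ℝ).contDiff
  have hWs : ContDiffAt ℝ ∞ (fun b => conicW (b, m, S) (φ b)) b := by unfold conicW; fun_prop
  have hPs : ContDiffAt ℝ ∞ (fun b => conicP (b, m, S) (φ b)) b := by unfold conicP; fun_prop
  have hdφ : HasDerivAt φ (deriv φ b) b := (h1.differentiableAt (by simp)).hasDerivAt
  have hev' : ∀ (s : ℝ) {f : ℝ → CB} {f' : CB}, HasDerivAt f f' b →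
      HasDerivAt (fun b => f b s) (f' s) b := fun s f f' hf =>
    (BoundedContinuousFunction.evalCLM ℝ s : CB →L[ℝ] ℝ).hasFDerivAt.comp_hasDerivAt b hf
  have hdW : HasDerivAt (fun b => conicW (b, m, S) (φ b)) ((1 : CB) + S (deriv φ b)) b := by
    have k1 : HasDerivAt (fun b : ℝ => b • (1 : CB)) ((1 : ℝ) • (1 : CB)) b :=
      (hasDerivAt_id b).smul_const (1 : CB)
    rw [one_smul] at k1
    exact k1.add (S.hasFDerivAt.comp_hasDerivAt b hdφ)
  have hdP : HasDerivAt (fun b => conicP (b, m, S) (φ b))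
      ((1 : CB) + S (deriv φ b) - m * deriv φ b) b := hdW.sub (hdφ.const_mul m)
  have hU : ∀ y, HasDerivAt (fun b => y * conicW (b, m, S) (φ b) (y ^ 2 - Y ^ 2))
      (y * conicW (1, m, S) (deriv φ b) (y ^ 2 - Y ^ 2)) b := fun y => by
    refine ((hev' _ hdW).const_mul y).congr_deriv ?_
    simp [conicW]
  have hP : ∀ y, HasDerivAt (fun b => conicP (b, m, S) (φ b) (y ^ 2 - Y ^ 2))
      (conicP (1, m, S) (deriv φ b) (y ^ 2 - Y ^ 2)) b := fun y => by
    refine (hev' _ hdP).congr_deriv ?_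
    simp [conicP, conicW]
  refine ⟨hD.isConical b1 h3 (half_pos hb) h2, fun y _ => ⟨?_, ?_⟩, ?_, ‖deriv φ b‖, fun y hy => ?_⟩
  · exact contDiffAt_const.mul ((hev _).contDiffAt.comp b hWs)
  · exact (hev _).contDiffAt.comp b hPs
  · refine (hD.tendsto_conicW (b := 1) (deriv φ b)).congr' ?_
    filter_upwards [eventually_gt_atTop 0] with y hy
    rw [(hU y).deriv]
    field_simp
  · rw [(hU y).deriv, (hP y).deriv, hD.sub_conicP _ hy]; exact (deriv φ b).norm_coe_le_norm _

/-- The function `ζ = u - y u'` of a conical profile is a fixed point of `conicT`. -/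
lemma IsConical.exists_fixed {Y0 Y b ε : ℝ} {u p : ℝ → ℝ} {m : CB} {S V : CB →L[ℝ] CB}
    (h : IsConical n Y0 b u p) (hY : Y0 < Y) (hD : IsConicData Y (1 + b ^ 2) m S V)
    (hb : 0 < b) (hn : 2 ≤ n) (hY4 : 4 ≤ Y0)
    (hε : ∀ y, Y ≤ y → |u y - y * p y| ≤ ε) (hε0 : 0 ≤ ε) :
    ∃ ζ : CB, ‖ζ‖ ≤ ε ∧ conicT n b V ((b, m, S), ζ) = ζ ∧
      ∀ y, Y < y → u y = y * conicW (b, m, S) ζ (y ^ 2 - Y ^ 2) := by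
  have hpos : ∀ s, Y0 < conicY Y s := fun s => hY.trans_le (le_conicY Y s)
  have hY0 : 0 < Y := by linarith
  have hc := continuous_conicY Y
  have hcu : Continuous fun s => u (conicY Y s) := h.profile.cont_u.comp_continuous hc hpos
  have hcp : Continuous fun s => p (conicY Y s) := h.profile.cont_p.comp_continuous hc hpos
  let z : ℝ → ℝ := fun s => u (conicY Y s) - conicY Y s * p (conicY Y s)
  have hcz : Continuous z := hcu.sub (hc.mul hcp)
  let ζ : CB := BoundedContinuousFunction.ofNormedAddCommGroup (fun s => z (max s 0))
    (by fun_prop) ε (fun s => hε _ (le_conicY Y _))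
  have hζ : ∀ s, 0 ≤ s → ζ s = z s := fun s hs => by
    change z (max s 0) = z s
    rw [max_eq_left hs]
  have hW : ∀ s, 0 ≤ s → conicW (b, m, S) ζ s = u (conicY Y s) / conicY Y s := fun s hs => by
    have e : conicW (b, m, S) ζ s = b + S ζ s := by simp [conicW]
    rw [e, hD.S_apply, max_eq_left hs]
    have k := integral_Ioi_of_hasDerivAt_of_tendsto (a := s) (m := b)
      (f := fun s => u (conicY Y s) / conicY Y s)
      (f' := fun s => -((2 * conicY Y s ^ 3)⁻¹ * ζ s))
      (hcu.div hc fun s => by linarith [hpos s]).continuousWithinAt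
      (fun x hx => by
        have hx0 : 0 < x := hs.trans_lt hx
        have h1 := hasDerivAt_conicY hY0 hx0
        have h3 : conicY Y x ≠ 0 := by linarith [hpos x]
        refine (((h.profile.deriv_u _ (hpos x)).comp x h1).div h1 h3).congr_deriv ?_
        rw [hζ x hx0.le]; simp only [z, comp]; field_simp; ring)
      (((integrableOn_mul_bdd hD.S_int ζ).mono_set (Ioi_subset_Ioi hs)).neg)
      (h.slope.comp (tendsto_conicY Y))
    rw [integral_neg] at k
    linarith
  have hP : ∀ s, 0 ≤ s → conicP (b, m, S) ζ s = p (conicY Y s) := fun s hs => by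
    have e : conicP (b, m, S) ζ s = conicW (b, m, S) ζ s - m s * ζ s := rfl
    rw [e, hW s hs, hD.m_apply, hζ s hs]
    have h3 : conicY Y s ≠ 0 := by linarith [hpos s]
    simp only [z]; field_simp; ring
  have hWpos : ∀ s, b / 2 ≤ conicW (b, m, S) ζ s := fun s => by
    have e : conicW (b, m, S) ζ s = conicW (b, m, S) ζ (max s 0) := by
      simp only [conicW, BoundedContinuousFunction.coe_add, Pi.add_apply, hD.S_apply]; simp
    rw [e, hW _ (le_max_right s 0), le_div_iff₀ (by linarith [hpos (max s 0)])]
    have h1 := h.slope_mul_lt hn (by linarith) (hpos (max s 0))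
    have h2 : 0 < b * conicY Y (max s 0) := mul_pos hb (by linarith [hpos (max s 0)])
    linarith
  refine ⟨ζ, BoundedContinuousFunction.norm_ofNormedAddCommGroup_le _ hε0 _, ?_, fun y hy => ?_⟩
  · change V (conicF n b (b, m, S) ζ) = ζ
    ext s
    rw [hD.V_apply]
    have hs := le_max_right s 0
    change _ = z (max s 0)
    generalize max s 0 = s at hs
    have k := integral_Ioi_of_hasDerivAt_of_tendsto (a := s) (m := 0)
      (f := fun s => exp (-((1 + b ^ 2) / 4 * s)) * z s)
      (f' := fun s => -(1 / 4 * exp (-((1 + b ^ 2) / 4 * s)) * conicF n b (b, m, S) ζ s))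
      (by fun_prop)
      (fun x hx => by
        have hx0 : 0 < x := hs.trans_lt hx
        have h2 : HasDerivAt z _ x := (h.hasDerivAt_zeta (hpos x)).comp x
          (hasDerivAt_conicY hY0 hx0)
        have h3 : conicY Y x ≠ 0 := by linarith [hpos x]
        have h4 := (h.profile.pos _ (hpos x)).ne'
        refine ((((((hasDerivAt_id x).const_mul ((1 + b ^ 2) / 4)).neg).exp).mul h2)).congr_deriv ?_
        rw [conicF_apply (half_pos hb) hWpos, hζ x hx0.le, hP x hx0.le, hW x hx0.le, hD.m_apply]
        simp only [z, id, Pi.neg_apply]; field_simp; ring)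
      (((integrableOn_mul_bdd hD.V_int _).mono_set (Ioi_subset_Ioi hs)).neg)
      (by
        have h1 : Tendsto (fun s : ℝ => (1 + b ^ 2) / 4 * s) atTop atTop :=
          tendsto_id.const_mul_atTop (by positivity)
        have h2 : Tendsto z atTop (𝓝 0) := (h.tendsto_zeta hn hb).comp (tendsto_conicY Y)
        simpa using (Real.tendsto_exp_neg_atTop_nhds_zero.comp h1).mul h2)
    rw [integral_neg] at k
    have e : exp ((1 + b ^ 2) / 4 * s) * exp (-((1 + b ^ 2) / 4 * s)) = 1 := by rw [← exp_add]; simp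
    linear_combination (-exp ((1 + b ^ 2) / 4 * s)) * k + z s * e
  · have hs : 0 ≤ y ^ 2 - Y ^ 2 := by nlinarith
    rw [hW _ hs, conicY_sub hY0 hy.le]
    have : y ≠ 0 := by linarith
    field_simp

/-- Conical profiles with the same slope agree near infinity. -/
lemma IsConical.eventually_eq {Y b : ℝ} {u p u' p' : ℝ → ℝ} (hn : 2 ≤ n) (hb : 0 < b)
    (h : IsConical n Y b u p) (h' : IsConical n Y b u' p') : ∀ᶠ y in atTop, u y = u' y := by
  obtain ⟨V, hV⟩ := exists_dampOp (c := 1 + b ^ 2) (by positivity)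
  obtain ⟨δ, hδ, Y1, hY1, H⟩ := exists_conic_fixed n hb V
  have hz : ∀ {u p : ℝ → ℝ}, IsConical n Y b u p → ∃ Z, ∀ y, Z ≤ y → |u y - y * p y| ≤ δ / 2 :=
    fun {u p} h => by
      have := (h.tendsto_zeta hn hb).eventually (closedBall_mem_nhds 0 (half_pos hδ))
      obtain ⟨Z, hZ⟩ := eventually_atTop.1 this
      exact ⟨Z, fun y hy => by simpa using hZ y hy⟩
  obtain ⟨Z, hZ⟩ := hz h
  obtain ⟨Z', hZ'⟩ := hz h'
  set Y0 := max Y 4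
  set W := max (Y0 + 1) (max Y1 (max Z Z'))
  have e1 : Y0 + 1 ≤ W := le_max_left _ _
  have e2 : Y1 ≤ W := (le_max_left _ _).trans (le_max_right _ _)
  have e3 : max Z Z' ≤ W := (le_max_right _ _).trans (le_max_right _ _)
  obtain ⟨m, S, hD, hm, hS⟩ := exists_isConicData (hY1.trans_le e2) hV
  obtain ⟨φ, hφ⟩ := H W e2 m S hm hS
  obtain ⟨-, -, -, hu⟩ := hφ b (by simpa using hδ)
  obtain ⟨ζ, k1, k2, k3⟩ := (h.mono (le_max_left Y 4)).exists_fixed (by linarith) hD hb hn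
    (le_max_right Y 4) (fun y hy => hZ y ((le_max_left Z Z').trans (e3.trans hy))) (by positivity)
  obtain ⟨ζ', k1', k2', k3'⟩ := (h'.mono (le_max_left Y 4)).exists_fixed (by linarith) hD hb hn
    (le_max_right Y 4) (fun y hy => hZ' y ((le_max_right Z Z').trans (e3.trans hy))) (by positivity)
  have : ζ = ζ' := (hu ζ (by linarith) k2).trans (hu ζ' (by linarith) k2').symm
  filter_upwards [eventually_gt_atTop W] with y hy
  rw [k3 y hy, k3' y hy, this]

end

section

/-! ### Continuation of profiles -/

lemma IsProfile.eqOn {s : Set ℝ} (hs : s.OrdConnected) {u p u' p' : ℝ → ℝ} {y0 : ℝ}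
    (h : IsProfile n s u p) (h' : IsProfile n s u' p') (hy0 : y0 ∈ s) (hu : u y0 = u' y0)
    (hp : p y0 = p' y0) : ∀ y ∈ s, u y = u' y ∧ p y = p' y := by
  intro y hy
  have hseg : ∀ σ ∈ Icc (0 : ℝ) 1, y0 + (y - y0) * σ ∈ s := fun σ hσ => by
    have hc : Convex ℝ s := hs.convex
    have := hc hy0 hy (sub_nonneg.2 hσ.2) hσ.1 (by ring)
    simp only [smul_eq_mul] at this
    convert this using 1
    ring
  obtain ⟨q, h1, h2, h3, h4⟩ := h.fixed hseg
  obtain ⟨q', h1', h2', h3', h4'⟩ := h'.fixed hseg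
  rw [hu] at h2 h3
  rw [hu, hp] at h4
  have e := profOp_fixed_unique h3 h3' h4 h4'
  have k1 := h1 1
  have k2 := h1' 1
  have k3 := h2 1
  have k4 := h2' 1
  have h1' : ((1 : unitInterval) : ℝ) = 1 := rfl
  simp only [h1', mul_one, add_sub_cancel] at k1 k2 k3 k4
  exact ⟨by rw [← k3, ← k4, e], by rw [← k1, ← k2, e]⟩

lemma IsProfile.congr {s : Set ℝ} (hs : IsOpen s) {u p u' p' : ℝ → ℝ} (h : IsProfile n s u p)
    (he : ∀ y ∈ s, u' y = u y ∧ p' y = p y) : IsProfile n s u' p' := by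
  have hev : ∀ y ∈ s, u' =ᶠ[𝓝 y] u ∧ p' =ᶠ[𝓝 y] p := fun y hy =>
    eventually_and.1 (mem_of_superset (hs.mem_nhds hy) he)
  refine ⟨fun y hy => ?_, fun y hy => ?_, fun y hy => ?_⟩
  · rw [(he y hy).1]; exact h.pos y hy
  · rw [(he y hy).2]; exact (h.deriv_u y hy).congr_of_eventuallyEq (hev y hy).1
  · rw [(he y hy).1, (he y hy).2]; exact (h.deriv_p y hy).congr_of_eventuallyEq (hev y hy).2

lemma IsProfile.union {s t : Set ℝ} {u p : ℝ → ℝ} (h : IsProfile n s u p)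
    (h' : IsProfile n t u p) : IsProfile n (s ∪ t) u p :=
  ⟨fun y hy => hy.elim (h.pos y) (h'.pos y), fun y hy => hy.elim (h.deriv_u y) (h'.deriv_u y),
    fun y hy => hy.elim (h.deriv_p y) (h'.deriv_p y)⟩

/-- Local existence of profiles, uniformly in the initial data. -/
lemma eventually_exists_isProfile (n : ℕ) {z : ℝ × ℝ × ℝ} (hz : 0 < z.2.1) :
    ∀ᶠ q : ℝ × ℝ × ℝ × ℝ in 𝓝 (0, z), ∃ u p, IsProfile n (Ioo (q.2.1 - q.1) (q.2.1 + q.1)) u p ∧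
      u q.2.1 = q.2.2.1 ∧ p q.2.1 = q.2.2.2 := by
  let v (z : ℝ × ℝ × ℝ) : ℝ × ℝ × ℝ := (1, z.2.2, (1 + z.2.2 ^ 2) * profQ n z.1 z.2.1 z.2.2)
  have hv : ContDiffAt ℝ 1 v z := by unfold v profQ; fun_prop (disch := exact hz.ne')
  obtain ⟨δ, hδ, a, r, L, K, hr, hpl⟩ := IsPicardLindelof.of_contDiffAt_one hv
  obtain ⟨φ, h1, h2⟩ := (hpl 0).exists_forall_mem_closedBall_eq_hasDerivWithinAt_continuousOn
  have hI : Icc (0 - δ) (0 + δ) ∈ 𝓝 (0 : ℝ) := Icc_mem_nhds (by linarith) (by linarith)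
  have hB := closedBall_mem_nhds z hr
  have hpos : ∀ᶠ q in 𝓝 (z, (0 : ℝ)), 0 < (φ q).2.1 :=
    (continuousAt_snd.fst.comp (h2.continuousAt (prod_mem_nhds hB hI))).eventually
      (lt_mem_nhds (by simpa [(h1 z (mem_closedBall_self hr.le)).1] using hz))
  rw [nhds_prod_eq] at hpos
  obtain ⟨A, hA, B, hB', hAB⟩ := eventually_prod_iff.1 hpos
  obtain ⟨ε, hε, hεB⟩ := Metric.eventually_nhds_iff.1 (hB'.and (Ioo_mem_nhds (a := 0 - δ)
    (b := 0 + δ) (by linarith) (by linarith)))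
  filter_upwards [prod_mem_nhds (Iio_mem_nhds hε) (inter_mem hB hA)] with ⟨t, w⟩ ⟨ht, hw, hwA⟩
  obtain ⟨h0, hd⟩ := h1 w hw
  simp only [mem_Iio] at ht
  have hm : ∀ s ∈ Ioo (-t) t, dist s 0 < ε := fun s hs => by
    simp [abs_lt]; constructor <;> linarith [hs.1, hs.2]
  have hd' : ∀ s ∈ Ioo (-t) t, HasDerivAt (fun s => φ (w, s)) (v (φ (w, s))) s := fun s hs =>
    (hd s (Ioo_subset_Icc_self (hεB (hm s hs)).2)).hasDerivAt
      (Icc_mem_nhds (hεB (hm s hs)).2.1 (hεB (hm s hs)).2.2)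
  have hfst : ∀ s ∈ Ioo (-t) t, (φ (w, s)).1 = w.1 + s := fun s hs => by
    have k := (convex_Ioo (-t) t).norm_image_sub_le_of_norm_hasDerivWithin_le (C := 0)
      (f := fun s => (φ (w, s)).1 - s) (f' := 0) (x := 0) (y := s) (fun x hx => by
        have k : HasDerivAt _ (1 : ℝ) x := (hd' x hx).fst
        exact ((k.sub (hasDerivAt_id x)).congr_deriv (sub_self _)).hasDerivWithinAt) (by simp)
      ⟨by linarith [hs.1, hs.2], by linarith [hs.1, hs.2]⟩ hs
    rw [zero_mul, norm_le_zero_iff, h0] at k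
    linarith
  have hy : ∀ y ∈ Ioo (w.1 - t) (w.1 + t), y - w.1 ∈ Ioo (-t) t := fun y hy =>
    ⟨by linarith [hy.1], by linarith [hy.2]⟩
  have hs : ∀ y ∈ Ioo (w.1 - t) (w.1 + t),
      HasDerivAt (fun y => (φ (w, y - w.1)).2) (v (φ (w, y - w.1))).2 y := fun y hy' =>
    ((hd' _ (hy y hy')).comp_sub_const y w.1).snd
  refine ⟨fun y => (φ (w, y - w.1)).2.1, fun y => (φ (w, y - w.1)).2.2,
    ⟨fun y hy' => hAB hwA (hεB (hm _ (hy y hy'))).1, fun y hy' =>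
      (hs y hy').fst, fun y hy' => ?_⟩, by simp [h0], by simp [h0]⟩
  have k : HasDerivAt _ (v (φ (w, y - w.1))).2.2 y := (hs y hy').snd
  simpa [v, hfst _ (hy y hy')] using k

/-- Profiles can be continued to the left under a priori bounds. -/
lemma IsProfile.exists_extension {T : Set ℝ} {α β y1 y2 m M : ℝ} {u p : ℝ → ℝ}
    (h : IsProfile n (Ioi β ∩ T) u p) (hα : α < y1) (hβ : β < y1) (hy : y1 < y2) (hT : Iic y2 ⊆ T)
    (hTo : IsOpen T) (hm : 0 < m)
    (hconf : ∀ β', α ≤ β' → β' < y1 → ∀ u' p', IsProfile n (Ioi β' ∩ T) u' p' →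
      (∀ y, y1 ≤ y → u' y = u y ∧ p' y = p y) →
      ∀ y ∈ Ioc β' y1, m ≤ u' y ∧ u' y ≤ M ∧ |p' y| ≤ M) :
    ∃ u' p', IsProfile n (Ioi α ∩ T) u' p' ∧ ∀ y, y1 ≤ y → u' y = u y ∧ p' y = p y := by
  have hK : IsCompact (Icc α y1 ×ˢ (Icc m M ×ˢ Icc (-M) M)) :=
    isCompact_Icc.prod (isCompact_Icc.prod isCompact_Icc)
  obtain ⟨ε, hloc, hε⟩ := ((hK.eventually_forall_of_forall_eventually (x₀ := (0 : ℝ))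
    (P := fun ε w => ∃ u p, IsProfile n (Ioo (w.1 - ε) (w.1 + ε)) u p ∧ u w.1 = w.2.1 ∧
      p w.1 = w.2.2) fun z hz => eventually_exists_isProfile n (hm.trans_le hz.2.1.1)).filter_mono
        nhdsWithin_le_nhds |>.and
    (self_mem_nhdsWithin (s := Ioi 0))).exists
  replace hε : 0 < ε := hε
  have step (k : ℕ) : ∃ u' p', IsProfile n (Ioi (max α (max α β - k * (ε / 2))) ∩ T) u' p' ∧
      ∀ y, y1 ≤ y → u' y = u y ∧ p' y = p y := by
    induction k with
    | zero => exact ⟨u, p, h.mono (inter_subset_inter_left _ (Ioi_subset_Ioi (by simp))), by simp⟩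
    | succ k ih =>
      obtain ⟨u', p', h', he⟩ := ih
      push_cast
      set β' := max α (max α β - k * (ε / 2))
      have hb : β' < y1 := max_lt hα ((sub_le_self _ (by positivity)).trans_lt (max_lt hα hβ))
      set y := min (β' + ε / 2) y1
      have hy1 : y ≤ y1 := min_le_right _ _
      have hy2 : β' < y := lt_min (by linarith) hb
      obtain ⟨c1, c2, c3⟩ := hconf β' (le_max_left _ _) hb u' p' h' he y ⟨hy2, hy1⟩
      obtain ⟨u'', p'', h'', e1, e2⟩ := hloc (y, u' y, p' y)
        ⟨⟨(le_max_left _ _).trans hy2.le, hy1⟩, ⟨c1, c2⟩, abs_le.1 c3⟩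
      simp only at h'' e1 e2
      have hlt : y < min (y + ε) y2 := lt_min (by linarith) (by linarith)
      have hI := IsProfile.eqOn (s := Ioo (max β' (y - ε)) (min (y + ε) y2)) ordConnected_Ioo
        (h''.mono (Ioo_subset_Ioo (le_max_right _ _) (min_le_left _ _)))
        (h'.mono fun t ht => ⟨(le_max_left _ _).trans_lt ht.1, hT (ht.2.le.trans (min_le_right _ _))⟩)
        ⟨max_lt hy2 (by linarith), hlt⟩ e1 e2
      refine ⟨fun t => if t < y then u'' t else u' t, fun t => if t < y then p'' t else p' t,
        (((h''.mono (Ioo_subset_Ioo_right (min_le_left _ y2))).congr isOpen_Ioo fun t ht => ?_).union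
        ((h'.mono (inter_subset_inter_left T (Ioi_subset_Ioi (le_max_left _ (y - ε))))).congr
          (isOpen_Ioi.inter hTo) fun t ht => ?_)).mono fun t ht => ?_, fun t ht => ?_⟩
      · by_cases hc : t < y
        · simp [hc]
        · simp [hc, hI t ⟨max_lt (by linarith) (by linarith), ht.2⟩]
      · by_cases hc : t < y
        · simp [hc, hI t ⟨ht.1, hc.trans hlt⟩]
        · simp [hc]
      · rcases lt_or_ge t y with hc | hc
        · have k1 := max_lt_iff.1 (mem_Ioi.1 ht.1)
          have k2 : β' < t + ε / 2 := max_lt (by linarith) (by linarith)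
          exact .inl ⟨by linarith [min_le_left (β' + ε / 2) y1], hc.trans hlt⟩
        · exact .inr ⟨mem_Ioi.2 (max_lt (by linarith) (by linarith)), ht.2⟩
      · simpa [(hy1.trans ht).not_gt] using he t ht
  obtain ⟨k, hk⟩ := exists_nat_ge ((max α β - α) / (ε / 2))
  obtain ⟨u', p', k1, k2⟩ := step k
  rw [max_eq_left (by linarith [(div_le_iff₀ (half_pos hε)).1 hk])] at k1
  exact ⟨u', p', k1, k2⟩

/-! ### The conical profiles -/

lemma exists_isConical (hn : 2 ≤ n) {b : ℝ} (hb : 0 < b) : ∃ u p, IsConical n 4 b u p := by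
  obtain ⟨δ, hδ, Y, hY, U, P, h⟩ := exists_conical_family n hb
  have h1 := (h b (by simpa using hδ)).1
  have hN := IsCapArc.one_le_sub hn
  set M := 2 * n₋₁ + b ^ 2 * (Y + 1) ^ 2 + 1
  have hcon : ∀ {u p : ℝ → ℝ}, (∀ y, Y + 1 ≤ y → u y = U b y ∧ p y = P b y) → ∀ {β : ℝ},
      IsProfile n (Ioi β) u p → IsConical n β b u p := by
    intro u p he β hp
    refine ⟨hp, h1.slope.congr' ?_, h1.bdd.imp fun C hC => ?_⟩
    · filter_upwards [eventually_ge_atTop (Y + 1)] with y hy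
      rw [(he y hy).1]
    · filter_upwards [hC, eventually_ge_atTop (Y + 1)] with y hy hy'
      rwa [(he y hy').1, (he y hy').2]
  obtain ⟨u, p, k1, k2⟩ := IsProfile.exists_extension (n := n) (T := univ) (α := 4) (β := Y)
    (y1 := Y + 1) (y2 := Y + 2) (m := cylRadius n) (M := M) (u := U b) (p := P b)
    (by rw [inter_univ]; exact h1.profile) (by linarith) (by linarith) (by linarith)
    (subset_univ _) isOpen_univ (cylRadius_pos hn) (fun β hβ hβ' u p hp he y hy => by
      rw [inter_univ] at hp
      have hc := hcon he hp
      have e2 := hc.sq_lt hn hb hβ hy.1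
      have e3 := hc.p_pos hn hb hβ hy.1
      have e4 := hc.zeta_pos hn (by linarith) hy.1
      have hy4 : 4 < y := by linarith [hy.1]
      have e5 : u y < M := by
        have : b ^ 2 * y ^ 2 ≤ b ^ 2 * (Y + 1) ^ 2 := by have := hy.2; gcongr
        nlinarith [hc.profile.pos y hy.1]
      refine ⟨((hc.outside hn hb hβ hy.1).1).le, e5.le, ?_⟩
      rw [abs_of_pos e3]; nlinarith)
  rw [inter_univ] at k1
  exact ⟨u, p, hcon k2 k1⟩

open Classical in
/-- The conical profile of slope `b`. -/
def conU (n : ℕ) (b : ℝ) : ℝ → ℝ := if h : ∃ u p, IsConical n 4 b u p then h.choose else 0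

open Classical in
/-- The derivative of the conical profile of slope `b`. -/
def conP (n : ℕ) (b : ℝ) : ℝ → ℝ :=
  if h : ∃ u p, IsConical n 4 b u p then h.choose_spec.choose else 0

lemma isConical_con (hn : 2 ≤ n) {b : ℝ} (hb : 0 < b) : IsConical n 4 b (conU n b) (conP n b) := by
  have h := exists_isConical hn hb
  rw [conU, conP, dif_pos h, dif_pos h]
  exact h.choose_spec.choose_spec

lemma IsConical.eq_con (hn : 2 ≤ n) {b Y : ℝ} {u p : ℝ → ℝ} (hb : 0 < b) (hY : 4 ≤ Y)
    (h : IsConical n Y b u p) {y : ℝ} (hy : Y < y) : u y = conU n b y ∧ p y = conP n b y := by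
  have h' := (isConical_con hn hb).mono hY
  obtain ⟨Z, hZ⟩ := eventually_atTop.1 (h.eventually_eq hn hb h')
  set z := max Z Y + 1
  have hzY : Y < z := by linarith [le_max_right Z Y]
  have hzZ : Z < z := by linarith [le_max_left Z Y]
  refine h.profile.eqOn ordConnected_Ioi h'.profile hzY (hZ z hzZ.le) ?_ y hy
  refine (h.profile.deriv_u z hzY).unique ((h'.profile.deriv_u z hzY).congr_of_eventuallyEq ?_)
  filter_upwards [lt_mem_nhds hzZ] with t ht
  exact hZ t ht.le

/-- Smoothness of the conical profiles in the slope, with the asymptotics of the derivative. -/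
lemma contDiffAt_con (hn : 2 ≤ n) {b : ℝ} (hb : 0 < b) :
    (∀ y, 4 < y → ContDiffAt ℝ ∞ (fun z : ℝ × ℝ => conU n z.1 z.2) (b, y) ∧
      ContDiffAt ℝ ∞ (fun z : ℝ × ℝ => conP n z.1 z.2) (b, y)) ∧
    Tendsto (fun y => deriv (fun b => conU n b y) b / y) atTop (𝓝 1) ∧ ∃ C, ∀ᶠ y in atTop,
        |deriv (fun b => conU n b y) b - y * deriv (fun b => conP n b y) b| ≤ C := by
  obtain ⟨δ, hδ, Y, hY, U, P, h⟩ := exists_conical_family n hb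
  have hev : ∀ᶠ c in 𝓝 b, |c - b| < δ ∧ 0 < c :=
    Filter.Eventually.and (ball_mem_nhds b hδ) (lt_mem_nhds hb)
  have heq : ∀ y, Y < y → (fun c => conU n c y) =ᶠ[𝓝 b] (fun c => U c y) ∧
      (fun c => conP n c y) =ᶠ[𝓝 b] (fun c => P c y) := fun y hy =>
    ⟨hev.mono fun c hc => ((h c hc.1).1.eq_con hn hc.2 hY hy).1.symm,
      hev.mono fun c hc => ((h c hc.1).1.eq_con hn hc.2 hY hy).2.symm⟩
  obtain ⟨-, h2, h3, C, h4⟩ := h b (by simpa using hδ)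
  refine ⟨fun y hy => ?_, ?_, C, ?_⟩
  · have hY1 : Y < Y + 1 := by linarith
    exact contDiffAt_profile_family isOpen_Ioi ordConnected_Ioi (y0 := Y + 1)
      (hev.mono fun c hc => (isConical_con hn hc.2).profile) (show 4 < Y + 1 by linarith) hy
      ((h2 _ hY1).1.congr_of_eventuallyEq (heq _ hY1).1)
      ((h2 _ hY1).2.congr_of_eventuallyEq (heq _ hY1).2)
  · refine h3.congr' ?_
    filter_upwards [eventually_gt_atTop Y] with y hy
    rw [(heq y hy).1.deriv_eq]
  · filter_upwards [eventually_gt_atTop Y] with y hy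
    rw [(heq y hy).1.deriv_eq, (heq y hy).2.deriv_eq]; exact h4 y hy

/-- The conical profiles increase with the slope. -/
lemma deriv_con_pos (hn : 2 ≤ n) {b y : ℝ} (hb : 0 < b) (hy : 4 < y) :
    0 < deriv (fun b => conU n b y) b := by
  obtain ⟨hs, hlim, C, hC⟩ := contDiffAt_con hn hb
  have hR := cylRadius_pos hn
  have hcb := isConical_con hn hb
  set ψ : ℝ → ℝ := fun y => deriv (fun b => conU n b y) b
  set π : ℝ → ℝ := fun y => deriv (fun b => conP n b y) b
  have hnear : ∀ {t : ℝ}, 4 < t → ∀ᶠ z : ℝ × ℝ in 𝓝 (b, t), 0 < z.1 ∧ 4 < z.2 := fun ht =>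
    (continuous_fst.continuousAt.eventually (lt_mem_nhds hb)).and
      (continuous_snd.continuousAt.eventually (lt_mem_nhds ht))
  have hψd : ∀ t, 4 < t → HasDerivAt ψ (π t) t := fun t ht =>
    hasDerivAt_deriv_param (Φ := fun z : ℝ × ℝ => conU n z.1 z.2)
      (Ψ := fun z : ℝ × ℝ => conP n z.1 z.2) ((hs t ht).1.of_le two_le_infty)
      ((hnear ht).mono fun z hz => (isConical_con hn hz.1).profile.deriv_u z.2 hz.2)
  have hub : ∀ t, 4 < t → HasDerivAt (fun b => conU n b t) (ψ t) b := fun t ht =>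
    (((hs t ht).1.comp b (f := fun b : ℝ => (b, t)) (by fun_prop)).differentiableAt
      (by simp)).hasDerivAt
  have hpb : ∀ t, 4 < t → HasDerivAt (fun b => conP n b t) (π t) b := fun t ht =>
    (((hs t ht).2.comp b (f := fun b : ℝ => (b, t)) (by fun_prop)).differentiableAt
      (by simp)).hasDerivAt
  have hzb : ∀ t, 4 < t → HasDerivAt (fun b => conU n b t - t * conP n b t) (ψ t - t * π t) b :=
    fun t ht => (hub t ht).sub ((hpb t ht).const_mul t)
  have hzd : ∀ t, 4 < t → HasDerivAt (fun t => ψ t - t * π t)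
      (t * conP n b t * π t * (conU n b t - t * conP n b t - 2 * n₋₁ / conU n b t) +
        t / 2 * (1 + conP n b t ^ 2) * (ψ t - t * π t +
          2 * n₋₁ * ψ t / conU n b t ^ 2)) t := fun t ht => by
    have h2 : HasDerivAt (fun b => t / 2 * (1 + conP n b t ^ 2) *
        (conU n b t - t * conP n b t - 2 * n₋₁ / conU n b t)) _ b :=
      ((((hpb t ht).pow 2).const_add 1).const_mul (t / 2)).mul
        ((hzb t ht).sub ((hasDerivAt_const b (2 * n₋₁)).div (hub t ht)
          ((hcb.profile.pos t ht).ne')))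
    refine ((hasDerivAt_deriv_param (a := b) (r := t) (Φ := fun z : ℝ × ℝ => conU n z.1 z.2 - z.2 *
      conP n z.1 z.2) (Ψ := fun z : ℝ × ℝ => z.2 / 2 * (1 + conP n z.1 z.2 ^ 2) *
      (conU n z.1 z.2 - z.2 * conP n z.1 z.2 - 2 * n₋₁ / conU n z.1 z.2))
      (((hs t ht).1.sub (contDiffAt_snd.mul (hs t ht).2)).of_le two_le_infty)
      ((hnear ht).mono fun z hz => (isConical_con hn hz.1).hasDerivAt_zeta
      hz.2)).congr_of_eventuallyEq ?_).congr_deriv ?_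
    · filter_upwards [lt_mem_nhds ht] with s hs'
      exact (hzb s hs').deriv.symm
    · rw [h2.deriv]
      simp only [Pi.pow_apply]
      field_simp
      ring
  obtain ⟨z, hz1, hz2, hz3⟩ : ∃ z, y < z ∧ 0 < ψ z ∧ 0 < ψ z - z * π z + 2 * ψ z := by
    have h1 : ∀ᶠ t in atTop, 1 / 2 < ψ t / t := hlim.eventually (lt_mem_nhds (by norm_num))
    obtain ⟨z, k1, k2, k3, k4⟩ := (h1.and (hC.and ((eventually_gt_atTop y).and
      (eventually_gt_atTop C)))).exists
    have hz0 : 0 < z := by linarith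
    rw [lt_div_iff₀ hz0] at k1
    have k5 := (abs_le.1 k2).1
    exact ⟨z, k3, by linarith, by linarith⟩
  have hψc : ContinuousOn ψ (Ioc 4 z) := fun t ht => (hψd t ht.1).continuousAt.continuousWithinAt
  have hpos : ∀ t ∈ Ioc 4 z, (∀ s ∈ Ioc t z, 0 < ψ s - s * π s + 2 * ψ s) → 0 < ψ t := fun t ht hs'
    => by
    have ht0 : 0 < t := by linarith [ht.1]
    have k := le_of_hasDerivAt_nonneg (φ := fun s => -(ψ s / s ^ 3))
      (φ' := fun s => -((π s * s ^ 3 - ψ s * (3 * s ^ 2)) / (s ^ 3) ^ 2)) ht.2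
      (((hψc.mono fun s hs => ⟨ht.1.trans_le hs.1, hs.2⟩).div
        (by fun_prop) fun s hs => by have : 0 < s := by linarith [hs.1]
                                     positivity).neg)
      (fun s hs => by
        have hs0 : 0 < s := by linarith [hs.1]
        refine (((hψd s (ht.1.trans hs.1)).div (hasDerivAt_pow 3 s)
          (by positivity)).neg).congr_deriv ?_
        norm_num)
      (fun s hs => by
        have hs0 : 0 < s := by linarith [hs.1]
        have h1 := hs' s ⟨hs.1, hs.2.le⟩
        rw [neg_nonneg]
        refine div_nonpos_of_nonpos_of_nonneg ?_ (by positivity)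
        have : 0 ≤ s ^ 2 * (3 * ψ s - s * π s) := mul_nonneg (by positivity) (by linarith)
        linarith)
    have hz0 : 0 < z := by linarith
    have h1 : 0 < ψ z / z ^ 3 := div_pos hz2 (by positivity)
    have h2 : 0 < ψ t / t ^ 3 := by linarith
    exact (div_pos_iff_of_pos_right (pow_pos ht0 3)).1 h2
  have key : ∀ t ∈ Ioc 4 z, 0 < ψ t - t * π t + 2 * ψ t := by
    refine pos_of_last_zero (fun t ht => ?_) hz3 ?_
    · exact ((hzd t ht.1).continuousAt.add
        ((hψd t ht.1).continuousAt.const_mul 2)).continuousWithinAt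
    · intro t ht h0 hs'
      have hψt := hpos t ⟨ht.1, ht.2.le⟩ hs'
      refine ⟨_, ?_, (hzd t ht.1).add ((hψd t ht.1).const_mul 2)⟩
      have hp := hcb.p_pos hn hb le_rfl ht.1
      have hq := hcb.zeta_mul_lt hn hb le_rfl ht.1
      have ho := (hcb.outside hn hb le_rfl ht.1).1
      have hu := hcb.profile.pos t ht.1
      have ht4 : 4 < t := ht.1
      have e1 : t * π t = 3 * ψ t := by linarith
      have e2 : π t < ψ t := by nlinarith
      have e3 : 2 * n₋₁ * ψ t / conU n b t ^ 2 < ψ t := by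
        rw [div_lt_iff₀ (by positivity), ← (cylRadius_sq hn), mul_comm]
        gcongr
      have e4 : t * conP n b t * π t * (conU n b t - t * conP n b t -
          2 * n₋₁ / conU n b t) ≤ 0 := by
        rw [mul_right_comm t, e1]
        exact mul_nonpos_of_nonneg_of_nonpos (by positivity) (by linarith)
      have e5 : t / 2 * (1 + conP n b t ^ 2) * (ψ t - t * π t +
          2 * n₋₁ * ψ t / conU n b t ^ 2) ≤ t / 2 * (1 + conP n b t ^ 2) * (-ψ t) :=
        mul_le_mul_of_nonneg_left (by linarith) (by positivity)
      have e6 : 2 * ψ t ≤ t / 2 * (1 + conP n b t ^ 2) * ψ t :=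
        mul_le_mul_of_nonneg_right (by nlinarith [sq_nonneg (conP n b t)]) hψt.le
      linarith
  exact hpos y ⟨hy, hz1.le⟩ fun s hs => key s ⟨hy.trans hs.1, hs.2⟩

end

section

/-! ### The slope of the conical profile through a point -/

lemma conU_strictMonoOn (hn : 2 ≤ n) {y : ℝ} (hy : 4 < y) :
    StrictMonoOn (fun b => conU n b y) (Ioi 0) := by
  refine strictMonoOn_of_deriv_pos (convex_Ioi 0) (fun b hb => ?_) fun b hb => ?_
  · exact (((contDiffAt_con hn hb).1 y hy).1.comp b (f := fun b : ℝ => (b, y))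
      (by fun_prop)).continuousAt.continuousWithinAt
  · rw [interior_Ioi] at hb
    exact deriv_con_pos hn hb hy

lemma exists_slope (hn : 2 ≤ n) {y r : ℝ} (hy : 4 < y) (hr : cylRadius n < r) :
    ∃ b, 0 < b ∧ conU n b y = r := by
  have hR := cylRadius_pos hn
  have hR2 := cylRadius_sq hn
  have hy0 : 0 < y := by linarith
  set b1 := √(r ^ 2 - cylRadius n ^ 2) / y with hb1
  have hd : 0 < r ^ 2 - cylRadius n ^ 2 := by nlinarith
  have h1 : 0 < b1 := div_pos (sqrt_pos.2 hd) hy0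
  have h2 : b1 ^ 2 * y ^ 2 = r ^ 2 - cylRadius n ^ 2 := by
    rw [hb1, div_pow, sq_sqrt hd.le]; field_simp
  have h3 : conU n b1 y < r := by
    have := (isConical_con hn h1).sq_lt hn h1 le_rfl hy
    exact lt_of_pow_lt_pow_left₀ 2 (by linarith) (by linarith)
  have h4 : 0 < r / y := by have := hR.trans hr; positivity
  have h5 : r < conU n (r / y) y := by
    have := (isConical_con hn h4).slope_mul_lt hn (by norm_num) hy
    rwa [div_mul_cancel₀ _ hy0.ne'] at this
  have h6 : b1 < r / y := by
    by_contra! hc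
    have : conU n (r / y) y ≤ conU n b1 y := (conU_strictMonoOn hn hy).monotoneOn h4 h1 hc
    linarith
  have hc : ContinuousOn (fun b => conU n b y) (Icc b1 (r / y)) := fun b hb =>
    (((contDiffAt_con hn (h1.trans_le hb.1)).1 y hy).1.comp b (f := fun b : ℝ => (b, y))
      (by fun_prop)).continuousAt.continuousWithinAt
  obtain ⟨b, hb, hb'⟩ := intermediate_value_Icc h6.le hc ⟨h3.le, h5.le⟩
  exact ⟨b, h1.trans_le hb.1, hb'⟩

open Classical in
/-- The slope of the conical profile through `(y, r)`. -/
def conB (n : ℕ) (y r : ℝ) : ℝ := if h : ∃ b, 0 < b ∧ conU n b y = r then h.choose else 0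

lemma conB_spec (hn : 2 ≤ n) {y r : ℝ} (hy : 4 < y) (hr : cylRadius n < r) :
    0 < conB n y r ∧ conU n (conB n y r) y = r := by
  have h := exists_slope hn hy hr
  rw [conB, dif_pos h]
  exact h.choose_spec

lemma conB_eq (hn : 2 ≤ n) {y r b : ℝ} (hy : 4 < y) (hb : 0 < b) (h : conU n b y = r) :
    conB n y r = b := by
  have hr : cylRadius n < r := by rw [← h]; exact ((isConical_con hn hb).outside hn hb le_rfl hy).1
  exact (conU_strictMonoOn hn hy).injOn (conB_spec hn hy hr).1 hb
    ((conB_spec hn hy hr).2.trans h.symm)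

lemma contDiffAt_conB (hn : 2 ≤ n) {y r : ℝ} (hy : 4 < y) (hr : cylRadius n < r) :
    ContDiffAt ℝ ∞ (fun z : ℝ × ℝ => conB n z.1 z.2) (y, r) := by
  obtain ⟨h1, h2⟩ := conB_spec hn hy hr
  set b := conB n y r
  have hs := ((contDiffAt_con hn h1).1 y hy).1
  obtain ⟨φ, p1, p2, p3⟩ := exists_smooth_implicit (E := ℝ × ℝ)
    (Φ := fun z => conU n z.2 z.1.1 - z.1.2) (x := (y, r)) (r := b)
    (by
      have : ContDiffAt ℝ ∞ (fun z : (ℝ × ℝ) × ℝ => conU n z.2 z.1.1) ((y, r), b) :=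
        ContDiffAt.comp (g := fun z : ℝ × ℝ => conU n z.1 z.2)
          (f := fun z : (ℝ × ℝ) × ℝ => (z.2, z.1.1)) ((y, r), b) hs (by fun_prop)
      fun_prop)
    (((hs.comp b (f := fun b : ℝ => (b, y)) (by fun_prop)).differentiableAt
      (by simp)).hasDerivAt.sub_const r) (deriv_con_pos hn h1 hy).ne'
  refine p1.congr_of_eventuallyEq ?_
  have e1 : ∀ᶠ z : ℝ × ℝ in 𝓝 (y, r), 4 < z.1 := continuousAt_fst.eventually (lt_mem_nhds hy)
  have e2 : ∀ᶠ z : ℝ × ℝ in 𝓝 (y, r), 0 < φ z :=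
    p1.continuousAt.eventually (by rw [p2]; exact lt_mem_nhds h1)
  filter_upwards [e1, e2, p3] with z z1 z2 z3
  simp only [h2, sub_self] at z3
  exact conB_eq hn z1 z2 (by linarith)

lemma contDiffAt_conP_conB (hn : 2 ≤ n) {y r : ℝ} (hy : 4 < y) (hr : cylRadius n < r) :
    ContDiffAt ℝ ∞ (fun z : ℝ × ℝ => conP n (conB n z.1 z.2) z.1) (y, r) := by
  obtain ⟨h1, h2⟩ := conB_spec hn hy hr
  exact ContDiffAt.comp (g := fun z : ℝ × ℝ => conP n z.1 z.2)
    (f := fun z : ℝ × ℝ => (conB n z.1 z.2, z.1)) (y, r) ((contDiffAt_con hn h1).1 y hy).2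
    ((contDiffAt_conB hn hy hr).prodMk contDiffAt_fst)

/-! ### The leaf through a point -/

/-- A label for the leaf through the points with `‖x‖ = r` at height `y`: minus the inverse of the
tip inside the cylinder, the slope outside. -/
def label (n : ℕ) (y r : ℝ) : ℝ :=
  if r < cylRadius n then -(capTip n y r)⁻¹ else if r = cylRadius n then 0 else conB n y r

variable {Y A y r : ℝ}

lemma label_inside (hr : r < cylRadius n) : label n y r = -(capTip n y r)⁻¹ := if_pos hr

lemma label_cylinder : label n y (cylRadius n) = 0 := by simp [label]

lemma label_outside (hr : cylRadius n < r) : label n y r = conB n y r := by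
  rw [label, if_neg hr.not_gt, if_neg hr.ne']

lemma sq_lt_of_lt_cylRadius (hn : 2 ≤ n) (hr0 : 0 ≤ r) (hr : r < cylRadius n) :
    r ^ 2 < 2 * n₋₁ := by
  rw [← cylRadius_sq hn]; gcongr

/-- The label determines the leaf. -/
lemma HighFrom.label_eq_iff (H : HighFrom n Y A) (hn : 2 ≤ n) (hy : Y < y) (hA : A ≤ y)
    (h4 : 4 < y) (hr : 0 ≤ r) :
    (∀ a, 0 < a → (label n y r = -a⁻¹ ↔ y ≤ a ∧ r = capU n a y)) ∧
    (label n y r = 0 ↔ r = cylRadius n) ∧ ∀ b, 0 < b → (label n y r = b ↔ r = conU n b y) := by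
  have hin : ∀ a, y ≤ a → capU n a y < cylRadius n := fun a ha =>
    lt_of_pow_lt_pow_left₀ 2 (cylRadius_pos hn).le
      (by rw [cylRadius_sq hn]; exact H.capU_sq_lt (hA.trans ha) ⟨hy, ha⟩)
  rcases lt_trichotomy r (cylRadius n) with h | h | h
  · obtain ⟨h1, h2⟩ := H.capTip_spec hy hA hr (sq_lt_of_lt_cylRadius hn hr h)
    rw [label_inside h]
    have h3 : 0 < (capTip n y r)⁻¹ := inv_pos.2 (by linarith)
    refine ⟨fun a ha => ⟨fun e => ?_, fun e => ?_⟩, ⟨fun e => by linarith, fun e => by linarith⟩,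
      fun b hb => ⟨fun e => by linarith, fun e => ?_⟩⟩
    · have : capTip n y r = a := inv_injective (neg_injective e)
      rw [← this]
      exact ⟨h1, h2.symm⟩
    · rw [H.capTip_eq hy hA e.1 e.2.symm]
    · have := ((isConical_con hn hb).outside hn hb le_rfl h4).1; linarith
  · rw [h, label_cylinder]
    refine ⟨fun a ha => ⟨fun e => ?_, fun e => ?_⟩, by simp, fun b hb =>
      ⟨fun e => by linarith, fun e => ?_⟩⟩
    · have := inv_pos.2 ha; linarith
    · have := hin a e.1; linarith [e.2]
    · have := ((isConical_con hn hb).outside hn hb le_rfl h4).1; linarith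
  · obtain ⟨h1, h2⟩ := conB_spec hn h4 h
    rw [label_outside h]
    refine ⟨fun a ha => ⟨fun e => ?_, fun e => ?_⟩, ⟨fun e => by linarith, fun e => by linarith⟩,
      fun b hb => ⟨fun e => by rw [← e, h2], fun e => conB_eq hn h4 hb e.symm⟩⟩
    · have := inv_pos.2 ha; linarith
    · have := hin a e.1; linarith [e.2]

lemma HighFrom.capTip_sq_ge (H : HighFrom n Y A) (hn : 2 ≤ n) (hy : Y < y) (hA : A ≤ y)
    (hr : 0 ≤ r) (hrR : r < cylRadius n) :
    n₋₁ / capTip n y r ^ 2 * y ^ 2 ≤ cylRadius n ^ 2 - r ^ 2 := by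
  obtain ⟨h1, h2⟩ := H.capTip_spec hy hA hr (sq_lt_of_lt_cylRadius hn hr hrR)
  have h := H _ (hA.trans h1)
  obtain ⟨ρ, k1, k2, k3⟩ := H.exists_gt (hA.trans h1) ⟨hy, h1⟩
  obtain ⟨-, -, k4⟩ := H.capU_spec (hA.trans h1) ⟨hy.le, h1⟩
  rw [h2] at k1 k4
  have := IsCapArc.sub_sq_ge k2 hn h.arcM_le' h.arcM_le k3 h.log_ge h.log_le ⟨hr, k1⟩
  rwa [k4, ← cylRadius_sq hn] at this

/-- The caps become vertical near the cylinder. -/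
lemma HighFrom.slope_ge (H : HighFrom n Y A) (hn : 2 ≤ n) (hy : Y < y) (hA : A ≤ y)
    (hr : 1 ≤ r) (hrR : r < cylRadius n) :
    13 / 28 * r * y ≤ (cylRadius n ^ 2 - r ^ 2) * arcSlope (capP n (capTip n y r)) r := by
  have hr0 : 0 ≤ r := by linarith
  obtain ⟨h1, h2⟩ := H.capTip_spec hy hA hr0 (sq_lt_of_lt_cylRadius hn hr0 hrR)
  have h := H _ (hA.trans h1)
  obtain ⟨ρ, k1, k2, k3⟩ := H.exists_gt (hA.trans h1) ⟨hy, h1⟩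
  obtain ⟨-, -, k4⟩ := H.capU_spec (hA.trans h1) ⟨hy.le, h1⟩
  rw [h2] at k1 k4
  have e1 := IsCapArc.mul_slope_ge k2 hn h.arcM_le' h.arcM_le k3 ⟨hr, k1⟩
  have e2 := H.capTip_sq_ge hn hy hA hr0 hrR
  rw [k4] at e1
  have hN := IsCapArc.one_le_sub hn
  have hy0 : 0 < y := by linarith [h.arcM_le, h.arcM_ge]
  set T := capTip n y r
  have hT : 0 < T := h.pos
  set g := arcSlope (capP n T) r
  have hd : 0 < cylRadius n ^ 2 - r ^ 2 := by
    have := sq_lt_of_lt_cylRadius hn hr0 hrR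
    rw [cylRadius_sq hn]; linarith
  have e3 : n₋₁ * y ^ 2 ≤ (cylRadius n ^ 2 - r ^ 2) * T ^ 2 := by
    rw [div_mul_eq_mul_div, div_le_iff₀ (by positivity)] at e2
    exact e2
  have e4 : (13 / 14 * r) * (n₋₁ * y ^ 2) ≤ (13 / 14 * r) * ((cylRadius n ^ 2 - r ^ 2) * T ^ 2) :=
    mul_le_mul_of_nonneg_left e3 (by positivity)
  have e5 := mul_le_mul_of_nonneg_left e1 hd.le
  have e6 : (2 * n₋₁ * y) * (13 / 28 * r * y) ≤
      (2 * n₋₁ * y) * ((cylRadius n ^ 2 - r ^ 2) * g) := by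
    linarith
  exact le_of_mul_le_mul_left e6 (by positivity)

lemma HighFrom.label_strictMonoOn (H : HighFrom n Y A) (hn : 2 ≤ n) (hy : Y < y) (hA : A ≤ y)
    (h4 : 4 < y) : StrictMonoOn (label n y) (Ici 0) := by
  intro r hr r' hr' hlt
  have hr : 0 ≤ r := hr
  have hneg : ∀ {r}, 0 ≤ r → r < cylRadius n → label n y r < 0 := fun h0 h => by
    obtain ⟨h1, h2⟩ := H.capTip_spec hy hA h0 (sq_lt_of_lt_cylRadius hn h0 h)
    rw [label_inside h, neg_lt_zero]; exact inv_pos.2 (by linarith)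
  have hpos : ∀ {r}, cylRadius n < r → 0 < label n y r := fun h => by
    rw [label_outside h]; exact (conB_spec hn h4 h).1
  rcases lt_trichotomy r' (cylRadius n) with h | h | h
  · obtain ⟨h1, h2⟩ := H.capTip_spec hy hA hr (sq_lt_of_lt_cylRadius hn hr (hlt.trans h))
    obtain ⟨h3, h4⟩ := H.capTip_spec hy hA hr' (sq_lt_of_lt_cylRadius hn hr' h)
    have h5 : capTip n y r < capTip n y r' := by
      rw [← (H.strictMono_tip hy hA).lt_iff_lt h1 h3]; simp only [h2, h4, hlt]
    rw [label_inside h, label_inside (hlt.trans h), neg_lt_neg_iff]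
    exact inv_strictAnti₀ (by linarith) h5
  · subst h; rw [label_cylinder]; exact hneg hr hlt
  · rcases lt_trichotomy r (cylRadius n) with h' | h' | h'
    · exact (hneg hr h').trans (hpos h)
    · subst h'; rw [label_cylinder]; exact hpos h
    · obtain ⟨h1, h2⟩ := conB_spec hn h4 h
      obtain ⟨h1', h2'⟩ := conB_spec hn h4 h'
      rw [label_outside h, label_outside h']
      rw [← (conU_strictMonoOn hn h4).lt_iff_lt h1' h1]; simp only [h2, h2', hlt]

/-- The label is smooth inside the cylinder, as a function of `y` and `r²`. -/
lemma HighFrom.exists_smooth_label (H : HighFrom n Y A) (hn : 2 ≤ n) (hy : Y < y) (hA : A < y)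
    (h0 : 0 < y) (hr : 0 ≤ r) (hrR : r < cylRadius n) :
    ∃ L : ℝ × ℝ → ℝ, ContDiffAt ℝ ∞ L (y, r ^ 2) ∧
      ∀ᶠ l : ℝ × ℝ in 𝓝 (y, r ^ 2), 0 ≤ l.2 → L l = label n l.1 √l.2 := by
  have hr2 := sq_lt_of_lt_cylRadius hn hr hrR
  obtain ⟨L, P, h1, -, h3⟩ := H.exists_smooth_tip hy hA hr hr2
  obtain ⟨k1, -⟩ := H.capTip_spec hy hA.le hr hr2
  have e : L (y, r ^ 2) = capTip n y r := by
    have := (h3.self_of_nhds (sq_nonneg r)).1; rwa [sqrt_sq hr] at this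
  refine ⟨fun l => -(L l)⁻¹, (h1.inv (by rw [e]; linarith)).neg, ?_⟩
  have e1 : ∀ᶠ l : ℝ × ℝ in 𝓝 (y, r ^ 2), l.2 < 2 * n₋₁ :=
    continuousAt_snd.eventually (gt_mem_nhds hr2)
  filter_upwards [h3, e1] with l l1 l2 l0
  rw [(l1 l0).1, label_inside]
  exact Real.sqrt_lt_sqrt l0 l2

lemma HighFrom.continuousAt_label (H : HighFrom n Y A) (hn : 2 ≤ n) (hy : Y < y) (hA : A < y)
    (h4 : 4 < y) (hr : 0 < r) : ContinuousAt (fun z : ℝ × ℝ => label n z.1 z.2) (y, r) := by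
  have hyn : ∀ᶠ z : ℝ × ℝ in 𝓝 (y, r), Y < z.1 ∧ A < z.1 ∧ 4 < z.1 :=
    (continuousAt_fst.eventually (lt_mem_nhds hy)).and
      ((continuousAt_fst.eventually (lt_mem_nhds hA)).and
        (continuousAt_fst.eventually (lt_mem_nhds h4)))
  have hrn : ∀ᶠ z : ℝ × ℝ in 𝓝 (y, r), 0 < z.2 := continuousAt_snd.eventually (lt_mem_nhds hr)
  rcases lt_trichotomy r (cylRadius n) with h | h | h
  · obtain ⟨L, h1, h2⟩ := H.exists_smooth_label hn hy hA (by linarith) hr.le h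
    have hc : Tendsto (fun z : ℝ × ℝ => (z.1, z.2 ^ 2)) (𝓝 (y, r)) (𝓝 (y, r ^ 2)) :=
      (by fun_prop : Continuous fun z : ℝ × ℝ => (z.1, z.2 ^ 2)).tendsto (y, r)
    have k : ContinuousAt (fun z : ℝ × ℝ => L (z.1, z.2 ^ 2)) (y, r) :=
      ContinuousAt.comp (g := L) (f := fun z : ℝ × ℝ => (z.1, z.2 ^ 2)) h1.continuousAt hc
    refine k.congr ?_
    filter_upwards [hc.eventually h2, hrn] with z z1 z2
    rw [z1 (sq_nonneg _), sqrt_sq z2.le]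
  · subst h
    have hv : label n y (cylRadius n) = 0 := label_cylinder
    rw [ContinuousAt, hv, tendsto_order]
    refine ⟨fun c hc => ?_, fun c hc => ?_⟩
    · have hN := IsCapArc.one_le_sub hn
      have k : ∀ᶠ z : ℝ × ℝ in 𝓝 (y, cylRadius n), cylRadius n ^ 2 - z.2 ^ 2 < c ^ 2 := by
        have : ContinuousAt (fun z : ℝ × ℝ => cylRadius n ^ 2 - z.2 ^ 2) (y, cylRadius n) := by
          fun_prop
        refine this.eventually (gt_mem_nhds ?_)
        simp only [sub_self]; exact sq_pos_of_neg hc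
      filter_upwards [k, hyn, hrn] with z z1 z2 z3
      rcases lt_or_ge z.2 (cylRadius n) with h | h
      · have k1 := H.capTip_sq_ge hn z2.1 z2.2.1.le z3.le h
        obtain ⟨k2, -⟩ := H.capTip_spec z2.1 z2.2.1.le z3.le (sq_lt_of_lt_cylRadius hn z3.le h)
        have hT : 0 < capTip n z.1 z.2 := by linarith
        rw [label_inside h]
        have k3 : (capTip n z.1 z.2)⁻¹ ^ 2 < (-c) ^ 2 := by
          have k4 : (capTip n z.1 z.2)⁻¹ ^ 2 ≤ n₋₁ / capTip n z.1 z.2 ^ 2 * z.1 ^ 2 := by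
            rw [inv_pow, div_eq_mul_inv, mul_right_comm]
            refine le_mul_of_one_le_left (by positivity) ?_
            nlinarith
          rw [neg_sq]
          linarith
        have := lt_of_pow_lt_pow_left₀ 2 (by linarith) k3
        linarith
      · have := (H.label_strictMonoOn hn z2.1 z2.2.1.le z2.2.2).monotoneOn (show cylRadius n ∈ Ici 0
          from (cylRadius_pos hn).le) z3.le h
        rw [label_cylinder] at this
        linarith
    · have k : ∀ᶠ z : ℝ × ℝ in 𝓝 (y, cylRadius n), z.2 < conU n c z.1 := by
        have k1 : ContinuousAt (fun z : ℝ × ℝ => conU n c z.1) (y, cylRadius n) :=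
          ContinuousAt.comp (g := conU n c) (f := fun z : ℝ × ℝ => z.1)
            ((isConical_con hn hc).profile.deriv_u y h4).continuousAt continuousAt_fst
        exact continuousAt_snd.eventually_lt k1 ((isConical_con hn hc).outside hn hc le_rfl h4).1
      filter_upwards [k, hyn, hrn] with z z1 z2 z3
      have := H.label_strictMonoOn hn z2.1 z2.2.1.le z2.2.2 z3.le
        (show conU n c z.1 ∈ Ici 0 by exact (z3.trans z1).le) z1
      rwa [((H.label_eq_iff hn z2.1 z2.2.1.le z2.2.2 (z3.trans z1).le).2.2 c hc).2 rfl] at this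
  · refine (contDiffAt_conB hn h4 h).continuousAt.congr ?_
    filter_upwards [continuousAt_snd.eventually (lt_mem_nhds h)] with z hz
    exact (label_outside hz).symm

/-- Inside the cylinder the label increases with the height. -/
lemma HighFrom.label_strictMonoOn_height (H : HighFrom n Y A) (hn : 2 ≤ n) (hr : 0 ≤ r)
    (hrR : r < cylRadius n) {y y' : ℝ} (hy : Y < y) (hA : A ≤ y) (hY : 0 ≤ Y) (hyy : y < y') :
    label n y r < label n y' r := by
  have hr2 := sq_lt_of_lt_cylRadius hn hr hrR
  obtain ⟨h1, h2⟩ := H.capTip_spec hy hA hr hr2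
  obtain ⟨h3, h4⟩ := H.capTip_spec (hy.trans hyy) (hA.trans hyy.le) hr hr2
  rw [label_inside hrR, label_inside hrR, neg_lt_neg_iff]
  refine inv_strictAnti₀ (by linarith) ?_
  by_contra! hc
  have k1 := (H.strictMono_tip hy hA).monotoneOn (h3.trans' hyy.le) h1 hc
  simp only [h2] at k1
  have k2 := H.strictAntiOn (hA.trans (hyy.le.trans h3)) ⟨hy.le, hyy.le.trans h3⟩
    ⟨(hy.trans hyy).le, h3⟩ hyy
  simp only [h4] at k2
  linarith

end

section

/-! ### The mean curvature of rotationally symmetric hypersurfaces -/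

/-- The pairing `(y, x) ↦ pt y x` as a continuous linear equivalence. -/
def ptL (n : ℕ) : (ℝ × Rn n) ≃L[ℝ] Amb n := (WithLp.prodContinuousLinearEquiv 2 ℝ ℝ (Rn n)).symm

@[simp] theorem pt_fst (y : ℝ) (x : Rn n) : (pt y x).fst = y := rfl

@[simp] theorem pt_snd (y : ℝ) (x : Rn n) : (pt y x).snd = x := rfl

lemma pt_eta (q : Amb n) : pt q.fst q.snd = q := rfl

lemma amb_ext {p q : Amb n} (h : p.fst = q.fst) (h' : p.snd = q.snd) : p = q := by
  rw [← pt_eta p, ← pt_eta q, h, h']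

lemma inner_amb (p q : Amb n) : ⟪p, q⟫ = p.fst * q.fst + ⟪p.snd, q.snd⟫ := by
  rw [WithLp.prod_inner_apply]
  simp [mul_comm]

lemma norm_sq_amb (p : Amb n) : ‖p‖ ^ 2 = p.fst ^ 2 + ‖p.snd‖ ^ 2 := by
  rw [← real_inner_self_eq_norm_sq, inner_amb, real_inner_self_eq_norm_sq]
  ring

lemma hasDerivAt_pt {a : ℝ → ℝ} {x : ℝ → Rn n} {a' t : ℝ} {x' : Rn n} (ha : HasDerivAt a a' t)
    (hx : HasDerivAt x x' t) : HasDerivAt (fun t => pt (a t) (x t)) (pt a' x') t :=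
  (ptL n).hasFDerivAt.comp_hasDerivAt t (ha.prodMk hx)

lemma contDiff_pt {k : WithTop ℕ∞} : ContDiff ℝ k fun z : ℝ × Rn n => pt z.1 z.2 := (ptL n).contDiff

lemma hasDerivAt_line (z v : Rn n) (t : ℝ) : HasDerivAt (fun t : ℝ => z + t • v) v t :=
  (((hasDerivAt_id t).smul_const v).const_add z).congr_deriv (one_smul ℝ v)

lemma hasDerivAt_line_sq (z v : Rn n) :
    HasDerivAt (fun t : ℝ => ‖z + t • v‖ ^ 2) (2 * ⟪z, v⟫) 0 := by
  have := (hasDerivAt_line z v 0).norm_sq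
  simpa using this

/-- The map `F` has near `z` the form `(A(‖w‖²), B(‖w‖²) w)`. -/
structure IsRadialAt (F : Rn n → Amb n) (A A1 B B1 : ℝ → ℝ) (a2 b2 : ℝ) (z : Rn n) : Prop where
  eq : F =ᶠ[𝓝 z] fun w => pt (A (‖w‖ ^ 2)) (B (‖w‖ ^ 2) • w)
  deriv_A : ∀ᶠ s in 𝓝 (‖z‖ ^ 2), HasDerivAt A (A1 s) s
  deriv_B : ∀ᶠ s in 𝓝 (‖z‖ ^ 2), HasDerivAt B (B1 s) s
  deriv_A1 : HasDerivAt A1 a2 (‖z‖ ^ 2)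
  deriv_B1 : HasDerivAt B1 b2 (‖z‖ ^ 2)
  smooth : ContDiffAt ℝ 2 F z

namespace IsRadialAt

variable {F : Rn n → Amb n} {A A1 B B1 : ℝ → ℝ} {a2 b2 : ℝ} {z : Rn n}

lemma eventually_fderiv (h : IsRadialAt F A A1 B B1 a2 b2 z) :
    ∀ᶠ w in 𝓝 z, ∀ v, fderiv ℝ F w v = pt (2 * A1 (‖w‖ ^ 2) * ⟪w, v⟫)
      ((2 * B1 (‖w‖ ^ 2) * ⟪w, v⟫) • w + B (‖w‖ ^ 2) • v) := by
  have hc : Tendsto (fun w : Rn n => ‖w‖ ^ 2) (𝓝 z) (𝓝 (‖z‖ ^ 2)) :=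
    (by fun_prop : Continuous fun w : Rn n => ‖w‖ ^ 2).tendsto z
  filter_upwards [h.eq.eventuallyEq_nhds, hc.eventually h.deriv_A, hc.eventually h.deriv_B,
    h.smooth.eventually (by simp)] with w h1 h2 h3 h4 v
  have k1 : HasDerivAt (fun t : ℝ => F (w + t • v)) (fderiv ℝ F w v) 0 :=
    (h4.differentiableAt (by simp)).hasFDerivAt.hasLineDerivAt v
  have hl : Tendsto (fun t : ℝ => w + t • v) (𝓝 0) (𝓝 w) := by
    have := (hasDerivAt_line w v 0).continuousAt.tendsto; simpa using this
  have hs := hasDerivAt_line_sq w v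
  have e0 : ‖w + (0 : ℝ) • v‖ ^ 2 = ‖w‖ ^ 2 := by simp
  have k2 : HasDerivAt (fun t : ℝ => A (‖w + t • v‖ ^ 2)) (A1 (‖w‖ ^ 2) * (2 * ⟪w, v⟫)) 0 :=
    HasDerivAt.comp (0 : ℝ) (by rw [e0]; exact h2) hs
  have k3 : HasDerivAt (fun t : ℝ => B (‖w + t • v‖ ^ 2)) (B1 (‖w‖ ^ 2) * (2 * ⟪w, v⟫)) 0 :=
    HasDerivAt.comp (0 : ℝ) (by rw [e0]; exact h3) hs
  rw [k1.unique ((hasDerivAt_pt k2 (k3.smul (hasDerivAt_line w v 0))).congr_of_eventuallyEq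
    (f₁ := fun t : ℝ => F (w + t • v)) (hl.eventually h1))]
  refine amb_ext ?_ ?_
  · simp only [pt_fst]; ring
  · simp only [pt_snd, zero_smul, add_zero]
    rw [add_comm]
    congr 2
    ring

lemma fderiv_apply (h : IsRadialAt F A A1 B B1 a2 b2 z) (v : Rn n) :
    fderiv ℝ F z v = pt (2 * A1 (‖z‖ ^ 2) * ⟪z, v⟫)
      ((2 * B1 (‖z‖ ^ 2) * ⟪z, v⟫) • z + B (‖z‖ ^ 2) • v) :=
  h.eventually_fderiv.self_of_nhds v

lemma hess_apply (h : IsRadialAt F A A1 B B1 a2 b2 z) (w v : Rn n) : fderiv ℝ (fderiv ℝ F) z w v =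
      pt (4 * a2 * ⟪z, w⟫ * ⟪z, v⟫ + 2 * A1 (‖z‖ ^ 2) * ⟪w, v⟫)
        ((4 * b2 * ⟪z, w⟫ * ⟪z, v⟫ + 2 * B1 (‖z‖ ^ 2) * ⟪w, v⟫) • z
          + (2 * B1 (‖z‖ ^ 2) * ⟪z, v⟫) • w + (2 * B1 (‖z‖ ^ 2) * ⟪z, w⟫) • v) := by
  have hd : DifferentiableAt ℝ (fderiv ℝ F) z :=
    (h.smooth.fderiv_right (m := 1) (by norm_num)).differentiableAt (by simp)
  have k0 : HasDerivAt (fun t : ℝ => fderiv ℝ F (z + t • w)) (fderiv ℝ (fderiv ℝ F) z w) 0 :=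
    hd.hasFDerivAt.hasLineDerivAt w
  have k1 : HasDerivAt (fun t : ℝ => fderiv ℝ F (z + t • w) v) (fderiv ℝ (fderiv ℝ F) z w v) 0 := by
    simpa using k0.clm_apply (hasDerivAt_const (0 : ℝ) v)
  have hl : Tendsto (fun t : ℝ => z + t • w) (𝓝 0) (𝓝 z) := by
    have := (hasDerivAt_line z w 0).continuousAt.tendsto; simpa using this
  have hs := hasDerivAt_line_sq z w
  have e0 : ‖z + (0 : ℝ) • w‖ ^ 2 = ‖z‖ ^ 2 := by simp
  have kA : HasDerivAt (fun t : ℝ => A1 (‖z + t • w‖ ^ 2)) (a2 * (2 * ⟪z, w⟫)) 0 :=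
    HasDerivAt.comp (0 : ℝ) (by rw [e0]; exact h.deriv_A1) hs
  have kB1 : HasDerivAt (fun t : ℝ => B1 (‖z + t • w‖ ^ 2)) (b2 * (2 * ⟪z, w⟫)) 0 :=
    HasDerivAt.comp (0 : ℝ) (by rw [e0]; exact h.deriv_B1) hs
  have kB : HasDerivAt (fun t : ℝ => B (‖z + t • w‖ ^ 2)) (B1 (‖z‖ ^ 2) * (2 * ⟪z, w⟫)) 0 :=
    HasDerivAt.comp (0 : ℝ) (by rw [e0]; exact h.deriv_B.self_of_nhds) hs
  have ki : HasDerivAt (fun t : ℝ => ⟪z + t • w, v⟫) ⟪w, v⟫ 0 := by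
    simpa using (hasDerivAt_line z w 0).inner ℝ (hasDerivAt_const (0 : ℝ) v)
  rw [k1.unique ((hasDerivAt_pt ((kA.const_mul 2).mul ki)
    ((((kB1.const_mul 2).mul ki).smul (hasDerivAt_line z w 0)).add
    (kB.smul_const v))).congr_of_eventuallyEq (f₁ := fun t : ℝ => fderiv ℝ F (z + t • w) v)
    ((hl.eventually h.eventually_fderiv).mono fun t ht => ht v))]
  refine amb_ext ?_ ?_
  · simp only [pt_fst, zero_smul, add_zero]; ring
  · simp only [pt_snd, zero_smul, add_zero, Pi.mul_apply]
    module

end IsRadialAt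

lemma inner_single (z : Rn n) (i : Fin n) : ⟪z, EuclideanSpace.single i (1 : ℝ)⟫ = z i := by
  simp [EuclideanSpace.inner_single_right]

lemma sum_sq_coord (z : Rn n) : ∑ i, z i * z i = ‖z‖ ^ 2 := by
  rw [EuclideanSpace.norm_sq_eq]
  exact Finset.sum_congr rfl fun i _ => by rw [norm_eq_abs, sq_abs, sq]

/-- The trace of a form with respect to a metric, both of which are isotropic in `z^⊥`. -/
lemma sum_inv_mul {z : Rn n} {β c P Q : ℝ} (hβ : β ≠ 0) (hE : β + c * ‖z‖ ^ 2 ≠ 0) :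
    ∑ i, ∑ j, (Matrix.of fun i j : Fin n => (if i = j then β else 0) + c * (z i * z j))⁻¹ i j *
      ((if i = j then P else 0) + Q * (z i * z j)) =
      n₋₁ * P / β + (P + Q * ‖z‖ ^ 2) / (β + c * ‖z‖ ^ 2) := by
  have hs := sum_sq_coord z
  set s := ‖z‖ ^ 2
  have hinv : (Matrix.of fun i j : Fin n => (if i = j then β else 0) + c * (z i * z j))⁻¹ =
      Matrix.of fun i j : Fin n => (if i = j then β⁻¹ else 0) + -(c / (β * (β + c * s))) * (z i * z j) := by
    refine Matrix.inv_eq_right_inv ?_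
    ext i k
    have e : ∀ j, ((if i = j then β else 0) + c * (z i * z j)) *
        ((if j = k then β⁻¹ else 0) + -(c / (β * (β + c * s))) * (z j * z k)) =
        (if i = j then β * ((if j = k then β⁻¹ else 0) + -(c / (β * (β + c * s))) * (z j * z k)) else 0)
        + (if j = k then c * β⁻¹ * (z i * z j) else 0)
        + -(c * c / (β * (β + c * s)) * (z i * z k)) * (z j * z j) := fun j => by
      split_ifs <;> ring
    simp only [Matrix.mul_apply, Matrix.of_apply, Matrix.one_apply]
    rw [Finset.sum_congr rfl fun j _ => e j, Finset.sum_add_distrib, Finset.sum_add_distrib,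
      ← Finset.mul_sum, hs, Finset.sum_ite_eq, Finset.sum_ite_eq']
    simp only [Finset.mem_univ, if_true]
    split_ifs
    · field_simp
      ring
    · field_simp; ring
  rw [hinv]
  have e : ∀ i j : Fin n, (Matrix.of fun i j : Fin n => (if i = j then β⁻¹ else 0) +
      -(c / (β * (β + c * s))) * (z i * z j)) i j * ((if i = j then P else 0) + Q * (z i * z j)) =
      (if i = j then β⁻¹ * P + (β⁻¹ * Q - c / (β * (β + c * s)) * P) * (z i * z j) else 0)
        + -(c / (β * (β + c * s))) * Q * (z i * z i) * (z j * z j) := fun i j => by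
    rw [Matrix.of_apply]
    split_ifs with h <;> ring
  simp only [e, Finset.sum_add_distrib, Finset.sum_ite_eq, Finset.mem_univ, if_true,
    ← Finset.mul_sum, ← Finset.sum_mul, hs, Finset.sum_const, Finset.card_univ, Fintype.card_fin,
    nsmul_eq_mul]
  field_simp
  ring

/-- The shrinker equation for `(A(‖z‖²), B(‖z‖²) z)`. -/
def radialExpr (n : ℕ) (s A A1 a2 B B1 b2 : ℝ) : ℝ := 2 * n₋₁ * A1 / B +
    (2 * A1 * B + s * (4 * a2 * (B + 2 * B1 * s) - 8 * A1 * b2 * s - 8 * A1 * B1)) /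
      ((B + 2 * B1 * s) ^ 2 + 4 * A1 ^ 2 * s) +
    1 / 2 * (A * (B + 2 * B1 * s) - 2 * A1 * B * s)

namespace IsRadialAt

variable {F : Rn n → Amb n} {A A1 B B1 : ℝ → ℝ} {a2 b2 : ℝ} {z : Rn n}

lemma meanCurvature_add (h : IsRadialAt F A A1 B B1 a2 b2 z) (hB : B (‖z‖ ^ 2) ≠ 0)
    (hE : (B (‖z‖ ^ 2) + 2 * B1 (‖z‖ ^ 2) * ‖z‖ ^ 2) ^ 2 + 4 * A1 (‖z‖ ^ 2) ^ 2 * ‖z‖ ^ 2 ≠ 0)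
    {ν : Amb n} {m : ℝ} (h1 : ν.fst = m * (B (‖z‖ ^ 2) + 2 * B1 (‖z‖ ^ 2) * ‖z‖ ^ 2))
    (h2 : ν.snd = (-2 * A1 (‖z‖ ^ 2) * m) • z) :
    meanCurvature F z ν + 1 / 2 * ⟪F z, ν⟫ =
      m * radialExpr n (‖z‖ ^ 2) (A (‖z‖ ^ 2)) (A1 (‖z‖ ^ 2)) a2 (B (‖z‖ ^ 2)) (B1 (‖z‖ ^ 2)) b2 := by
  have hzz : ⟪z, z⟫ = ‖z‖ ^ 2 := real_inner_self_eq_norm_sq z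
  have hFz := h.eq.self_of_nhds
  have hfd := h.fderiv_apply
  have hhs := h.hess_apply
  simp only at hFz
  set s := ‖z‖ ^ 2 with hs
  generalize A s = a at *
  generalize A1 s = a1 at *
  generalize B s = b at *
  generalize B1 s = b1 at *
  have hE' : b ^ 2 + (4 * a1 ^ 2 + 4 * b1 ^ 2 * s + 4 * b * b1) * ‖z‖ ^ 2 ≠ 0 := by
    rw [← hs]
    convert hE using 1
    ring
  have hg : firstFundamentalForm F z = Matrix.of fun i j : Fin n =>
      (if i = j then b ^ 2 else 0) + (4 * a1 ^ 2 + 4 * b1 ^ 2 * s + 4 * b * b1) * (z i * z j) := by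
    ext i j
    have hij : ⟪EuclideanSpace.single i (1 : ℝ), EuclideanSpace.single j (1 : ℝ)⟫ =
        if i = j then (1 : ℝ) else 0 := by
      rw [inner_single]
      simp [eq_comm]
    rw [inner_single] at hij
    simp only [firstFundamentalForm, Matrix.of_apply, hfd, inner_amb, pt_fst, pt_snd, inner_add_left,
      inner_add_right, real_inner_smul_left, real_inner_smul_right, hzz, inner_single, hij,
      real_inner_comm z]
    split_ifs <;> ring
  have hB2 : ∀ i j : Fin n, ⟪fderiv ℝ (fderiv ℝ F) z (EuclideanSpace.single i 1)
      (EuclideanSpace.single j 1), ν⟫ = (if i = j then 2 * a1 * b * m else 0) +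
        (4 * a2 * (b + 2 * b1 * s) - 8 * a1 * b2 * s - 8 * a1 * b1) * m * (z i * z j) := fun i j =>
          by
    have hij : ⟪EuclideanSpace.single i (1 : ℝ), EuclideanSpace.single j (1 : ℝ)⟫ =
        if i = j then (1 : ℝ) else 0 := by
      rw [inner_single]
      simp [eq_comm]
    simp only [hhs, inner_amb, h1, h2, pt_fst, pt_snd, inner_add_left,
      real_inner_smul_right, hzz, inner_single, hij, real_inner_comm z]
    split_ifs <;> ring
  rw [meanCurvature, hg]
  simp only [hB2]
  rw [sum_inv_mul (pow_ne_zero 2 hB) hE', hFz, inner_amb, h1, h2, ← hs]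
  simp only [pt_fst, pt_snd, real_inner_smul_left, real_inner_smul_right, hzz]
  have e : b ^ 2 + (4 * a1 ^ 2 + 4 * b1 ^ 2 * s + 4 * b * b1) * s =
    (b + 2 * b1 * s) ^ 2 + 4 * a1 ^ 2 * s := by ring
  rw [radialExpr, e]
  field_simp
  ring

/-- The shrinker equation at a point of a rotationally symmetric immersion. -/
lemma shrinker_iff (h : IsRadialAt F A A1 B B1 a2 b2 z) (hB : B (‖z‖ ^ 2) ≠ 0)
    (hE : (B (‖z‖ ^ 2) + 2 * B1 (‖z‖ ^ 2) * ‖z‖ ^ 2) ^ 2 + 4 * A1 (‖z‖ ^ 2) ^ 2 * ‖z‖ ^ 2 ≠ 0) :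
    (∀ ν, IsUnitNormal F z ν → meanCurvature F z ν + 1 / 2 * ⟪F z, ν⟫ = 0) ↔
      radialExpr n (‖z‖ ^ 2) (A (‖z‖ ^ 2)) (A1 (‖z‖ ^ 2)) a2 (B (‖z‖ ^ 2)) (B1 (‖z‖ ^ 2)) b2 = 0 := by
  have hmc := @meanCurvature_add n F A A1 B B1 a2 b2 z h hB hE
  have hzz : ⟪z, z⟫ = ‖z‖ ^ 2 := real_inner_self_eq_norm_sq z
  have hfd := h.fderiv_apply
  set s := ‖z‖ ^ 2 with hs
  generalize A1 s = a1 at *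
  generalize B s = b at *
  generalize B1 s = b1 at *
  constructor
  · intro H
    set E := (b + 2 * b1 * s) ^ 2 + 4 * a1 ^ 2 * s with hEdef
    have hE0 : 0 < E := lt_of_le_of_ne (by positivity) hE.symm
    set m := (√E)⁻¹ with hm
    have hm2 : m ^ 2 * E = 1 := by rw [hm, inv_pow, sq_sqrt hE0.le, inv_mul_cancel₀ hE]
    have k := H (pt (m * (b + 2 * b1 * s)) ((-2 * a1 * m) • z)) ⟨?_, fun v => ?_⟩
    · rw [hmc (m := m) rfl rfl] at k
      refine (mul_eq_zero.1 k).resolve_left fun h0 => ?_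
      rw [h0] at hm2
      simp at hm2
    · rw [← sq_eq_sq₀ (norm_nonneg _) zero_le_one, norm_sq_amb, pt_fst, pt_snd, norm_smul,
        mul_pow _ ‖z‖, ← hs, norm_eq_abs, sq_abs, one_pow, ← hm2, hEdef]
      ring
    · rw [hfd, inner_amb]
      simp only [pt_fst, pt_snd, inner_add_left, real_inner_smul_right, hzz, real_inner_comm z]
      ring
  · rintro H ν ⟨-, hν⟩
    have hη : ν.snd = (-(2 * a1 * ν.fst + 2 * b1 * ⟪z, ν.snd⟫) / b) • z := by
      rw [← sub_eq_zero, ← inner_self_eq_zero (𝕜 := ℝ)]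
      set v := ν.snd - (-(2 * a1 * ν.fst + 2 * b1 * ⟪z, ν.snd⟫) / b) • z with hv
      have k := hν v
      rw [hfd, inner_amb] at k
      simp only [pt_fst, pt_snd, inner_add_left, real_inner_smul_left] at k
      have k2 : ⟪v, v⟫ = ⟪v, ν.snd⟫ + (2 * a1 * ν.fst + 2 * b1 * ⟪z, ν.snd⟫) / b * ⟪z, v⟫ := by
        conv_lhs => rw [hv, inner_sub_right, real_inner_smul_right, ← hv]
        rw [real_inner_comm v z]; ring
      rw [k2]
      field_simp
      linear_combination k
    set k := -(2 * a1 * ν.fst + 2 * b1 * ⟪z, ν.snd⟫) / b with hk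
    have hrel : k * (b + 2 * b1 * s) = -(2 * a1 * ν.fst) := by
      have e1 : ⟪z, ν.snd⟫ = k * s := by rw [hη, real_inner_smul_right, hzz]
      have e2 : k * b = -(2 * a1 * ν.fst + 2 * b1 * ⟪z, ν.snd⟫) := by rw [hk]; field_simp
      rw [e1] at e2
      linear_combination e2
    obtain ⟨m, hm1, hm2⟩ : ∃ m, ν.fst = m * (b + 2 * b1 * s) ∧ k = -2 * a1 * m := by
      by_cases hX : b + 2 * b1 * s = 0
      · have ha : a1 ≠ 0 := fun h0 => hE (by rw [hX, h0]; ring)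
        rw [hX, mul_zero] at hrel
        have : ν.fst = 0 := by
          have : 2 * a1 * ν.fst = 0 := by linarith
          simpa [ha] using this
        exact ⟨-k / (2 * a1), by rw [hX, this, mul_zero], by field_simp⟩
      · refine ⟨ν.fst / (b + 2 * b1 * s), by field_simp, ?_⟩
        field_simp
        linear_combination hrel
    rw [hmc hm1 (by rw [hη, hm2]), H, mul_zero]

end IsRadialAt

end

section

/-- A continuous map with a continuous left inverse on its image is an embedding. -/
lemma isEmbedding_domRestrict {X Z : Type*} [TopologicalSpace X] [TopologicalSpace Z] {K : Set X}
    {F : X → Z} {G : Z → X} (hF : ContinuousOn F K) (hG : ContinuousOn G (F '' K))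
    (h : ∀ x ∈ K, G (F x) = x) : IsEmbedding (K.domRestrict F) := by
  have hF' : Continuous (K.domRestrict F) := continuousOn_iff_continuous_domRestrict.1 hF
  let f : K → F '' K := fun x => ⟨F x, mem_image_of_mem F x.2⟩
  have hf : Continuous f := hF'.subtype_mk _
  have hg : Continuous ((F '' K).domRestrict G) := continuousOn_iff_continuous_domRestrict.1 hG
  have hgf : (F '' K).domRestrict G ∘ f = Subtype.val := funext fun x => h x x.2
  exact IsEmbedding.subtypeVal.comp (IsEmbedding.of_comp hf hg (hgf ▸ IsEmbedding.subtypeVal))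

lemma continuous_fst_amb : Continuous fun p : Amb n => p.fst :=
  (continuous_fst.comp (ptL n).symm.continuous : _)

lemma continuous_snd_amb : Continuous fun p : Amb n => p.snd :=
  (continuous_snd.comp (ptL n).symm.continuous : _)

lemma IsRadialAt.fderiv_injective {F : Rn n → Amb n} {A A1 B B1 : ℝ → ℝ} {a2 b2 : ℝ} {z : Rn n}
    (h : IsRadialAt F A A1 B B1 a2 b2 z) (hB : B (‖z‖ ^ 2) ≠ 0)
    (hE : (B (‖z‖ ^ 2) + 2 * B1 (‖z‖ ^ 2) * ‖z‖ ^ 2) ^ 2 + 4 * A1 (‖z‖ ^ 2) ^ 2 * ‖z‖ ^ 2 ≠ 0) :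
    Injective (fderiv ℝ F z) := by
  rw [injective_iff_map_eq_zero]
  intro v hv
  rw [h.fderiv_apply] at hv
  have h1 : 2 * A1 (‖z‖ ^ 2) * ⟪z, v⟫ = 0 := congrArg (fun p : Amb n => p.fst) hv
  have h2 : (2 * B1 (‖z‖ ^ 2) * ⟪z, v⟫) • z + B (‖z‖ ^ 2) • v = 0 :=
    congrArg (fun p : Amb n => p.snd) hv
  have h3 : (B (‖z‖ ^ 2) + 2 * B1 (‖z‖ ^ 2) * ‖z‖ ^ 2) * ⟪z, v⟫ = 0 := by
    have := congrArg (fun w => ⟪z, w⟫) h2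
    simp only [inner_add_right, real_inner_smul_right, real_inner_self_eq_norm_sq,
      inner_zero_right] at this
    linear_combination this
  have h4 : ⟪z, v⟫ = 0 := by
    by_contra h0
    refine hE ?_
    rw [(mul_eq_zero.1 h3).resolve_right h0]
    have : A1 (‖z‖ ^ 2) = 0 := by simpa [h0] using h1
    rw [this]; ring
  rw [h4, mul_zero, zero_smul, zero_add] at h2
  exact (smul_eq_zero.1 h2).resolve_left hB

section Curve

variable {F : Rn n → Amb n} {X Y X1 Y1 : ℝ → ℝ} {x2 y2 : ℝ} {z : Rn n}

/-- The rotation of the curve `r = X`, `y = Y`. -/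
lemma isRadialAt_of_curve (hz0 : z ≠ 0) (hF : F =ᶠ[𝓝 z] fun w => pt (Y ‖w‖) ((X ‖w‖ / ‖w‖) • w))
    (hX : ∀ᶠ t in 𝓝 ‖z‖, HasDerivAt X (X1 t) t) (hY : ∀ᶠ t in 𝓝 ‖z‖, HasDerivAt Y (Y1 t) t)
    (hX1 : HasDerivAt X1 x2 ‖z‖) (hY1 : HasDerivAt Y1 y2 ‖z‖) (hs : ContDiffAt ℝ 2 F z) :
    IsRadialAt F (fun s => Y √s) (fun s => Y1 √s / (2 * √s)) (fun s => X √s / √s)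
      (fun s => (X1 √s * √s - X √s) / (2 * √s ^ 3)) (y2 / (4 * ‖z‖ ^ 2) - Y1 ‖z‖ / (4 * ‖z‖ ^ 3))
      (x2 / (4 * ‖z‖ ^ 3) - 3 * (X1 ‖z‖ * ‖z‖ - X ‖z‖) / (4 * ‖z‖ ^ 5)) z := by
  have hq : 0 < ‖z‖ := norm_pos_iff.2 hz0
  have hq2 : √(‖z‖ ^ 2) = ‖z‖ := sqrt_sq hq.le
  have hsq : ∀ s : ℝ, 0 < s → HasDerivAt (fun s => √s) (1 / (2 * √s)) s := fun s hs =>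
    Real.hasDerivAt_sqrt hs.ne'
  have hc : Tendsto (fun s => √s) (𝓝 (‖z‖ ^ 2)) (𝓝 ‖z‖) := by
    have := Real.continuous_sqrt.tendsto (‖z‖ ^ 2); rwa [hq2] at this
  have hpos : ∀ᶠ t in 𝓝 (‖z‖ ^ 2), 0 < t := lt_mem_nhds (by positivity)
  have hd := hsq (‖z‖ ^ 2) (by positivity)
  have hcomp : ∀ {f : ℝ → ℝ} {f' : ℝ}, HasDerivAt f f' ‖z‖ →
      HasDerivAt (fun s => f √s) (f' * (1 / (2 * √(‖z‖ ^ 2)))) (‖z‖ ^ 2) := fun hf =>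
    HasDerivAt.comp (‖z‖ ^ 2) (by rw [hq2]; exact hf) hd
  refine ⟨?_, ?_, ?_, ?_, ?_, hs⟩
  · filter_upwards [hF] with w hw
    simp only [sqrt_sq (norm_nonneg w), hw]
  · filter_upwards [hc.eventually hY, hpos] with t ht ht0
    exact (ht.comp t (hsq t ht0)).congr_deriv (by ring)
  · filter_upwards [hc.eventually hX, hpos] with t ht ht0
    refine ((ht.comp t (hsq t ht0)).div (hsq t ht0) (sqrt_pos.2 ht0).ne').congr_deriv ?_
    simp only [comp]
    field_simp
  · refine ((hcomp hY1).div (hd.const_mul 2) (by rw [hq2]; positivity)).congr_deriv ?_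
    simp only [hq2]
    field_simp
    ring
  · refine ((((hcomp hX1).mul hd).sub (hcomp hX.self_of_nhds)).div ((hd.pow 3).const_mul 2)
      (by simp only [Pi.pow_apply]; rw [hq2]; positivity)).congr_deriv ?_
    simp only [Pi.pow_apply, Pi.sub_apply, Pi.mul_apply, hq2]
    field_simp; ring

/-- The rotation of a regular curve is an immersion, and a self-shrinker if and only if the curve
solves the corresponding equation. -/
lemma shrinker_curve_iff (hz0 : z ≠ 0) (hF : F =ᶠ[𝓝 z] fun w => pt (Y ‖w‖) ((X ‖w‖ / ‖w‖) • w))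
    (hX : ∀ᶠ t in 𝓝 ‖z‖, HasDerivAt X (X1 t) t) (hY : ∀ᶠ t in 𝓝 ‖z‖, HasDerivAt Y (Y1 t) t)
    (hX1 : HasDerivAt X1 x2 ‖z‖) (hY1 : HasDerivAt Y1 y2 ‖z‖) (hs : ContDiffAt ℝ 2 F z)
    (hX0 : X ‖z‖ ≠ 0) (hE : X1 ‖z‖ ^ 2 + Y1 ‖z‖ ^ 2 ≠ 0) :
    Injective (fderiv ℝ F z) ∧
    ((∀ ν, IsUnitNormal F z ν → meanCurvature F z ν + 1 / 2 * ⟪F z, ν⟫ = 0) ↔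
      (y2 * X1 ‖z‖ - x2 * Y1 ‖z‖) / (X1 ‖z‖ ^ 2 + Y1 ‖z‖ ^ 2) + n₋₁ * Y1 ‖z‖ / X ‖z‖ +
        1 / 2 * (Y ‖z‖ * X1 ‖z‖ - X ‖z‖ * Y1 ‖z‖) = 0) := by
  have h := isRadialAt_of_curve hz0 hF hX hY hX1 hY1 hs
  have hB : X √(‖z‖ ^ 2) / √(‖z‖ ^ 2) ≠ 0 := by
    rw [sqrt_sq (norm_nonneg z)]; exact div_ne_zero hX0 (norm_ne_zero_iff.2 hz0)
  have e1 : X √(‖z‖ ^ 2) / √(‖z‖ ^ 2) + 2 * ((X1 √(‖z‖ ^ 2) * √(‖z‖ ^ 2) - X √(‖z‖ ^ 2)) /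
      (2 * √(‖z‖ ^ 2) ^ 3)) * ‖z‖ ^ 2 = X1 ‖z‖ := by
    rw [sqrt_sq (norm_nonneg z)]
    field_simp; ring
  have e2 : X1 ‖z‖ ^ 2 + 4 * (Y1 √(‖z‖ ^ 2) / (2 * √(‖z‖ ^ 2))) ^ 2 * ‖z‖ ^ 2 =
      X1 ‖z‖ ^ 2 + Y1 ‖z‖ ^ 2 := by
    rw [sqrt_sq (norm_nonneg z)]
    field_simp; ring
  refine ⟨h.fderiv_injective hB (by rw [e1, e2]; exact hE), ?_⟩
  rw [h.shrinker_iff hB (by rw [e1, e2]; exact hE), radialExpr, e1, e2, sqrt_sq (norm_nonneg z)]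
  refine Eq.congr ?_ rfl
  field_simp
  ring

end Curve

/-! ### The conical ends -/

lemma contDiffAt_revolve {s : Set ℝ} (hs : IsOpen s) {u : ℝ → ℝ} (h : ContDiffOn ℝ ∞ u s)
    {z : Rn n} (hz : ‖z‖ ∈ s) (hz0 : z ≠ 0) : ContDiffAt ℝ ∞ (revolve u) z := by
  have h1 : ContDiffAt ℝ ∞ (fun z : Rn n => ‖z‖) z := contDiffAt_norm ℝ hz0
  have h2 : ContDiffAt ℝ ∞ (fun z : Rn n => u ‖z‖) z :=
    ContDiffAt.comp z (h.contDiffAt (hs.mem_nhds hz)) h1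
  exact contDiff_pt.contDiffAt.comp z
    (h1.prodMk ((h2.div h1 (norm_ne_zero_iff.2 hz0)).smul contDiffAt_id))

/-- The conical profiles give conical ends. -/
lemma isConicalEnd_con (hn : 2 ≤ n) {y0 b : ℝ} (hy0 : 4 < y0) (hb : 0 < b) :
    IsConicalEnd n y0 b (conU n b) := by
  have hc := isConical_con hn hb
  have h0 : ∀ z ∈ tube n y0, ‖z‖ ∈ Ioi (4 : ℝ) ∧ z ≠ 0 := fun z hz => by
    have : y0 ≤ ‖z‖ := hz
    exact ⟨hy0.trans_le this, norm_pos_iff.1 (by linarith)⟩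
  have hE : ∀ x : ℝ, x ^ 2 + 1 ^ 2 ≠ 0 := fun x => by positivity
  have hcurve := fun z (hz : z ∈ tube n y0) => by
    have hev : ∀ᶠ t in 𝓝 ‖z‖, 4 < t := isOpen_Ioi.mem_nhds (h0 z hz).1
    exact shrinker_curve_iff (F := revolve (conU n b)) (Y1 := fun _ => 1) (h0 z hz).2
      (Eventually.of_forall fun w => rfl) (hev.mono fun t ht => hc.profile.deriv_u t ht)
      (Eventually.of_forall fun t => hasDerivAt_id t) (hc.profile.deriv_p _ (h0 z hz).1)
      (hasDerivAt_const _ _) ((contDiffAt_revolve isOpen_Ioi (hc.profile.contDiffOn isOpen_Ioi)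
        (h0 z hz).1 (h0 z hz).2).of_le two_le_infty) (hc.profile.pos _ (h0 z hz).1).ne' (hE _)
  refine ⟨fun y hy => (hc.outside hn hb le_rfl (hy0.trans_le hy)).1, ⟨⟨{z | 4 < ‖z‖},
    isOpen_lt continuous_const continuous_norm, fun z hz => (h0 z hz).1, fun z hz =>
    (contDiffAt_revolve isOpen_Ioi (hc.profile.contDiffOn isOpen_Ioi) hz
      (norm_pos_iff.1 (by linarith [show 4 < ‖z‖ from hz]))).contDiffWithinAt⟩, fun z hz => ?_, ?_⟩,
    fun z hz => ?_, fun y hy => hc.profile.shrinkerODEAt isOpen_Ioi (hy0.trans_le hy),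
    hc.isBigO hn hb le_rfl, ?_⟩
  · exact (hcurve z hz).1
  · refine isEmbedding_domRestrict (G := fun p => (p.fst / ‖p.snd‖) • p.snd) ?_ ?_ ?_
    · exact fun z hz => (contDiffAt_revolve isOpen_Ioi (hc.profile.contDiffOn isOpen_Ioi)
        (h0 z hz).1 (h0 z hz).2).continuousAt.continuousWithinAt
    · have h1 := continuous_fst_amb (n := n)
      have h2 := continuous_snd_amb (n := n)
      refine ContinuousOn.smul (h1.continuousOn.div h2.norm.continuousOn ?_) h2.continuousOn
      rintro _ ⟨z, hz, rfl⟩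
      rw [revolve, pt_snd, norm_ne_zero_iff, smul_ne_zero_iff]
      exact ⟨div_ne_zero (hc.profile.pos _ (h0 z hz).1).ne' (norm_ne_zero_iff.2 (h0 z hz).2),
        (h0 z hz).2⟩
    · intro z hz
      have h1 := hc.profile.pos _ (h0 z hz).1
      have h2 := norm_ne_zero_iff.2 (h0 z hz).2
      simp only [revolve, pt_fst, pt_snd, norm_smul, smul_smul, norm_div, norm_norm,
        norm_of_nonneg h1.le]
      rw [show ‖z‖ / (conU n b ‖z‖ / ‖z‖ * ‖z‖) * (conU n b ‖z‖ / ‖z‖) = 1 by field_simp, one_smul]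
  · have h2 := norm_pos_iff.2 (h0 z hz).2
    have h1 := hc.profile.pos _ (h0 z hz).1
    refine (hcurve z hz).2.2 ?_
    have := hE (conP n b ‖z‖)
    rw [profQ, id]
    field_simp
    ring
  · rintro _ ⟨z, hz, rfl⟩
    have hz' : ‖z‖ = y0 := by simpa using hz
    have hm := h0 z hz'.ge
    refine ⟨hz', ?_⟩
    rw [revolve, pt_snd, norm_smul, norm_div, norm_norm, norm_of_nonneg (hc.profile.pos _ hm.1).le,
      div_mul_cancel₀ _ (norm_ne_zero_iff.2 hm.2), hz']
    exact Real.le_sqrt_of_sq_le (hc.sq_lt hn hb le_rfl hy0).le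

/-! ### The caps -/

/-- The embedding of the cap with tip `a` and boundary radius `ρ`. -/
def capEmb (n : ℕ) (a ρ : ℝ) (x : Rn n) : Amb n := pt (capF n a (ρ * ‖x‖)) (ρ • x)

/-- The cap with tip `a` above the height `y0`. -/
def capSet (n : ℕ) (y0 a : ℝ) : Set (Amb n) :=
  {q | ‖q.snd‖ ≤ capU n a y0 ∧ q.fst = capF n a ‖q.snd‖}

lemma HasArc.exists_radial (hn : 2 ≤ n) {a ρ : ℝ} {z : Rn n} (hρ : 0 < ρ)
    (h : HasArc n a (ρ * ‖z‖)) : ContDiffAt ℝ ∞ (capEmb n a ρ) z ∧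
      ∃ A A1 a2, IsRadialAt (capEmb n a ρ) A A1 (fun _ => ρ) (fun _ => 0) a2 0 z ∧
        radialExpr n (‖z‖ ^ 2) (A (‖z‖ ^ 2)) (A1 (‖z‖ ^ 2)) a2 ρ 0 0 = 0 := by
  have hr : 0 ≤ ρ * ‖z‖ := by positivity
  obtain ⟨Φ, P, hΦ, hP, hev⟩ := h.exists_smooth hn hr
  set s0 := ‖z‖ ^ 2 with hs₀
  have hs00 : 0 ≤ s0 := by positivity
  have e0 : (ρ * ‖z‖) ^ 2 = ρ ^ 2 * s0 := by rw [hs₀]; ring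
  rw [e0] at hΦ hP hev
  set A : ℝ → ℝ := fun s => Φ (a, ρ ^ 2 * s)
  have hAs : ContDiffAt ℝ ∞ A s0 :=
    ContDiffAt.comp (g := Φ) (f := fun s : ℝ => (a, ρ ^ 2 * s)) s0 hΦ (by fun_prop)
  have hPs : ContinuousAt (fun s : ℝ => P (a, ρ ^ 2 * s)) s0 :=
    ContinuousAt.comp (g := P) (f := fun s : ℝ => (a, ρ ^ 2 * s)) hP.continuousAt (by fun_prop)
  have hct : Tendsto (fun s : ℝ => (a, ρ ^ 2 * s)) (𝓝 s0) (𝓝 (a, ρ ^ 2 * s0)) :=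
    (by fun_prop : Continuous fun s : ℝ => (a, ρ ^ 2 * s)).tendsto s0
  have hsqrt : ∀ s : ℝ, √(ρ ^ 2 * s) = ρ * √s := fun s => by
    rw [Real.sqrt_mul (sq_nonneg ρ), sqrt_sq hρ.le]
  have hev' : ∀ᶠ s in 𝓝 s0, 0 ≤ s → HasArc n a (ρ * √s) ∧ A s = capF n a (ρ * √s) ∧
      P (a, ρ ^ 2 * s) = capP n a (ρ * √s) := by
    filter_upwards [hct.eventually hev] with s hs hs0
    have := hs (by positivity); simpa only [hsqrt] using this
  have hn2 : Tendsto (fun w : Rn n => ‖w‖ ^ 2) (𝓝 z) (𝓝 s0) :=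
    (by fun_prop : Continuous fun w : Rn n => ‖w‖ ^ 2).tendsto z
  have heq : capEmb n a ρ =ᶠ[𝓝 z] fun w => pt (A (‖w‖ ^ 2)) (ρ • w) := by
    filter_upwards [hn2.eventually hev'] with w hw
    rw [(hw (by positivity)).2.1, sqrt_sq (norm_nonneg w)]; rfl
  have hsm : ContDiffAt ℝ ∞ (capEmb n a ρ) z := by
    refine ContDiffAt.congr_of_eventuallyEq ?_ heq
    exact contDiff_pt.contDiffAt.comp z ((ContDiffAt.comp z hAs
      (contDiff_norm_sq ℝ).contDiffAt).prodMk (contDiffAt_id.const_smul ρ))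
  have hAd : ∀ᶠ s in 𝓝 s0, HasDerivAt A (deriv A s) s :=
    ((hAs.of_le two_le_infty).eventually (by simp)).mono fun s hs =>
      (hs.differentiableAt (by simp)).hasDerivAt
  have hA2 : ContDiffAt ℝ 1 (deriv A) s0 := by
    have h1 : ContDiffAt ℝ 1 (fderiv ℝ A) s0 :=
      (hAs.of_le two_le_infty).fderiv_right (m := 1) (by norm_num)
    exact (h1.clm_apply contDiffAt_const : ContDiffAt ℝ 1 (fun s => fderiv ℝ A s 1) s0)
  refine ⟨hsm, A, deriv A, deriv (deriv A) s0, ⟨heq, hAd, Eventually.of_forall fun s =>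
    hasDerivAt_const s ρ, (hA2.differentiableAt (by simp)).hasDerivAt, hasDerivAt_const _ _,
      hsm.of_le two_le_infty⟩, ?_⟩
  -- the derivatives of `A` at positive arguments
  have hpos : ∀ᶠ s in 𝓝 s0, 0 < s → deriv A s = ρ ^ 2 * P (a, ρ ^ 2 * s) := by
    filter_upwards [hev'.eventually_nhds] with s hs hs0
    obtain ⟨k1, k2, k3⟩ := hs.self_of_nhds hs0.le
    obtain ⟨t, ht, harc⟩ := k1.exists_gt hn (by positivity)
    have hd : HasDerivAt (fun s => capF n a (ρ * √s)) _ s :=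
      HasDerivAt.comp (h₂ := capF n a) s (harc.deriv_f (ρ * √s) ⟨by positivity, ht⟩)
        ((Real.hasDerivAt_sqrt hs0.ne').const_mul ρ)
    have : HasDerivAt A _ s := hd.congr_of_eventuallyEq (by
      filter_upwards [hs, lt_mem_nhds hs0] with t ht ht0
      exact (ht ht0.le).2.1)
    rw [this.deriv, k3]
    have := sqrt_pos.2 hs0; field_simp
  rw [radialExpr]
  rcases hs00.eq_or_lt with h0 | h0
  · have k1 : deriv A s0 = ρ ^ 2 * P (a, ρ ^ 2 * s0) := by
      have l1 : Tendsto (deriv A) (𝓝[>] s0) (𝓝 (deriv A s0)) :=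
        hA2.continuousAt.tendsto.mono_left nhdsWithin_le_nhds
      have l2 : Tendsto (fun s => ρ ^ 2 * P (a, ρ ^ 2 * s)) (𝓝[>] s0)
          (𝓝 (ρ ^ 2 * P (a, ρ ^ 2 * s0))) :=
        (hPs.tendsto.const_mul _).mono_left nhdsWithin_le_nhds
      refine tendsto_nhds_unique l1 (l2.congr' ?_)
      filter_upwards [nhdsWithin_le_nhds hpos, self_mem_nhdsWithin] with s hs hs'
      exact (hs (hs00.trans_lt hs')).symm
    obtain ⟨k2, k3, k4⟩ := hev'.self_of_nhds hs00
    rw [k4] at k1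
    rw [k1, k3, ← h0]
    simp only [Real.sqrt_zero, mul_zero, k2.f_zero, k2.p_zero]
    have hn0 : (n : ℝ) ≠ 0 := by positivity
    field_simp
    ring
  · obtain ⟨k2, k3, k4⟩ := hev'.self_of_nhds hs00
    obtain ⟨t, ht, harc⟩ := k2.exists_gt hn (by positivity)
    have hq := sqrt_pos.2 h0
    have hd : HasDerivAt (fun s => ρ ^ 2 * capP n a (ρ * √s)) _ s0 :=
      (HasDerivAt.comp (h₂ := capP n a) s0 (harc.deriv_p (ρ * √s0) ⟨by positivity, ht⟩)
        ((Real.hasDerivAt_sqrt h0.ne').const_mul ρ)).const_mul (ρ ^ 2)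
    have hd' : HasDerivAt (deriv A) _ s0 := hd.congr_of_eventuallyEq (by
      filter_upwards [hpos, hev', lt_mem_nhds h0] with s l1 l2 l3
      rw [l1 l3, (l2 l3.le).2.2])
    rw [hd'.deriv, hpos.self_of_nhds h0, k3, k4]
    have hs2 : s0 = √s0 ^ 2 := (sq_sqrt hs00).symm
    generalize √s0 = q at *
    rw [hs2, capG]; simp only [mul_zero, zero_mul, add_zero, sub_zero]; field_simp; ring

/-- The caps are embedded self-shrinkers. -/
lemma HighFrom.isCapEmbedding {Y A a y0 : ℝ} (H : HighFrom n Y A) (hA : A ≤ a) (hY : Y < y0)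
    (ha : y0 < a) : IsCapEmbedding n y0 a (capEmb n a (capU n a y0)) ∧
      capEmb n a (capU n a y0) '' closedBall 0 1 = capSet n y0 a := by
  have hρ := H.capU_pos hA ⟨hY.le, ha⟩
  obtain ⟨ρ', h1, h2, -⟩ := H.exists_gt hA ⟨hY, ha.le⟩
  obtain ⟨-, h3, h4⟩ := H.capU_spec hA ⟨hY.le, ha.le⟩
  have hle : ∀ s ∈ Icc 0 (capU n a y0), y0 ≤ capF n a s := fun s hs =>
    H.le_capF hA ⟨hY.le, ha.le⟩ hs
  have hR : capU n a y0 ≤ cylRadius n := Real.le_sqrt_of_sq_le (H.capU_sq_lt hA ⟨hY, ha.le⟩).le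
  set ρ := capU n a y0
  have hrad : ∀ x : Rn n, ρ * ‖x‖ < ρ' → _ := fun x hx => (h2.mono hx.le).exists_radial
    ((H a hA).two_le) hρ
  have hball : ∀ x ∈ closedBall (0 : Rn n) 1, ρ * ‖x‖ ≤ ρ := fun x hx => by
    have : ‖x‖ ≤ 1 := by simpa using hx
    nlinarith
  have hE : ∀ s c : ℝ, 0 ≤ s → (ρ + 2 * 0 * s) ^ 2 + 4 * c ^ 2 * s ≠ 0 := fun s c hs => by
    rw [mul_zero, zero_mul, add_zero]; positivity
  refine ⟨⟨⟨⟨{x | ρ * ‖x‖ < ρ'}, isOpen_lt (by fun_prop) continuous_const,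
    fun x hx => (hball x hx).trans_lt h1, fun x hx => (hrad x hx).1.contDiffWithinAt⟩,
    fun x hx => ?_, ?_⟩, fun B x hx => ?_, fun x hx => ?_, ?_, ?_, ?_⟩, ?_⟩
  · obtain ⟨-, B, B1, b2, k1, -⟩ := hrad x ((hball x hx).trans_lt h1)
    exact k1.fderiv_injective hρ.ne' (hE _ _ (by positivity))
  · refine isEmbedding_domRestrict (G := fun p => ρ⁻¹ • p.snd)
      (fun x hx => (hrad x ((hball x hx).trans_lt h1)).1.continuousAt.continuousWithinAt)
      (show Continuous fun p : Amb n => ρ⁻¹ • p.snd from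
        continuous_snd_amb.const_smul ρ⁻¹).continuousOn fun x hx => ?_
    rw [capEmb, pt_snd, smul_smul, inv_mul_cancel₀ hρ.ne', one_smul]
  · simp [capEmb]
  · obtain ⟨-, B, B1, b2, k1, k2⟩ := hrad x ((hball x hx).trans_lt h1)
    exact (k1.shrinker_iff hρ.ne' (hE _ _ (by positivity))).2 k2
  · ext p
    constructor
    · rintro ⟨⟨x, hx, rfl⟩, h0⟩
      have : x = 0 := by simpa [capEmb, hρ.ne'] using h0
      rw [this]
      simp [capEmb, h3.f_zero]
    · rintro rfl
      exact ⟨⟨0, by simp, by simp [capEmb, h3.f_zero]⟩, rfl⟩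
  · rintro _ ⟨x, hx, rfl⟩
    have := hball x hx
    refine ⟨?_, hle _ ⟨by positivity, this⟩⟩
    rw [capEmb, pt_snd, norm_smul, norm_of_nonneg hρ.le]
    exact this.trans hR
  · rintro _ ⟨x, hx, rfl⟩
    have hx1 : ‖x‖ = 1 := by simpa using hx
    refine ⟨?_, ?_⟩
    · rw [capEmb, pt_fst, hx1, mul_one, h4]
    · rw [capEmb, pt_snd, norm_smul, norm_of_nonneg hρ.le, hx1, mul_one]; exact hR
  · ext q
    constructor
    · rintro ⟨x, hx, rfl⟩
      have e : ‖(capEmb n a ρ x).snd‖ = ρ * ‖x‖ := by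
        rw [capEmb, pt_snd, norm_smul, norm_of_nonneg hρ.le]
      exact ⟨by rw [e]; exact hball x hx, by rw [e]; rfl⟩
    · rintro ⟨hq1, hq2⟩
      have e : ρ * ‖ρ⁻¹ • q.snd‖ = ‖q.snd‖ := by
        rw [norm_smul, norm_inv, norm_of_nonneg hρ.le, mul_inv_cancel_left₀ hρ.ne']
      refine ⟨ρ⁻¹ • q.snd, ?_, ?_⟩
      · rw [mem_closedBall_zero_iff, norm_smul, norm_inv, norm_of_nonneg hρ.le,
          inv_mul_le_iff₀ hρ, mul_one]
        exact hq1
      · refine amb_ext ?_ ?_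
        · rw [capEmb, pt_fst, e, hq2]
        · rw [capEmb, pt_snd, smul_smul, mul_inv_cancel₀ hρ.ne', one_smul]

end

section

/-! ### Uniqueness of the caps -/

lemma _root_.Set.LeftInvOn.continuousOn_image {X ψ : ℝ → ℝ} {K : Set ℝ} (h : LeftInvOn ψ X K)
    (hK : IsCompact K) (hX : ContinuousOn X K) : ContinuousOn ψ (X '' K) := by
  refine continuousOn_iff_isClosed.2 fun C hC => ⟨X '' (C ∩ K), ((hK.inter_left hC).image_of_continuousOn
    (hX.mono inter_subset_right)).isClosed, ?_⟩
  ext x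
  constructor
  · rintro ⟨h1, s, hs, rfl⟩
    exact ⟨⟨s, ⟨by rwa [mem_preimage, h hs] at h1, hs⟩, rfl⟩, s, hs, rfl⟩
  · rintro ⟨⟨s, ⟨h1, hs⟩, rfl⟩, h2⟩
    exact ⟨by rwa [mem_preimage, h hs], h2⟩

/-- A curve `r = X`, `y = Y` that starts orthogonally to the axis at height `a`, and whose rotation
is a self-shrinker. -/
structure IsCapCurve (n : ℕ) (a : ℝ) (X Y X1 Y1 X2 Y2 : ℝ → ℝ) : Prop where
  deriv_X : ∀ t ∈ Icc (0 : ℝ) 1, HasDerivAt X (X1 t) t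
  deriv_Y : ∀ t ∈ Icc (0 : ℝ) 1, HasDerivAt Y (Y1 t) t
  deriv_X1 : ∀ t ∈ Icc (0 : ℝ) 1, HasDerivAt X1 (X2 t) t
  deriv_Y1 : ∀ t ∈ Icc (0 : ℝ) 1, HasDerivAt Y1 (Y2 t) t
  cont_X2 : ContinuousOn X2 (Icc 0 1)
  cont_Y2 : ContinuousOn Y2 (Icc 0 1)
  X_zero : X 0 = 0
  Y_zero : Y 0 = a
  Y1_zero : Y1 0 = 0
  X_pos : ∀ t ∈ Ioc (0 : ℝ) 1, 0 < X t
  regular : ∀ t ∈ Icc (0 : ℝ) 1, X1 t ^ 2 + Y1 t ^ 2 ≠ 0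
  ode : ∀ t ∈ Ioo (0 : ℝ) 1, (Y2 t * X1 t - X2 t * Y1 t) / (X1 t ^ 2 + Y1 t ^ 2) +
    n₋₁ * Y1 t / X t + 1 / 2 * (Y t * X1 t - X t * Y1 t) = 0

namespace IsCapCurve

variable {a : ℝ} {X Y X1 Y1 X2 Y2 : ℝ → ℝ}

/-- As long as the curve is a graph, it coincides with the arc with the same tip. -/
lemma eq_arc (h : IsCapCurve n a X Y X1 Y1 X2 Y2) (hn : 2 ≤ n) {t : ℝ} (ht : t ∈ Ico (0 : ℝ) 1)
    (hX1 : ∀ s ∈ Icc 0 t, 0 < X1 s) : HasArc n a (X t) ∧ Y t = capF n a (X t) ∧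
      Y1 t = 2 * X t * capP n a (X t) * X1 t := by
  rcases ht.1.eq_or_lt with rfl | ht0
  · rw [h.X_zero, h.Y_zero, h.Y1_zero, capF_zero hn]
    exact ⟨hasArc_zero hn a, rfl, by ring⟩
  have hsub : Icc 0 t ⊆ Icc (0 : ℝ) 1 := Icc_subset_Icc_right ht.2.le
  have hpos : ∀ s ∈ Ioc 0 t, 0 < X s := fun s hs => h.X_pos s ⟨hs.1, hs.2.trans ht.2.le⟩
  have cX : ContinuousOn X (Icc 0 t) := fun s hs =>
    (h.deriv_X s (hsub hs)).continuousAt.continuousWithinAt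
  have hmono : StrictMonoOn X (Icc 0 t) :=
    strictMonoOn_of_deriv_pos (convex_Icc 0 t) cX fun s hs => by
      have hs' := interior_subset hs
      rw [(h.deriv_X s (hsub hs')).deriv]; exact hX1 s hs'
  have h0m : 0 ∈ Icc 0 t := ⟨le_rfl, ht.1⟩
  have htm : t ∈ Icc 0 t := ⟨ht.1, le_rfl⟩
  have him : X '' Icc 0 t = Icc 0 (X t) := by
    have := hmono.monotoneOn.image_Icc_subset
    have k := intermediate_value_Icc ht.1 cX
    rw [h.X_zero] at this k
    exact this.antisymm k
  set ψ := invFunOn X (Icc 0 t)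
  have hψ : LeftInvOn ψ X (Icc 0 t) := hmono.injOn.leftInvOn_invFunOn
  have cψ := hψ.continuousOn_image isCompact_Icc cX
  rw [him] at cψ
  have hψm : MapsTo ψ (Icc 0 (X t)) (Icc 0 t) := him ▸ hψ.mapsTo (surjOn_image X _)
  have hdψ : ∀ s ∈ Ioo 0 t, HasDerivAt ψ (X1 s)⁻¹ (X s) := fun s hs => by
    have hs' := Ioo_subset_Icc_self hs
    have hn : Icc 0 (X t) ∈ 𝓝 (X s) := Icc_mem_nhds (hpos s ⟨hs.1, hs.2.le⟩) (hmono hs' htm hs.2)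
    refine HasDerivAt.of_local_left_inverse (f := X) (cψ.continuousAt hn)
      (by rw [hψ hs']; exact h.deriv_X s (hsub hs')) (hX1 s hs').ne' ?_
    filter_upwards [hn] with r hr
    rw [← him] at hr
    exact invFunOn_eq hr
  set q0 := fun s => Y1 s / (2 * X s * X1 s) with hq0
  set q := update q0 0 (-a / (4 * n)) with hq
  have hq' : ∀ s ∈ Ioc 0 t, q s = q0 s := fun s hs => update_of_ne hs.1.ne' _ _
  have cq : ContinuousOn q (Icc 0 t) := by
    refine continuousOn_update_iff.2 ⟨fun s hs => ?_, fun _ => ?_⟩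
    · have hs0 := hpos s ⟨lt_of_le_of_ne hs.1.1 fun h0 => hs.2 h0.symm, hs.1.2⟩
      have := hX1 s hs.1
      exact ((h.deriv_Y1 s (hsub hs.1)).continuousAt.div (((h.deriv_X s (hsub
        hs.1)).continuousAt.const_mul 2).mul (h.deriv_X1 s (hsub hs.1)).continuousAt)
        (mul_pos (mul_pos two_pos hs0) this).ne').continuousWithinAt
    · have h0 := hsub h0m
      have hl : 𝓝[>] (0 : ℝ) ≤ 𝓝[≠] 0 := nhdsWithin_mono _ fun s hs => (ne_of_gt hs)
      have hl' : 𝓝[>] (0 : ℝ) ≤ 𝓝[Icc 0 1] 0 := nhdsWithin_le_of_mem (Icc_mem_nhdsGT one_pos)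
      have sX := (hasDerivAt_iff_tendsto_slope.1 (h.deriv_X 0 h0)).mono_left hl
      have sY := (hasDerivAt_iff_tendsto_slope.1 (h.deriv_Y1 0 h0)).mono_left hl
      have tX1 := (h.deriv_X1 0 h0).continuousAt.tendsto.mono_left (hl.trans nhdsWithin_le_nhds)
      have tY1 := (h.deriv_Y1 0 h0).continuousAt.tendsto.mono_left (hl.trans nhdsWithin_le_nhds)
      have hx := hX1 0 h0m
      have hN : (0 : ℝ) < n := by positivity
      have k := tendsto_nhds_unique_of_eventuallyEq
        (((((((h.cont_Y2 0 h0).tendsto.mono_left hl').mul tX1).sub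
        (((h.cont_X2 0 h0).tendsto.mono_left hl').mul tY1)).div
        ((tX1.pow 2).add (tY1.pow 2)) (h.regular 0 h0)).add ((sY.const_mul n₋₁).div sX
        hx.ne')).add (((((h.deriv_Y 0 h0).continuousAt.tendsto.mono_left
          (hl.trans nhdsWithin_le_nhds)).mul tX1).sub
          (((h.deriv_X 0 h0).continuousAt.tendsto.mono_left (hl.trans nhdsWithin_le_nhds)).mul
          tY1)).const_mul (1 / 2))) (tendsto_const_nhds (x := 0)) (by
          filter_upwards [Ioo_mem_nhdsGT (zero_lt_one' ℝ)] with s hs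
          have := hs.1
          have := h.X_pos s ⟨hs.1, hs.2.le⟩
          refine Eq.trans ?_ (h.ode s hs)
          simp only [Pi.div_apply, slope_def_field, h.X_zero, h.Y1_zero, sub_zero]
          field_simp)
      rw [h.X_zero, h.Y_zero, h.Y1_zero] at k
      have e : Y2 0 / (2 * X1 0 * X1 0) = -a / (4 * n) := by
        field_simp at k ⊢
        exact mul_left_cancel₀ (pow_ne_zero 2 hx.ne') (by linarith)
      rw [← e]
      refine ((sY.div ((sX.const_mul 2).mul tX1) (by positivity)).congr' ?_).mono_left
        (nhdsWithin_mono _ fun s hs => lt_of_le_of_ne hs.1.1 fun h0 => hs.2 h0.symm)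
      filter_upwards [self_mem_nhdsWithin] with s (hs : 0 < s)
      simp only [hq0, Pi.div_apply, slope_def_field, h.X_zero, h.Y1_zero, sub_zero]
      field_simp
  have hex : ∀ r ∈ Ioo 0 (X t), ∃ s ∈ Ioo 0 t, X s = r := fun r hr => by
    have := intermediate_value_Ioo ht.1 cX
    rw [h.X_zero] at this
    exact this hr
  have arc : IsCapArc n a (X t) (Y ∘ ψ) (q ∘ ψ) := by
    have hψ0 : ψ 0 = 0 := by rw [← h.X_zero, hψ h0m, h.X_zero]
    refine ⟨by simp [hψ0, h.Y_zero], by simp [hψ0, hq], ContinuousOn.comp (fun s hs =>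
      (h.deriv_Y s (hsub hs)).continuousAt.continuousWithinAt) cψ hψm, cq.comp cψ hψm, ?_, ?_⟩
    all_goals
      intro r hr
      obtain ⟨s, hs, rfl⟩ := hex r hr
      have hs' := Ioo_subset_Icc_self hs
      have hx := hX1 s hs'
      have hx' := hpos s ⟨hs.1, hs.2.le⟩
    · refine (HasDerivAt.comp (h₂ := Y) (X s) (by rw [hψ hs']; exact h.deriv_Y s (hsub hs'))
        (hdψ s hs)).congr_deriv ?_
      simp only [comp, hψ hs', hq' s ⟨hs.1, hs.2.le⟩, hq0]
      field_simp
    · have hd : HasDerivAt q _ s := ((h.deriv_Y1 s (hsub hs')).div (((h.deriv_X s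
        (hsub hs')).const_mul 2).mul (h.deriv_X1 s (hsub hs')))
        (mul_pos (mul_pos two_pos hx') hx).ne').congr_of_eventuallyEq
        (by filter_upwards [Ioc_mem_nhds hs.1 hs.2] using hq')
      refine (HasDerivAt.comp (h₂ := q) (X s) (by rw [hψ hs']; exact hd) (hdψ s hs)).congr_deriv ?_
      have hode := h.ode s ⟨hs.1, hs.2.trans ht.2⟩
      have hE := h.regular s (hsub hs')
      simp only [comp, hψ hs', hq' s ⟨hs.1, hs.2.le⟩, hq0, capG, Pi.mul_apply]
      have : Y2 s = (X2 s * Y1 s - (X1 s ^ 2 + Y1 s ^ 2) * (n₋₁ * Y1 s / X s +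
          1 / 2 * (Y s * X1 s - X s * Y1 s))) / X1 s := by
        rw [eq_div_iff hx.ne']
        rw [add_assoc, div_add' _ _ _ hE, div_eq_zero_iff, or_iff_left hE] at hode
        linarith
      rw [this]
      field_simp
      ring
  have hXt := hpos t ⟨ht0, le_rfl⟩
  obtain ⟨k1, k2⟩ := arc.eq_cap hn ⟨hXt.le, le_rfl⟩
  have := hX1 t htm
  refine ⟨arc.hasArc hn hXt.le, ?_, ?_⟩
  · rw [k1, comp, hψ htm]
  · rw [k2, comp, hψ htm, hq' t ⟨ht0, le_rfl⟩, hq0]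
    field_simp

lemma X1_zero_pos (h : IsCapCurve n a X Y X1 Y1 X2 Y2) : 0 < X1 0 := by
  have hd := h.deriv_X 0 ⟨le_rfl, zero_le_one⟩
  have h2 : 0 ≤ X1 0 := by
    refine ge_of_tendsto ((hasDerivAt_iff_tendsto_slope.1 hd).mono_left
      (nhdsWithin_mono 0 (show Ioi (0 : ℝ) ⊆ {0}ᶜ from fun s hs => ne_of_gt hs))) ?_
    filter_upwards [Ioc_mem_nhdsGT (zero_lt_one' ℝ)] with s hs
    rw [slope_def_field, h.X_zero, sub_zero, sub_zero]; exact (div_pos (h.X_pos s hs) hs.1).le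
  refine lt_of_le_of_ne h2 fun h0 => h.regular 0 ⟨le_rfl, zero_le_one⟩ ?_
  rw [← h0, h.Y1_zero]
  ring

/-- A cap curve that ends at its lowest height `y0` runs exactly through the arc above `y0`. -/
lemma image_eq (h : IsCapCurve n a X Y X1 Y1 X2 Y2) (hn : 2 ≤ n) (ha : 0 < a) {ρ y0 : ℝ}
    (harc : HasArc n a ρ) (hρ : 0 ≤ ρ) (hf : capF n a ρ = y0)
    (hY : ∀ t ∈ Icc (0 : ℝ) 1, y0 ≤ Y t) (hY1 : Y 1 = y0) :
    (∀ t ∈ Icc (0 : ℝ) 1, Y t = capF n a (X t)) ∧ X '' Icc 0 1 = Icc 0 ρ := by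
  have hX0 : ∀ s ∈ Icc (0 : ℝ) 1, 0 ≤ X s := fun s hs => by
    rcases hs.1.eq_or_lt with h0 | h0
    · rw [← h0, h.X_zero]
    · exact (h.X_pos s ⟨h0, hs.2⟩).le
  have hlim : ∀ {r : ℝ} {φ : ℝ → ℝ}, r ∈ Ioc (0 : ℝ) 1 → ContinuousAt φ r →
      (∀ s ∈ Ico 0 r, φ s ≤ 0) → φ r ≤ 0 := fun {r φ} hr hφ hs =>
    le_of_tendsto (hφ.tendsto.mono_left (nhdsWithin_le_nhds (s := Iio r)))
      (by filter_upwards [Ico_mem_nhdsLT hr.1] with s hs' using hs s hs')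
  have cX : ∀ r ∈ Icc (0 : ℝ) 1, ContinuousAt X r := fun r hr => (h.deriv_X r hr).continuousAt
  have hA : ∀ s ∈ Ico (0 : ℝ) 1, (∀ q ∈ Icc 0 s, 0 < X1 q) → X s ≤ ρ ∧
      Y s = capF n a (X s) ∧ Y1 s = 2 * X s * capP n a (X s) * X1 s := fun s hs hpos => by
    obtain ⟨k1, k2⟩ := h.eq_arc hn hs hpos
    refine ⟨not_lt.1 fun hc => ?_, k2⟩
    have := k1.f_strictAnti hn ha ⟨hρ, hc.le⟩ ⟨hX0 s ⟨hs.1, hs.2.le⟩, le_rfl⟩ hc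
    linarith [hY s ⟨hs.1, hs.2.le⟩, k2.1]
  obtain ⟨M, hM⟩ := isCompact_Icc.exists_bound_of_continuousOn
    (f := fun r => 2 * r * capP n a r) (s := Icc 0 ρ)
    ((by fun_prop : ContinuousOn (fun r : ℝ => 2 * r) (Icc 0 ρ)).mul harc.cont_p)
  have hB : ∀ s ∈ Ico (0 : ℝ) 1, 0 < X1 s := by
    refine pos_of_first_zero (fun s hs =>
      (h.deriv_X1 s ⟨hs.1, hs.2.le⟩).continuousAt.continuousWithinAt) h.X1_zero_pos ?_
    intro r hr h0 hpos
    exfalso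
    have hr1 : r ∈ Icc (0 : ℝ) 1 := ⟨hr.1.le, hr.2.le⟩
    have := hlim (φ := fun s => |Y1 s| - M * X1 s) ⟨hr.1, hr.2.le⟩
      ((h.deriv_Y1 r hr1).continuousAt.abs.sub ((h.deriv_X1 r hr1).continuousAt.const_mul M))
      (fun s hs => by
        obtain ⟨k1, -, k3⟩ := hA s ⟨hs.1, hs.2.trans hr.2⟩ fun q hq =>
          hpos q ⟨hq.1, hq.2.trans_lt hs.2⟩
        rw [k3, abs_mul, abs_of_pos (hpos s hs), sub_nonpos]
        exact mul_le_mul_of_nonneg_right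
          (hM (X s) ⟨hX0 s ⟨hs.1, hs.2.le.trans hr.2.le⟩, k1⟩) (hpos s hs).le)
    rw [h0, mul_zero, sub_zero, abs_nonpos_iff] at this
    exact h.regular r hr1 (by rw [h0, this]; ring)
  have hC := fun s hs => hA s hs fun q hq => hB q ⟨hq.1, hq.2.trans_lt hs.2⟩
  have h1m : (1 : ℝ) ∈ Icc (0 : ℝ) 1 := ⟨zero_le_one, le_rfl⟩
  have hXle : ∀ s ∈ Icc (0 : ℝ) 1, X s ≤ ρ := fun s hs => by
    rcases hs.2.eq_or_lt with h0 | h0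
    · have := hlim (φ := fun s => X s - ρ) ⟨one_pos, le_rfl⟩ ((cX 1 h1m).sub continuousAt_const)
        (fun s hs => by linarith [(hC s hs).1])
      rw [h0]; linarith
    · exact (hC s ⟨hs.1, h0⟩).1
  have hcX : ContinuousOn X (Icc 0 1) := fun s hs => (cX s hs).continuousWithinAt
  have hYeq : ∀ t ∈ Icc (0 : ℝ) 1, Y t = capF n a (X t) :=
    EqOn.of_subset_closure (s := Ico 0 1) (fun s hs => (hC s hs).2.1)
      (fun s hs => (h.deriv_Y s hs).continuousAt.continuousWithinAt)
      (harc.cont_f.comp hcX fun s hs => ⟨hX0 s hs, hXle s hs⟩) Ico_subset_Icc_self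
      (by rw [closure_Ico zero_ne_one])
  have hX1 : X 1 = ρ := (harc.f_strictAnti hn ha).injOn ⟨hX0 1 h1m, hXle 1 h1m⟩ ⟨hρ, le_rfl⟩
    (by rw [← hYeq 1 h1m, hY1, hf])
  refine ⟨hYeq, Subset.antisymm (image_subset_iff.2 fun s hs => ⟨hX0 s hs, hXle s hs⟩) ?_⟩
  have := intermediate_value_Icc zero_le_one hcX
  rwa [h.X_zero, hX1] at this

end IsCapCurve

lemma smul_mem_ball {t : ℝ} {ξ : Rn n} (ht : t ∈ Icc (0 : ℝ) 1) (hξ : ‖ξ‖ = 1) :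
    t • ξ ∈ closedBall (0 : Rn n) 1 := by
  rw [mem_closedBall_zero_iff, norm_smul, hξ, mul_one, norm_of_nonneg ht.1]; exact ht.2

/-- Rotationally symmetric discs are rotated curves. -/
lemma IsCapEmbedding.eq_curve {y0 a : ℝ} {F : Rn n → Amb n}
    (h : IsCapEmbedding n y0 a F) {e : Rn n} (he : ‖e‖ = 1) {t : ℝ} (ht : t ∈ Icc (0 : ℝ) 1)
    {ξ : Rn n} (hξ : ‖ξ‖ = 1) : F (t • ξ) = pt (F (t • e)).fst (⟪e, (F (t • e)).snd⟫ • ξ) := by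
  have h1 : (F (t • e)).snd = ⟪e, (F (t • e)).snd⟫ • e := by
    have k := h.symmetric (ℝ ∙ e).reflection _ (smul_mem_ball ht he)
    rw [map_smul, Submodule.reflection_mem_subspace_eq_self
      (Submodule.mem_span_singleton_self e)] at k
    have k2 : (F (t • e)).snd = (ℝ ∙ e).reflection (F (t • e)).snd :=
      congrArg (fun p : Amb n => p.snd) k
    obtain ⟨c, hc⟩ := Submodule.mem_span_singleton.1 ((Submodule.reflection_eq_self_iff _).1 k2.symm)
    rw [← hc, real_inner_smul_right, real_inner_self_eq_norm_sq, he]; simp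
  have k := h.symmetric (ℝ ∙ (e - ξ))ᗮ.reflection _ (smul_mem_ball ht he)
  rw [map_smul, Submodule.reflection_sub (he.trans hξ.symm), h1, map_smul,
    Submodule.reflection_sub (he.trans hξ.symm)] at k
  rw [k]

lemma IsCapEmbedding.exists_curve (hn : 2 ≤ n) {y0 a : ℝ} {F : Rn n → Amb n}
    (h : IsCapEmbedding n y0 a F) :
    ∃ X Y X1 Y1 X2 Y2 : ℝ → ℝ, IsCapCurve n a X Y X1 Y1 X2 Y2 ∧
      (∀ t ∈ Icc (0 : ℝ) 1, y0 ≤ Y t) ∧ Y 1 = y0 ∧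
      F '' closedBall 0 1 = {q | ∃ t ∈ Icc (0 : ℝ) 1, q.fst = Y t ∧ ‖q.snd‖ = X t} := by
  obtain ⟨e, he⟩ : ∃ e : Rn n, ‖e‖ = 1 := ⟨EuclideanSpace.single ⟨0, by omega⟩ 1, by simp⟩
  have he0 : e ≠ 0 := norm_ne_zero_iff.1 (by rw [he]; exact one_ne_zero)
  have hne : ‖-e‖ = 1 := by rw [norm_neg, he]
  obtain ⟨⟨U, hUo, hUb, hUs⟩, hinj, hemb⟩ := h.embedding
  have hFinj : InjOn F (closedBall 0 1) := injOn_iff_injective.2 hemb.injective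
  set Y : ℝ → ℝ := fun t => (F (t • e)).fst with hY
  set X : ℝ → ℝ := fun t => ⟪e, (F (t • e)).snd⟫
  have hcurve : ∀ {t : ℝ} {ξ : Rn n}, t ∈ Icc (0 : ℝ) 1 → ‖ξ‖ = 1 →
      F (t • ξ) = pt (Y t) (X t • ξ) := fun ht hξ => h.eq_curve he ht hξ
  -- smoothness
  set V : Set ℝ := (fun t : ℝ => t • e) ⁻¹' U
  have hVo : IsOpen V := hUo.preimage (by fun_prop)
  have hVI : Icc (0 : ℝ) 1 ⊆ V := fun t ht => hUb (smul_mem_ball ht he)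
  have hγs : ContDiffOn ℝ ∞ (fun t : ℝ => (ptL n).symm (F (t • e))) V :=
    (ptL n).symm.contDiff.comp_contDiffOn
      (hUs.comp (by fun_prop : ContDiff ℝ ∞ fun t : ℝ => t • e).contDiffOn fun t ht => ht)
  have hYs : ContDiffOn ℝ ∞ Y V := contDiff_fst.comp_contDiffOn hγs
  have hXs : ContDiffOn ℝ ∞ X V := contDiffOn_const.inner ℝ (contDiff_snd.comp_contDiffOn hγs)
  have hder : ∀ {φ : ℝ → ℝ}, ContDiffOn ℝ ∞ φ V → ContDiffOn ℝ ∞ (deriv φ) V := fun hφ =>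
    hφ.deriv_of_isOpen hVo (by simp)
  have hdt : ∀ {φ : ℝ → ℝ}, ContDiffOn ℝ ∞ φ V → ∀ t ∈ V, HasDerivAt φ (deriv φ t) t :=
    fun hφ t ht => ((hφ.contDiffAt (hVo.mem_nhds ht)).differentiableAt (by simp)).hasDerivAt
  have h0m : (0 : ℝ) ∈ Icc (0 : ℝ) 1 := ⟨le_rfl, zero_le_one⟩
  have hX00 : X 0 = 0 := by
    have k1 := hcurve h0m he
    have k2 := hcurve h0m hne
    rw [zero_smul] at k1 k2
    have k3 : X 0 • e = X 0 • -e := congrArg (fun p : Amb n => p.snd) (k1.symm.trans k2)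
    rw [smul_neg, eq_neg_iff_add_eq_zero, ← add_smul, smul_eq_zero] at k3
    have := k3.resolve_right he0; linarith
  have hXne : ∀ t ∈ Ioc (0 : ℝ) 1, X t ≠ 0 := fun t ht h0 => by
    have ht' : t ∈ Icc (0 : ℝ) 1 := ⟨ht.1.le, ht.2⟩
    have k : F (t • e) = F (t • -e) := by rw [hcurve ht' he, hcurve ht' hne, h0, zero_smul, zero_smul]
    have k2 := smul_right_injective _ ht.1.ne' (hFinj (smul_mem_ball ht' he) (smul_mem_ball ht' hne) k)
    rw [eq_neg_iff_add_eq_zero, ← two_smul ℝ, smul_eq_zero] at k2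
    exact he0 (k2.resolve_left two_ne_zero)
  have hXc : ContinuousOn X (Icc 0 1) := hXs.continuousOn.mono hVI
  obtain ⟨σ, hσ, hσpos⟩ : ∃ σ : ℝ, σ ^ 2 = 1 ∧ ∀ t ∈ Ioc (0 : ℝ) 1, 0 < σ * X t := by
    obtain ⟨σ, hσ, hσ1⟩ : ∃ σ : ℝ, σ ^ 2 = 1 ∧ 0 < σ * X 1 := by
      rcases lt_or_gt_of_ne (hXne 1 ⟨one_pos, le_rfl⟩) with k | k
      · exact ⟨-1, by norm_num, by linarith⟩
      · exact ⟨1, by norm_num, by linarith⟩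
    refine ⟨σ, hσ, fun t ht => ?_⟩
    by_contra! hc
    obtain ⟨s, hs, hs0⟩ := intermediate_value_Icc ht.2
      ((continuousOn_const (c := σ)).mul (hXc.mono (Icc_subset_Icc_left ht.1.le))) ⟨hc, hσ1.le⟩
    have hσ0 : σ ≠ 0 := fun h0 => by rw [h0] at hσ; norm_num at hσ
    exact hXne s ⟨ht.1.trans_le hs.1, hs.2⟩ ((mul_eq_zero.1 hs0).resolve_left hσ0)
  have hσX : ∀ t ∈ Icc (0 : ℝ) 1, |X t| = σ * X t := fun t ht => by
    have k : 0 ≤ σ * X t := by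
      rcases ht.1.eq_or_lt with h0 | h0
      · rw [← h0, hX00, mul_zero]
      · exact (hσpos t ⟨h0, ht.2⟩).le
    have hσ1 : |σ| = 1 := by rw [← abs_one, ← sq_eq_sq_iff_abs_eq_abs, hσ, one_pow]
    rw [← abs_of_nonneg k, abs_mul, hσ1, one_mul]
  have hfd : ∀ t ∈ Icc (0 : ℝ) 1,
      fderiv ℝ F (t • e) e = pt (deriv Y t) (deriv X t • e) := fun t ht => by
    have k1 : HasDerivAt (fun t : ℝ => F (t • e)) (fderiv ℝ F (t • e) e) t := by
      have k : HasDerivAt (fun t : ℝ => t • e) e t := by simpa using (hasDerivAt_id t).smul_const e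
      exact ((hUs.contDiffAt (hUo.mem_nhds (hUb (smul_mem_ball ht he)))).differentiableAt
        (by simp)).hasFDerivAt.comp_hasDerivAt t k
    refine ((uniqueDiffOn_Icc zero_lt_one) t ht).eq_deriv _ k1.hasDerivWithinAt
      ((hasDerivAt_pt (hdt hYs t (hVI ht)) ((hdt hXs t (hVI ht)).smul_const
        e)).hasDerivWithinAt.congr (fun s hs => hcurve hs he) (hcurve ht he))
  have hreg : ∀ t ∈ Icc (0 : ℝ) 1, deriv X t ^ 2 + deriv Y t ^ 2 ≠ 0 := fun t ht h0 => by
    have k1 : deriv X t = 0 := by nlinarith [sq_nonneg (deriv X t), sq_nonneg (deriv Y t)]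
    have k2 : deriv Y t = 0 := by nlinarith [sq_nonneg (deriv X t), sq_nonneg (deriv Y t)]
    have k3 := hfd t ht
    rw [k1, k2, zero_smul] at k3
    exact he0 (hinj _ (smul_mem_ball ht he) (k3.trans (map_zero (fderiv ℝ F (t • e))).symm))
  have hY10 : deriv Y 0 = 0 := by
    have k1 := hdt hYs 0 (hVI h0m)
    have k2 : HasDerivAt (fun t => Y (-t)) (deriv Y 0 * -1) 0 :=
      HasDerivAt.comp (h₂ := Y) (0 : ℝ) (by rw [neg_zero]; exact k1) (hasDerivAt_neg 0)
    have k3 : ∀ t ∈ Icc (0 : ℝ) 1, Y (-t) = Y t := fun t ht => by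
      have := congrArg (fun p : Amb n => p.fst) (hcurve ht hne)
      rw [smul_neg, ← neg_smul] at this
      exact this
    have := ((uniqueDiffOn_Icc zero_lt_one) (0 : ℝ) h0m).eq_deriv _ k1.hasDerivWithinAt
      (k2.hasDerivWithinAt.congr (fun s hs => (k3 s hs).symm) (k3 0 h0m).symm)
    linarith
  have hY0 : Y 0 = a := by
    have k : F 0 ∈ F '' closedBall 0 1 ∩ {p | p.snd = 0} := by
      refine ⟨⟨0, by simp, rfl⟩, ?_⟩
      have := hcurve h0m he
      rw [zero_smul, hX00, zero_smul] at this
      rw [this]; rfl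
    rw [h.meets_axis] at k
    have k' : F 0 = pt a 0 := k
    simp only [hY, zero_smul, k', pt_fst]
  have hode : ∀ t ∈ Ioo (0 : ℝ) 1, (deriv (deriv Y) t * deriv X t - deriv (deriv X) t * deriv Y t) /
      (deriv X t ^ 2 + deriv Y t ^ 2) + n₋₁ * deriv Y t / X t +
        1 / 2 * (Y t * deriv X t - X t * deriv Y t) = 0 := fun t ht => by
    have ht' : t ∈ Icc (0 : ℝ) 1 := ⟨ht.1.le, ht.2.le⟩
    have hz : ‖t • e‖ = t := by rw [norm_smul, he, mul_one, norm_of_nonneg ht.1.le]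
    have hz0 : t • e ≠ 0 := smul_ne_zero ht.1.ne' he0
    have hev : ∀ᶠ s in 𝓝 t, s ∈ V := hVo.mem_nhds (hVI ht')
    have hFe : F =ᶠ[𝓝 (t • e)] fun w => pt (Y ‖w‖) ((X ‖w‖ / ‖w‖) • w) := by
      have : ∀ᶠ w in 𝓝 (t • e), ‖w‖ ∈ Ioo (0 : ℝ) 1 :=
        continuous_norm.continuousAt.eventually (by simp only [hz]; exact isOpen_Ioo.mem_nhds ht)
      filter_upwards [this] with w hw
      have k := hcurve (t := ‖w‖) (ξ := ‖w‖⁻¹ • w) ⟨hw.1.le, hw.2.le⟩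
        (by rw [norm_smul, norm_inv, norm_norm, inv_mul_cancel₀ hw.1.ne'])
      rw [smul_smul, mul_inv_cancel₀ hw.1.ne', one_smul, smul_smul] at k
      exact k
    have key := (shrinker_curve_iff (X1 := deriv X) (Y1 := deriv Y) (x2 := deriv (deriv X) t)
      (y2 := deriv (deriv Y) t) hz0 hFe
      (by rw [hz]; exact hev.mono fun s hs => hdt hXs s hs)
      (by rw [hz]; exact hev.mono fun s hs => hdt hYs s hs)
      (by rw [hz]; exact hdt (hder hXs) t (hVI ht')) (by rw [hz]; exact hdt (hder hYs) t (hVI ht'))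
      ((hUs.contDiffAt (hUo.mem_nhds (hUb (smul_mem_ball ht' he)))).of_le two_le_infty)
      (by rw [hz]; exact hXne t ⟨ht.1, ht.2.le⟩) (by rw [hz]; exact hreg t ht')).2.1
      (h.shrinker _ (smul_mem_ball ht' he))
    rwa [hz] at key
  refine ⟨fun t => σ * X t, Y, fun t => σ * deriv X t, deriv Y, fun t => σ * deriv (deriv X) t,
    deriv (deriv Y), ⟨fun t ht => (hdt hXs t (hVI ht)).const_mul σ, fun t ht => hdt hYs t (hVI ht),
    fun t ht => (hdt (hder hXs) t (hVI ht)).const_mul σ, fun t ht => hdt (hder hYs) t (hVI ht),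
    continuousOn_const.mul ((hder (hder hXs)).continuousOn.mono hVI),
    (hder (hder hYs)).continuousOn.mono hVI, by simp only [hX00, mul_zero], hY0, hY10, hσpos,
    fun t ht => ?_, fun t ht => ?_⟩, fun t ht => ?_, ?_, ?_⟩
  · simp only [mul_pow, hσ, one_mul]
    exact hreg t ht
  · have hσ0 : σ ≠ 0 := fun h0 => by rw [h0] at hσ; norm_num at hσ
    have k := congrArg (fun x => σ * x) (hode t ht)
    simp only [mul_zero] at k
    rw [← k, mul_pow, hσ, one_mul]
    have hσ' : σ⁻¹ = σ := inv_eq_of_mul_eq_one_left (by rw [← sq, hσ])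
    rw [mul_comm σ (X t), ← div_div, div_eq_mul_inv _ σ, hσ']
    ring
  · exact (h.subset_halfCylinder ⟨_, smul_mem_ball ht he, rfl⟩).2
  · have := (h.boundary_subset ⟨(1 : ℝ) • e, by simp [he], rfl⟩).1
    exact this
  · ext q
    constructor
    · rintro ⟨x, hx, rfl⟩
      have hx' : ‖x‖ ∈ Icc (0 : ℝ) 1 := ⟨norm_nonneg x, by simpa using hx⟩
      obtain ⟨ξ, hξ, hxξ⟩ : ∃ ξ : Rn n, ‖ξ‖ = 1 ∧ x = ‖x‖ • ξ := by
        rcases eq_or_ne x 0 with h0 | h0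
        · exact ⟨e, he, by simp [h0]⟩
        · have h0' := norm_ne_zero_iff.2 h0
          exact ⟨‖x‖⁻¹ • x, by rw [norm_smul, norm_inv, norm_norm, inv_mul_cancel₀ h0'],
            by rw [smul_smul, mul_inv_cancel₀ h0', one_smul]⟩
      refine ⟨‖x‖, hx', ?_⟩
      have k := hcurve hx' hξ
      rw [← hxξ] at k
      rw [k]
      refine ⟨rfl, ?_⟩
      rw [pt_snd, norm_smul, hξ, mul_one, norm_eq_abs, hσX _ hx']
    · rintro ⟨t, ht, hq1, hq2⟩
      obtain ⟨ξ, hξ, hqξ⟩ : ∃ ξ : Rn n, ‖ξ‖ = 1 ∧ q.snd = X t • ξ := by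
        simp only [← hσX t ht] at hq2
        rcases eq_or_ne (X t) 0 with h0 | h0
        · rw [h0, abs_zero, norm_eq_zero] at hq2
          exact ⟨e, he, by rw [hq2, h0, zero_smul]⟩
        · refine ⟨(X t)⁻¹ • q.snd, ?_, by rw [smul_smul, mul_inv_cancel₀ h0, one_smul]⟩
          rw [norm_smul, hq2, norm_inv, norm_eq_abs, inv_mul_cancel₀ (abs_ne_zero.2 h0)]
      exact ⟨t • ξ, smul_mem_ball ht hξ, by rw [hcurve ht hξ]; exact amb_ext hq1.symm hqξ.symm⟩

/-- The caps are unique. -/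
lemma HighFrom.image_eq_capSet {Y A a y0 : ℝ} (H : HighFrom n Y A) (hA : A ≤ a) (hY : Y < y0)
    (ha : y0 < a) {F : Rn n → Amb n} (h : IsCapEmbedding n y0 a F) :
    F '' closedBall 0 1 = capSet n y0 a := by
  have hn := (H a hA).two_le
  obtain ⟨X, Yc, X1, Y1, X2, Y2, hc, hge, h1, him⟩ := h.exists_curve hn
  obtain ⟨ρ', k1, k2, -⟩ := H.exists_gt hA ⟨hY, ha.le⟩
  obtain ⟨k3, -, k4⟩ := H.capU_spec hA ⟨hY.le, ha.le⟩
  obtain ⟨l1, l2⟩ := hc.image_eq hn (H a hA).pos (k2.mono k1.le) k3 k4 hge h1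
  rw [him]
  ext q
  constructor
  · rintro ⟨t, ht, q1, q2⟩
    have : X t ∈ Icc 0 (capU n a y0) := l2 ▸ mem_image_of_mem X ht
    exact ⟨q2.trans_le this.2, by rw [q1, q2, l1 t ht]⟩
  · rintro ⟨q1, q2⟩
    obtain ⟨t, ht, ht'⟩ : ‖q.snd‖ ∈ X '' Icc 0 1 := l2 ▸ ⟨norm_nonneg _, q1⟩
    exact ⟨t, ht, by rw [q2, l1 t ht, ht'], ht'.symm⟩

end

/-! ### Foliated charts -/

lemma exists_box_subset_image {Z : Type*} [PseudoMetricSpace Z] {g : Z × ℝ → ℝ} {W : Set (Z × ℝ)}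
    (hW : IsOpen W) (hg : ContinuousOn g W)
    (hm : ∀ z s s', (z, s) ∈ W → (z, s') ∈ W → s < s' → g (z, s) < g (z, s')) {z0 : Z} {s0 : ℝ}
    (h : (z0, s0) ∈ W) : ∃ δ > 0, ∃ ε > 0, ∃ η > 0, ball z0 δ ×ˢ ball s0 ε ⊆ W ∧
      ∀ z ∈ ball z0 δ, ∀ t ∈ ball (g (z0, s0)) η, ∃ s ∈ ball s0 ε, g (z, s) = t := by
  obtain ⟨ε0, hε₀, hsub⟩ := isOpen_iff.1 hW _ h
  rw [← ball_prod_same] at hsub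
  set ε := ε0 / 2 with hε
  have hε0 : 0 < ε := by positivity
  have hmem : ∀ z ∈ ball z0 ε0, ∀ s ∈ Icc (s0 - ε) (s0 + ε), (z, s) ∈ W := fun z hz s hs =>
    hsub ⟨hz, by rw [mem_ball, Real.dist_eq, abs_lt]; constructor <;> linarith [hs.1, hs.2]⟩
  have hz0 : z0 ∈ ball z0 ε0 := mem_ball_self hε₀
  have hl : s0 - ε ∈ Icc (s0 - ε) (s0 + ε) := ⟨le_rfl, by linarith⟩
  have hr : s0 + ε ∈ Icc (s0 - ε) (s0 + ε) := ⟨by linarith, le_rfl⟩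
  have h1 := hm _ _ _ (hmem z0 hz0 _ hl) h (by linarith)
  have h2 := hm _ _ _ h (hmem z0 hz0 _ hr) (by linarith)
  set t0 := g (z0, s0)
  obtain ⟨η, hη, h3, h4⟩ : ∃ η > 0, g (z0, s0 - ε) < t0 - η ∧ t0 + η < g (z0, s0 + ε) := by
    refine ⟨min (t0 - g (z0, s0 - ε)) (g (z0, s0 + ε) - t0) / 2, ?_, ?_, ?_⟩
    · have := lt_min (sub_pos.2 h1) (sub_pos.2 h2); linarith
    · linarith [min_le_left (t0 - g (z0, s0 - ε)) (g (z0, s0 + ε) - t0)]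
    · linarith [min_le_right (t0 - g (z0, s0 - ε)) (g (z0, s0 + ε) - t0)]
  have hc : ∀ s ∈ Icc (s0 - ε) (s0 + ε), ContinuousAt (fun z => g (z, s)) z0 := fun s hs =>
    ContinuousAt.comp (g := g) (f := fun z => (z, s))
      (hg.continuousAt (hW.mem_nhds (hmem z0 hz0 s hs))) (by fun_prop)
  obtain ⟨δ, hδ, h5⟩ := eventually_nhds_iff_ball.1
    (((hc _ hl).eventually (gt_mem_nhds h3)).and (((hc _ hr).eventually (lt_mem_nhds h4)).and
      (ball_mem_nhds z0 hε₀)))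
  refine ⟨δ, hδ, ε, hε0, η, hη, fun q hq => ?_, fun z hz t ht => ?_⟩
  · have := hq.2
    rw [mem_ball, Real.dist_eq, abs_lt] at this
    exact hmem q.1 (h5 _ hq.1).2.2 q.2 ⟨by linarith, by linarith⟩
  · obtain ⟨k1, k2, k3⟩ := h5 z hz
    rw [mem_ball, Real.dist_eq, abs_lt] at ht
    obtain ⟨s, hs, hs'⟩ := intermediate_value_Icc (by linarith : s0 - ε ≤ s0 + ε)
      (f := fun s => g (z, s)) (hg.comp (by fun_prop) fun s hs => hmem z k3 s hs)
      (show t ∈ Icc _ _ from ⟨by linarith, by linarith⟩)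
    refine ⟨s, ?_, hs'⟩
    rw [mem_ball, Real.dist_eq, abs_lt]
    have e1 : s ≠ s0 - ε := fun e => by simp only [e] at hs'; linarith
    have e2 : s ≠ s0 + ε := fun e => by simp only [e] at hs'; linarith
    constructor
    · linarith [lt_of_le_of_ne hs.1 e1.symm]
    · linarith [lt_of_le_of_ne hs.2 e2]

/-- A continuous function that increases along the fibres of a chart is the transversal coordinate
of a foliated chart. -/
lemma exists_foliated_chart {X E : Type*} [TopologicalSpace X] [NormedAddCommGroup E]
    [NormedSpace ℝ E] (κ : OpenPartialHomeomorph X (E × ℝ)) {l : X → ℝ} {W : Set X}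
    (hW : IsOpen W) (hWs : W ⊆ κ.source) (hl : ContinuousOn l W)
    (hm : ∀ q ∈ W, ∀ q' ∈ W, (κ q).1 = (κ q').1 → (κ q).2 < (κ q').2 → l q < l q') {p : X}
    (hp : p ∈ W) : ∃ φ : OpenPartialHomeomorph X (E × ℝ), p ∈ φ.source ∧ φ.source ⊆ W ∧
      φ.target = ball 0 1 ×ˢ Ioo (-1) 1 ∧
      ∀ q ∈ φ.source, ∀ q' ∈ φ.source, ((φ q).2 = (φ q').2 ↔ l q = l q') := by
  set V : Set (E × ℝ) := κ.target ∩ κ.symm ⁻¹' W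
  have hVo : IsOpen V := κ.isOpen_inter_preimage_symm hW
  set g : E × ℝ → ℝ := fun z => l (κ.symm z) with hg
  have hgc : ContinuousOn g V := hl.comp (κ.continuousOn_symm.mono inter_subset_left) fun z hz => hz.2
  have hgm : ∀ z s s', (z, s) ∈ V → (z, s') ∈ V → s < s' → g (z, s) < g (z, s') :=
    fun z s s' h h' hs => hm _ h.2 _ h'.2 (by rw [κ.right_inv h.1, κ.right_inv h'.1])
      (by rwa [κ.right_inv h.1, κ.right_inv h'.1])
  have hκp : κ p ∈ V := ⟨κ.map_source (hWs hp), by rw [mem_preimage, κ.left_inv (hWs hp)]; exact hp⟩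
  obtain ⟨δ, hδ, ε, hε, η, hη, hbox, hsurj⟩ := exists_box_subset_image hVo hgc hgm hκp
  set z0 := (κ p).1
  set s0 := (κ p).2
  set t0 := g (z0, s0)
  set B := ball z0 δ ×ˢ ball s0 ε
  have hBo : IsOpen B := isOpen_ball.prod isOpen_ball
  set O := B ∩ g ⁻¹' ball t0 η
  have hOo : IsOpen O := (hgc.mono hbox).isOpen_inter_preimage hBo isOpen_ball
  have hOV : O ⊆ V := inter_subset_left.trans hbox
  set ψ : E × ℝ → E × ℝ := fun z => (z.1, g z) with hψ
  have hinj : InjOn ψ O := by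
    rintro ⟨z, s⟩ h ⟨z', s'⟩ h' e
    obtain ⟨rfl, e2⟩ := Prod.mk.inj e
    rcases lt_trichotomy s s' with k | k | k
    · exact absurd e2 (hgm _ _ _ (hOV h) (hOV h') k).ne
    · rw [k]
    · exact absurd e2 (hgm _ _ _ (hOV h') (hOV h) k).ne'
  have himg : ψ '' O = ball z0 δ ×ˢ ball t0 η := by
    refine subset_antisymm ?_ ?_
    · rintro _ ⟨z, hz, rfl⟩
      exact ⟨hz.1.1, hz.2⟩
    · rintro ⟨z, t⟩ ⟨hz, ht⟩
      obtain ⟨s, hs, e⟩ := hsurj z hz t ht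
      exact ⟨(z, s), ⟨⟨hz, hs⟩, by rw [mem_preimage, e]; exact ht⟩, by simp only [hψ, e]⟩
  have hopen : IsOpenMap (O.domRestrict ψ) := fun N hN => by
    obtain ⟨N', hN', rfl⟩ := isOpen_induced_iff.1 hN
    rw [isOpen_iff_mem_nhds]
    rintro _ ⟨⟨⟨z, s⟩, hzO⟩, hz, rfl⟩
    obtain ⟨δ', hδ', ε', hε', η', hη', hbox', hsurj'⟩ := exists_box_subset_image
      (hOo.inter hN') (hgc.mono fun q hq => hOV hq.1)
      (fun z s s' h h' => hgm z s s' (hOV h.1) (hOV h'.1)) ⟨hzO, hz⟩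
    refine mem_of_superset (prod_mem_nhds (ball_mem_nhds z hδ') (ball_mem_nhds (g (z, s)) hη')) ?_
    rintro ⟨w, t⟩ ⟨hw, ht⟩
    obtain ⟨s', hs', e⟩ := hsurj' w hw t ht
    have k := hbox' (show (w, s') ∈ _ from ⟨hw, hs'⟩)
    exact ⟨⟨(w, s'), k.1⟩, k.2, Prod.ext rfl e⟩
  have hψc : ContinuousOn ψ O := continuous_fst.continuousOn.prodMk (hgc.mono hOV)
  set e1 : OpenPartialHomeomorph (E × ℝ) (E × ℝ) :=
    OpenPartialHomeomorph.ofContinuousOpenRestrict (hinj.toPartialEquiv ψ O) hψc hopen hOo with he1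
  set e₂ := (OpenPartialHomeomorph.unitBallBall z0 δ hδ).symm.prod
    (OpenPartialHomeomorph.unitBallBall t0 η hη).symm with he2
  have hs1 : e1.source = O := rfl
  have ht1 : e1.target = ball z0 δ ×ˢ ball t0 η := himg
  have hs2 : e₂.source = ball z0 δ ×ˢ ball t0 η := rfl
  have hsrc : ∀ q, q ∈ ((κ.trans e1).trans e₂).source ↔ q ∈ κ.source ∧ κ q ∈ O := fun q => by
    simp only [OpenPartialHomeomorph.trans_source, mem_inter_iff, mem_preimage, hs2,
      OpenPartialHomeomorph.coe_trans, comp_apply, hs1]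
    refine ⟨fun h => h.1, fun h => ⟨h, ?_⟩⟩
    rw [← ht1]; exact e1.map_source h.2
  have hval : ∀ q ∈ ((κ.trans e1).trans e₂).source, g (κ q) = l q := fun q hq => by
    rw [hg]; simp only [κ.left_inv ((hsrc q).1 hq).1]
  refine ⟨(κ.trans e1).trans e₂, (hsrc p).2 ⟨hWs hp, ⟨mem_ball_self hδ,
    mem_ball_self hε⟩, mem_ball_self hη⟩, fun q hq => ?_, ?_, fun q hq q' hq' => ?_⟩
  · have := (hOV ((hsrc q).1 hq).2).2
    rwa [mem_preimage, κ.left_inv ((hsrc q).1 hq).1] at this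
  · have ht2 : e₂.target = ball 0 1 ×ˢ Ioo (-1) 1 := by
      have : Ioo (-1 : ℝ) 1 = ball 0 1 := by rw [Real.ball_eq_Ioo]; norm_num
      rw [this]; rfl
    ext w
    rw [← ht2, OpenPartialHomeomorph.trans_target, OpenPartialHomeomorph.trans_target]
    refine ⟨fun h => h.1, fun h => ⟨h, ?_, ?_⟩⟩
    · have := e₂.map_target h
      rwa [hs2, ← ht1] at this
    · have : e₂.symm w ∈ e1.target := by rw [ht1, ← hs2]; exact e₂.map_target h
      exact (hOV (e1.map_target this)).1
  · rw [← hval q hq, ← hval q' hq']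
    have k : ∀ q ∈ ((κ.trans e1).trans e₂).source, g (κ q) ∈ ball t0 η :=
      fun q hq => ((hsrc q).1 hq).2.2
    exact (OpenPartialHomeomorph.unitBallBall t0 η hη).symm.injOn.eq_iff (k q hq) (k q' hq')

section

/-! ### The foliation -/

variable {Y A a y0 b0 : ℝ}

lemma HighFrom.capSet_eq_surface (H : HighFrom n Y A) (hA : A ≤ a) (hY : Y < y0) (ha : y0 < a) :
    capSet n y0 a = surfaceOfRevolution n (capU n a) (Icc y0 a) := by
  have hh := H a hA
  obtain ⟨h1, h2, h3⟩ := H.capU_spec hA ⟨hY.le, ha.le⟩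
  ext q
  constructor
  · rintro ⟨k1, k2⟩
    have k4 := (h2.f_strictAnti hh.two_le hh.pos).antitoneOn ⟨le_rfl, h1⟩ ⟨norm_nonneg q.snd, k1⟩
      (norm_nonneg q.snd)
    rw [capF_zero hh.two_le] at k4
    exact ⟨⟨k2 ▸ (H.le_capF hA ⟨hY.le, ha.le⟩ ⟨norm_nonneg q.snd, k1⟩), k2 ▸ k4⟩,
      (capU_eq hh.two_le hh.pos (norm_nonneg _) (h2.mono k1) k2.symm).symm⟩
  · rintro ⟨k1, k2⟩
    have k3 : q.fst ∈ Icc Y a := ⟨hY.le.trans k1.1, k1.2⟩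
    refine ⟨?_, ?_⟩
    · rw [k2]
      exact (H.strictAntiOn hA).antitoneOn ⟨hY.le, ha.le⟩ k3 k1.1
    · rw [k2, (H.capU_spec hA k3).2.2]

lemma HighFrom.capU_lt (H : HighFrom n Y A) (hA : A ≤ a) {y : ℝ} (hy : y ∈ Ioc Y a) :
    capU n a y < cylRadius n :=
  lt_of_pow_lt_pow_left₀ 2 (cylRadius_pos (H a hA).two_le).le
    (by rw [cylRadius_sq (H a hA).two_le]; exact H.capU_sq_lt hA hy)

/-- The height `y0` is large enough for the foliation of the region `r < b0 y`, `y > y0`. -/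
structure IsBase (n : ℕ) (b0 y0 Y A : ℝ) : Prop where
  two_le : 2 ≤ n
  high : HighFrom n Y A
  Y_nonneg : 0 ≤ Y
  Y_lt : Y < y0
  A_lt : A < y0
  four_lt : 4 < y0
  b0_pos : 0 < b0
  radius_le : cylRadius n ≤ b0 * y0

/-- The label of the leaf through a point. -/
def ambLabel (q : Amb n) : ℝ := label n q.fst ‖q.snd‖

/-- The leaf with a given label. -/
def leafOf (n : ℕ) (y0 c : ℝ) : Set (Amb n) :=
  if c < 0 then capSet n y0 (-c⁻¹) else if c = 0 then cylinder n
  else surfaceOfRevolution n (conU n c) (Ici y0)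

namespace IsBase

lemma leaf_spec (h : IsBase n b0 y0 Y A) {S : Set (Amb n)}
    (hS : S ∈ leaves n b0 y0 (capSet n y0) (conU n)) :
    ∃ c, S = leafOf n y0 c ∧ ∀ q ∈ region n b0 y0, q ∈ S ↔ ambLabel q = c := by
  have hy0 : 0 < y0 := by linarith [h.four_lt]
  have hl : ∀ q ∈ region n b0 y0, _ := fun q hq =>
    h.high.label_eq_iff h.two_le (h.Y_lt.trans hq.2) (h.A_lt.trans hq.2).le (h.four_lt.trans hq.2)
      (norm_nonneg q.snd)
  rcases hS with ⟨a, ha, rfl⟩ | ⟨b, hb, hb', rfl⟩ | rfl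
  · have ha0 : 0 < a := hy0.trans ha
    refine ⟨-a⁻¹, ?_, fun q hq => ?_⟩
    · rw [leafOf, if_pos (by simpa using ha0), inv_neg, inv_inv, neg_neg]
    · rw [h.high.capSet_eq_surface (h.A_lt.trans ha).le h.Y_lt ha, ambLabel, (hl q hq).1 a ha0]
      exact ⟨fun k => ⟨k.1.2, k.2⟩, fun k => ⟨⟨hq.2.le, k.1⟩, k.2⟩⟩
  · refine ⟨b, ?_, fun q hq => ?_⟩
    · rw [leafOf, if_neg hb.not_gt, if_neg hb.ne']
    · rw [ambLabel, (hl q hq).2.2 b hb]; exact ⟨fun k => k.2, fun k => ⟨hq.2.le, k⟩⟩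
  · refine ⟨0, by simp [leafOf], fun q hq => ?_⟩
    rw [ambLabel, (hl q hq).2.1]; rfl

lemma leafOf_mem (h : IsBase n b0 y0 Y A) {q : Amb n} (hq : q ∈ region n b0 y0) :
    leafOf n y0 (ambLabel q) ∈ leaves n b0 y0 (capSet n y0) (conU n) ∧
      q ∈ leafOf n y0 (ambLabel q) := by
  have hy0 : 0 < y0 := by linarith [h.four_lt]
  rw [ambLabel]
  rcases lt_trichotomy ‖q.snd‖ (cylRadius n) with k | k | k
  · obtain ⟨k1, k3⟩ := h.high.capTip_spec (h.Y_lt.trans hq.2) (h.A_lt.trans hq.2).le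
      (norm_nonneg q.snd) (sq_lt_of_lt_cylRadius h.two_le (norm_nonneg _) k)
    have k2 : y0 < capTip n q.fst ‖q.snd‖ := hq.2.trans_le k1
    rw [label_inside k, leafOf, if_pos (by simpa using hy0.trans k2), inv_neg, inv_inv, neg_neg]
    refine ⟨Or.inl ⟨_, k2, rfl⟩, ?_⟩
    rw [h.high.capSet_eq_surface (h.A_lt.trans k2).le h.Y_lt k2]
    exact ⟨⟨hq.2.le, k1⟩, k3.symm⟩
  · rw [k, label_cylinder, leafOf, if_neg (lt_irrefl _), if_pos rfl]
    exact ⟨Or.inr (Or.inr rfl), k⟩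
  · have h4 := h.four_lt.trans hq.2
    obtain ⟨k1, k2⟩ := conB_spec h.two_le h4 k
    rw [label_outside k, leafOf, if_neg k1.not_gt, if_neg k1.ne']
    refine ⟨Or.inr (Or.inl ⟨_, k1, ?_, rfl⟩), hq.2.le, k2.symm⟩
    have k3 := (isConical_con h.two_le k1).slope_mul_lt h.two_le (by norm_num) h4
    rw [k2] at k3
    exact lt_of_mul_lt_mul_right (k3.trans hq.1) (by linarith)

lemma continuousAt_ambLabel (h : IsBase n b0 y0 Y A) {q : Amb n} (hq : y0 < q.fst) :
    ContinuousAt (ambLabel (n := n)) q := by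
  have hY := h.Y_lt.trans hq
  have hA := h.A_lt.trans hq
  have h4 := h.four_lt.trans hq
  rcases (norm_nonneg q.snd).eq_or_lt with k | k
  · obtain ⟨L, hL, hev⟩ := h.high.exists_smooth_label h.two_le hY hA (by linarith)
      (norm_nonneg q.snd) (by rw [← k]; exact cylRadius_pos h.two_le)
    have hc : ContinuousAt (fun q : Amb n => (q.fst, ‖q.snd‖ ^ 2)) q :=
      (continuous_fst_amb.prodMk (continuous_snd_amb.norm.pow 2)).continuousAt
    refine (ContinuousAt.comp (g := L) (f := fun q : Amb n => (q.fst, ‖q.snd‖ ^ 2)) hL.continuousAt hc).congr ?_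
    filter_upwards [hc.eventually hev] with w hw
    rw [comp_apply, hw (by positivity), sqrt_sq (norm_nonneg _)]
    rfl
  · exact ContinuousAt.comp (g := fun z : ℝ × ℝ => label n z.1 z.2)
      (f := fun q : Amb n => (q.fst, ‖q.snd‖)) (h.high.continuousAt_label h.two_le hY hA h4 k)
      (continuous_fst_amb.prodMk continuous_snd_amb.norm).continuousAt

end IsBase

/-- The coordinates `(y x / ‖x‖, ‖x‖)` away from the axis. -/
def polarChart (n : ℕ) : OpenPartialHomeomorph (Amb n) (Rn n × ℝ) where
  toFun q := ((q.fst / ‖q.snd‖) • q.snd, ‖q.snd‖)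
  invFun z := pt ‖z.1‖ ((z.2 / ‖z.1‖) • z.1)
  source := {q | 0 < q.fst ∧ q.snd ≠ 0}
  target := {z | z.1 ≠ 0 ∧ 0 < z.2}
  map_source' q hq := by
    have h := norm_pos_iff.2 hq.2
    exact ⟨smul_ne_zero (div_pos hq.1 h).ne' hq.2, h⟩
  map_target' z hz := by
    have h := norm_pos_iff.2 hz.1
    exact ⟨h, smul_ne_zero (div_pos hz.2 h).ne' hz.1⟩
  left_inv' q hq := by
    have h := norm_pos_iff.2 hq.2
    have h1 := hq.1
    have e : ‖(q.fst / ‖q.snd‖) • q.snd‖ = q.fst := by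
      rw [norm_smul, norm_of_nonneg (by positivity), div_mul_cancel₀ _ h.ne']
    refine amb_ext (by simpa using e) ?_
    simp only [pt_snd, e, smul_smul]
    rw [div_mul_div_comm, mul_comm q.fst, div_self (by positivity), one_smul]
  right_inv' z hz := by
    have h := norm_pos_iff.2 hz.1
    have h1 := hz.2
    have e : ‖(z.2 / ‖z.1‖) • z.1‖ = z.2 := by
      rw [norm_smul, norm_of_nonneg (by positivity), div_mul_cancel₀ _ h.ne']
    refine Prod.ext ?_ (by simpa using e)
    simp only [pt_snd, pt_fst, e, smul_smul]
    rw [div_mul_div_comm, mul_comm z.2, div_self (by positivity), one_smul]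
  open_source := (isOpen_lt continuous_const continuous_fst_amb).inter
    (isOpen_ne_fun continuous_snd_amb continuous_const)
  open_target := (isOpen_ne_fun continuous_fst continuous_const).inter
    (isOpen_lt continuous_const continuous_snd)
  continuousOn_toFun := by
    refine ContinuousOn.prodMk (ContinuousOn.smul (continuous_fst_amb.continuousOn.div
      continuous_snd_amb.norm.continuousOn fun q hq => norm_ne_zero_iff.2 hq.2)
      continuous_snd_amb.continuousOn) continuous_snd_amb.norm.continuousOn
  continuousOn_invFun := by
    refine contDiff_pt (k := 0) |>.continuous.comp_continuousOn (ContinuousOn.prodMk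
      continuous_fst.norm.continuousOn (ContinuousOn.smul (continuous_snd.continuousOn.div
        continuous_fst.norm.continuousOn fun z hz => norm_ne_zero_iff.2 hz.1)
        continuous_fst.continuousOn))

lemma isOpen_region : IsOpen (region n b0 y0) :=
  (isOpen_lt continuous_snd_amb.norm (continuous_const.mul continuous_fst_amb)).inter
    (isOpen_lt continuous_const continuous_fst_amb)

lemma IsBase.exists_chart (h : IsBase n b0 y0 Y A) {p : Amb n} (hp : p ∈ region n b0 y0) :
    ∃ φ : OpenPartialHomeomorph (Amb n) (Rn n × ℝ), p ∈ φ.source ∧ φ.source ⊆ region n b0 y0 ∧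
      φ.target = ball (0 : Rn n) 1 ×ˢ Ioo (-1 : ℝ) 1 ∧
      ∀ q ∈ φ.source, ∀ q' ∈ φ.source, ((φ q).2 = (φ q').2 ↔ ambLabel q = ambLabel q') := by
  by_cases h0 : p.snd = 0
  · set W := region n b0 y0 ∩ {q | ‖q.snd‖ < cylRadius n} with hW
    obtain ⟨φ, k1, k2, k3, k4⟩ := exists_foliated_chart
      ((ptL n).symm.toHomeomorph.trans (Homeomorph.prodComm ℝ (Rn n))).toOpenPartialHomeomorph
      (l := ambLabel) (W := W)
      (isOpen_region.inter (isOpen_lt continuous_snd_amb.norm continuous_const))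
      (subset_univ _) (fun q hq => (h.continuousAt_ambLabel hq.1.2).continuousWithinAt)
      (fun q hq q' hq' e1 e2 => by
        have e1' : q.snd = q'.snd := e1
        have e2' : q.fst < q'.fst := e2
        rw [ambLabel, ambLabel, ← e1']
        exact h.high.label_strictMonoOn_height h.two_le (norm_nonneg _) hq.2 (h.Y_lt.trans hq.1.2)
          (h.A_lt.trans hq.1.2).le h.Y_nonneg e2')
      (show p ∈ W from ⟨hp, by simp [h0, cylRadius_pos h.two_le]⟩)
    exact ⟨φ, k1, k2.trans inter_subset_left, k3, k4⟩
  · have hy0 : 0 < y0 := by linarith [h.four_lt]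
    obtain ⟨φ, k1, k2, k3, k4⟩ := exists_foliated_chart (polarChart n)
      (l := ambLabel) (W := region n b0 y0 ∩ (polarChart n).source)
      (isOpen_region.inter (polarChart n).open_source) inter_subset_right
      (fun q hq => (h.continuousAt_ambLabel hq.1.2).continuousWithinAt)
      (fun q hq q' hq' e1 e2 => by
        have e2' : ‖q.snd‖ < ‖q'.snd‖ := e2
        have e : ∀ q ∈ (polarChart n).source, ‖((polarChart n) q).1‖ = q.fst := fun q hq => by
          have := congrArg (fun p : Amb n => p.fst) ((polarChart n).left_inv hq); exact this
        have e3 : q.fst = q'.fst := by rw [← e q hq.2, ← e q' hq'.2, e1]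
        rw [ambLabel, ambLabel, ← e3]
        exact h.high.label_strictMonoOn h.two_le (h.Y_lt.trans hq.1.2) (h.A_lt.trans hq.1.2).le
          (h.four_lt.trans hq.1.2) (norm_nonneg _) (norm_nonneg _) e2')
      (show p ∈ _ from ⟨hp, hy0.trans hp.2, h0⟩)
    exact ⟨φ, k1, k2.trans inter_subset_left, k3, k4⟩

lemma isConnected_surface (hn : 2 ≤ n) {J : Set ℝ} (hJ : IsConnected J) {u : ℝ → ℝ}
    (hu : ContinuousOn u J) (h0 : ∀ y ∈ J, 0 ≤ u y) : IsConnected (surfaceOfRevolution n u J) := by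
  have hs : IsConnected (sphere (0 : Rn n) 1) := isConnected_sphere (by
    rw [rank_eq_card_basis (EuclideanSpace.basisFun (Fin n) ℝ).toBasis, Fintype.card_fin]
    exact_mod_cast hn) 0 zero_le_one
  have : surfaceOfRevolution n u J =
      (fun z : ℝ × Rn n => pt z.1 (u z.1 • z.2)) '' (J ×ˢ sphere 0 1) := by
    ext q
    constructor
    · rintro ⟨k1, k2⟩
      by_cases hq : q.snd = 0
      · obtain ⟨e, he⟩ := hs.nonempty
        rw [hq, norm_zero] at k2
        exact ⟨(q.fst, e), ⟨k1, he⟩, amb_ext rfl (by simp [← k2, hq])⟩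
      · refine ⟨(q.fst, ‖q.snd‖⁻¹ • q.snd), ⟨k1, by simp [norm_smul, hq]⟩, amb_ext rfl ?_⟩
        simp only [pt_snd, ← k2, smul_smul]
        rw [mul_inv_cancel₀ (norm_ne_zero_iff.2 hq), one_smul]
    · rintro ⟨⟨y, e⟩, ⟨k1, k2⟩, rfl⟩
      refine ⟨k1, ?_⟩
      have : ‖e‖ = 1 := by simpa using k2
      rw [pt_snd, norm_smul, this, mul_one, norm_of_nonneg (h0 y k1), pt_fst]
  rw [this]
  exact (hJ.prod hs).image _ (contDiff_pt (k := 0) |>.continuous.comp_continuousOn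
    (continuous_fst.continuousOn.prodMk ((hu.comp continuous_fst.continuousOn fun z hz => hz.1).smul
      continuous_snd.continuousOn)))

lemma IsBase.isConnected_leaf (h : IsBase n b0 y0 Y A) {S : Set (Amb n)}
    (hS : S ∈ leaves n b0 y0 (capSet n y0) (conU n)) : IsConnected (S ∩ region n b0 y0) := by
  have hR : ∀ y, y0 < y → cylRadius n < b0 * y := fun y hy =>
    h.radius_le.trans_lt (by have := h.b0_pos; gcongr)
  rcases hS with ⟨a, ha, rfl⟩ | ⟨b, hb, hb', rfl⟩ | rfl
  · have hA := h.A_lt.trans ha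
    have : capSet n y0 a ∩ region n b0 y0 = surfaceOfRevolution n (capU n a) (Ioc y0 a) := by
      rw [h.high.capSet_eq_surface hA.le h.Y_lt ha]
      ext q
      refine ⟨fun k => ⟨⟨k.2.2, k.1.1.2⟩, k.1.2⟩, fun k => ⟨⟨⟨k.1.1.le, k.1.2⟩, k.2⟩, ?_, k.1.1⟩⟩
      rw [k.2]; exact (h.high.capU_lt hA.le ⟨h.Y_lt.trans k.1.1, k.1.2⟩).trans (hR _ k.1.1)
    rw [this]
    exact isConnected_surface h.two_le (isConnected_Ioc ha)
      ((h.high.continuousOn_y hA).mono (Ioc_subset_Ioc_left h.Y_lt.le)) fun y hy =>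
        (h.high.capU_spec hA.le ⟨(h.Y_lt.trans hy.1).le, hy.2⟩).1
  · have hc := isConical_con h.two_le hb
    have : surfaceOfRevolution n (conU n b) (Ici y0) ∩ region n b0 y0 =
        surfaceOfRevolution n (conU n b) {y | y0 < y ∧ conU n b y < b0 * y} := by
      ext q
      exact ⟨fun k => ⟨⟨k.2.2, k.1.2 ▸ k.2.1⟩, k.1.2⟩,
        fun k => ⟨⟨k.1.1.le, k.2⟩, k.2 ▸ k.1.2, k.1.1⟩⟩
    rw [this]
    refine isConnected_surface h.two_le ⟨?_, OrdConnected.isPreconnected ⟨?_⟩⟩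
      (hc.profile.cont_u.mono fun y hy => h.four_lt.trans hy.1)
      fun y hy => (hc.profile.pos y (h.four_lt.trans hy.1)).le
    · obtain ⟨y, k1, k2⟩ := ((hc.slope.eventually (gt_mem_nhds hb')).and
        (eventually_gt_atTop y0)).exists
      exact ⟨y, k2, (div_lt_iff₀ (by linarith [h.four_lt])).1 k1⟩
    · intro y hy z hz t ht
      have ht0 : y0 < t := hy.1.trans_le ht.1
      refine ⟨ht0, ?_⟩
      rw [← div_lt_iff₀ (by linarith [h.four_lt])]
      refine lt_of_le_of_lt ((hc.strictAntiOn_div h.two_le (by norm_num)).antitoneOn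
        (show (4 : ℝ) < y from h.four_lt.trans hy.1) (show (4 : ℝ) < t from h.four_lt.trans ht0)
        ht.1) ?_
      rw [div_lt_iff₀ (by linarith [h.four_lt, hy.1])]
      exact hy.2
  · have : cylinder n ∩ region n b0 y0 = surfaceOfRevolution n (fun _ => cylRadius n) (Ioi y0) := by
      ext q; exact ⟨fun k => ⟨k.2.2, k.1⟩, fun k => ⟨k.2, by rw [k.2]; exact hR _ k.1, k.1⟩⟩
    rw [this]
    exact isConnected_surface h.two_le isConnected_Ioi continuousOn_const fun y _ =>
      (cylRadius_pos h.two_le).le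

lemma IsBase.isFoliation (h : IsBase n b0 y0 Y A) :
    IsFoliation (region n b0 y0) (leaves n b0 y0 (capSet n y0) (conU n)) := by
  have huniq : ∀ S ∈ leaves n b0 y0 (capSet n y0) (conU n), ∀ q ∈ region n b0 y0, q ∈ S →
      S = leafOf n y0 (ambLabel q) := fun S hS q hq hqS => by
    obtain ⟨c, k1, k2⟩ := h.leaf_spec hS
    rw [(k2 q hq).1 hqS, k1]
  refine ⟨fun p hp => ⟨_, h.leafOf_mem hp, fun S hS => huniq S hS.1 p hp hS.2⟩,
    fun S hS => h.isConnected_leaf hS, fun p hp => ?_⟩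
  obtain ⟨φ, k1, k2, k3, k4⟩ := h.exists_chart hp
  refine ⟨φ, k1, k2, k3, fun q hq q' hq' => (k4 q hq q' hq').trans ⟨fun e => ?_, ?_⟩⟩
  · exact ⟨_, (h.leafOf_mem (k2 hq)).1, (h.leafOf_mem (k2 hq)).2, e ▸ (h.leafOf_mem (k2 hq')).2⟩
  · rintro ⟨S, hS, l1, l2⟩
    obtain ⟨c, m1, m2⟩ := h.leaf_spec hS
    rw [(m2 q (k2 hq)).1 l1, (m2 q' (k2 hq')).1 l2]

end

section

/-! ### The field of unit normals -/

variable {Y A a y0 b0 : ℝ}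

lemma contDiff_fst_amb : ContDiff ℝ ∞ fun q : Amb n => q.fst :=
  contDiff_fst.comp (ptL n).symm.contDiff

lemma contDiff_snd_amb : ContDiff ℝ ∞ fun q : Amb n => q.snd :=
  contDiff_snd.comp (ptL n).symm.contDiff

/-- The reciprocal of `dy/dr` of the leaf through `(y, r)`, with the opposite sign. -/
def transSlope (n : ℕ) (y r : ℝ) : ℝ :=
  if r < cylRadius n then (arcSlope (capP n (capTip n y r)) r)⁻¹
  else if r = cylRadius n then 0 else -conP n (conB n y r) y

/-- A normal vector of the leaf through a point. -/
def rawNormal (q : Amb n) : Amb n :=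
  if ‖q.snd‖ < cylRadius n then pt 1 (-(2 * capP n (capTip n q.fst ‖q.snd‖) ‖q.snd‖) • q.snd)
  else pt (transSlope n q.fst ‖q.snd‖) (‖q.snd‖⁻¹ • q.snd)

/-- The unit normal of the leaf through a point. -/
def unitNormal (q : Amb n) : Amb n := ‖rawNormal q‖⁻¹ • rawNormal q

lemma rawNormal_ne_zero (hn : 2 ≤ n) (q : Amb n) : rawNormal q ≠ 0 := by
  intro h0
  rw [rawNormal] at h0
  split_ifs at h0 with h
  · have := congrArg (fun p : Amb n => p.fst) h0
    exact one_ne_zero this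
  · have h1 : ‖q.snd‖⁻¹ • q.snd = 0 := congrArg (fun p : Amb n => p.snd) h0
    have h2 : 0 < ‖q.snd‖ := (cylRadius_pos hn).trans_le (not_lt.1 h)
    exact smul_ne_zero (inv_ne_zero h2.ne') (norm_pos_iff.1 h2) h1

lemma one_lt_radius (hn : 2 ≤ n) : 1 < cylRadius n := by
  have h1 := cylRadius_sq hn
  have h2 := cylRadius_pos hn
  have h3 : (2 : ℝ) ≤ n := by exact_mod_cast hn
  nlinarith

namespace IsBase

lemma contDiffAt_rawNormal (h : IsBase n b0 y0 Y A) {q : Amb n} (hq : y0 < q.fst)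
    (hR : ‖q.snd‖ ≠ cylRadius n) : ContDiffAt ℝ ∞ (rawNormal (n := n)) q := by
  have hn0 := continuous_snd_amb (n := n).norm.continuousAt (x := q)
  rcases lt_or_gt_of_ne hR with k | k
  · obtain ⟨L, P, -, hP, hev⟩ := h.high.exists_smooth_tip (h.Y_lt.trans hq) (h.A_lt.trans hq)
      (norm_nonneg q.snd) (sq_lt_of_lt_cylRadius h.two_le (norm_nonneg _) k)
    have hc : ContDiffAt ℝ ∞ (fun q : Amb n => (q.fst, ‖q.snd‖ ^ 2)) q :=
      (contDiff_fst_amb.prodMk (contDiff_snd_amb.norm_sq ℝ)).contDiffAt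
    have hPc : ContDiffAt ℝ ∞ (fun q : Amb n => P (q.fst, ‖q.snd‖ ^ 2)) q :=
      ContDiffAt.comp (g := P) (f := fun q : Amb n => (q.fst, ‖q.snd‖ ^ 2)) q hP hc
    have hv : ContDiffAt ℝ ∞ (fun q : Amb n => pt 1 (-(2 * P (q.fst, ‖q.snd‖ ^ 2)) • q.snd)) q :=
      contDiff_pt.contDiffAt.comp q (contDiffAt_const.prodMk
        ((contDiffAt_const.mul hPc).neg.smul contDiff_snd_amb.contDiffAt))
    refine hv.congr_of_eventuallyEq ?_
    filter_upwards [hc.continuousAt.eventually hev, hn0.eventually (gt_mem_nhds k)] with w hw hw'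
    rw [rawNormal, if_pos hw', (hw (by positivity)).2]
    simp only [sqrt_sq (norm_nonneg w.snd)]
  · have hs : q.snd ≠ 0 := norm_pos_iff.1 ((cylRadius_pos h.two_le).trans k)
    have hnr : ContDiffAt ℝ ∞ (fun q : Amb n => ‖q.snd‖) q := contDiff_snd_amb.contDiffAt.norm ℝ hs
    have hP : ContDiffAt ℝ ∞ (fun q : Amb n => conP n (conB n q.fst ‖q.snd‖) q.fst) q :=
      ContDiffAt.comp (g := fun z : ℝ × ℝ => conP n (conB n z.1 z.2) z.1)
        (f := fun q : Amb n => (q.fst, ‖q.snd‖)) q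
        (contDiffAt_conP_conB h.two_le (h.four_lt.trans hq) k)
        (contDiff_fst_amb.contDiffAt.prodMk hnr)
    have hv : ContDiffAt ℝ ∞ (fun q : Amb n =>
        pt (-conP n (conB n q.fst ‖q.snd‖) q.fst) (‖q.snd‖⁻¹ • q.snd)) q :=
      contDiff_pt.contDiffAt.comp q (hP.neg.prodMk
        ((hnr.inv (norm_ne_zero_iff.2 hs)).smul contDiff_snd_amb.contDiffAt))
    refine hv.congr_of_eventuallyEq ?_
    filter_upwards [hn0.eventually (lt_mem_nhds k)] with w hw
    rw [rawNormal, if_neg hw.not_gt, transSlope, if_neg hw.not_gt, if_neg hw.ne']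

lemma slope_pos (h : IsBase n b0 y0 Y A) {y r : ℝ} (hy : y0 < y) (h0 : 0 < r)
    (hr : r < cylRadius n) : 0 < arcSlope (capP n (capTip n y r)) r := by
  obtain ⟨k1, k2⟩ := h.high.capTip_spec (h.Y_lt.trans hy) (h.A_lt.trans hy).le h0.le
    (sq_lt_of_lt_cylRadius h.two_le h0.le hr)
  have hA := (h.A_lt.trans hy).le.trans k1
  obtain ⟨-, k3, -⟩ := h.high.capU_spec hA ⟨(h.Y_lt.trans hy).le, k1⟩
  rw [k2] at k3
  exact h.high.slope_pos hA h0 k3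

lemma abs_transSlope_le (h : IsBase n b0 y0 Y A) {y r : ℝ} (hy : y0 < y) (h1 : 1 ≤ r) :
    |transSlope n y r| ≤ 2 * cylRadius n * |r - cylRadius n| := by
  have hR := one_lt_radius h.two_le
  have h4 := h.four_lt.trans hy
  rw [transSlope]
  split_ifs with k k'
  · have hg := h.slope_pos hy (by linarith) k
    set g := arcSlope (capP n (capTip n y r)) r
    rw [abs_of_pos (inv_pos.2 hg), abs_of_neg (by linarith), inv_le_iff_one_le_mul₀ hg]
    have k2 : 1 ≤ 13 / 28 * r * y := by nlinarith
    refine (k2.trans (h.high.slope_ge h.two_le (h.Y_lt.trans hy) (h.A_lt.trans hy).le h1 k)).trans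
      (mul_le_mul_of_nonneg_right ?_ hg.le)
    nlinarith
  · simp [k']
  · have k1 : cylRadius n < r := lt_of_le_of_ne (not_lt.1 k) (Ne.symm k')
    obtain ⟨k2, k3⟩ := conB_spec h.two_le h4 k1
    have hc := isConical_con h.two_le k2
    have k4 := hc.p_pos h.two_le k2 le_rfl h4
    have k5 := (hc.outside h.two_le k2 le_rfl h4).2
    rw [k3] at k5
    rw [abs_neg, abs_of_pos k4, abs_of_pos (by linarith)]; nlinarith

lemma unitNormal_eq (h : IsBase n b0 y0 Y A) {q : Amb n} (hq : y0 < q.fst) (h0 : q.snd ≠ 0) :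
    unitNormal q = ‖pt (transSlope n q.fst ‖q.snd‖) (‖q.snd‖⁻¹ • q.snd)‖⁻¹ •
      pt (transSlope n q.fst ‖q.snd‖) (‖q.snd‖⁻¹ • q.snd) := by
  rw [unitNormal, rawNormal]
  split_ifs with k
  · have hr := norm_pos_iff.2 h0
    have hg := h.slope_pos hq hr k
    rw [transSlope, if_pos k]
    have e : pt 1 (-(2 * capP n (capTip n q.fst ‖q.snd‖) ‖q.snd‖) • q.snd) =
        arcSlope (capP n (capTip n q.fst ‖q.snd‖)) ‖q.snd‖ •
          pt (arcSlope (capP n (capTip n q.fst ‖q.snd‖)) ‖q.snd‖)⁻¹ (‖q.snd‖⁻¹ • q.snd) := by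
      refine amb_ext ?_ ?_
      · simp only [pt_fst, WithLp.smul_fst, smul_eq_mul, mul_inv_cancel₀ hg.ne']
      · simp only [pt_snd, WithLp.smul_snd, smul_smul]
        congr 1
        rw [arcSlope]; field_simp
    rw [e, norm_smul, norm_of_nonneg hg.le, smul_smul, mul_inv, mul_right_comm,
      inv_mul_cancel₀ hg.ne', one_mul]
  · rfl

lemma continuousAt_unitNormal (h : IsBase n b0 y0 Y A) {q : Amb n} (hq : y0 < q.fst) :
    ContinuousAt (unitNormal (n := n)) q := by
  by_cases hR : ‖q.snd‖ = cylRadius n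
  · have h1 := one_lt_radius h.two_le
    have hs : q.snd ≠ 0 := norm_pos_iff.1 (by linarith)
    have hev : ∀ᶠ w : Amb n in 𝓝 q, y0 < w.fst ∧ 1 < ‖w.snd‖ :=
      (continuous_fst_amb.continuousAt.eventually (lt_mem_nhds hq)).and
        (continuous_snd_amb.norm.continuousAt.eventually (lt_mem_nhds (by simpa only [hR] using h1)))
    have hm : ContinuousAt (fun w : Amb n => transSlope n w.fst ‖w.snd‖) q := by
      have e : transSlope n q.fst ‖q.snd‖ = 0 := by rw [transSlope, if_neg hR.not_lt, if_pos hR]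
      rw [ContinuousAt, e]
      refine squeeze_zero_norm' (hev.mono fun w hw => h.abs_transSlope_le hw.1 hw.2.le) ?_
      have : Continuous fun w : Amb n => 2 * cylRadius n * |‖w.snd‖ - cylRadius n| :=
        continuous_const.mul (continuous_snd_amb.norm.sub continuous_const).abs
      have := this.tendsto q
      rwa [hR, sub_self, abs_zero, mul_zero] at this
    have hv : ContinuousAt (fun w : Amb n =>
        pt (transSlope n w.fst ‖w.snd‖) (‖w.snd‖⁻¹ • w.snd)) q :=
      ContinuousAt.comp (g := fun z : ℝ × Rn n => pt z.1 z.2)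
        (f := fun w : Amb n => (transSlope n w.fst ‖w.snd‖, ‖w.snd‖⁻¹ • w.snd))
        (contDiff_pt (k := 0)).continuous.continuousAt (hm.prodMk
          ((continuous_snd_amb.norm.continuousAt.inv₀ (norm_ne_zero_iff.2 hs)).smul
            continuous_snd_amb.continuousAt))
    have hv0 : pt (transSlope n q.fst ‖q.snd‖) (‖q.snd‖⁻¹ • q.snd) ≠ 0 := fun e =>
      smul_ne_zero (inv_ne_zero (norm_ne_zero_iff.2 hs)) hs (congrArg (fun p : Amb n => p.snd) e)
    refine ((hv.norm.inv₀ (norm_ne_zero_iff.2 hv0)).smul hv).congr ?_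
    filter_upwards [hev] with w hw
    exact (h.unitNormal_eq hw.1 (norm_pos_iff.1 (by linarith [hw.2]))).symm
  · have := (h.contDiffAt_rawNormal hq hR).continuousAt
    exact (this.norm.inv₀ (norm_ne_zero_iff.2 (rawNormal_ne_zero h.two_le q))).smul this

lemma inner_rawNormal (h : IsBase n b0 y0 Y A) {S : Set (Amb n)}
    (hS : S ∈ leaves n b0 y0 (capSet n y0) (conU n)) {p : Amb n} (hp : p ∈ S ∩ region n b0 y0) :
    IsNormalTo S p (rawNormal p) := by
  rintro γ w rfl hγ hw
  obtain ⟨hpS, -, hpy⟩ := hp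
  have hL := (ptL n).symm.hasFDerivAt.comp_hasDerivAt 0 hw
  have h1 : HasDerivAt (fun t => (γ t).fst) w.fst 0 :=
    (ContinuousLinearMap.fst ℝ ℝ (Rn n)).hasFDerivAt.comp_hasDerivAt 0 hL
  have h2 : HasDerivAt (fun t => (γ t).snd) w.snd 0 :=
    (ContinuousLinearMap.snd ℝ ℝ (Rn n)).hasFDerivAt.comp_hasDerivAt 0 hL
  have h3 : (γ 0).snd ≠ 0 →
      HasDerivAt (fun t => ‖(γ t).snd‖) (⟪(γ 0).snd, w.snd⟫ / ‖(γ 0).snd‖) 0 := fun h0 => by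
    have := h2.norm_sq.sqrt (by positivity)
    simp only [sqrt_sq (norm_nonneg _)] at this
    exact this.congr_deriv (by field_simp)
  have hR := cylRadius_pos h.two_le
  rw [inner_amb, rawNormal]
  rcases hS with ⟨a, ha, rfl⟩ | ⟨b, hb, hb', rfl⟩ | rfl
  · have hA := h.A_lt.trans ha
    obtain ⟨l1, l2⟩ : (γ 0).fst ∈ Icc y0 a ∧ _ := by
      rw [h.high.capSet_eq_surface hA.le h.Y_lt ha] at hpS; exact hpS
    have hY := h.Y_lt.trans hpy
    rw [if_pos (l2.trans_lt (h.high.capU_lt hA.le ⟨hY, l1.2⟩)),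
      h.high.capTip_eq hY (h.A_lt.trans hpy).le l1.2 l2.symm]
    simp only [pt_fst, pt_snd, real_inner_smul_right]
    by_cases h0 : (γ 0).snd = 0
    · have k : w.fst = 0 := by
        refine IsLocalMax.hasDerivAt_eq_zero ?_ h1
        have e : (γ 0).fst = a := by rw [hpS.2, h0, norm_zero, capF_zero h.two_le]
        filter_upwards [hγ] with t ht
        rw [h.high.capSet_eq_surface hA.le h.Y_lt ha] at ht
        rw [e]; exact ht.1.2
      rw [k, h0, inner_zero_right]
      ring
    · have hr := norm_pos_iff.2 h0
      obtain ⟨l3, l4, -⟩ := h.high.capU_spec hA.le ⟨hY.le, l1.2⟩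
      rw [← l2] at l4
      obtain ⟨ρ, l5, l6⟩ := l4.exists_gt h.two_le (norm_nonneg _)
      have k : HasDerivAt (fun t => capF n a ‖(γ t).snd‖) _ 0 :=
        HasDerivAt.comp (h₂ := capF n a) (0 : ℝ) (l6.deriv_f _ ⟨hr, l5⟩) (h3 h0)
      rw [h1.unique (k.congr_of_eventuallyEq (hγ.mono fun t ht => ht.2)), real_inner_comm]
      field_simp; ring
  · have hc := isConical_con h.two_le hb
    have h4 := h.four_lt.trans hpy
    have k1 : ‖(γ 0).snd‖ = conU n b (γ 0).fst := hpS.2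
    have k2 : cylRadius n < ‖(γ 0).snd‖ := by rw [k1]; exact (hc.outside h.two_le hb le_rfl h4).1
    have h0 := norm_pos_iff.1 (hR.trans k2)
    rw [if_neg k2.not_gt, transSlope, if_neg k2.not_gt, if_neg k2.ne',
      conB_eq h.two_le h4 hb k1.symm]
    have k : HasDerivAt (fun t => conU n b (γ t).fst) _ 0 :=
      HasDerivAt.comp (h₂ := conU n b) (0 : ℝ) (hc.profile.deriv_u _ h4) h1
    simp only [pt_fst, pt_snd, real_inner_smul_right]
    rw [real_inner_comm, ← div_eq_inv_mul, (h3 h0).unique (k.congr_of_eventuallyEq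
      (hγ.mono fun t ht => ht.2))]
    ring
  · have k1 : ‖(γ 0).snd‖ = cylRadius n := hpS
    have h0 : (γ 0).snd ≠ 0 := norm_pos_iff.1 (by rw [k1]; exact hR)
    rw [if_neg k1.not_lt, transSlope, if_neg k1.not_lt, if_pos k1]
    simp only [pt_fst, pt_snd, real_inner_smul_right]
    rw [real_inner_comm, ← div_eq_inv_mul, (h3 h0).unique
      ((hasDerivAt_const (0 : ℝ) (cylRadius n)).congr_of_eventuallyEq (hγ.mono fun t ht => ht))]
    ring

lemma exists_normal (h : IsBase n b0 y0 Y A) : ∃ ν : Amb n → Amb n,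
    ContinuousOn ν (region n b0 y0) ∧ ContDiffOn ℝ ∞ ν (region n b0 y0 \ cylinder n) ∧
    (∀ p ∈ region n b0 y0, ‖ν p‖ = 1) ∧
    ∀ S ∈ leaves n b0 y0 (capSet n y0) (conU n), ∀ p ∈ S ∩ region n b0 y0,
      IsNormalTo S p (ν p) := by
  refine ⟨unitNormal, fun p hp => (h.continuousAt_unitNormal hp.2).continuousWithinAt,
    fun p hp => ?_, fun p _ => ?_, fun S hS p hp γ w k1 k2 k3 => ?_⟩
  · have k := h.contDiffAt_rawNormal hp.1.2 hp.2
    have k0 := rawNormal_ne_zero h.two_le p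
    exact (((k.norm ℝ k0).inv (norm_ne_zero_iff.2 k0)).smul k).contDiffWithinAt
  · have k0 := norm_ne_zero_iff.2 (rawNormal_ne_zero h.two_le p)
    rw [unitNormal, norm_smul, norm_inv, norm_norm, inv_mul_cancel₀ k0]
  · rw [unitNormal, real_inner_smul_right, h.inner_rawNormal hS hp γ w k1 k2 k3, mul_zero]

end IsBase

end

section

/-! ### Profiles near the cylinder -/

variable {s : Set ℝ} {u p : ℝ → ℝ} {y : ℝ}

lemma IsProfile.hasDerivAt_sq_div (h : IsProfile n s u p) (hy : y ∈ s) (h0 : y ≠ 0) :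
    HasDerivAt (fun t => (u t ^ 2 - 2 * n₋₁) / t ^ 2)
      (4 * u y * profQ n y (u y) (p y) / y ^ 3) y := by
  have h1 := (h.pos y hy).ne'
  refine ((((h.deriv_u y hy).pow 2).sub_const _).div (hasDerivAt_pow 2 y)
    (pow_ne_zero 2 h0)).congr_deriv ?_
  simp only [Pi.pow_apply, profQ]
  field_simp
  ring

lemma IsProfile.hasDerivAt_Q (h : IsProfile n s u p) (hy : y ∈ s) :
    HasDerivAt (fun t => profQ n t (u t) (p t))
      (y / 2 * ((1 + p y ^ 2) * profQ n y (u y) (p y)) - n₋₁ * p y / u y ^ 2) y := by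
  refine ((((hasDerivAt_id y).div_const 2).mul (h.deriv_p y hy)).sub
    ((h.deriv_u y hy).div_const 2)).add ((hasDerivAt_const y n₋₁).div (h.deriv_u y hy)
      ((h.pos y hy).ne'))
    |>.congr_deriv ?_
  simp only [id]
  field_simp
  ring

lemma abs_profQ_le (hn : 2 ≤ n) {y u p : ℝ} (hu : |u - cylRadius n| ≤ 1 / 2) :
    |profQ n y u p| ≤ |y| / 2 * |p| + 3 / 2 * |u - cylRadius n| := by
  have hR := one_lt_radius hn
  have hR2 := cylRadius_sq hn
  set R := cylRadius n
  have h1 := abs_le.1 hu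
  have hu0 : 0 < u := by linarith
  have e : profQ n y u p = y / 2 * p - (u - R) * ((u + R) / (2 * u)) := by
    rw [profQ]; field_simp; linarith
  have h2 : |(u + R) / (2 * u)| ≤ 3 / 2 := by
    rw [abs_of_pos (by positivity), div_le_iff₀ (by positivity)]; linarith
  rw [e]
  refine (abs_sub _ _).trans ?_
  rw [abs_mul, abs_mul, abs_div, abs_two, mul_comm (3 / 2 : ℝ)]
  gcongr

lemma abs_linear_err_le (hn : 2 ≤ n) {u p : ℝ} (hu : |u - cylRadius n| ≤ 1 / 2) :
    |n₋₁ * p / u ^ 2 - p / 2| ≤ 3 * |p| * |u - cylRadius n| := by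
  have hR := one_lt_radius hn
  set R := cylRadius n
  have h1 := abs_le.1 hu
  have hu0 : 0 < u := by linarith
  have e : n₋₁ * p / u ^ 2 - p / 2 = -(p * (u - R) * ((u + R) / (2 * u ^ 2))) := by
    field_simp; linear_combination -p * (cylRadius_sq hn)
  have h2 : |(u + R) / (2 * u ^ 2)| ≤ 3 := by
    rw [abs_of_pos (by positivity), div_le_iff₀ (by positivity)]; nlinarith
  rw [e, abs_neg, abs_mul, abs_mul]
  nlinarith [abs_nonneg p, abs_nonneg (u - R), mul_nonneg (abs_nonneg p) (abs_nonneg (u - R))]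

/-- Backward growth of the distance to the cylinder. -/
lemma IsProfile.confined (h : IsProfile n s u p) (hn : 2 ≤ n) {β y1 E : ℝ} (hβ : -1 ≤ β)
    (hy1 : 1 ≤ y1) (hs : Ioc β y1 ⊆ s) (hE : 0 < E)
    (h0 : (u y1 - cylRadius n) ^ 2 + p y1 ^ 2 ≤ E)
    (hsm : 2 * E * exp ((3 + 2 * y1) * (y1 + 1)) ≤ 1 / 4) :
    ∀ y ∈ Ioc β y1, (u y - cylRadius n) ^ 2 + p y ^ 2 ≤ 2 * E * exp ((3 + 2 * y1) * (y1 + 1)) := by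
  set R := cylRadius n
  have hexp : ∀ y ∈ Ioc β y1, exp ((3 + 2 * y1) * (y1 - y)) ≤
      exp ((3 + 2 * y1) * (y1 + 1)) := fun y hy => by
    gcongr; linarith [hy.1]
  have hd : ∀ y ∈ Ioc β y1, HasDerivAt (fun t => 2 * E * exp ((3 + 2 * y1) * (y1 - t)) -
      ((u t - R) ^ 2 + p t ^ 2)) (-(3 + 2 * y1) * (2 * E * exp ((3 + 2 * y1) * (y1 - y))) -
        (2 * (u y - R) * p y + 2 * p y * ((1 + p y ^ 2) * profQ n y (u y) (p y)))) y := fun y hy => by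
    refine ((((((hasDerivAt_id y).const_sub y1).const_mul (3 + 2 * y1)).exp).const_mul
      (2 * E)).sub ((((h.deriv_u y (hs hy)).sub_const R).pow 2).add
        ((h.deriv_p y (hs hy)).pow 2))).congr_deriv ?_
    simp only [id]
    ring
  have key := pos_of_last_zero (fun y hy => (hd y hy).continuousAt.continuousWithinAt)
    (by simp only [sub_self, mul_zero, Real.exp_zero, mul_one]; linarith) (fun y hy hz _ =>
      ⟨_, ?_, hd y ⟨hy.1, hy.2.le⟩⟩)
  · intro y hy
    have := key y hy
    nlinarith [hexp y hy]
  · have hy' : y ∈ Ioc β y1 := ⟨hy.1, hy.2.le⟩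
    have k2 := hexp y hy'
    have k3 : (u y - R) ^ 2 + p y ^ 2 ≤ 1 / 4 := by nlinarith
    have k4 : |u y - R| ≤ 1 / 2 := abs_le_of_sq_le_sq (by nlinarith [sq_nonneg (p y)]) (by norm_num)
    have k7 : |y| ≤ y1 := abs_le.2 ⟨by linarith [hy.1], hy.2.le⟩
    have k8 : |y| / 2 * |p y| ≤ y1 / 2 * |p y| := by gcongr
    set Q := profQ n y (u y) (p y)
    have k9 : |2 * (u y - R) * p y + 2 * p y * ((1 + p y ^ 2) * Q)| ≤
        2 * (|u y - R| * |p y|) + 2 * |p y| * (5 / 4 * |Q|) := by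
      refine (abs_add_le _ _).trans ?_
      rw [abs_mul, abs_mul, abs_mul, abs_mul, abs_mul, abs_two,
        abs_of_pos (show 0 < 1 + p y ^ 2 by positivity), mul_assoc]
      have : 1 + p y ^ 2 ≤ 5 / 4 := by nlinarith [sq_nonneg (u y - R)]
      gcongr
    have k10 : |Q| ≤ y1 / 2 * |p y| + 3 / 2 * |u y - R| := (abs_profQ_le (p := p y) (y := y) hn
      k4).trans (by gcongr)
    have k11 : 2 * E * exp ((3 + 2 * y1) * (y1 - y)) = |u y - R| ^ 2 + |p y| ^ 2 := by
      rw [sq_abs, sq_abs]; linarith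
    have k12 : 0 < |u y - R| ^ 2 + |p y| ^ 2 := by rw [← k11]; positivity
    have k13 := (abs_le.1 k9).1
    rw [k11]
    have k14 : 2 * |p y| * (5 / 4 * |Q|) ≤
        2 * |p y| * (5 / 4 * (y1 / 2 * |p y| + 3 / 2 * |u y - R|)) := by gcongr
    nlinarith [sq_nonneg (|u y - R| - |p y|), mul_nonneg (by linarith : 0 ≤ y1)
      (sq_nonneg |u y - R|), mul_nonneg (by linarith : 0 ≤ y1) (sq_nonneg |p y|)]

lemma profQ_bounds (hn : 2 ≤ n) {Y e u p : ℝ} (hY : 20 ≤ Y) (he : 0 < e)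
    (hu : |u - cylRadius n| ≤ 1 / 200)
    (hT : |(Y / 2 * profQ n Y u p - p / 2) * Y| ≤ cylRadius n / 50 * e)
    (hW : -cylRadius n ^ 2 * e * Y ^ 2 ≤ u ^ 2 - cylRadius n ^ 2)
    (hW' : u ^ 2 - cylRadius n ^ 2 ≤ -cylRadius n ^ 2 * e * (Y ^ 2 - 8)) :
    -(21 / 20 * cylRadius n * e) ≤ profQ n Y u p ∧
      profQ n Y u p ≤ -(19 / 20 * cylRadius n * e) := by
  have hR := one_lt_radius hn
  set R := cylRadius n
  replace hu := abs_le.1 hu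
  have hu0 : 0 < u := by linarith
  have k1 := abs_le.1 hT
  have k2 : (Y ^ 2 - 2) * profQ n Y u p * u = (u ^ 2 - R ^ 2) +
      2 * ((Y / 2 * profQ n Y u p - p / 2) * Y) * u := by
    rw [profQ, cylRadius_sq hn]
    field_simp; ring
  generalize (Y / 2 * profQ n Y u p - p / 2) * Y = T at k1 k2
  generalize profQ n Y u p = Q at k2 ⊢
  have hRe : 0 < R * e := by positivity
  have hY2 : 400 ≤ Y ^ 2 := by nlinarith
  have k3 : 0 < (Y ^ 2 - 2) * u := mul_pos (by linarith) hu0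
  have k5 : R ≤ 1.01 * u := by linarith
  have k6 : 0.99 * u ≤ R := by linarith
  have k7 : T * u ≤ R / 50 * e * u := mul_le_mul_of_nonneg_right k1.2 hu0.le
  have k8 : -(R / 50 * e) * u ≤ T * u := mul_le_mul_of_nonneg_right k1.1 hu0.le
  have k9 : R * e * Y ^ 2 * R ≤ R * e * Y ^ 2 * (1.01 * u) := by gcongr
  have k10 : R * e * (Y ^ 2 - 8) * (0.99 * u) ≤ R * e * (Y ^ 2 - 8) * R :=
    mul_le_mul_of_nonneg_left k6 (mul_nonneg hRe.le (by linarith))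
  have k11 : 400 * (R * e * u) ≤ Y ^ 2 * (R * e * u) := by gcongr
  constructor <;> refine le_of_mul_le_mul_right ?_ k3 <;> linarith

set_option maxHeartbeats 800000 in
/-- Near the cylinder, the curvature of the profile of a cap is almost constant. -/
lemma IsProfile.near_cylinder (h : IsProfile n s u p) (hn : 2 ≤ n) {Y B c e : ℝ} (hY : 20 ≤ Y)
    (he : 0 < e) (hs : Icc 0 (2 * Y) ⊆ s)
    (hB : ∀ y ∈ Icc 0 (2 * Y), |u y - cylRadius n| ≤ B * e ∧ |p y| ≤ B * e) (hBe : B * e ≤ 1 / 200)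
    (hT : |Y * profQ n (2 * Y) (u (2 * Y)) (p (2 * Y)) - p (2 * Y) / 2| ≤ c * e)
    (h1 : exp (Y ^ 2 / 4) * (c * exp (-Y ^ 2)) * Y ≤ cylRadius n / 100)
    (h2 : exp (Y ^ 2 / 4) * (4 * Y ^ 4 * (B ^ 2 * e)) * Y ≤ cylRadius n / 100)
    (hW : -cylRadius n ^ 2 * e * Y ^ 2 ≤ u Y ^ 2 - cylRadius n ^ 2)
    (hW' : u Y ^ 2 - cylRadius n ^ 2 ≤ -cylRadius n ^ 2 * e * (Y ^ 2 - 8)) :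
    ∀ y ∈ Icc 0 Y, -(11 / 10 * cylRadius n * e) ≤ profQ n y (u y) (p y) ∧
      profQ n y (u y) (p y) ≤ -(9 / 10 * cylRadius n * e) := by
  have hR := one_lt_radius hn
  set R := cylRadius n
  set Q : ℝ → ℝ := fun t => profQ n t (u t) (p t) with hQ
  set T : ℝ → ℝ := fun t => t / 2 * Q t - p t / 2 with hTd
  set Q' : ℝ → ℝ := fun y => y / 2 * ((1 + p y ^ 2) * Q y) - n₋₁ * p y / u y ^ 2 with hQ'
  have hB0 : 0 ≤ B * e := (abs_nonneg _).trans (hB 0 ⟨le_rfl, by linarith⟩).2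
  have hQd : ∀ y ∈ Icc 0 (2 * Y), HasDerivAt Q (Q' y) y := fun y hy => h.hasDerivAt_Q (hs hy)
  have hQb : ∀ y ∈ Icc 0 (2 * Y), |Q y| ≤ 2 * Y * (B * e) := fun y hy => by
    obtain ⟨k1, k2⟩ := hB y hy
    refine (abs_profQ_le hn (by linarith)).trans ?_
    rw [abs_of_nonneg hy.1]
    have : y / 2 * |p y| ≤ Y * (B * e) := by
      refine mul_le_mul (by linarith [hy.2]) k2 (abs_nonneg _) (by linarith)
    nlinarith
  have hp2 : ∀ y ∈ Icc 0 (2 * Y), p y ^ 2 ≤ (B * e) ^ 2 := fun y hy =>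
    sq_le_sq.2 ((hB y hy).2.trans (le_abs_self _))
  have hQT : ∀ y ∈ Icc 0 (2 * Y), |Q' y - T y| ≤ Y ^ 2 * (B * e) ^ 2 := fun y hy => by
    obtain ⟨k1, k2⟩ := hB y hy
    have k3 := abs_linear_err_le (p := p y) hn (k1.trans (by linarith))
    have k4 : |p y| * |u y - R| ≤ (B * e) * (B * e) := mul_le_mul k2 k1 (abs_nonneg _) hB0
    have k5 : |y / 2 * (p y ^ 2 * Q y)| ≤ Y * ((B * e) ^ 2 * (2 * Y * (B * e))) := by
      rw [abs_mul, abs_mul, abs_of_nonneg (show 0 ≤ y / 2 by linarith [hy.1]),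
        abs_of_nonneg (sq_nonneg _)]
      have := hp2 y hy
      have := hQb y hy
      have : y / 2 ≤ Y := by linarith [hy.2]
      gcongr
    have e1 : Q' y - T y = y / 2 * (p y ^ 2 * Q y) - (n₋₁ * p y / u y ^ 2 - p y / 2) := by
      simp only [hQ', hTd]; ring
    rw [e1]
    refine (abs_sub _ _).trans ?_
    have k6 : Y ^ 2 * (B * e) ^ 2 * (B * e) ≤ Y ^ 2 * (B * e) ^ 2 * (1 / 200) := by gcongr
    have k7 : 400 * (B * e) ^ 2 ≤ Y ^ 2 * (B * e) ^ 2 := by gcongr; nlinarith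
    nlinarith
  have hSd : ∀ y ∈ Icc 0 (2 * Y), HasDerivAt (fun t => T t * exp (-(t ^ 2 / 4)))
      ((y / 2 * (Q' y - T y) - p y ^ 2 * Q y / 2) * exp (-(y ^ 2 / 4))) y := fun y hy => by
    refine (((((hasDerivAt_id y).div_const 2).mul (hQd y hy)).sub ((h.deriv_p y (hs hy)).div_const
      2)).mul (((hasDerivAt_pow 2 y).div_const 4).neg.exp)).congr_deriv ?_
    simp only [hTd, hQ, id, Pi.sub_apply, Pi.mul_apply, Pi.neg_apply]; ring
  have hSb : ∀ y ∈ Icc 0 (2 * Y), |(y / 2 * (Q' y - T y) - p y ^ 2 * Q y / 2) *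
      exp (-(y ^ 2 / 4))| ≤ 2 * Y ^ 3 * (B * e) ^ 2 := fun y hy => by
    have k1 : exp (-(y ^ 2 / 4)) ≤ 1 := Real.exp_le_one_iff.2 (by nlinarith [sq_nonneg y])
    rw [abs_mul, abs_of_pos (exp_pos _)]
    refine (mul_le_of_le_one_right (abs_nonneg _) k1).trans ((abs_sub _ _).trans ?_)
    have k2 : |y / 2 * (Q' y - T y)| ≤ Y * (Y ^ 2 * (B * e) ^ 2) := by
      rw [abs_mul, abs_of_nonneg (show 0 ≤ y / 2 by linarith [hy.1])]
      exact mul_le_mul (by linarith [hy.2]) (hQT y hy) (abs_nonneg _) (by linarith)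
    have k3 : |p y ^ 2 * Q y / 2| ≤ (B * e) ^ 2 * (2 * Y * (B * e)) / 2 := by
      rw [abs_div, abs_mul, abs_of_nonneg (sq_nonneg (p y)), abs_two]
      have := hp2 y hy
      have := hQb y hy; gcongr
    have k4 : (B * e) ^ 2 * (Y * (B * e)) ≤ (B * e) ^ 2 * Y ^ 3 := by
      gcongr
      nlinarith [pow_le_pow_left₀ (by norm_num) hY 2]
    nlinarith
  have hTb : ∀ y ∈ Icc 0 Y, |T y| * Y ≤ R / 50 * e := fun y hy => by
    have hyI : y ∈ Icc 0 (2 * Y) := ⟨hy.1, by linarith [hy.2]⟩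
    have k := (convex_Icc 0 (2 * Y)).norm_image_sub_le_of_norm_hasDerivWithin_le
      (fun t ht => (hSd t ht).hasDerivWithinAt) hSb (show 2 * Y ∈ _ from ⟨by linarith, le_rfl⟩) hyI
    rw [norm_eq_abs, norm_eq_abs] at k
    have k1 : |y - 2 * Y| ≤ 2 * Y := abs_le.2 ⟨by linarith [hy.1], by linarith [hy.2]⟩
    have k2 : |T (2 * Y) * exp (-((2 * Y) ^ 2 / 4))| ≤ c * e * exp (-Y ^ 2) := by
      rw [abs_mul, abs_of_pos (exp_pos _), show (-((2 * Y) ^ 2 / 4)) = -Y ^ 2 by ring]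
      refine mul_le_mul_of_nonneg_right ?_ (exp_pos _).le
      simpa only [hTd, hQ, mul_div_cancel_left₀ Y (two_ne_zero (α := ℝ))] using hT
    have k3 : |T y * exp (-(y ^ 2 / 4))| ≤ c * e * exp (-Y ^ 2) +
        2 * Y ^ 3 * (B * e) ^ 2 * (2 * Y) := by
      have := abs_sub_abs_le_abs_sub (T y * exp (-(y ^ 2 / 4)))
        (T (2 * Y) * exp (-((2 * Y) ^ 2 / 4)))
      have : 2 * Y ^ 3 * (B * e) ^ 2 * |y - 2 * Y| ≤ 2 * Y ^ 3 * (B * e) ^ 2 * (2 * Y) := by gcongr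
      linarith
    have k4 : |T y| = exp (y ^ 2 / 4) * |T y * exp (-(y ^ 2 / 4))| := by
      rw [abs_mul, abs_of_pos (exp_pos (-(y ^ 2 / 4))), mul_left_comm, ← exp_add,
        add_neg_cancel, Real.exp_zero, mul_one]
    have k5 : exp (y ^ 2 / 4) ≤ exp (Y ^ 2 / 4) := by
      gcongr
      · exact hy.1
      · exact hy.2
    calc |T y| * Y ≤ exp (Y ^ 2 / 4) * (c * e * exp (-Y ^ 2) +
          2 * Y ^ 3 * (B * e) ^ 2 * (2 * Y)) * Y := by rw [k4]; gcongr
      _ = (exp (Y ^ 2 / 4) * (c * exp (-Y ^ 2)) * Y +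
          exp (Y ^ 2 / 4) * (4 * Y ^ 4 * (B ^ 2 * e)) * Y) * e := by ring
      _ ≤ R / 50 * e := by gcongr; linarith
  have hBY : Y ^ 3 * (B * e) ^ 2 ≤ R / 100 * e := by
    refine le_trans ?_ (mul_le_mul_of_nonneg_right h2 he.le)
    have k1 : 1 ≤ exp (Y ^ 2 / 4) := Real.one_le_exp (by positivity)
    have k2 : Y ^ 3 ≤ 4 * Y ^ 5 := by
      nlinarith [pow_le_pow_left₀ (by norm_num) hY 2, pow_pos (by linarith : 0 < Y) 3]
    calc Y ^ 3 * (B * e) ^ 2 ≤ 1 * (4 * Y ^ 5) * (B * e) ^ 2 := by rw [one_mul]; gcongr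
      _ ≤ exp (Y ^ 2 / 4) * (4 * Y ^ 5) * (B * e) ^ 2 := by gcongr
      _ = _ := by ring
  have hYm : Y ∈ Icc 0 Y := ⟨by linarith, le_rfl⟩
  have hQY : -(21 / 20 * R * e) ≤ Q Y ∧ Q Y ≤ -(19 / 20 * R * e) := by
    refine profQ_bounds hn hY he ((hB Y ⟨hYm.1, by linarith⟩).1.trans hBe) ?_ hW hW'
    rw [abs_mul, abs_of_nonneg hYm.1]; exact hTb Y hYm
  intro y hy
  have k := (convex_Icc 0 Y).norm_image_sub_le_of_norm_hasDerivWithin_le (f := Q) (f' := Q')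
    (C := R / 50 * e / Y + Y ^ 2 * (B * e) ^ 2)
    (fun t ht => (hQd t ⟨ht.1, by linarith [ht.2]⟩).hasDerivWithinAt) (fun t ht => by
      have k1 := hQT t ⟨ht.1, by linarith [ht.2]⟩
      have k2 : |T t| ≤ R / 50 * e / Y := (le_div_iff₀ (by linarith)).2 (hTb t ht)
      rw [norm_eq_abs]
      calc |Q' t| = |T t + (Q' t - T t)| := by ring_nf
        _ ≤ _ := (abs_add_le _ _).trans (add_le_add k2 k1)) hYm hy
  have k1 : |y - Y| ≤ Y := abs_le.2 ⟨by linarith [hy.1], by linarith [hy.2]⟩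
  have k2 : |Q y - Q Y| ≤ 3 / 100 * R * e := by
    refine k.trans ((mul_le_mul_of_nonneg_left k1 (by positivity)).trans ?_)
    have hY0 : Y ≠ 0 := by linarith
    rw [add_mul, div_mul_cancel₀ _ hY0]; linarith
  have k3 := abs_le.1 k2
  constructor <;> nlinarith [mul_pos (by linarith : 0 < R) he]

end

section

/-! ### The profiles of the caps -/

variable {Y0 A Y a : ℝ}

lemma HighFrom.isProfile_cap (H : HighFrom n Y0 A) (ha : A < a) :
    IsProfile n (Ioo Y0 a) (capU n a) fun y => -(arcSlope (capP n a) (capU n a y))⁻¹ := by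
  refine ⟨fun y hy => H.capU_pos ha.le ⟨hy.1.le, hy.2⟩, fun y hy => H.hasDerivAt_y ha hy,
    fun y hy => ?_⟩
  obtain ⟨ρ, h1, h2, -⟩ := H.exists_gt ha.le ⟨hy.1, hy.2.le⟩
  obtain ⟨-, k2, k3⟩ := H.capU_spec ha.le ⟨hy.1.le, hy.2.le⟩
  have hU := H.capU_pos ha.le ⟨hy.1.le, hy.2⟩
  have hg := H.slope_pos ha.le hU k2
  have hE := IsCapArc.E_eq (n := n) (f := capF n a) (π := capP n a) (r := capU n a y)
  have hd : HasDerivAt (fun y => arcSlope (capP n a) (capU n a y)) _ y :=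
    HasDerivAt.comp (h₂ := arcSlope (capP n a)) y (IsCapArc.deriv_g h2 ⟨hU, h1⟩)
      (H.hasDerivAt_y ha hy)
  refine (hd.inv hg.ne').neg.congr_deriv ?_
  rw [k3] at hE
  rw [profQ]
  generalize arcSlope (capP n a) (capU n a y) = g at *
  generalize capU n a y = r at *
  generalize arcE n (capF n a) (capP n a) r = E at *
  have : E = (r * y + r ^ 2 * g - 2 * n₋₁ * g) / (2 * r) := by
    rw [eq_div_iff (by positivity)]; linarith
  rw [this]
  field_simp
  ring

set_option maxHeartbeats 1000000 in
/-- The profile of a cap over `[0, a]`. -/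
lemma HighFrom.exists_profile (H : HighFrom n Y0 A) (hn : 2 ≤ n) (hY₀ : Y0 < Y) (hY : 20 ≤ Y)
    (hA : A < a) (ha0 : 0 < a) (ha : 8 * Y ^ 2 ≤ a ^ 2) {c B : ℝ}
    (hc : c = 12 * cylRadius n ^ 2 * Y ^ 2)
    (hB : B = 2 * c * exp ((3 + 2 * (2 * Y)) * (2 * Y + 1)))
    (hBa : B * (a ^ 2)⁻¹ ≤ 1 / 200)
    (h1 : exp (Y ^ 2 / 4) * (3 * Y ^ 2 * c * exp (-Y ^ 2)) * Y ≤ cylRadius n / 100)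
    (h2 : exp (Y ^ 2 / 4) * (4 * Y ^ 4 * (B ^ 2 * (a ^ 2)⁻¹)) * Y ≤ cylRadius n / 100)
    (hlog : arcC n * log a * Y ^ 2 ≤ cylRadius n ^ 2 * a ^ 2) :
    ∃ u p : ℝ → ℝ, IsProfile n (Ioi (-1) ∩ Iio a) u p ∧ (∀ y, Y ≤ y → u y = capU n a y) ∧
      (∀ y ∈ Icc 0 Y, 2 * n₋₁ * (1 - y ^ 2 / a ^ 2) ≤ u y ^ 2) ∧
      ∀ y ∈ Icc 5 Y, u y ^ 2 ≤ 2 * n₋₁ * (1 - (y ^ 2 - 10) / a ^ 2) := by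
  have hR := one_lt_radius hn
  have hR2 := cylRadius_sq hn
  have hcap := H.isProfile_cap hA
  set R := cylRadius n
  set e := (a ^ 2)⁻¹ with he
  have he0 : 0 < e := by positivity
  have hc0 : 0 < c := by rw [hc]; positivity
  have hYa : 2 * Y < a := lt_of_pow_lt_pow_left₀ 2 ha0.le (by nlinarith)
  have hYe : 4 * Y ^ 2 * e ≤ 1 / 2 := by rw [he, mul_inv_le_iff₀ (by positivity)]; linarith
  set p0 : ℝ → ℝ := fun y => -(arcSlope (capP n a) (capU n a y))⁻¹ with hp0
  -- data at `2 Y`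
  have hdat : |capU n a (2 * Y) - R| ≤ c * e ∧ |p0 (2 * Y)| ≤ c * e := by
    have hm : 2 * Y ∈ Ioc Y0 a := ⟨by linarith, hYa.le⟩
    have k1 := H.capU_sq_ge hA.le hm
    have k2 := H.capU_lt hA.le hm
    obtain ⟨k3, k4, k5'⟩ := H.capU_spec hA.le ⟨hm.1.le, hm.2⟩
    have hg := H.slope_pos hA.le (H.capU_pos hA.le ⟨hm.1.le, hYa⟩) k4
    rw [div_eq_mul_inv, ← he, ← hR2] at k1
    set r := capU n a (2 * Y) with hr
    have hr1 : 1 ≤ r := by nlinarith [IsCapArc.one_le_sub hn]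
    rw [hc]
    have : 0 ≤ R ^ 2 * Y ^ 2 * e := by positivity
    constructor
    · rw [abs_of_neg (by linarith)]; nlinarith
    · simp only [hp0, ← hr]
      rw [abs_neg, abs_of_pos (inv_pos.2 hg), inv_le_iff_one_le_mul₀ hg]
      obtain ⟨ρ, l1, l2, l3⟩ := H.exists_gt hA.le hm
      have hh := H a hA.le
      have k6 := IsCapArc.mul_slope_ge l2 hn hh.arcM_le' hh.arcM_le l3 ⟨hr1, l1⟩
      rw [k5', ← hR2] at k6
      have k7 : 13 / 14 * r ≤ R ^ 2 * (2 * Y) * arcSlope (capP n a) r * e := by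
        rw [he, ← div_eq_mul_inv, le_div_iff₀ (by positivity)]; exact k6
      have k8 : 0 < R ^ 2 * Y * arcSlope (capP n a) r * e := by positivity
      nlinarith
  set E := 2 * (c * e) ^ 2 with hE
  have hBe0 : 0 ≤ B * e := by rw [hB]; positivity
  have hEB : 2 * E * exp ((3 + 2 * (2 * Y)) * (2 * Y + 1)) ≤ (B * e) ^ 2 := by
    have k : 1 ≤ exp ((3 + 2 * (2 * Y)) * (2 * Y + 1)) := Real.one_le_exp (by positivity)
    rw [hE, hB]
    nlinarith [mul_nonneg (mul_nonneg (sq_nonneg (c * e)) (sub_nonneg.2 k)) (zero_le_one.trans k)]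
  have hB4 : (B * e) ^ 2 ≤ 1 / 4 := by nlinarith
  have hconf : ∀ β', -1 ≤ β' → β' < 2 * Y → ∀ u p, IsProfile n (Ioi β' ∩ Iio a) u p →
      (∀ y, 2 * Y ≤ y → u y = capU n a y ∧ p y = p0 y) → ∀ y ∈ Ioc β' (2 * Y),
        |u y - R| ≤ B * e ∧ |p y| ≤ B * e := fun β' hβ hβ' u p h hag y hy => by
    have k := le_trans (h.confined hn (E := E) hβ (by linarith)
      (fun t ht => ⟨ht.1, ht.2.trans_lt hYa⟩) (by positivity)
      (by
        rw [(hag _ le_rfl).1, (hag _ le_rfl).2, hE]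
        linarith [sq_le_sq.2 (hdat.1.trans (le_abs_self _)),
          sq_le_sq.2 (hdat.2.trans (le_abs_self _))]) (hEB.trans hB4) y hy) hEB
    exact ⟨abs_le_of_sq_le_sq (by nlinarith [sq_nonneg (p y)]) hBe0,
      abs_le_of_sq_le_sq (by nlinarith [sq_nonneg (u y - R)]) hBe0⟩
  obtain ⟨u, p, hup, hag⟩ := IsProfile.exists_extension (α := -1) (β := Y0) (T := Iio a)
    (y1 := 2 * Y) (y2 := (2 * Y + a) / 2) (m := 1 / 2) (M := R + 1) hcap (by linarith)
    (by linarith) (by linarith) (fun t ht => by have : t ≤ _ := ht; show t < a; linarith)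
    isOpen_Iio (by norm_num) (fun β' k1 k2 u p k3 k4 y hy => by
      obtain ⟨l1, l2⟩ := hconf β' k1 k2 u p k3 k4 y hy
      have := abs_le.1 l1; exact ⟨by linarith, by linarith, by linarith⟩)
  have hYm : 2 * Y ∈ Ioo (max Y0 (-1)) a := ⟨max_lt (by linarith) (by linarith), hYa⟩
  have heq : ∀ y, Y ≤ y → u y = capU n a y := fun y hy => by
    rcases lt_or_ge y (2 * Y) with k | k
    · exact (IsProfile.eqOn ordConnected_Ioo
        (hup.mono fun t ht => ⟨(le_max_right _ _).trans_lt ht.1, ht.2⟩)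
        (hcap.mono (Ioo_subset_Ioo_left (le_max_left _ _))) hYm (hag _ le_rfl).1 (hag _ le_rfl).2
        y ⟨max_lt (by linarith) (by linarith), k.trans hYa⟩).1
    · exact (hag y k).1
  have hs : Icc 0 (2 * Y) ⊆ Ioi (-1) ∩ Iio a := fun t ht =>
    ⟨show -1 < t by linarith [ht.1], ht.2.trans_lt hYa⟩
  have hbd : ∀ y ∈ Icc 0 (2 * Y), |u y - R| ≤ B * e ∧ |p y| ≤ B * e := fun y hy =>
    hconf (-1) le_rfl (by linarith) u p hup hag y ⟨by linarith [hy.1], hy.2⟩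
  have hmY : Y ∈ Ioc Y0 a := ⟨hY₀, by linarith⟩
  have hW : -R ^ 2 * e * Y ^ 2 ≤ u Y ^ 2 - R ^ 2 := by
    have k := H.capU_sq_ge hA.le hmY
    rw [← hR2, div_eq_mul_inv, ← he] at k
    rw [heq Y le_rfl]; linarith
  have hW' : u Y ^ 2 - R ^ 2 ≤ -R ^ 2 * e * (Y ^ 2 - 8) := by
    have k := H.capU_sq_le hA.le hmY
    have k1 : arcC n * log a / a ^ 4 * Y ^ 2 ≤ R ^ 2 * e := by
      rw [he, div_mul_eq_mul_div, div_le_iff₀ (by positivity)]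
      refine hlog.trans (le_of_eq ?_)
      field_simp
    have k2 : 14 * n₋₁ / a ^ 2 = 7 * R ^ 2 * e := by rw [hR2, he]; ring
    rw [k2, ← hR2, div_eq_mul_inv (R ^ 2), ← he] at k
    rw [heq Y le_rfl]; linarith
  have hQ := hup.near_cylinder hn hY he0 hs hbd hBa (c := 3 * Y ^ 2 * c) (by
    rw [(hag _ le_rfl).1, (hag _ le_rfl).2]
    have k := abs_profQ_le (n := n) (y := 2 * Y) (p := p0 (2 * Y)) hn (u := capU n a (2 * Y)) (by
        have := (hbd (2 * Y) ⟨by linarith, le_rfl⟩).1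
        rw [(hag _ le_rfl).1] at this
        linarith)
    rw [abs_of_nonneg (by linarith : (0 : ℝ) ≤ 2 * Y)] at k
    refine (abs_sub _ _).trans ?_
    rw [abs_mul, abs_div, abs_two, abs_of_nonneg (by linarith : 0 ≤ Y)]
    have k1 : |profQ n (2 * Y) (capU n a (2 * Y)) (p0 (2 * Y))| ≤ 2 * Y * (c * e) := by
      have : 2 * Y / 2 * |p0 (2 * Y)| ≤ 2 * Y / 2 * (c * e) :=
        mul_le_mul_of_nonneg_left hdat.2 (by linarith)
      nlinarith [hdat.1, mul_pos hc0 he0]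
    nlinarith [hdat.2, mul_pos hc0 he0]) h1 h2 hW hW'
  have hdW : ∀ t ∈ Ioc 0 Y, _ := fun t ht => hup.hasDerivAt_sq_div
    (hs ⟨ht.1.le, by linarith [ht.2]⟩) ht.1.ne'
  have hu0 : ∀ t ∈ Icc 0 Y, 0 < u t := fun t ht => hup.pos t (hs ⟨ht.1, by linarith [ht.2]⟩)
  rw [← hR2] at hdW ⊢
  have hY0 : 0 < Y := by linarith
  have hQ0 : ∀ t ∈ Icc 0 Y, profQ n t (u t) (p t) < 0 := fun t ht =>
    (hQ t ht).2.trans_lt (neg_neg_of_pos (by positivity))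
  have hRe : 0 < R ^ 2 * e := by positivity
  refine ⟨u, p, hup, heq, fun y hy => ?_, fun y hy => ?_⟩
  · rw [div_eq_mul_inv, ← he]
    rcases hy.1.eq_or_lt with h0 | h0
    · have k1 := hu0 0 ⟨le_rfl, hY0.le⟩
      have k2 : profQ n 0 (u 0) (p 0) * (2 * u 0) = R ^ 2 - u 0 ^ 2 := by
        rw [profQ, hR2]; field_simp; ring
      rw [← h0]
      nlinarith [mul_neg_of_neg_of_pos (hQ0 0 ⟨le_rfl, hY0.le⟩) k1]
    · have k := le_of_hasDerivAt_nonneg (φ := fun t => -((u t ^ 2 - R ^ 2) / t ^ 2)) hy.2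
        (fun t ht => (hdW t ⟨h0.trans_le ht.1, ht.2⟩).neg.continuousAt.continuousWithinAt)
        (fun t ht => (hdW t ⟨h0.trans ht.1, ht.2.le⟩).neg) (fun t ht => by
          have ht0 := h0.trans ht.1
          have l1 := mul_neg_of_neg_of_pos (hQ0 t ⟨ht0.le, ht.2.le⟩) (hu0 t ⟨ht0.le, ht.2.le⟩)
          rw [← neg_div]; exact div_nonneg (by linarith) (by positivity))
      simp only [neg_le_neg_iff] at k
      have k1 : -R ^ 2 * e ≤ (u Y ^ 2 - R ^ 2) / Y ^ 2 := (le_div_iff₀ (by positivity)).2 hW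
      have k2 := (le_div_iff₀ (by positivity)).1 (k1.trans k)
      linarith
  · rw [div_eq_mul_inv, ← he]
    have h0 : 0 < y := by linarith [hy.1]
    have k := le_of_hasDerivAt_nonneg
      (φ := fun t => (u t ^ 2 - R ^ 2) / t ^ 2 - 5 / 2 * R ^ 2 * e * (t ^ 2)⁻¹)
      (φ' := fun t => 4 * u t * profQ n t (u t) (p t) / t ^ 3 + 5 * R ^ 2 * e / t ^ 3) hy.2
      (fun t ht => ContinuousAt.continuousWithinAt
        ((hdW t ⟨h0.trans_le ht.1, ht.2⟩).continuousAt.sub (continuousAt_const.mul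
          ((continuousAt_id.pow 2).inv₀ (pow_ne_zero 2 (h0.trans_le ht.1).ne')))))
      (fun t ht => by
        have ht0 := h0.trans ht.1
        refine ((hdW t ⟨ht0, ht.2.le⟩).sub ((((hasDerivAt_pow 2 t).inv
          (pow_ne_zero 2 ht0.ne')).const_mul (5 / 2 * R ^ 2 * e)))).congr_deriv ?_
        simp only [Nat.cast_ofNat, Nat.add_one_sub_one, pow_one]
        field_simp; ring)
      (fun t ht => by
        have ht0 := h0.trans ht.1
        have l3 := abs_le.1 (hbd t ⟨ht0.le, by linarith [ht.2]⟩).1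
        have l4 : u t ≤ 101 / 100 * R := by linarith
        have l5 := mul_le_mul l4 (neg_le.1 ((hQ t ⟨ht0.le, ht.2.le⟩).1))
          (neg_pos.2 (hQ0 t ⟨ht0.le, ht.2.le⟩)).le (by linarith)
        rw [← add_div]; exact div_nonneg (by nlinarith) (by positivity))
    have hye : (u Y ^ 2 - R ^ 2) / Y ^ 2 ≤ -R ^ 2 * e + 8 * R ^ 2 * e * (Y ^ 2)⁻¹ := by
      rw [div_le_iff₀ (by positivity)]
      refine hW'.trans (le_of_eq ?_)
      field_simp; ring
    have k1 : (Y ^ 2)⁻¹ ≤ (y ^ 2)⁻¹ := by gcongr; exact hy.2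
    have k2 : (u y ^ 2 - R ^ 2) / y ^ 2 ≤ -R ^ 2 * e + 8 * R ^ 2 * e * (y ^ 2)⁻¹ := by nlinarith
    rw [div_le_iff₀ (by positivity)] at k2
    have k3 : (-R ^ 2 * e + 8 * R ^ 2 * e * (y ^ 2)⁻¹) * y ^ 2 = -R ^ 2 * e * (y ^ 2 - 8) := by
      field_simp; ring
    nlinarith

end

lemma arcC_pos (hn : 2 ≤ n) : 0 < arcC n := by
  have hN := IsCapArc.one_le_sub hn
  have hM : 0 < arcM n := by rw [arcM]; linarith
  rw [arcC]
  positivity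

set_option maxHeartbeats 1000000 in
/-- The caps and the profiles of the caps with a high tip. -/
lemma exists_cap_profiles (hn : 2 ≤ n) : ∃ Y0 A y1, HighFrom n Y0 A ∧ 0 ≤ Y0 ∧ Y0 < y1 ∧ A < y1 ∧
    ∀ a, y1 < a → ∃ u : ℝ → ℝ, (∀ y0, y1 ≤ y0 → y0 < a → IsCapProfile n y0 a (capSet n y0 a) u) ∧
      (∀ y ∈ Icc 0 a, 2 * n₋₁ * (1 - y ^ 2 / a ^ 2) ≤ u y ^ 2) ∧
      ∀ y ∈ Icc 5 a, u y ^ 2 ≤ 2 * n₋₁ *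
        (1 - (1 - arcC n * (log a / a ^ 2)) * ((y ^ 2 - 10) / a ^ 2)) := by
  have hN := IsCapArc.one_le_sub hn
  have hR := one_lt_radius hn
  have hR2 := cylRadius_sq hn
  have hC := arcC_pos hn
  set R := cylRadius n
  set Y0 := max (tipM n + tipμ n + 11) 0
  obtain ⟨A, H⟩ := exists_highFrom (Y := Y0) hn (le_max_left _ _)
  obtain ⟨Y, h1, hY, hYY⟩ : ∃ Y, exp (Y ^ 2 / 4) * (3 * Y ^ 2 * (12 * R ^ 2 * Y ^ 2) *
      exp (-Y ^ 2)) * Y ≤ R / 100 ∧ 20 ≤ Y ∧ Y0 < Y := by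
    obtain ⟨Y, k1, k2, k3⟩ := (((Real.tendsto_pow_mul_exp_neg_atTop_nhds_zero 5).eventually
      (gt_mem_nhds (show (0 : ℝ) < R / 100 / (36 * R ^ 2) by positivity))).and
      ((eventually_ge_atTop 20).and (eventually_gt_atTop Y0))).exists
    refine ⟨Y, ?_, k2, k3⟩
    rw [lt_div_iff₀ (by positivity)] at k1
    have k4 : exp (Y ^ 2 / 4) * exp (-Y ^ 2) ≤ exp (-Y) := by rw [← exp_add]; gcongr; nlinarith
    calc _ = Y ^ 5 * (exp (Y ^ 2 / 4) * exp (-Y ^ 2)) * (36 * R ^ 2) := by ring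
      _ ≤ Y ^ 5 * exp (-Y) * (36 * R ^ 2) := by gcongr
      _ ≤ R / 100 := k1.le
  set c := 12 * R ^ 2 * Y ^ 2 with hc
  set B := 2 * c * exp ((3 + 2 * (2 * Y)) * (2 * Y + 1)) with hB
  have hsq : ∀ K : ℝ, ∀ᶠ a : ℝ in atTop, K ≤ a ^ 2 := fun K =>
    (tendsto_pow_atTop two_ne_zero).eventually_ge_atTop K
  obtain ⟨y1, hy1⟩ := eventually_atTop.1 ((hsq (8 * Y ^ 2)).and ((hsq (200 * B)).and
    ((hsq (exp (Y ^ 2 / 4) * (4 * Y ^ 4 * B ^ 2) * Y * (100 / R))).and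
      (eventually_ge_atTop (arcC n * Y ^ 2)))))
  refine ⟨Y0, A, max y1 (max A Y) + 1, H, le_max_right _ _,
    by linarith [le_max_right y1 (max A Y), le_max_right A Y],
    by linarith [le_max_right y1 (max A Y), le_max_left A Y], fun a ha => ?_⟩
  have hYa : Y < a := by linarith [le_max_right y1 (max A Y), le_max_right A Y]
  have hAa : A < a := by linarith [le_max_right y1 (max A Y), le_max_left A Y]
  have ha0 : 0 < a := by linarith
  obtain ⟨k1, k2, k3, k4⟩ := hy1 a (by linarith [le_max_left y1 (max A Y)])
  have hloga : log a ≤ a := (Real.log_le_sub_one_of_pos ha0).trans (by linarith)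
  have hlog0 : 0 ≤ log a := by linarith [(H a hAa.le).log_ge]
  obtain ⟨u, p, hup, heq, hlow, hupp⟩ := H.exists_profile hn hYY hY hAa ha0 k1 hc hB
    (by rw [mul_inv_le_iff₀ (by positivity)]; linarith) h1
    (by
      rw [mul_div_assoc', div_le_iff₀ (by linarith)] at k3
      have : exp (Y ^ 2 / 4) * (4 * Y ^ 4 * (B ^ 2 * (a ^ 2)⁻¹)) * Y =
        (exp (Y ^ 2 / 4) * (4 * Y ^ 4 * B ^ 2) * Y) * (a ^ 2)⁻¹ := by ring
      rw [this, mul_inv_le_iff₀ (by positivity)]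
      linarith)
    (by
      have l1 : arcC n * log a * Y ^ 2 ≤ a * a := by
        calc arcC n * log a * Y ^ 2 = arcC n * Y ^ 2 * log a := by ring
          _ ≤ a * a := by gcongr
      nlinarith)
  have hopen : IsOpen (Ioi (-1) ∩ Iio a) := isOpen_Ioi.inter isOpen_Iio
  have hmem : ∀ y ∈ Ico 0 a, y ∈ Ioi (-1) ∩ Iio a := fun y hy =>
    ⟨show -1 < y by linarith [hy.1], hy.2⟩
  refine ⟨u, fun y0 hy0 hy0a => ⟨fun y hy => ?_, (hup.contDiffOn hopen).mono hmem,
    fun y hy => hup.pos y (hmem y hy), by rw [heq a hYa.le, H.capU_tip hAa.le],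
    fun y hy => hup.shrinkerODEAt hopen (hmem y ⟨hy.1.le, hy.2⟩), ?_⟩, fun y hy => ?_,
    fun y hy => ?_⟩
  · rcases hy.2.eq_or_lt with rfl | h0
    · have hn1 : Ioi Y ∈ 𝓝[Icc 0 y] y := mem_nhdsWithin_of_mem_nhds (Ioi_mem_nhds hYa)
      have hc := (H.continuousOn_y hAa y ⟨hYY.trans hYa, le_rfl⟩).mono_of_mem_nhdsWithin
        (s := Icc 0 y) (by
          filter_upwards [hn1, self_mem_nhdsWithin] with t ht ht'
          exact ⟨hYY.trans ht, ht'.2⟩)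
      refine hc.congr_of_eventuallyEq ?_ (heq y hYa.le)
      filter_upwards [hn1] with t ht
      exact heq t (le_of_lt ht)
    · exact (hup.deriv_u y (hmem y ⟨hy.1, h0⟩)).continuousAt.continuousWithinAt
  · have hyY : Y < y0 := by linarith [le_max_right y1 (max A Y), le_max_right A Y]
    rw [H.capSet_eq_surface hAa.le (hYY.trans hyY) hy0a]
    ext q
    refine and_congr_right fun hq => ?_
    rw [heq _ (hyY.le.trans hq.1)]
  · rcases le_or_gt y Y with h | h
    · exact hlow y ⟨hy.1, h⟩
    · rw [heq y h.le]; exact H.capU_sq_ge hAa.le ⟨hYY.trans h, hy.2⟩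
  · rcases le_or_gt y Y with h | h
    · refine (hupp y ⟨hy.1, h⟩).trans ?_
      have l1 : 0 ≤ (y ^ 2 - 10) / a ^ 2 := div_nonneg (by nlinarith [hy.1]) (by positivity)
      have l2 : 0 ≤ arcC n * (log a / a ^ 2) := by positivity
      gcongr
      nlinarith
    · rw [heq y h.le]
      refine (H.capU_sq_le hAa.le ⟨hYY.trans h, hy.2⟩).trans ?_
      set L := arcC n * log a / a ^ 4 with hL
      have l1 : 0 ≤ L := by positivity
      have e1 : 2 * n₋₁ * (1 - (1 - arcC n * (log a / a ^ 2)) *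
          ((y ^ 2 - 10) / a ^ 2)) = 2 * n₋₁ - 2 * n₋₁ / a ^ 2 * y ^ 2 +
            20 * (n₋₁ / a ^ 2) + 2 * n₋₁ * (L * (y ^ 2 - 10)) := by
        rw [hL]; field_simp; ring
      have e2 : 14 * n₋₁ / a ^ 2 = 14 * (n₋₁ / a ^ 2) := by ring
      have l2 : 0 ≤ n₋₁ / a ^ 2 := by positivity
      have l3 : 0 ≤ L * (y ^ 2 - 10) := mul_nonneg l1 (by nlinarith)
      have l4 : 1 * (L * (y ^ 2 - 10)) ≤ n₋₁ * (L * (y ^ 2 - 10)) := by gcongr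
      have l5 : 0 ≤ L * (y ^ 2 - 20) := mul_nonneg l1 (by nlinarith)
      rw [e1, e2]; linarith

end ShrinkerFoliation

end

theorem mainTheorem9 (n : ℕ) (hn : 2 ≤ n) (b₀ : ℝ) (hb₀ : 0 < b₀) :
    ∃ y₀ : ℝ, 0 < y₀ ∧ ∃ (cap : ℝ → Set (Amb n)) (uOut : ℝ → ℝ → ℝ),
      -- existence and uniqueness of the caps
      (∀ a, y₀ < a → IsCap n y₀ a (cap a) ∧ ∀ S, IsCap n y₀ a S → S = cap a) ∧
      -- the conical ends
      (∀ b, 0 < b → b < b₀ → IsConicalEnd n y₀ b (uOut b)) ∧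
      -- the boundaries of the caps lie in the disc `r ≤ b₀ y₀`, `y = y₀`
      (∀ a, y₀ < a → ∀ F, IsCapEmbedding n y₀ a F →
        F '' Metric.sphere 0 1 ⊆ disc n y₀ (b₀ * y₀)) ∧
      -- the foliation
      IsFoliation (region n b₀ y₀) (leaves n b₀ y₀ cap uOut) ∧
      -- the field of unit normals
      (∃ ν : Amb n → Amb n,
        ContinuousOn ν (region n b₀ y₀) ∧
        ContDiffOn ℝ ∞ ν (region n b₀ y₀ \ cylinder n) ∧
        (∀ p ∈ region n b₀ y₀, ‖ν p‖ = 1) ∧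
        ∀ S ∈ leaves n b₀ y₀ cap uOut, ∀ p ∈ S ∩ region n b₀ y₀, IsNormalTo S p (ν p)) ∧
      -- the profiles of the caps and their asymptotic bounds
      ∃ (u : ℝ → ℝ → ℝ) (C₀ C : ℝ), 0 < C₀ ∧ 0 < C ∧ ∀ a, y₀ < a →
        IsCapProfile n y₀ a (cap a) (u a) ∧
        (∀ y ∈ Set.Icc 0 a, √(2 * ((n : ℝ) - 1)) * √(1 - y ^ 2 / a ^ 2) ≤ u a y) ∧
        ∀ y ∈ Set.Icc 5 (a - C₀ / a),
          u a y ≤ √(2 * ((n : ℝ) - 1)) *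
            √(1 - (1 - C * (Real.log a / a ^ 2)) * ((y ^ 2 - 10) / a ^ 2)) := by
  obtain ⟨Y, A, y₁, H, hY0, hY, hA, hprof⟩ := exists_cap_profiles hn
  have hR := cylRadius_pos hn
  obtain ⟨y₀, h1, h2, h3⟩ : ∃ y₀, y₁ ≤ y₀ ∧ 4 < y₀ ∧ cylRadius n / b₀ ≤ y₀ :=
    ⟨max y₁ (max 5 (cylRadius n / b₀)), le_max_left _ _,
      by linarith [le_max_right y₁ (max 5 (cylRadius n / b₀)), le_max_left 5 (cylRadius n / b₀)],
      (le_max_right _ _).trans (le_max_right _ _)⟩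
  rw [div_le_iff₀' hb₀] at h3
  have hbase : IsBase n b₀ y₀ Y A :=
    ⟨hn, H, hY0, hY.trans_le h1, hA.trans_le h1, h2, hb₀, h3⟩
  choose u hu using fun a : Set.Ioi y₁ => hprof a a.2
  have hcap : ∀ a, y₀ < a → _ := fun a ha =>
    H.isCapEmbedding (hbase.A_lt.trans ha).le hbase.Y_lt ha
  refine ⟨y₀, by linarith, capSet n y₀, conU n, fun a ha => ⟨⟨_, (hcap a ha).1, (hcap a ha).2.symm⟩,
    ?_⟩, fun b hb _ => isConicalEnd_con hn h2 hb, fun a _ F hF p hp => ?_, hbase.isFoliation,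
    hbase.exists_normal, fun a y => if h : y₁ < a then u ⟨a, h⟩ y else 0, 1, arcC n, one_pos,
    arcC_pos hn, fun a ha => ?_⟩
  · rintro S ⟨F, hF, rfl⟩
    exact H.image_eq_capSet (hbase.A_lt.trans ha).le hbase.Y_lt ha hF
  · exact ⟨(hF.boundary_subset hp).1, (hF.boundary_subset hp).2.trans h3⟩
  · have ha1 : y₁ < a := h1.trans_lt ha
    simp only [dif_pos ha1]
    obtain ⟨k1, k2, k3⟩ := hu ⟨a, ha1⟩
    have k4 := k1 y₀ h1 ha
    have hN : 0 ≤ 2 * ((n : ℝ) - 1) := by linarith [IsCapArc.one_le_sub hn]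
    have hpos : ∀ y ∈ Set.Icc 0 a, 0 ≤ u ⟨a, ha1⟩ y := fun y hy => by
      rcases hy.2.eq_or_lt with h | h
      · rw [h, k4.tip]
      · exact (k4.pos y ⟨hy.1, h⟩).le
    refine ⟨k4, fun y hy => ?_, fun y hy => ?_⟩
    · rw [← Real.sqrt_mul hN]
      exact Real.sqrt_le_iff.2 ⟨hpos y hy, k2 y hy⟩
    · have hya : y ≤ a := hy.2.trans (by
        have : 0 < 1 / a := by have : 0 < a := by linarith
                               positivity
        linarith)
      rw [← Real.sqrt_mul hN]
      exact Real.le_sqrt_of_sq_le (k3 y ⟨hy.1, hya⟩)
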